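/- Let $p$ be an odd prime, $m\ge 6$, and let $l$ be an integer with $1\le l\le m-1$ and $l\notin\{\frac m6,\frac m4,\frac m2,\frac{3m}4,\frac{5m}6\}$. Let $q=p^m$, $d=\gcd(m,l)$, $d'=\gcd(m,2l)$ and, when $m$ is even, $s=m/2$ and $\mu=(-1)^{s/d}$ (used only when $d'=2d$). Let $Tr$ be the trace from $\mathbb F_q$ to $\mathbb F_p$ and let $$\mathcal C=\{(Tr(ax^{p^{3l}+1}+bx^{p^l+1}+cx)+h)_{x\in\mathbb F_q}: a,b,c\in\mathbb F_q,\ h\in\mathbb F_p\},$$ a linear code of length $q$ over $\mathbb F_p$ with coordinates indexed by $\mathbb F_q$. Say that $\mathcal C$ holds a $2$-$(p^m,i,\lambda)$ design if $i$ and $\lambda$ are positive integers with $2<i<p^m$, and the set of supports of the codewords of Hamming weight $i$ in $\mathcal C$ is such that every two distinct elements of $\mathbb F_q$ lie together in exactly $\lambda$ of these supports. Then for every $\varepsilon\in\{1,-1\}$ the code $\mathcal C$ holds $2$-$(p^m,i,\lambda)$ designs for the following pairs; in particular it has codewords of each of these weights $i$. (1) Suppose $d'=d$ is odd. * $i=p^{m-1}(p-1)$,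 $\lambda=(p^m-p^{m-1}-1)(p^{2m+2d-1}+p^{2m+d}-p^{2m+d-1}-p^{2m}-p^{2m-1}+p^{2m-2d}-p^{2m-3d}+p^{2m-3d-1}+p^{m+2d-1}-p^m+p^{m-2d}-p^{m-2d-1}+p^{2d}-1)/(p^{2d}-1)$; * $i=p^{\frac{m+d-2}2}(p-1)(p^{\frac{m-d}2}+\varepsilon)$, $\lambda=\frac12p^{m-d-1}(i-1)(p^{m-d}-1)$; * $i=p^{\frac{m+2d-1}2}K$, $\lambda=\frac12p^{\frac{m-2d-1}2}K(i-1)\frac{p^{m-d}-1}{p^{2d}-1}$, where $K=p^{\frac{m-2d+1}2}-p^{\frac{m-2d-1}2}+\varepsilon(-1)^{\frac{p-1}2}$; * if $d\ne1$: $i=p^{\frac{m-1}2}K$, $\lambda=p^{\frac{m+4d-1}2}K(i-1)\frac{p^m-p^{m-d}-p^{m-2d}+1}{2(p^{2d}-1)}$, where $K=p^{\frac{m+1}2}-p^{\frac{m-1}2}+\varepsilon(-1)^{\frac{p-1}2}$; * if $d\ne1$: $i=p^{\frac{m+d-2}2}K$, $\lambda=\frac12p^{m-d-1}K(i-1)(p^{\frac{m-d}2}+\varepsilon)$,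 where $K=p^{\frac{m-d+2}2}-p^{\frac{m-d}2}+\varepsilon$; * if $d=1$: $i=p^{\frac{m-1}2}K$, $\lambda=p^{\frac{m+3}2}K(i-1)\frac{p^m-p^{m-1}-p^{m-2}+1}{2(p^2-1)}+\frac12p^{m-2}K(i-1)(p^{\frac{m-1}2}+\varepsilon)$, where $K=p^{\frac{m+1}2}-p^{\frac{m-1}2}+\varepsilon$. (2) Suppose $d'=d$ is even. If $m\ge8$: * $i=p^{s-1}(p-1)(p^s+\varepsilon)$, $\lambda=p^{s+2d-1}(p^s+\varepsilon)(i-1)\frac{p^m-p^{m-d}-p^{m-2d}+1}{2(p^{2d}-1)}$; * $i=p^{s-1}K$, $\lambda=\frac12p^{s+2d-1}K(i-1)\frac{p^m-p^{m-d}-p^{m-2d}+1}{p^{2d}-1}$, where $K=p^{s+1}-p^s+\varepsilon$; * $i=p^{\frac{m+d-2}2}(p-1)(p^{\frac{m-d}2}+\varepsilon)$, $\lambda=\frac12p^{m-d-1}(p^{m-d}-1)(i-1)$; * $i=p^{\frac{m+d-2}2}K$, $\lambda=\frac12p^{m-d-1}K(i-1)(p^{\frac{m-d}2}+\varepsilon)$,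 where $K=p^{\frac{m-d+2}2}-p^{\frac{m-d}2}+\varepsilon$; * $i=p^{\frac{m+2d-2}2}(p-1)(p^{\frac{m-2d}2}+\varepsilon)$, $\lambda=\frac12p^{s-d-1}(p^{\frac{m-2d}2}+\varepsilon)(i-1)\frac{p^{m-d}-1}{p^{2d}-1}$; * $i=p^{\frac{m+2d-2}2}K$, $\lambda=\frac12p^{s-d-1}K(i-1)\frac{p^{m-d}-1}{p^{2d}-1}$, where $K=p^{\frac{m-2d+2}2}-p^{\frac{m-2d}2}+\varepsilon$; * $i=p^{m-1}(p-1)$, $\lambda=(p^m-p^{m-1}-1)(p^{2m-d}-p^{2m-2d}+p^{2m-3d}-p^{m-2d}+1)$. If $m=6$ (so that $d=2$): * $i=p^2(p-1)(p^3+\varepsilon)$, $\lambda=p^6(p^3+\varepsilon)(i-1)\frac{p^6-p^4-p^2+1}{2(p^4-1)}$; * $i=p^2(p^4-p^3+\varepsilon)$, $\lambda=\frac12p^6(p^4-p^3+\varepsilon)(i-1)\frac{p^6-p^4-p^2+1}{p^4-1}$; * $i=p^3(p-1)(p^2+\varepsilon)$, $\lambda=\frac12p^3(p^4-1)(i-1)$;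 * $i=p^3(p^3-p^2+\varepsilon)$, $\lambda=\frac12p^3(p^3-p^2+\varepsilon)(i-1)(p^2+\varepsilon)$; * $i=p^4(p-1)^2$, $\lambda=\frac12(p-1)(i-1)$; * $i=p^4(p^2-p+\varepsilon)$, $\lambda=\frac12(p^2-p+\varepsilon)(i-1)$; * $i=p^5(p-1)$, $\lambda=(p^6-p^5-1)(p^{10}-p^8+p^6-p^2+1)$. (3) Suppose $d'=2d$. Put $D=(p^d+1)(p^{2d}-1)(p^{3d}+1)$, $E=(p^d+1)^2(p^{2d}-1)$, $X_0=p^{m+6d}-p^{m+4d}-p^{m+d}+\mu p^{s+5d}-\mu p^{s+4d}+p^{6d}$, $X_1=p^{m+3d}+p^{m+2d}-p^m-p^{m-d}-p^{m-2d}-\mu p^{s+3d}+\mu p^s+p^{3d}$, $X_2=(p^{s-d}+\mu)(p^{s+d}+p^s-p^{s-2d}-\mu p^d)$, $X_3=(p^{s-2d}-\mu)(p^{s-d}+\mu)$. * $i=p^{s-1}(p-1)K$, $\lambda=p^{s-1}K(i-1)X_0/D$, where $K=p^s-\mu$; * $i=p^{s-1}K$, $\lambda=p^{s-1}K(i-1)X_0/D$,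 where $K=p^{s+1}-p^s+\mu$; * $i=p^{s+d-1}(p-1)K$, $\lambda=p^{s-d-1}K(i-1)X_1/E$, where $K=p^{s-d}+\mu$; * $i=p^{s+d-1}K$, $\lambda=p^{s-d-1}K(i-1)X_1/E$, where $K=p^{s-d+1}-p^{s-d}-\mu$; * $i=p^{s+2d-1}(p-1)K$, $\lambda=p^{s-2d-1}K(i-1)X_2/E$, where $K=p^{s-2d}-\mu$; * $i=p^{s+2d-1}K$, $\lambda=p^{s-2d-1}K(i-1)X_2/E$, where $K=p^{s-2d+1}-p^{s-2d}+\mu$; * $i=p^{s+3d-1}(p-1)K$, $\lambda=p^{s-3d-1}K(i-1)X_3/D$, where $K=p^{s-3d}+\mu$; * $i=p^{s+3d-1}K$, $\lambda=p^{s-3d-1}K(i-1)X_3/D$, where $K=p^{s-3d+1}-p^{s-3d}-\mu$; * $i=p^{m-1}(p-1)$, $\lambda=(p^m-p^{m-1}-1)\Bigl(1+\frac{p^{2m}+p^{2m-9d}-\mu(p^d-1)(p^{3s-d}+p^{3s-8d})+\mu p^{3s-3d}-\mu p^{3s-5d}+(p^d-1)p^{m-d}-p^{m-4d}-p^{m-6d}}{p^d+1}\Bigr)$.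 -/

import Mathlib

/-- The linear code of length `|F|` over `𝔽_p`, with coordinates indexed by the elements of `F`,
whose codewords are `(Tr(a x^{p^{3l}+1} + b x^{p^l+1} + c x) + h)_{x ∈ F}`
for `a, b, c ∈ F` and `h ∈ 𝔽_p`; here `Tr` is the trace from `F` to `𝔽_p`. -/
def doCode (p l : ℕ) [Fact p.Prime] (F : Type*) [Field F] [Algebra (ZMod p) F] :
    Submodule (ZMod p) (F → ZMod p) where
  carrier := {f | ∃ (a b c : F) (h : ZMod p), ∀ x : F,
    f x = Algebra.trace (ZMod p) F
      (a * x ^ (p ^ (3 * l) + 1) + b * x ^ (p ^ l + 1) + c * x) + h}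
  zero_mem' := ⟨0, 0, 0, 0, fun x => by simp⟩
  add_mem' := by
    rintro f g ⟨a, b, c, h, hf⟩ ⟨a', b', c', h', hg⟩
    refine ⟨a + a', b + b', c + c', h + h', fun x => ?_⟩
    rw [Pi.add_apply, hf, hg, add_add_add_comm, ← map_add]
    congr 2
    ring
  smul_mem' := by
    rintro r f ⟨a, b, c, h, hf⟩
    refine ⟨r • a, r • b, r • c, r * h, fun x => ?_⟩
    rw [Pi.smul_apply, hf, smul_eq_mul, mul_add, ← smul_eq_mul r (Algebra.trace _ _ _),
      ← map_smul]
    congr 2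
    simp only [smul_add, Algebra.smul_mul_assoc]

/-- The support of a word. -/
def wordSupport {ι K : Type*} [Fintype ι] [Zero K] [DecidableEq K] (f : ι → K) : Finset ι :=
  Finset.univ.filter fun x => f x ≠ 0

/-- The set of the supports of all codewords of Hamming weight `i` in the code `C`. -/
def supportBlocks {ι K : Type*} [Fintype ι] [Zero K] [DecidableEq K] (C : Set (ι → K)) (i : ℕ) :
    Set (Finset ι) :=
  {B | ∃ f ∈ C, hammingNorm f = i ∧ wordSupport f = B}

/-- `(P, 𝓑)` is a simple `t`-`(v, k, lam)` design with `0 < t < k < v` and `0 < lam`. -/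
structure IsSimpleDesign {P : Type*} [Fintype P] (t v k lam : ℕ) (𝓑 : Set (Finset P)) :
    Prop where
  card_points : Fintype.card P = v
  t_pos : 0 < t
  t_lt : t < k
  k_lt : k < v
  lam_pos : 0 < lam
  card_block : ∀ B ∈ 𝓑, B.card = k
  balanced : ∀ T : Finset P, T.card = t → {B ∈ 𝓑 | T ⊆ B}.ncard = lam

/-- The code `C` holds a `t`-`(v, i, lam)` design: `i` and `lam`, given by rational expressions,
are natural numbers, and the supports of the codewords of weight `i` in `C` form a simple
`t`-`(v, i, lam)` design (in particular `C` does have codewords of weight `i`). -/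
def HoldsDesign {ι K : Type*} [Fintype ι] [Zero K] [DecidableEq K] (C : Set (ι → K))
    (t v : ℕ) (i lam : ℚ) : Prop :=
  ∃ k L : ℕ, (k : ℚ) = i ∧ (L : ℚ) = lam ∧ IsSimpleDesign t v k L (supportBlocks C k)

/-! The substitutions `x ↦ u * x + t` with `u ≠ 0` preserve the code and act doubly transitively on
the coordinates. Hence the supports of the words of a fixed weight `i` cover every pair of points
equally often, and counting flags gives `λ q (q - 1) = b i (i - 1)`, where `b` is the number of
supports (`exists_balanced_of_transitive`). If `(p - 2) i < (p - 1) d_min`, a pigeonhole on the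
ratio of two words with the same support shows that they are proportional, so `b` is the number of
words of weight `i` divided by `p - 1` (`card_blocks`). With `excess = p * (number of zeros) - q`,
one has `p * weight = (p - 1) q - excess`, and `holdsDesign_of_excess` turns a bound on the excess
together with a count of the words of one excess into a design. What remains is the weight
distribution.

A word is a quadratic form `Tr(a x^(p^(3l)+1) + b x^(p^l+1))` over the prime field plus an affine
function. Completing the square reduces its zeros to a level set of the form, unless the linear part
does not vanish on the radical, in which case every value is taken equally often (`card_words`). No
Gauss sum is evaluated: the level sizes are given by integers `A`, `B` with `A² + p B² = q *
|radical|` (`exists_levelCard_eq`), and descent makes one of them vanish according to the parity of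
the rank (`sq_add_prime_mul_sq`). So the weight distribution follows from the joint distribution,
over the pairs `(a, b)`, of the dimension of the radical and the sign of the exponential sum.

The radical is the kernel of a skew polynomial of degree at most 3 in `x ↦ x^(p^(2l))`, so its
dimension is `d' j` with `j ≤ 3`; when `d' = d`, comparing the norms of the extreme coefficients
excludes `j = 3` (`card_ker_skew_le`, `exists_card_doRadical`). The distribution is then determined
by power moments, which orthogonality of characters converts into numbers of solutions of equations
in `(x^(p^(3l)+1), x^(p^l+1))`.

If `d' = d`, then `m / d` is odd. Multiplying `(a, b)` by a nonsquare of the fixed field of `x ↦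
x^(p^l)` multiplies the sum by `-1` to the rank over that field (`exists_nonsquare_twist`). The
ordinary and the twisted second moments give the three radical counts; the same twist balances the
signs for `j = 0, 2`, and the first moment settles `j = 1`. If `d' = 2d`, nonzero level sets are
unions of cosets of the `(p^d + 1)`-th roots of unity, and a congruence modulo `p^d + 1` determines
the sign from `j` (`amplitude_eq_of_even`). The moments of order 0 to 3 then form a Vandermonde
system for the four radical counts; the cubic moment rests on `fixed_of_doPair_add_doPair`.

Substituting the counts yields the stated parameters. The excluded values of `l` are exactly those
for which `m / (2d) ≤ 3` when `d' = 2d`. -/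

open Finset ComplexConjugate

set_option linter.unusedSectionVars false

/-! ### Absolute values of exponential sums of quadratic forms. -/

section QuadraticForms

variable {K V : Type*} [Field K] [Fintype K] [AddCommGroup V] [Module K V] [Fintype V]

/-- Summing a nontrivial additive character along a linear functional. -/
theorem sum_addChar_dual (ψ : AddChar K ℂ) (hψ : ψ ≠ 0) (f : V →ₗ[K] K) [Decidable (f = 0)] :
    ∑ y, ψ (f y) = if f = 0 then (Fintype.card V : ℂ) else 0 := by
  classical
  have h := AddChar.sum_eq_ite (ψ.compAddMonoidHom f.toAddMonoidHom)
  have key : ψ.compAddMonoidHom f.toAddMonoidHom = 0 ↔ f = 0 := by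
    constructor
    · intro h0
      by_contra hf
      apply hψ
      obtain ⟨v, hv⟩ : ∃ v, f v ≠ 0 := by
        by_contra! hc
        exact hf (LinearMap.ext hc)
      ext t
      have h1 := DFunLike.congr_fun h0 ((t / f v) • v)
      simpa [hv] using h1
    · rintro rfl
      ext; simp
  simp only [key] at h
  simpa using h

/-- The exponential sum of a quadratic form. -/
noncomputable def quadExpSum (ψ : AddChar K ℂ) (Q : QuadraticForm K V) : ℂ := ∑ x, ψ (Q x)

theorem QuadraticMap.apply_eq_zero_of_mem_ker_polarBilin (h2 : (2 : K) ≠ 0)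
    (Q : QuadraticForm K V) {x : V} (hx : x ∈ LinearMap.ker Q.polarBilin) : Q x = 0 := by
  have h1 : Q.polarBilin x x = 0 := by rw [LinearMap.mem_ker.1 hx]; rfl
  rw [QuadraticMap.polarBilin_apply_apply, QuadraticMap.polar_self] at h1
  simpa [h2] using h1

/-- The substitution `x = u + y` turns `Q x - Q y` into `Q u + polar u y`. The sum over `y` kills
every `u` outside the radical, and on the radical `Q` vanishes because 2 is invertible. -/
theorem quadExpSum_mul_conj (h2 : (2 : K) ≠ 0) (ψ : AddChar K ℂ) (hψ : ψ ≠ 0)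
    (Q : QuadraticForm K V) :
    quadExpSum ψ Q * conj (quadExpSum ψ Q) =
      Fintype.card V * Nat.card (LinearMap.ker Q.polarBilin) := by
  classical
  have h1 : quadExpSum ψ Q * conj (quadExpSum ψ Q) =
      ∑ u, ∑ y, ψ (Q u) * ψ (Q.polarBilin u y) := by
    rw [quadExpSum, map_sum, Finset.sum_mul_sum, Finset.sum_comm]
    conv_rhs => rw [Finset.sum_comm]
    refine Finset.sum_congr rfl fun y _ => ?_
    refine (Equiv.sum_comp (Equiv.addRight y) _).symm.trans ?_
    refine Finset.sum_congr rfl fun u _ => ?_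
    rw [← AddChar.map_neg_eq_conj, ← AddChar.map_add_eq_mul, ← AddChar.map_add_eq_mul,
      QuadraticMap.polarBilin_apply_apply, QuadraticMap.polar]
    congr 1
    simp only [Equiv.coe_addRight]
    ring
  have h3 : ∀ u, ∑ y, ψ (Q u) * ψ (Q.polarBilin u y) =
      if u ∈ LinearMap.ker Q.polarBilin then (Fintype.card V : ℂ) else 0 := by
    intro u
    rw [← Finset.mul_sum, sum_addChar_dual ψ hψ]
    by_cases hu : u ∈ LinearMap.ker Q.polarBilin
    · rw [if_pos hu, if_pos (LinearMap.mem_ker.1 hu),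
        Q.apply_eq_zero_of_mem_ker_polarBilin h2 hu]
      simp
    · rw [if_neg hu, if_neg (fun h => hu (LinearMap.mem_ker.2 h)), mul_zero]
  rw [h1, Finset.sum_congr rfl fun u _ => h3 u, Finset.sum_ite, Finset.sum_const_zero, add_zero,
    Finset.sum_const, nsmul_eq_mul, mul_comm, Nat.card_eq_fintype_card, Fintype.card_subtype]

end QuadraticForms

/-! ### A norm equation solved by descent. -/

section Descent

/-- The integral solutions of `A² + pB² = p^e`. -/
theorem sq_add_prime_mul_sq {p : ℕ} (hp : p.Prime) (e : ℕ) : ∀ A B : ℤ,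
    A ^ 2 + p * B ^ 2 = (p : ℤ) ^ e →
      (Even e → B = 0 ∧ A ^ 2 = (p : ℤ) ^ e) ∧ (Odd e → A = 0 ∧ p * B ^ 2 = (p : ℤ) ^ e) := by
  have hp2 : (2 : ℤ) ≤ p := by exact_mod_cast hp.two_le
  induction e with
  | zero =>
    intro A B h
    refine ⟨fun _ => ?_, fun h => by simp at h⟩
    have hB : B = 0 := by
      by_contra hB
      have : 1 ≤ B ^ 2 := by
        have := sq_nonneg B
        have : B ^ 2 ≠ 0 := pow_ne_zero 2 hB
        omega
      nlinarith [sq_nonneg A]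
    subst hB
    simpa using h
  | succ e ih =>
    intro A B h
    -- Writing `A = p A'` and dividing by `p` exchanges the roles of `A` and `B` and lowers the
    -- exponent by one; this is why the parity of `e` decides which of the two vanishes.
    have hA : (p : ℤ) ∣ A := by
      refine (Nat.prime_iff_prime_int.1 hp).dvd_of_dvd_pow (n := 2) ?_
      have : A ^ 2 = p * (p ^ e - B ^ 2) := by rw [mul_sub, ← pow_succ', ← h]; ring
      exact ⟨_, this⟩
    obtain ⟨A', rfl⟩ := hA
    have h' : B ^ 2 + p * A' ^ 2 = (p : ℤ) ^ e := by
      have : (p : ℤ) * (B ^ 2 + p * A' ^ 2) = p * p ^ e := by rw [← pow_succ', ← h]; ring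
      exact mul_left_cancel₀ (by omega) this
    obtain ⟨h1, h2⟩ := ih B A' h'
    refine ⟨fun he => ?_, fun he => ?_⟩
    · have := h2 (by rcases Nat.even_or_odd e with h | h <;> grind)
      refine ⟨this.1, ?_⟩
      rw [pow_succ' (p : ℤ), ← this.2]; ring
    · have := h1 (by rcases Nat.even_or_odd e with h | h <;> grind)
      refine ⟨by rw [this.1, mul_zero], ?_⟩
      rw [this.2, pow_succ' (p : ℤ)]

end Descent

/-! ### Sizes of the level sets of a quadratic form over the prime field. -/

section Levels

variable {p : ℕ} [Fact p.Prime] {V : Type*} [AddCommGroup V] [Module (ZMod p) V] [Fintype V]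

/-- The number of solutions of `f x = t`. -/
def levelCard {V K : Type*} [Fintype V] [DecidableEq K] (f : V → K) (t : K) : ℕ :=
  (univ.filter fun x => f x = t).card

theorem sum_comp_eq_sum_levelCard {R : Type*} [CommRing R] (f : V → ZMod p) (g : ZMod p → R) :
    ∑ x, g (f x) = ∑ t, (levelCard f t : R) * g t := by
  rw [← Finset.sum_fiberwise_of_maps_to (s := univ) (t := univ) (g := f) (fun _ _ => mem_univ _)]
  refine Finset.sum_congr rfl fun t _ => ?_
  rw [Finset.sum_congr rfl (g := fun _ => g t) (fun x hx => by rw [(mem_filter.1 hx).2]),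
    Finset.sum_const, nsmul_eq_mul, levelCard]

/-- Parseval over all multiples `ψ(c ·)` of a primitive character: `c = 0` contributes the square of
the number of points, and each of the other `p - 1` characters contributes the number of points
times the size of the radical. -/
theorem sum_levelCard_sq (hp : p ≠ 2) (Q : QuadraticForm (ZMod p) V) :
    (p : ℤ) * ∑ t, (levelCard Q t : ℤ) ^ 2 = (Fintype.card V : ℤ) ^ 2 +
      (p - 1) * (Fintype.card V * Nat.card (LinearMap.ker Q.polarBilin)) := by
  classical
  have h2 : (2 : ZMod p) ≠ 0 := Ring.two_ne_zero (by rwa [ZMod.ringChar_zmod_n])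
  set ψ : AddChar (ZMod p) ℂ := ZMod.stdAddChar
  have hψ : ψ.IsPrimitive := ZMod.isPrimitive_stdAddChar p
  have h1 : ∑ c, quadExpSum (ψ.mulShift c) Q * conj (quadExpSum (ψ.mulShift c) Q) =
      p * ∑ t, (levelCard Q t : ℂ) ^ 2 := by
    simp only [quadExpSum, map_sum, Finset.sum_mul_sum]
    rw [Finset.sum_comm, Finset.mul_sum]
    have h3 : ∀ x, ∑ c, ∑ y, (ψ.mulShift c) (Q x) * conj ((ψ.mulShift c) (Q y)) =
        p * levelCard Q (Q x) := by
      intro x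
      rw [Finset.sum_comm]
      have h4 : ∀ y, ∑ c, (ψ.mulShift c) (Q x) * conj ((ψ.mulShift c) (Q y)) =
          if Q y = Q x then (p : ℂ) else 0 := by
        intro y
        have h5 := AddChar.sum_mulShift (Q x - Q y) hψ
        have h6 : ∀ c : ZMod p, (ψ.mulShift c) (Q x) * conj ((ψ.mulShift c) (Q y)) =
            ψ (c * (Q x - Q y)) := by
          intro c
          rw [← AddChar.map_neg_eq_conj, ← AddChar.map_add_eq_mul, AddChar.mulShift_apply]
          congr 1
          ring
        rw [Finset.sum_congr rfl fun c _ => h6 c, h5]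
        simp only [sub_eq_zero, eq_comm (a := Q x), ZMod.card]
        split_ifs <;> simp
      rw [Finset.sum_congr rfl fun y _ => h4 y, Finset.sum_ite, Finset.sum_const_zero, add_zero,
        Finset.sum_const, nsmul_eq_mul, levelCard, mul_comm]
    rw [Finset.sum_congr rfl fun x _ => h3 x,
      sum_comp_eq_sum_levelCard Q (fun t => (p : ℂ) * levelCard Q t)]
    refine Finset.sum_congr rfl fun t _ => ?_
    ring
  have h2' : ∑ c, quadExpSum (ψ.mulShift c) Q * conj (quadExpSum (ψ.mulShift c) Q) =
      (Fintype.card V : ℂ) ^ 2 +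
      (p - 1) * (Fintype.card V * Nat.card (LinearMap.ker Q.polarBilin)) := by
    rw [← Finset.add_sum_erase _ _ (mem_univ (0 : ZMod p))]
    congr 1
    · simp [quadExpSum, sq]
    · rw [Finset.sum_congr rfl fun c hc =>
        quadExpSum_mul_conj h2 (ψ.mulShift c) (hψ (Finset.ne_of_mem_erase hc)) Q,
        Finset.sum_const, Finset.card_erase_of_mem (mem_univ _), Finset.card_univ, ZMod.card,
        nsmul_eq_mul, Nat.cast_sub (Fact.out : p.Prime).one_le, Nat.cast_one]
  rw [h1] at h2'
  exact_mod_cast h2'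

/-- The involution `x ↦ -x` fixes only the origin, where the form is 0. Evenness is what makes `A`
and `B` in `exists_levelCard_eq` integers, as the descent requires. -/
theorem even_levelCard (hp : p ≠ 2) (Q : QuadraticForm (ZMod p) V) {t : ZMod p} (ht : t ≠ 0) :
    Even (levelCard Q t) := by
  have h2 : (2 : ZMod p) ≠ 0 := Ring.two_ne_zero (by rwa [ZMod.ringChar_zmod_n])
  rw [← ZMod.natCast_eq_zero_iff_even, levelCard, Finset.cast_card]
  refine Finset.sum_involution (fun x _ => -x) (fun _ _ => by decide) ?_ (fun x hx => ?_)
    (fun x _ => neg_neg x)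
  · intro x hx _ h
    have h3 : x = 0 := by
      have : (2 : ZMod p) • x = 0 := by
        rw [two_smul]; nth_rewrite 1 [← h]; exact neg_add_cancel x
      exact (smul_eq_zero.1 this).resolve_left h2
    apply ht
    rw [← (mem_filter.1 hx).2, h3, QuadraticMap.map_zero]
  · simpa using hx

theorem levelCard_mul_sq (Q : QuadraticForm (ZMod p) V) {c : ZMod p} (hc : c ≠ 0) (t : ZMod p) :
    levelCard Q (c * c * t) = levelCard Q t := by
  refine Finset.card_bij' (fun x _ => c⁻¹ • x) (fun x _ => c • x) ?_ ?_ ?_ ?_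
  · intro x hx
    simp only [mem_filter, mem_univ, true_and, QuadraticMap.map_smul, smul_eq_mul] at hx ⊢
    rw [hx]; field_simp
  · intro x hx
    simp only [mem_filter, mem_univ, true_and, QuadraticMap.map_smul, smul_eq_mul] at hx ⊢
    rw [hx]
  · intro x _; simp [smul_smul, hc]
  · intro x _; simp [smul_smul, hc]

/-- Scaling the argument makes the level size constant on the nonzero squares, say `2u`, and on the
nonsquares, say `2v`. With `Z` zeros, take `A = Z - (u + v)` and `B = u - v`; counting all points
and Parseval then give the norm equation. -/
theorem exists_levelCard_eq (hp : p ≠ 2) (Q : QuadraticForm (ZMod p) V) :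
    ∃ A B : ℤ, A ^ 2 + p * B ^ 2 = Fintype.card V * Nat.card (LinearMap.ker Q.polarBilin) ∧
      ∀ t, (p : ℤ) * levelCard Q t =
        Fintype.card V + (if t = 0 then (p - 1 : ℤ) else -1) * A + p * quadraticChar (ZMod p) t * B := by
  have hchar : ringChar (ZMod p) ≠ 2 := by rwa [ZMod.ringChar_zmod_n]
  obtain ⟨s, hs⟩ := FiniteField.exists_nonsquare hchar
  have hs0 : s ≠ 0 := by rintro rfl; exact hs (IsSquare.zero)
  obtain ⟨u, hu⟩ := even_levelCard hp Q one_ne_zero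
  obtain ⟨v, hv⟩ := even_levelCard hp Q hs0
  have hp0 : (p : ℤ) ≠ 0 := by exact_mod_cast (Fact.out : p.Prime).ne_zero
  have hp1 : (p : ℤ) - 1 ≠ 0 := by
    have := (Fact.out : p.Prime).one_lt
    omega
  have hZ : ∀ t, (levelCard Q t : ℤ) = (u + v) + (if t = 0 then ((levelCard Q 0 : ℤ) - (u + v)) else 0)
      + quadraticChar (ZMod p) t * (u - v) := by
    intro t
    by_cases ht : t = 0
    · subst ht; simp
    rw [if_neg ht]
    by_cases hsq : IsSquare t
    · rw [(quadraticChar_one_iff_isSquare ht).2 hsq]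
      obtain ⟨c, rfl⟩ := hsq
      have hc : c ≠ 0 := by rintro rfl; simp at ht
      have := levelCard_mul_sq Q hc 1
      rw [mul_one] at this
      rw [this, hu]; push_cast; ring
    · have h1 := (quadraticChar_neg_one_iff_not_isSquare).2 hsq
      have h2 := (quadraticChar_neg_one_iff_not_isSquare).2 hs
      have h3 : IsSquare (t / s) := by
        rw [← quadraticChar_one_iff_isSquare (div_ne_zero ht hs0)]
        have : quadraticChar (ZMod p) t = quadraticChar (ZMod p) (t / s) * quadraticChar (ZMod p) s := by
          rw [← map_mul, div_mul_cancel₀ _ hs0]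
        rw [h1, h2] at this
        omega
      obtain ⟨c, hc⟩ := h3
      have hc0 : c ≠ 0 := by rintro rfl; simp [ht, hs0] at hc
      have h4 : t = c * c * s := by rw [← hc, div_mul_cancel₀ _ hs0]
      rw [h1, h4, levelCard_mul_sq Q hc0, hv]; push_cast; ring
  set Z : ℤ := ((levelCard Q 0 : ℕ) : ℤ)
  have hη := quadraticChar_sum_zero (F := ZMod p) hchar
  have hη2 : ∑ t : ZMod p, (quadraticChar (ZMod p) t) ^ 2 = (p : ℤ) - 1 := by
    rw [← Finset.add_sum_erase _ _ (mem_univ (0 : ZMod p)), Finset.sum_congr rfl fun c hc =>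
        quadraticChar_sq_one (Finset.ne_of_mem_erase hc),
        Finset.sum_const, Finset.card_erase_of_mem (mem_univ _), Finset.card_univ, ZMod.card,
        nsmul_eq_mul, Nat.cast_sub (Fact.out : p.Prime).one_le]
    simp
  have hsum : (Fintype.card V : ℤ) = p * (u + v) + (Z - (u + v)) := by
    have h1 := sum_comp_eq_sum_levelCard (R := ℤ) Q (fun _ => 1)
    simp only [mul_one, Finset.sum_const, nsmul_eq_mul, Finset.card_univ] at h1
    rw [h1, Finset.sum_congr rfl fun t _ => hZ t, Finset.sum_add_distrib, Finset.sum_add_distrib,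
      ← Finset.sum_mul, hη, Finset.sum_ite_eq' univ (0 : ZMod p)]
    simp [ZMod.card]
  have hsq : ∑ t, (levelCard Q t : ℤ) ^ 2 = Z ^ 2 + (p - 1) * ((u + v) ^ 2 + (u - v) ^ 2) := by
    have h1 : ∀ t, (levelCard Q t : ℤ) ^ 2 = (u + v) ^ 2 +
        (if t = 0 then (Z ^ 2 - (u + v) ^ 2) else 0) +
        quadraticChar (ZMod p) t * (2 * (u + v) * (u - v)) +
        quadraticChar (ZMod p) t ^ 2 * (u - v) ^ 2 := by
      intro t
      rw [hZ t]
      by_cases ht : t = 0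
      · subst ht; simp
      · rw [if_neg ht, if_neg ht]; ring
    rw [Finset.sum_congr rfl fun t _ => h1 t, Finset.sum_add_distrib, Finset.sum_add_distrib,
      Finset.sum_add_distrib, ← Finset.sum_mul, ← Finset.sum_mul, hη, hη2,
      Finset.sum_ite_eq' univ (0 : ZMod p)]
    simp [ZMod.card]
    ring
  have hpair := sum_levelCard_sq hp Q
  rw [hsq] at hpair
  refine ⟨Z - (u + v), u - v, ?_, fun t => ?_⟩
  · apply mul_left_cancel₀ hp1
    rw [hsum] at hpair ⊢
    linear_combination hpair
  · rw [hZ t, hsum]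
    split_ifs <;> ring

/-- The level sets of a quadratic form over `𝔽_p` of even rank. -/
theorem exists_levelCard_of_even (hp : p ≠ 2) (Q : QuadraticForm (ZMod p) V) {m k : ℕ}
    (hV : Fintype.card V = p ^ m) (hk : Nat.card (LinearMap.ker Q.polarBilin) = p ^ k)
    (he : Even (m + k)) :
    ∃ A : ℤ, A ^ 2 = (p : ℤ) ^ (m + k) ∧ (∀ t, (p : ℤ) * levelCard Q t =
        p ^ m + (if t = 0 then (p - 1 : ℤ) else -1) * A) ∧
      ∀ ψ : AddChar (ZMod p) ℂ, ψ ≠ 0 → quadExpSum ψ Q = A := by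
  obtain ⟨A, B, h1, h2⟩ := exists_levelCard_eq hp Q
  rw [hV, hk] at h1
  obtain ⟨hB, hA⟩ := (sq_add_prime_mul_sq Fact.out (m + k) A B
    (by rw [h1]; push_cast; ring)).1 he
  have h3 : ∀ t, (p : ℤ) * levelCard Q t = p ^ m + (if t = 0 then (p - 1 : ℤ) else -1) * A := by
    intro t
    rw [h2 t, hB, hV]; push_cast; ring
  refine ⟨A, hA, h3, fun ψ hψ => ?_⟩
  have hp0 : (p : ℂ) ≠ 0 := by exact_mod_cast (Fact.out : p.Prime).ne_zero
  have h4 : ∀ t, (p : ℂ) * levelCard Q t = p ^ m - A + (if t = 0 then (p * A : ℂ) else 0) := by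
    intro t
    have h5 := congrArg (Int.cast : ℤ → ℂ) (h3 t)
    push_cast at h5
    rw [h5]; split_ifs <;> ring
  have h5 : ∑ t, ψ t = 0 := AddChar.sum_eq_zero_of_ne_one hψ
  apply mul_left_cancel₀ hp0
  rw [quadExpSum, sum_comp_eq_sum_levelCard Q ψ, Finset.mul_sum]
  simp only [← mul_assoc, h4, add_mul, Finset.sum_add_distrib, ← Finset.mul_sum, h5, ite_mul,
    zero_mul, Finset.sum_ite_eq', mem_univ, if_true, mul_zero, AddChar.map_zero_eq_one]
  ring

/-- The level sets of a quadratic form over `𝔽_p` of odd rank. -/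
theorem exists_levelCard_of_odd (hp : p ≠ 2) (Q : QuadraticForm (ZMod p) V) {m k : ℕ}
    (hV : Fintype.card V = p ^ m) (hk : Nat.card (LinearMap.ker Q.polarBilin) = p ^ k)
    (he : Odd (m + k)) :
    ∃ B : ℤ, p * B ^ 2 = (p : ℤ) ^ (m + k) ∧ ∀ t, (p : ℤ) * levelCard Q t =
        p ^ m + p * quadraticChar (ZMod p) t * B := by
  obtain ⟨A, B, h1, h2⟩ := exists_levelCard_eq hp Q
  rw [hV, hk] at h1
  obtain ⟨hA, hB⟩ := (sq_add_prime_mul_sq Fact.out (m + k) A B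
    (by rw [h1]; push_cast; ring)).2 he
  refine ⟨B, hB, fun t => ?_⟩
  rw [h2 t, hA, hV]; push_cast; ring

end Levels

/-! ### The effect of a nonsquare scalar on an exponential sum. -/

section Twist

variable {K V : Type*} [Field K] [Fintype K] [AddCommGroup V] [Module K V] [Fintype V]

/-- The number of square roots of `t` is `1 + χ(t)`, the constant 1 contributes nothing since `ψ(w
·)` sums to 0, and `χ(c) = -1` changes the sign of the remaining Gauss sum. -/
theorem sum_addChar_nonsquare_mul_sq (hK : ringChar K ≠ 2) (ψ : AddChar K ℂ) (hψ : ψ ≠ 0) {c : K}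
    (hc : ¬ IsSquare c) {w : K} (hw : w ≠ 0) :
    ∑ x, ψ (c * (w * (x * x))) = - ∑ x, ψ (w * (x * x)) := by
  classical
  have hc0 : c ≠ 0 := by rintro rfl; exact hc IsSquare.zero
  have key : ∀ g : K → ℂ, ∑ x, g (x * x) = ∑ t, ((quadraticChar K t : ℂ) + 1) * g t := by
    intro g
    rw [← Finset.sum_fiberwise_of_maps_to (s := univ) (t := univ) (g := fun x : K => x * x)
      (fun _ _ => mem_univ _)]
    refine Finset.sum_congr rfl fun t _ => ?_
    rw [Finset.sum_congr rfl (g := fun _ => g t) (fun x hx => by rw [(mem_filter.1 hx).2]),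
      Finset.sum_const, nsmul_eq_mul]
    congr 1
    have h := quadraticChar_card_sqrts hK t
    have h2 : (univ.filter fun x : K => x * x = t) = {x | x ^ 2 = t}.toFinset := by
      ext x; simp [sq]
    rw [h2]
    exact_mod_cast h
  have h1 := key (fun t => ψ (c * (w * t)))
  have h2 := key (fun t => ψ (w * t))
  have h3 : ∑ t, ((quadraticChar K t : ℂ) + 1) * ψ (c * (w * t)) =
      ∑ t, (-(quadraticChar K t : ℂ) + 1) * ψ (w * t) := by
    rw [← Equiv.sum_comp (Equiv.mulLeft₀ c hc0) (fun t => (-(quadraticChar K t : ℂ) + 1) * ψ (w * t))]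
    refine Finset.sum_congr rfl fun t _ => ?_
    simp only [Equiv.mulLeft₀_apply, map_mul, quadraticChar_neg_one_iff_not_isSquare.2 hc]
    rw [mul_left_comm]
    push_cast; ring
  have h4 : ∑ t, ψ (w * t) = 0 := by
    have := sum_addChar_dual ψ hψ (LinearMap.mul K K w)
    rw [if_neg] at this
    · simpa using this
    · intro h
      have := LinearMap.congr_fun h 1
      simp [hw] at this
  rw [h1, h2, h3]
  simp only [add_mul, Finset.sum_add_distrib, one_mul, h4, neg_mul, Finset.sum_neg_distrib]
  ring

theorem quadExpSum_of_equivalent (ψ : AddChar K ℂ) {W : Type*} [AddCommGroup W] [Module K W]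
    [Fintype W] (Q : QuadraticForm K V) (R : QuadraticForm K W) (e : Q.IsometryEquiv R) :
    quadExpSum ψ Q = quadExpSum ψ R := by
  refine Fintype.sum_equiv e.toLinearEquiv.toEquiv _ _ fun x => ?_
  congr 1
  exact (e.map_app x).symm

theorem quadExpSum_weightedSumSquares (ψ : AddChar K ℂ) {n : ℕ} (c : K) (w : Fin n → K) :
    quadExpSum ψ (c • QuadraticMap.weightedSumSquares K w) =
      ∏ i, ∑ x, ψ (c * (w i * (x * x))) := by
  classical
  rw [quadExpSum, Finset.prod_univ_sum, Fintype.piFinset_univ]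
  refine Finset.sum_congr rfl fun v _ => ?_
  rw [smul_apply, QuadraticMap.weightedSumSquares_apply]
  simp only [smul_eq_mul, Finset.mul_sum]
  exact map_sum ψ.toAddMonoidHom (fun i => c * (w i * (v i * v i))) univ

/-- Multiplying a quadratic form of rank `r` by a nonsquare multiplies its exponential sum
by `(-1)^r`. -/
theorem quadExpSum_nonsquare_smul (hK : ringChar K ≠ 2) (ψ : AddChar K ℂ) (hψ : ψ ≠ 0) {c : K}
    (hc : ¬ IsSquare c) (Q : QuadraticForm K V) {j : ℕ}
    (hj : Nat.card (LinearMap.ker Q.polarBilin) = Fintype.card K ^ j) :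
    quadExpSum ψ (c • Q) = (-1) ^ (Module.finrank K V + j) * quadExpSum ψ Q := by
  classical
  have h2 : (2 : K) ≠ 0 := Ring.two_ne_zero hK
  have : Invertible (2 : K) := invertibleOfNonzero h2
  have : FiniteDimensional K V := Module.Finite.of_finite
  obtain ⟨n, hn, w, ⟨e⟩⟩ : ∃ n, n = Module.finrank K V ∧ ∃ w : Fin n → K,
      QuadraticMap.Equivalent Q (QuadraticMap.weightedSumSquares K w) :=
    ⟨_, rfl, QuadraticForm.equivalent_weightedSumSquares Q⟩
  have e' : (c • Q).IsometryEquiv (c • QuadraticMap.weightedSumSquares K w) :=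
    { e.toLinearEquiv with
      map_app' := fun x => by
        have := e.map_app x
        simp only [smul_apply]
        rw [← this]; rfl }
  have hQ : quadExpSum ψ Q = ∏ i, ∑ x, ψ (w i * (x * x)) := by
    have := quadExpSum_weightedSumSquares ψ 1 w
    simp only [one_smul, one_mul] at this
    rw [← this]
    exact quadExpSum_of_equivalent ψ _ _ e
  have hcQ : quadExpSum ψ (c • Q) = ∏ i, ∑ x, ψ (c * (w i * (x * x))) := by
    rw [← quadExpSum_weightedSumSquares ψ c w]
    exact quadExpSum_of_equivalent ψ _ _ e'
  have hsgn : quadExpSum ψ (c • Q) =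
      (∏ i, if w i = 0 then (1 : ℂ) else -1) * quadExpSum ψ Q := by
    rw [hcQ, hQ, ← Finset.prod_mul_distrib]
    refine Finset.prod_congr rfl fun i _ => ?_
    by_cases hi : w i = 0
    · simp [hi]
    · rw [if_neg hi, sum_addChar_nonsquare_mul_sq hK ψ hψ hc hi]; ring
  rw [hsgn, ← hn]
  congr 1
  -- the number of vanishing weights is `j`
  set z := (univ.filter fun i => w i = 0).card
  set r := (univ.filter fun i => ¬ w i = 0).card
  have hzr : z + r = n := by
    have := Finset.card_filter_add_card_filter_not (s := (univ : Finset (Fin n))) (fun i => w i = 0)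
    simpa using this
  -- A one-variable sum has squared modulus `|K|²` when its weight vanishes and `|K|` otherwise.
  -- Comparing the product of these with `quadExpSum_mul_conj` identifies the number of vanishing
  -- weights, without computing the radical of the diagonal form.
  have hg : ∀ i, (∑ x, ψ (w i * (x * x))) * conj (∑ x, ψ (w i * (x * x))) =
      (Fintype.card K : ℂ) * (if w i = 0 then (Fintype.card K : ℂ) else 1) := by
    intro i
    have h3 := quadExpSum_mul_conj h2 ψ hψ (w i • (QuadraticMap.sq : QuadraticForm K K))
    have h4 : Nat.card (LinearMap.ker (w i • (QuadraticMap.sq : QuadraticForm K K)).polarBilin) =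
        if w i = 0 then Fintype.card K else 1 := by
      split_ifs with hi
      · have : LinearMap.ker (w i • (QuadraticMap.sq : QuadraticForm K K)).polarBilin = ⊤ := by
          rw [LinearMap.ker_eq_top]
          ext; simp [hi, QuadraticMap.polar]
        rw [this, Nat.card_congr (Submodule.topEquiv (R := K) (M := K)).toEquiv,
          Nat.card_eq_fintype_card]
      · have hx0 : ∀ x ∈ LinearMap.ker (w i • (QuadraticMap.sq : QuadraticForm K K)).polarBilin,
            x = 0 := by
          intro x hx
          have := (w i • (QuadraticMap.sq : QuadraticForm K K)).apply_eq_zero_of_mem_ker_polarBilin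
            h2 hx
          simpa [hi] using this
        have : Subsingleton (LinearMap.ker (w i • (QuadraticMap.sq : QuadraticForm K K)).polarBilin) :=
          ⟨fun x y => Subtype.ext ((hx0 x x.2).trans (hx0 y y.2).symm)⟩
        exact Nat.card_of_subsingleton 0
    rw [h4] at h3
    have h5 : quadExpSum ψ (w i • (QuadraticMap.sq : QuadraticForm K K)) =
        ∑ x, ψ (w i * (x * x)) := by
      refine Finset.sum_congr rfl fun x _ => ?_
      simp [QuadraticMap.sq]
    rw [h5] at h3
    rw [h3]
    split_ifs <;> simp
  have hnorm := quadExpSum_mul_conj h2 ψ hψ Q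
  rw [hQ, map_prod, ← Finset.prod_mul_distrib, Finset.prod_congr rfl fun i _ => hg i,
    Finset.prod_mul_distrib, Finset.prod_ite, Finset.prod_const, Finset.prod_const,
    Finset.prod_const_one, mul_one, hj, Module.card_eq_pow_finrank (K := K) (V := V), ← hn,
    Finset.card_univ, Fintype.card_fin] at hnorm
  have hz : z = j := by
    have h6 : Fintype.card K ^ n * Fintype.card K ^ z = Fintype.card K ^ n * Fintype.card K ^ j := by
      exact_mod_cast hnorm
    have h7 : 1 < Fintype.card K := Fintype.one_lt_card
    exact Nat.pow_right_injective h7 (Nat.eq_of_mul_eq_mul_left (by positivity) h6)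
  rw [Finset.prod_ite, Finset.prod_const_one, one_mul, Finset.prod_const]
  change (-1 : ℂ) ^ r = _
  rw [← hzr, ← hz, add_assoc, add_comm r, ← add_assoc, pow_add, ← two_mul, pow_mul]
  simp

end Twist

/-! ### Zeros of a quadratic form plus an affine function. -/

section Words

variable {p : ℕ} [Fact p.Prime] {V : Type*} [AddCommGroup V] [Module (ZMod p) V] [Fintype V]

/-- The polar form is symmetric, so in finite dimension the image of `V` in its dual is the whole
annihilator of the radical. -/
theorem exists_mem_ker_of_notMem_range (Q : QuadraticForm (ZMod p) V)
    {f : Module.Dual (ZMod p) V} (hf : f ∉ LinearMap.range Q.polarBilin) :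
    ∃ w ∈ LinearMap.ker Q.polarBilin, f w ≠ 0 := by
  by_contra! hc
  apply hf
  have h1 := LinearMap.range_dualMap_eq_dualAnnihilator_ker Q.polarBilin
  have h2 : f ∈ (LinearMap.ker Q.polarBilin).dualAnnihilator := by
    rw [Submodule.mem_dualAnnihilator]
    exact hc
  rw [← h1] at h2
  obtain ⟨g, rfl⟩ := h2
  have : FiniteDimensional (ZMod p) V := Module.Finite.of_finite
  obtain ⟨v, rfl⟩ := (Module.evalEquiv (ZMod p) V).surjective g
  refine ⟨v, ?_⟩
  ext x
  simp [QuadraticMap.polar_comm (⇑Q) v x]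

/-- Translation by a multiple of a radical vector `w` with `f w ≠ 0` leaves `Q` unchanged and shifts
the value by an arbitrary constant, so all `p` values are taken equally often. -/
theorem levelCard_of_notMem_range (hp : p ≠ 2) (Q : QuadraticForm (ZMod p) V)
    {f : Module.Dual (ZMod p) V} (hf : f ∉ LinearMap.range Q.polarBilin) (h : ZMod p) :
    p * levelCard (fun x => Q x + f x + h) 0 = Fintype.card V := by
  have h2 : (2 : ZMod p) ≠ 0 := Ring.two_ne_zero (by rwa [ZMod.ringChar_zmod_n])
  obtain ⟨w, hw, hfw⟩ := exists_mem_ker_of_notMem_range Q hf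
  have h1 : ∀ t, levelCard (fun x => Q x + f x + h) t = levelCard (fun x => Q x + f x + h) 0 := by
    intro t
    have h3 : ∀ (c : ZMod p) x, Q (x + c • w) + f (x + c • w) + h = Q x + f x + h + c * f w := by
      intro c x
      have h4 : Q.polarBilin w x = 0 := by rw [LinearMap.mem_ker.1 hw]; rfl
      have h5 : Q (x + c • w) = Q x := by
        rw [QuadraticMap.map_add Q, QuadraticMap.map_smul,
          Q.apply_eq_zero_of_mem_ker_polarBilin h2 hw, QuadraticMap.polar_smul_right,
          QuadraticMap.polar_comm, ← QuadraticMap.polarBilin_apply_apply, h4]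
        simp
      rw [h5, map_add, map_smul, smul_eq_mul]; ring
    refine Finset.card_bij' (fun x _ => x + (-(t / f w)) • w) (fun x _ => x + (t / f w) • w)
      ?_ ?_ ?_ ?_
    · intro x hx
      simp only [mem_filter, mem_univ, true_and] at hx ⊢
      rw [h3, hx]; field_simp; ring
    · intro x hx
      simp only [mem_filter, mem_univ, true_and] at hx ⊢
      rw [h3, hx]; field_simp; ring
    · intro x _; simp
    · intro x _; simp
  have h6 := sum_comp_eq_sum_levelCard (R := ℤ) (fun x => Q x + f x + h) (fun _ => 1)
  simp only [mul_one, h1, Finset.sum_const, nsmul_eq_mul, Finset.card_univ, ZMod.card] at h6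
  exact_mod_cast h6.symm

/-- Completing the square: `Q x + polar u x = Q (x + u) - Q u`. -/
theorem levelCard_polarBilin_add (Q : QuadraticForm (ZMod p) V) (u : V) (h : ZMod p) :
    levelCard (fun x => Q x + Q.polarBilin u x + h) 0 = levelCard Q (Q u - h) := by
  refine Finset.card_bij' (fun x _ => x + u) (fun x _ => x - u) ?_ ?_ ?_ ?_
  · intro x hx
    simp only [mem_filter, mem_univ, true_and, QuadraticMap.polarBilin_apply_apply] at hx ⊢
    rw [QuadraticMap.map_add Q, QuadraticMap.polar_comm]
    linear_combination hx
  · intro x hx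
    simp only [mem_filter, mem_univ, true_and, QuadraticMap.polarBilin_apply_apply] at hx ⊢
    have := QuadraticMap.map_add Q (x - u) u
    rw [sub_add_cancel, hx] at this
    rw [QuadraticMap.polar_comm]
    linear_combination -this
  · intro x _; simp
  · intro x _; simp

/-- The number of words `Q + ℓ + h`, for a fixed quadratic form `Q`, having `N` zeros. -/
theorem card_words (hp : p ≠ 2) (Q : QuadraticForm (ZMod p) V) [Fintype (Module.Dual (ZMod p) V)]
    (N : ℕ) :
    (univ.filter fun w : Module.Dual (ZMod p) V × ZMod p =>
      levelCard (fun x => Q x + w.1 x + w.2) 0 = N).card * Nat.card (LinearMap.ker Q.polarBilin) =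
    Fintype.card V * (univ.filter fun t => levelCard Q t = N).card +
      if p * N = Fintype.card V then
        p * Fintype.card V * (Nat.card (LinearMap.ker Q.polarBilin) - 1) else 0 := by
  classical
  have : FiniteDimensional (ZMod p) V := Module.Finite.of_finite
  set W := LinearMap.ker Q.polarBilin
  set R := LinearMap.range Q.polarBilin
  have hD : Fintype.card (Module.Dual (ZMod p) V) = Fintype.card V := by
    rw [Module.card_eq_pow_finrank (K := ZMod p), Module.card_eq_pow_finrank (K := ZMod p) (V := V),
      Subspace.dual_finrank_eq]
  have hRW : Nat.card R * Nat.card W = Fintype.card V := by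
    rw [← Nat.card_eq_fintype_card, Submodule.card_eq_card_quotient_mul_card W, mul_comm,
      Nat.card_congr Q.polarBilin.quotKerEquivRange.toEquiv]
  have hR : (univ.filter fun f : Module.Dual (ZMod p) V => f ∈ R).card = Nat.card R := by
    rw [Nat.card_eq_fintype_card, Fintype.card_subtype]
  -- For a functional represented by `u`, the map `h ↦ Q u - h` runs once through all levels of `Q`.
  -- For the other functionals the number of zeros does not depend on `h`.
  have hfib : ∀ f : Module.Dual (ZMod p) V,
      (univ.filter fun h => levelCard (fun x => Q x + f x + h) 0 = N).card =
      if f ∈ R then (univ.filter fun t => levelCard Q t = N).card else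
        if p * N = Fintype.card V then p else 0 := by
    intro f
    split_ifs with h1 h2
    · obtain ⟨u, rfl⟩ := h1
      simp only [levelCard_polarBilin_add]
      refine Finset.card_bij' (fun h _ => Q u - h) (fun t _ => Q u - t) ?_ ?_ ?_ ?_ <;> simp
    · have : (univ.filter fun h => levelCard (fun x => Q x + f x + h) 0 = N) = univ := by
        refine Finset.filter_true_of_mem fun h _ => ?_
        have := levelCard_of_notMem_range hp Q h1 h
        exact Nat.eq_of_mul_eq_mul_left (Fact.out : p.Prime).pos (this.trans h2.symm)
      rw [this, Finset.card_univ, ZMod.card]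
    · rw [Finset.card_eq_zero, Finset.filter_eq_empty_iff]
      intro h _ h3
      apply h2
      rw [← h3, levelCard_of_notMem_range hp Q h1 h]
  have hcard : (univ.filter fun w : Module.Dual (ZMod p) V × ZMod p =>
      levelCard (fun x => Q x + w.1 x + w.2) 0 = N).card =
      ∑ f : Module.Dual (ZMod p) V,
        (univ.filter fun h => levelCard (fun x => Q x + f x + h) 0 = N).card := by
    simp only [Finset.card_filter]
    rw [Fintype.sum_prod_type]
  rw [hcard, Finset.sum_congr rfl fun f _ => hfib f, Finset.sum_ite, Finset.sum_const,
    Finset.sum_const, hR, smul_eq_mul, smul_eq_mul]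
  have hnR : (univ.filter fun f : Module.Dual (ZMod p) V => f ∉ R).card =
      Fintype.card V - Nat.card R := by
    have := Finset.card_filter_add_card_filter_not (s := (univ : Finset (Module.Dual (ZMod p) V)))
      (fun f => f ∈ R)
    rw [hR, Finset.card_univ, hD] at this
    omega
  rw [hnR, add_mul]
  congr 1
  · rw [← hRW]; ring
  · split_ifs
    · rw [← hRW, ← Nat.mul_sub_one]
      ring
    · simp

end Words

/-! ### Kernels of skew polynomials in a field automorphism. -/

section SkewPolynomials

variable {F : Type*} [Field F] [Fintype F]

/-- The kernel of a linear operator `∑_{i ≤ k} c_i τ^i` with `c_k ≠ 0` has at most `κ^k` elements,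
where `κ` is the number of fixed points of `τ`; in case of equality, `c_0` and `(-1)^k c_k` have the
same image under every `τ`-invariant multiplicative map. -/
theorem card_ker_skew_le [DecidableEq F] (τ : F ≃+* F) {κ : ℕ}
    (hκ : (univ.filter fun x => τ x = x).card = κ) {M : Type*} [CommMonoidWithZero M]
    [IsCancelMulZero M] [Nontrivial M]
    (N : F →*₀ M) (hN : ∀ x, N (τ x) = N x) (k : ℕ) : ∀ c : ℕ → F, c k ≠ 0 →
      (univ.filter fun x => ∑ i ∈ range (k + 1), c i * τ^[i] x = 0).card ≤ κ ^ k ∧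
      ((univ.filter fun x => ∑ i ∈ range (k + 1), c i * τ^[i] x = 0).card = κ ^ k →
        N (c 0) = N (-1) ^ k * N (c k)) := by
  have hκ2 : 2 ≤ κ := by
    rw [← hκ, ← Finset.card_pair (zero_ne_one (α := F))]
    exact Finset.card_le_card (fun x hx => by
      simp only [mem_insert, mem_singleton] at hx
      rcases hx with rfl | rfl <;> simp)
  induction k with
  | zero =>
    intro c hc
    refine ⟨?_, by simp⟩
    rw [pow_zero, Finset.card_le_one]
    simp [hc]
  | succ k ih =>
    intro c hc
    set S := univ.filter fun x => ∑ i ∈ range (k + 1 + 1), c i * τ^[i] x = 0 with hS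
    by_cases hw : ∃ w ∈ S, w ≠ 0
    swap
    · push Not at hw
      have h1 : S.card ≤ 1 := by
        rw [Finset.card_le_one]
        intro x hx y hy
        rw [hw x hx, hw y hy]
      have h2 : 2 ≤ κ ^ (k + 1) := hκ2.trans (Nat.le_self_pow (by omega) κ)
      exact ⟨by omega, by omega⟩
    obtain ⟨w, hwS, hw0⟩ := hw
    have hmul : ∀ i (x y : F), τ^[i] (x * y) = τ^[i] x * τ^[i] y := by
      intro i; induction i with
      | zero => intro x y; rfl
      | succ i ih => intro x y; rw [Function.iterate_succ_apply, map_mul, ih]; rfl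
    have hsub : ∀ i (x y : F), τ^[i] (x - y) = τ^[i] x - τ^[i] y := by
      intro i; induction i with
      | zero => intro x y; rfl
      | succ i ih => intro x y; rw [Function.iterate_succ_apply, map_sub, ih]; rfl
    have hne : ∀ i, τ^[i] w ≠ 0 := by
      intro i; induction i with
      | zero => exact hw0
      | succ i ih => rw [Function.iterate_succ_apply']; simpa using ih
    have hNi : ∀ i, N (τ^[i] w) = N w := by
      intro i; induction i with
      | zero => rfl
      | succ i ih => rw [Function.iterate_succ_apply', hN, ih]
    set c' : ℕ → F := fun i => c i * τ^[i] w with hc'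
    set e : ℕ → F := fun i => - ∑ j ∈ range (i + 1), c' j with he
    have hsum0 : ∑ j ∈ range (k + 1 + 1), c' j = 0 := (mem_filter.1 hwS).2
    have hek : e k = c' (k + 1) := by
      rw [Finset.sum_range_succ] at hsum0
      simp only [he]
      linear_combination -hsum0
    have hek0 : e k ≠ 0 := by rw [hek]; exact mul_ne_zero hc (hne _)
    obtain ⟨ih1, ih2⟩ := ih e hek0
    set S' := univ.filter fun x => ∑ i ∈ range (k + 1), e i * τ^[i] x = 0 with hS'
    have hmaps : ∀ x ∈ S, τ (x / w) - x / w ∈ S' := by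
      intro x hx
      have hx' : ∑ i ∈ range (k + 1 + 1), c' i * τ^[i] (x / w) = 0 := by
        rw [← (mem_filter.1 hx).2]
        refine Finset.sum_congr rfl fun i _ => ?_
        simp only [hc']
        rw [mul_assoc, ← hmul, mul_div_cancel₀ _ hw0]
      rw [hS', mem_filter]
      refine ⟨mem_univ _, ?_⟩
      set y := x / w
      -- Summation by parts; at `r = k + 1` the boundary term vanishes because the `c'` sum to 0.
      have habel : ∀ r, ∑ i ∈ range (r + 1), c' i * τ^[i] y =
          (∑ i ∈ range (r + 1), c' i) * τ^[r] y + ∑ i ∈ range r, e i * τ^[i] (τ y - y) := by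
        intro r
        induction r with
        | zero => simp
        | succ r ihr =>
          rw [Finset.sum_range_succ, ihr, Finset.sum_range_succ _ (r + 1),
            Finset.sum_range_succ (fun i => e i * τ^[i] (τ y - y)), hsub,
            ← Function.iterate_succ_apply]
          simp only [he]
          ring
      have h3 := habel (k + 1)
      rw [hx', hsum0, zero_mul, zero_add] at h3
      exact h3.symm
    -- A fibre of `y ↦ τ y - y` is a translate of part of the fixed field, hence has at most `κ`
    -- elements.
    have hcard : S.card ≤ κ * S'.card := by
      refine Finset.card_le_mul_card_image_of_maps_to hmaps κ fun z _ => ?_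
      by_cases hz : ∃ x0 ∈ S, τ (x0 / w) - x0 / w = z
      · obtain ⟨x0, _, hx0⟩ := hz
        rw [← hκ]
        refine Finset.card_le_card_of_injOn (fun x => (x - x0) / w) ?_ ?_
        · intro x hx
          have hx1 := (mem_filter.1 (Finset.mem_coe.1 hx)).2
          simp only [coe_filter, mem_univ, true_and, Set.mem_ofPred_eq]
          rw [sub_div, map_sub]
          linear_combination hx1 - hx0
        · intro x _ y _ hxy
          simpa [hw0, div_left_inj'] using hxy
      · push Not at hz
        rw [Finset.card_eq_zero.2]
        · exact Nat.zero_le _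
        · rw [Finset.filter_eq_empty_iff]
          exact fun x hx => hz x hx
    refine ⟨hcard.trans (by rw [pow_succ']; exact Nat.mul_le_mul_left κ ih1), fun heq => ?_⟩
    -- A kernel of maximal size forces a kernel of maximal size for the quotient, so the norm
    -- relation passes through the induction. The factor `N w` occurs in both extreme coefficients
    -- and cancels, while the sign in `e 0 = -(c 0 * w)` accounts for one factor `N (-1)`.
    have h4 : S'.card = κ ^ k := by
      refine le_antisymm ih1 ?_
      rw [heq, pow_succ'] at hcard
      exact Nat.le_of_mul_le_mul_left hcard (by omega)
    have h5 := ih2 h4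
    have h6 : e 0 = (-1) * (c 0 * w) := by simp [he, hc']
    rw [h6, hek, map_mul, map_mul, map_mul, hNi] at h5
    have hNw : N w ≠ 0 := by simpa using hw0
    have hN1 : N (-1) * N (-1) = 1 := by rw [← map_mul]; simp
    apply mul_right_cancel₀ hNw
    calc N (c 0) * N w = (N (-1) * N (-1)) * (N (c 0) * N w) := by rw [hN1, one_mul]
      _ = N (-1) * (N (-1) * (N (c 0) * N w)) := by rw [mul_assoc]
      _ = N (-1) ^ (k + 1) * N (c (k + 1)) * N w := by rw [h5, pow_succ']; simp only [mul_assoc]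

end SkewPolynomials

/-! ### Fixed points of powers of Frobenius. -/

section FixedPoints

variable {F : Type*} [Field F] [Fintype F] [DecidableEq F]

theorem card_pow_eq_one (k : ℕ) (hk : 0 < k) :
    (univ.filter fun x : F => x ^ k = 1).card = (Fintype.card F - 1).gcd k := by
  have h1 := IsCyclic.card_powMonoidHom_ker Fˣ k
  rw [Nat.card_eq_fintype_card (α := Fˣ), Fintype.card_units] at h1
  rw [← h1, Nat.card_eq_fintype_card, ← Finset.card_univ]
  symm
  refine Finset.card_bij (fun u _ => ((u : Fˣ) : F)) ?_ ?_ ?_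
  · intro u _
    have := u.2
    rw [MonoidHom.mem_ker, powMonoidHom_apply] at this
    simp only [mem_filter, mem_univ, true_and]
    rw [← Units.val_pow_eq_pow_val, this, Units.val_one]
  · intro u _ v _ h
    exact Subtype.ext (Units.ext h)
  · intro x hx
    have hx1 := (mem_filter.1 hx).2
    have hx0 : x ≠ 0 := by rintro rfl; rw [zero_pow hk.ne'] at hx1; exact zero_ne_one hx1
    exact ⟨⟨Units.mk0 x hx0, by
      rw [MonoidHom.mem_ker, powMonoidHom_apply]; ext; simpa using hx1⟩, mem_univ _, rfl⟩

theorem card_pow_prime_pow_eq_self {p m r : ℕ} (hp : p.Prime) (hF : Fintype.card F = p ^ m)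
    (hr : 0 < r) :
    (univ.filter fun x : F => x ^ p ^ r = x).card = p ^ m.gcd r := by
  have h1 : (univ.filter fun x : F => x ^ p ^ r = x) =
      insert 0 (univ.filter fun x : F => x ^ (p ^ r - 1) = 1) := by
    have hpr : 1 < p ^ r := Nat.one_lt_pow hr.ne' hp.one_lt
    ext x
    simp only [mem_filter, mem_univ, true_and, mem_insert]
    by_cases hx : x = 0
    · simp [hx, hp.ne_zero]
    · simp only [hx, false_or]
      rw [← mul_left_inj' (a := x ^ (p ^ r - 1)) (b := 1) hx, ← pow_succ, one_mul, Nat.sub_add_cancel hpr.le]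
  have hpr : 0 < p ^ r - 1 := Nat.sub_pos_of_lt (Nat.one_lt_pow hr.ne' hp.one_lt)
  rw [h1, Finset.card_insert_of_notMem (by simp [hpr.ne']), card_pow_eq_one _ hpr, hF,
    Nat.pow_sub_one_gcd_pow_sub_one, Nat.sub_add_cancel (Nat.one_le_pow _ _ hp.pos)]

end FixedPoints

/-! ### The quadratic forms attached to the code and their radicals. -/

section Forms

variable {F : Type*} [Field F] [Fintype F]

/-- The quadratic form `x ↦ Tr(a σ³(x) x + b σ(x) x)`. -/
noncomputable def doForm (K : Type*) [Field K] [Algebra K F] (σ : F ≃ₐ[K] F) (a b : F) :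
    QuadraticForm K F :=
  LinearMap.BilinMap.toQuadraticMap (LinearMap.mk₂ K
    (fun x y => Algebra.trace K F (a * σ (σ (σ x)) * y + b * σ x * y))
    (fun x x' y => by rw [← map_add]; congr 1; simp only [map_add]; ring)
    (fun c x y => by rw [← map_smul]; congr 1
                     simp only [map_mul, AlgEquiv.commutes, Algebra.smul_def]; ring)
    (fun x y y' => by rw [← map_add]; congr 1; ring)
    (fun c x y => by rw [← map_smul]; congr 1; simp only [Algebra.smul_def]; ring))

theorem doForm_apply (K : Type*) [Field K] [Algebra K F] (σ : F ≃ₐ[K] F) (a b x : F) :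
    doForm K σ a b x = Algebra.trace K F (a * (σ (σ (σ x)) * x) + b * (σ x * x)) := by
  simp only [doForm, LinearMap.BilinMap.toQuadraticMap_apply, LinearMap.mk₂_apply, mul_assoc]

/-- The operator whose kernel is the radical of `doForm`. -/
def doRadical (p l : ℕ) (a b x : F) : F :=
  a * x + b ^ p ^ (2 * l) * x ^ p ^ (2 * l) + b ^ p ^ (3 * l) * x ^ p ^ (4 * l) +
    a ^ p ^ (3 * l) * x ^ p ^ (6 * l)

/-- The trace is invariant under `σ`, so each of the four terms of the polar form may be hit with a
power of `σ` until `y` appears as `σ³ y`. The coefficient of `σ³ y` is then polynomial in `x`. -/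
theorem polar_doForm {K : Type*} [Field K] [Finite K] [Algebra K F] (σ : F ≃ₐ[K] F) {p l : ℕ}
    (hσ : ∀ x, σ x = x ^ p ^ l) (a b x y : F) :
    (doForm K σ a b).polarBilin x y =
      Algebra.trace K F (doRadical p l a b x * y ^ p ^ (3 * l)) := by
  have hT : ∀ z, Algebra.trace K F (σ z) = Algebra.trace K F z := fun z =>
    Algebra.trace_eq_of_algEquiv σ z
  have h0 : (doForm K σ a b).polarBilin x y =
      Algebra.trace K F (a * (σ (σ (σ x)) * y)) + Algebra.trace K F (a * (σ (σ (σ y)) * x)) +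
      (Algebra.trace K F (b * (σ x * y)) + Algebra.trace K F (b * (σ y * x))) := by
    rw [QuadraticMap.polarBilin_apply_apply, QuadraticMap.polar, doForm_apply, doForm_apply,
      doForm_apply]
    simp only [← map_add, ← map_sub]
    congr 1
    simp only [map_add]
    ring
  rw [h0, ← hT (a * (σ (σ (σ x)) * y)), ← hT (σ (a * (σ (σ (σ x)) * y))),
    ← hT (σ (σ (a * (σ (σ (σ x)) * y)))), ← hT (b * (σ x * y)), ← hT (σ (b * (σ x * y))),
    ← hT (σ (σ (b * (σ x * y)))), ← hT (b * (σ y * x)), ← hT (σ (b * (σ y * x)))]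
  have hadd : ∀ u v, Algebra.trace K F u + Algebra.trace K F v = Algebra.trace K F (u + v) :=
    fun u v => (map_add _ u v).symm
  simp only [hadd]
  congr 1
  simp only [hσ, doRadical, mul_pow, ← pow_mul, ← pow_add]
  ring_nf

/-- `σ³ y` runs through the whole field, so nondegeneracy of the trace form makes `x` radical
exactly when that coefficient vanishes. -/
theorem card_ker_doForm {K : Type*} [Field K] [Finite K] [Algebra K F] [DecidableEq F]
    (σ : F ≃ₐ[K] F) {p l : ℕ} (hσ : ∀ x, σ x = x ^ p ^ l) (a b : F) :
    Nat.card (LinearMap.ker (doForm K σ a b).polarBilin) =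
      (univ.filter fun x => doRadical p l a b x = 0).card := by
  have hfd : FiniteDimensional K F := Module.Finite.of_finite
  rw [← Fintype.card_subtype, ← Nat.card_eq_fintype_card]
  refine Nat.card_congr (Equiv.subtypeEquivRight fun x => ?_)
  rw [LinearMap.mem_ker]
  constructor
  · intro h
    by_contra hx
    apply traceForm_nondegenerate K F |>.1 |> fun hn => hx (hn _ fun z => ?_)
    have h1 := polar_doForm σ hσ a b x (σ.symm (σ.symm (σ.symm z)))
    rw [h] at h1
    have h2 : (σ.symm (σ.symm (σ.symm z))) ^ p ^ (3 * l) = z := by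
      have h3 : ∀ w, w ^ p ^ (3 * l) = σ (σ (σ w)) := by
        intro w
        simp only [hσ, ← pow_mul, ← pow_add]
        ring_nf
      rw [h3]; simp
    rw [h2] at h1
    rw [Algebra.traceForm_apply, ← h1]
    rfl
  · intro h
    ext y
    rw [polar_doForm σ hσ, h]
    simp

variable {p m l : ℕ} [Fact p.Prime] [CharP F p] [DecidableEq F]

theorem iterate_iterateFrobeniusEquiv (r i : ℕ) (x : F) :
    (iterateFrobeniusEquiv F p r)^[i] x = x ^ p ^ (i * r) := by
  induction i with
  | zero => simp
  | succ i ih =>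
    rw [Function.iterate_succ_apply', ih, iterateFrobeniusEquiv_def, ← pow_mul, ← pow_add]
    ring_nf

/-- The radical is a vector space over the fixed field of `x ↦ x^(p^(2l))`, which has `p^d'`
elements, and is the kernel of a skew polynomial of degree at most 3. When `d' = d`, a kernel of
dimension 3 would give `N a = N(-1)³ N(a^(p^(3l))) = -N a` for the norm `N` to this field, which is
impossible for `a ≠ 0`. -/
theorem exists_card_doRadical (hpodd : Odd p) (hF : Fintype.card F = p ^ m) (hl : 0 < l) {a b : F}
    (hab : ¬ (a = 0 ∧ b = 0)) :
    ∃ j, j ≤ 3 ∧ (univ.filter fun x => doRadical p l a b x = 0).card = p ^ (m.gcd (2 * l) * j) ∧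
      (m.gcd (2 * l) = m.gcd l → j ≤ 2) := by
  have hp : p.Prime := Fact.out
  set d' := m.gcd (2 * l) with hd'
  have hd'0 : 0 < d' := Nat.gcd_pos_of_pos_right _ (by omega)
  have hκ : 1 < p ^ d' := Nat.one_lt_pow hd'0.ne' hp.one_lt
  have hadd : ∀ (k : ℕ) (x y : F), (x + y) ^ p ^ k = x ^ p ^ k + y ^ p ^ k :=
    fun k x y => add_pow_char_pow x y p k
  set E : Subfield F := (iterateFrobenius F p (2 * l)).eqLocusField (RingHom.id F) with hE
  let _ : Fintype E := Fintype.ofFinite E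
  have hmemE : ∀ x, x ∈ E ↔ x ^ p ^ (2 * l) = x := fun x => by
    rw [hE, RingHom.mem_eqLocusField, iterateFrobenius_def]; rfl
  have hEcard : Fintype.card E = p ^ d' := by
    rw [← card_pow_prime_pow_eq_self hp hF (by omega : 0 < 2 * l), ← Fintype.card_subtype]
    exact Fintype.card_congr (Equiv.subtypeEquivRight hmemE)
  have hEk : ∀ (c : E) (k : ℕ), (c : F) ^ p ^ (2 * k * l) = c := by
    intro c k
    have h1 := iterate_iterateFrobeniusEquiv (F := F) (p := p) (2 * l) k (c : F)
    rw [Function.iterate_fixed] at h1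
    · rw [show 2 * k * l = k * (2 * l) by ring]; exact h1.symm
    · rw [iterateFrobeniusEquiv_def]; exact (hmemE c).1 c.2
  let S : Submodule E F :=
    { carrier := {x | doRadical p l a b x = 0}
      zero_mem' := by simp [doRadical, hp.ne_zero]
      add_mem' := by
        intro x y hx hy
        have hx' : doRadical p l a b x = 0 := hx
        have hy' : doRadical p l a b y = 0 := hy
        change doRadical p l a b (x + y) = 0
        simp only [doRadical, hadd] at hx' hy' ⊢
        linear_combination hx' + hy'
      smul_mem' := by
        intro c x hx
        have hx' : doRadical p l a b x = 0 := hx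
        change doRadical p l a b ((c : F) * x) = 0
        have h1 := hEk c 1
        have h2 := hEk c 2
        have h3 := hEk c 3
        simp only [mul_one, show 2 * 2 = 4 by rfl, show 2 * 3 = 6 by rfl] at h1 h2 h3
        simp only [doRadical, mul_pow, h1, h2, h3] at hx' ⊢
        linear_combination (c : F) * hx' }
  let _ : Fintype S := Fintype.ofFinite S
  have hS : (univ.filter fun x => doRadical p l a b x = 0).card = Fintype.card S := by
    rw [← Fintype.card_subtype]
    exact Fintype.card_congr (Equiv.subtypeEquivRight fun x => Iff.rfl)
  have hcardS : (univ.filter fun x => doRadical p l a b x = 0).card =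
      p ^ (d' * Module.finrank E S) := by
    rw [hS, Module.card_eq_pow_finrank (K := E), hEcard, ← pow_mul]
  -- the kernel bound
  set c : ℕ → F := fun i => if i = 0 then a else if i = 1 then b ^ p ^ (2 * l) else
    if i = 2 then b ^ p ^ (3 * l) else if i = 3 then a ^ p ^ (3 * l) else 0 with hc
  set τ := iterateFrobeniusEquiv F p (2 * l) with hτ
  have hτκ : (univ.filter fun x => τ x = x).card = p ^ d' := by
    rw [← card_pow_prime_pow_eq_self hp hF (by omega : 0 < 2 * l)]
    congr 1
  have h4 : ∀ x, ∑ i ∈ range 4, c i * τ^[i] x = doRadical p l a b x := by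
    intro x
    simp only [hc, hτ, iterate_iterateFrobeniusEquiv, Finset.sum_range_succ, doRadical]
    simp
    ring_nf
  -- a norm map
  set e := (p ^ m - 1) / (p ^ d' - 1) with he
  have hdvd : p ^ d' - 1 ∣ p ^ m - 1 := Nat.pow_sub_one_dvd_pow_sub_one p (Nat.gcd_dvd_left _ _)
  have hm0 : m ≠ 0 := by
    rintro rfl
    rw [pow_zero] at hF
    exact absurd (Fintype.one_lt_card (α := F)) (by omega)
  have hpm : 1 < p ^ m := Nat.one_lt_pow hm0 hp.one_lt
  have hde : (p ^ d' - 1) * e = p ^ m - 1 := Nat.mul_div_cancel' hdvd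
  have he0 : e ≠ 0 := by
    intro h0
    rw [h0, mul_zero] at hde
    omega
  let N : F →*₀ F := powMonoidWithZeroHom he0
  have hNapp : ∀ x, N x = x ^ e := fun x => rfl
  have hNpow : ∀ r, d' ∣ r → ∀ x, N (x ^ p ^ r) = N x := by
    intro r hr x
    rw [hNapp, hNapp]
    by_cases hx : x = 0
    · subst hx; simp [he0, hp.ne_zero]
    obtain ⟨w, hw⟩ := Nat.pow_sub_one_dvd_pow_sub_one p hr
    have h5 : p ^ r = (p ^ d' - 1) * w + 1 := by
      have := Nat.one_le_pow r p hp.pos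
      omega
    have h6 : x ^ (p ^ m - 1) = 1 := by rw [← hF]; exact FiniteField.pow_card_sub_one_eq_one x hx
    rw [← pow_mul, h5, add_mul, one_mul, pow_add, mul_right_comm, hde, pow_mul, h6, one_pow, one_mul]
  have hN : ∀ x, N (τ x) = N x := by
    intro x
    rw [hτ, iterateFrobeniusEquiv_def]
    exact hNpow _ (Nat.gcd_dvd_right _ _) x
  have hS3 : (univ.filter fun x => doRadical p l a b x = 0).card ≤ (p ^ d') ^ 3 ∧
      ((univ.filter fun x => doRadical p l a b x = 0).card = (p ^ d') ^ 3 →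
        a ≠ 0 ∧ N a = N (-1) ^ 3 * N (a ^ p ^ (3 * l))) := by
    by_cases ha : a = 0
    -- For `a = 0` the coefficient of `τ³` vanishes and the bound for degree 2 applies.
    · have hb : b ≠ 0 := fun hb => hab ⟨ha, hb⟩
      have h5 := (card_ker_skew_le τ hτκ N hN 2 c (by simp [hc, hb])).1
      have h6 : ∀ x, ∑ i ∈ range (2 + 1), c i * τ^[i] x = doRadical p l a b x := by
        intro x
        rw [← h4, Finset.sum_range_succ _ 3]
        simp [hc, ha, hp.ne_zero]
      simp only [h6] at h5
      have h7 : (p ^ d') ^ 2 < (p ^ d') ^ 3 := Nat.pow_lt_pow_right hκ (by norm_num)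
      exact ⟨by omega, by omega⟩
    · have h5 := card_ker_skew_le τ hτκ N hN 3 c (by simp [hc, ha])
      simp only [show 3 + 1 = 4 by rfl, h4] at h5
      refine ⟨h5.1, fun h => ⟨ha, ?_⟩⟩
      have h6 := h5.2 h
      simpa [hc] using h6
  rw [hcardS, pow_mul] at hS3
  have hj3 : Module.finrank E S ≤ 3 := (Nat.pow_le_pow_iff_right hκ).1 hS3.1
  refine ⟨Module.finrank E S, hj3, hcardS, fun hd => ?_⟩
  by_contra hj
  have hj : Module.finrank E S = 3 := by omega
  obtain ⟨ha, h5⟩ := hS3.2 (by rw [hj])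
  have hdl : d' ∣ 3 * l := by
    rw [hd]; exact (Nat.gcd_dvd_right _ _).mul_left 3
  obtain ⟨n, hn⟩ : d' ∣ m := Nat.gcd_dvd_left _ _
  have hnodd : Odd n := by
    by_contra hne
    obtain ⟨w, hw⟩ := Nat.not_odd_iff_even.1 hne
    have h6 : 2 * d' ∣ d' := by
      nth_rewrite 2 [hd']
      refine Nat.dvd_gcd ⟨w, by rw [hn, hw]; ring⟩ (Nat.mul_dvd_mul_left 2 ?_)
      rw [hd]; exact Nat.gcd_dvd_right _ _
    have := Nat.le_of_dvd hd'0 h6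
    omega
  -- `e` is a geometric sum of `n` odd terms, and `n = m / d'` is odd here.
  have heodd : Odd e := by
    have h6 : e = ∑ i ∈ range n, (p ^ d') ^ i := by
      have h7 := Nat.geomSum_eq (m := p ^ d') (by omega) n
      rw [h7, ← pow_mul, ← hn]
    rw [h6, Finset.odd_sum_iff_odd_card_odd, Finset.filter_true_of_mem, Finset.card_range]
    · exact hnodd
    · exact fun i _ => (hpodd.pow).pow
  have h7 : N (-1) = -1 := by rw [hNapp]; exact heodd.neg_one_pow
  rw [hNpow _ hdl, h7] at h5
  have h8 : (2 : F) * N a = 0 := by linear_combination h5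
  have h9 : N a ≠ 0 := by simpa using ha
  rcases mul_eq_zero.1 h8 with h | h
  · apply Ring.two_ne_zero (R := F) ?_ h
    rw [ringChar.eq F p]
    rintro rfl
    exact absurd hpodd (by decide)
  · exact h9 h

end Forms

/-! ### Solutions of equations in the pair of monomials. -/

section Counting

variable {F : Type*} [Field F] [Fintype F] [DecidableEq F] {p m l : ℕ} [Fact p.Prime] [CharP F p]

/-- The pair `(x^{p^{3l}+1}, x^{p^l+1})`. -/
def doPair (p l : ℕ) (x : F) : F × F := (x ^ p ^ (3 * l) * x, x ^ p ^ l * x)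

theorem doPair_mul (x y : F) : doPair p l (x * y) = doPair p l x * doPair p l y := by
  simp only [doPair, mul_pow, Prod.mk_mul_mk]
  congr 1 <;> ring

theorem doPair_eq_zero {x : F} : doPair p l x = 0 ↔ x = 0 := by
  have : p ≠ 0 := (Fact.out : p.Prime).ne_zero
  constructor
  · intro h
    have h1 : x ^ p ^ l * x = 0 := congrArg Prod.snd h
    rcases mul_eq_zero.1 h1 with h | h
    · exact pow_eq_zero_iff (pow_ne_zero _ this) |>.1 h
    · exact h
  · rintro rfl
    simp [doPair]

/-- The fixed points of the `p^r`-power map are those of the `p^s`-power map, when `s ∣ r` and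
`gcd(m, s) = gcd(m, r)`. -/
theorem pow_prime_pow_eq_self_iff (hF : Fintype.card F = p ^ m) {r s : ℕ} (hs : 0 < s) (hr : 0 < r)
    (hsr : s ∣ r) (hg : m.gcd s = m.gcd r) (x : F) : x ^ p ^ r = x ↔ x ^ p ^ s = x := by
  have hp : p.Prime := Fact.out
  have hsub : (univ.filter fun x : F => x ^ p ^ s = x) ⊆ univ.filter fun x : F => x ^ p ^ r = x := by
    intro x hx
    simp only [mem_filter, mem_univ, true_and] at hx ⊢
    obtain ⟨k, rfl⟩ := hsr
    have h1 := iterate_iterateFrobeniusEquiv (F := F) (p := p) s k x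
    rw [Function.iterate_fixed (by rwa [iterateFrobeniusEquiv_def])] at h1
    rw [mul_comm]; exact h1.symm
  have heq := Finset.eq_of_subset_of_card_le hsub (by
    rw [card_pow_prime_pow_eq_self hp hF hs, card_pow_prime_pow_eq_self hp hF hr, hg])
  have := Finset.ext_iff.1 heq x
  simpa using this.symm

/-- Equal components force `t^(p^(3l)) = t^(p^l)`, and the outer `p^l`-th power can be removed by
injectivity of Frobenius. -/
theorem pow_two_mul_eq_self_of_doPair {t c : F} (hc : c ≠ 0) (h : doPair p l t = (c, c)) :
    t ^ p ^ (2 * l) = t := by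
  have h1 : t ^ p ^ (3 * l) * t = c := congrArg Prod.fst h
  have h2 : t ^ p ^ l * t = c := congrArg Prod.snd h
  have ht : t ≠ 0 := by rintro rfl; rw [mul_zero] at h2; exact hc h2.symm
  have h3 : t ^ p ^ (3 * l) = t ^ p ^ l := mul_right_cancel₀ ht (h1.trans h2.symm)
  have h4 : (t ^ p ^ (2 * l)) ^ p ^ l = t ^ p ^ l := by
    rw [← pow_mul, ← pow_add, ← h3]; ring_nf
  exact (iterateFrobeniusEquiv F p l).injective (by
    rw [iterateFrobeniusEquiv_def, iterateFrobeniusEquiv_def, h4])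

/-- Both monomials are multiplicative. For `y = 0` only `x = 0` remains; for `y ≠ 0` the quotient `t
= x / y` is the only unknown. -/
theorem card_doPair_eq_mul (c : F) :
    (univ.filter fun w : F × F => doPair p l w.1 = (c, c) * doPair p l w.2).card =
      1 + (Fintype.card F - 1) * (univ.filter fun t : F => doPair p l t = (c, c)).card := by
  have h1 : (univ.filter fun w : F × F => doPair p l w.1 = (c, c) * doPair p l w.2).card =
      ∑ y : F, (univ.filter fun x : F => doPair p l x = (c, c) * doPair p l y).card := by
    simp only [Finset.card_filter]
    rw [Fintype.sum_prod_type, Finset.sum_comm]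
  rw [h1, ← Finset.add_sum_erase _ _ (mem_univ (0 : F))]
  congr 1
  · have : (univ.filter fun x : F => doPair p l x = (c, c) * doPair p l 0) = {0} := by
      ext x
      simp [doPair_eq_zero.2 rfl, doPair_eq_zero]
    rw [this, Finset.card_singleton]
  · rw [Finset.sum_congr rfl (g := fun _ => (univ.filter fun t : F => doPair p l t = (c, c)).card),
      Finset.sum_const, Finset.card_erase_of_mem (mem_univ _), Finset.card_univ, smul_eq_mul]
    intro y hy
    have hy0 : y ≠ 0 := Finset.ne_of_mem_erase hy
    have key : ∀ t, doPair p l (t * y) = (c, c) * doPair p l y ↔ doPair p l t = (c, c) := by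
      intro t
      rw [doPair_mul]
      have h2 : (doPair p l y).1 ≠ 0 := mul_ne_zero (pow_ne_zero _ hy0) hy0
      have h3 : (doPair p l y).2 ≠ 0 := mul_ne_zero (pow_ne_zero _ hy0) hy0
      rw [Prod.ext_iff, Prod.ext_iff]
      simp [h2, h3]
    refine Finset.card_bij' (fun x _ => x / y) (fun t _ => t * y) ?_ ?_ ?_ ?_
    · intro x hx
      simp only [mem_filter, mem_univ, true_and] at hx ⊢
      rw [← key, div_mul_cancel₀ _ hy0, hx]
    · intro t ht
      simp only [mem_filter, mem_univ, true_and] at ht ⊢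
      exact (key t).2 ht
    · intro x _; simp [hy0]
    · intro x _; simp [hy0]

/-- A solution is fixed by `x ↦ x^(p^(2l))`, hence by `x ↦ x^(p^l)` since the two gcds agree, and
the equation becomes `t² = 1`. -/
theorem card_doPair_eq_one_of_odd (h2 : (2 : F) ≠ 0) (hF : Fintype.card F = p ^ m) (hl : 0 < l)
    (hg : m.gcd (2 * l) = m.gcd l) :
    (univ.filter fun t : F => doPair p l t = (1, 1)).card = 2 := by
  have : (univ.filter fun t : F => doPair p l t = (1, 1)) = {1, -1} := by
    ext t
    simp only [mem_filter, mem_univ, true_and, mem_insert, mem_singleton]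
    constructor
    · intro h
      have h3 := pow_two_mul_eq_self_of_doPair one_ne_zero h
      rw [pow_prime_pow_eq_self_iff hF hl (by omega) (Dvd.intro_left 2 rfl) hg.symm] at h3
      have h4 : t ^ p ^ l * t = 1 := congrArg Prod.snd h
      rw [h3] at h4
      exact mul_self_eq_one_iff.1 h4
    · have hp : Odd p := by
        rcases (Fact.out : p.Prime).eq_two_or_odd' with h | h
        · subst h
          exact absurd (CharTwo.two_eq_zero (R := F)) h2
        · exact h
      rintro (rfl | rfl)
      · simp [doPair]
      · simp [doPair, hp.pow.neg_one_pow]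
  rw [this, Finset.card_pair]
  intro h
  apply h2
  linear_combination h

/-- The same reduction leads to `t² = c` in the fixed field. This is what makes the twisted second
moment trivial for nonsquare `c`. -/
theorem card_doPair_eq_nonsquare_of_odd (hF : Fintype.card F = p ^ m) (hl : 0 < l)
    (hg : m.gcd (2 * l) = m.gcd l) {c : F}
    (hc : ∀ t : F, t ^ p ^ l = t → t * t ≠ c) :
    (univ.filter fun t : F => doPair p l t = (c, c)).card = 0 := by
  have hc0 : c ≠ 0 := fun h => hc 0 (by simp [(Fact.out : p.Prime).ne_zero]) (by rw [h, mul_zero])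
  rw [Finset.card_eq_zero, Finset.filter_eq_empty_iff]
  intro t _ h
  have h3 := pow_two_mul_eq_self_of_doPair hc0 h
  rw [pow_prime_pow_eq_self_iff hF hl (by omega) (Dvd.intro_left 2 rfl) hg.symm] at h3
  have h4 : t ^ p ^ l * t = c := congrArg Prod.snd h
  rw [h3] at h4
  exact hc t h3 h4

variable {d : ℕ}

/-- On the subfield with `p^(2d)` elements, `t ↦ t^(p^d + 1)` is the norm to the subfield with `p^d`
elements. Each fibre has at most `p^d + 1` elements, being a set of roots, and the total count
leaves no room for a smaller one. -/
theorem card_pow_succ_eq (hF : Fintype.card F = p ^ m) (hd : 0 < d) (hdm : 2 * d ∣ m) {c : F}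
    (hc0 : c ≠ 0) (hc : c ^ p ^ d = c) :
    (univ.filter fun t : F => t ^ (p ^ d + 1) = c).card = p ^ d + 1 := by
  have hp : p.Prime := Fact.out
  have hpd : 1 < p ^ d := Nat.one_lt_pow hd.ne' hp.one_lt
  have hfac : (p ^ d + 1) * (p ^ d - 1) = p ^ (2 * d) - 1 := by
    rw [← Nat.sq_sub_sq, ← pow_mul, one_pow, mul_comm 2]
  set A := univ.filter fun t : F => t ^ (p ^ (2 * d) - 1) = 1
  set B := univ.filter fun t : F => t ^ (p ^ d - 1) = 1
  have hp2d : 1 < p ^ (2 * d) := Nat.one_lt_pow (by omega) hp.one_lt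
  have hA : A.card = (p ^ d + 1) * (p ^ d - 1) := by
    rw [card_pow_eq_one _ (by omega), hF, hfac]
    exact Nat.gcd_eq_right (Nat.pow_sub_one_dvd_pow_sub_one p hdm)
  have hB : B.card = p ^ d - 1 := by
    rw [card_pow_eq_one _ (by omega), hF]
    exact Nat.gcd_eq_right (Nat.pow_sub_one_dvd_pow_sub_one p ((Dvd.intro_left 2 rfl).trans hdm))
  have hmaps : ∀ t ∈ A, t ^ (p ^ d + 1) ∈ B := by
    intro t ht
    simp only [A, B, mem_filter, mem_univ, true_and] at ht ⊢
    rw [← pow_mul, hfac, ht]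
  have hfib := Finset.card_eq_sum_card_fiberwise hmaps
  have hle : ∀ b ∈ B, (A.filter fun t => t ^ (p ^ d + 1) = b).card ≤ p ^ d + 1 := by
    intro b _
    have h1 : (A.filter fun t => t ^ (p ^ d + 1) = b) ⊆ (Polynomial.nthRoots (p ^ d + 1) b).toFinset := by
      intro t ht
      rw [Multiset.mem_toFinset, Polynomial.mem_nthRoots (by omega)]
      exact (mem_filter.1 ht).2
    exact (Finset.card_le_card h1).trans ((Multiset.toFinset_card_le _).trans
      (Polynomial.card_nthRoots _ _))
  have heq : ∀ b ∈ B, (A.filter fun t => t ^ (p ^ d + 1) = b).card = p ^ d + 1 := by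
    rw [← Finset.sum_eq_sum_iff_of_le hle, ← hfib, hA, Finset.sum_const, hB, smul_eq_mul, mul_comm]
  have hcB : c ∈ B := by
    simp only [B, mem_filter, mem_univ, true_and]
    apply mul_right_cancel₀ hc0
    rw [← pow_succ, Nat.sub_add_cancel hpd.le, hc, one_mul]
  refine Eq.trans ?_ (heq c hcB)
  congr 1
  ext t
  simp only [A, mem_filter, mem_univ, true_and]
  refine ⟨fun h => ⟨?_, h⟩, fun h => h.2⟩
  rw [← hfac, pow_mul, h]
  exact (mem_filter.1 hcB).2

/-- On the fixed field of the square of `x ↦ x^{p^l}`, this map is `x ↦ x^{p^d}`, `d = gcd(m, l)`,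
if `gcd(m, 2l) = 2d`. -/
theorem pow_prime_pow_eq_of_fixed (hF : Fintype.card F = p ^ m) (hl : 0 < l) (hd : d = m.gcd l)
    (hg : m.gcd (2 * l) = 2 * d) {t : F} :
    t ^ p ^ (2 * l) = t ↔ t ^ p ^ (2 * d) = t := by
  have hd0 : 0 < d := hd ▸ Nat.gcd_pos_of_pos_right _ hl
  have h2d : 2 * d ∣ m := hg ▸ Nat.gcd_dvd_left _ _
  exact pow_prime_pow_eq_self_iff hF (by omega) (by omega)
    (Nat.mul_dvd_mul_left 2 (hd ▸ Nat.gcd_dvd_right _ _)) (by rw [hg]; exact Nat.gcd_eq_right h2d) t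

/-- `gcd(m, 2l) = 2d` means that `l / d` is odd while `m / d` is even: otherwise `2d` would divide
both `m` and `l`. -/
theorem odd_div_of_gcd_eq (hm : 0 < m) (hd : d = m.gcd l) (hg : m.gcd (2 * l) = 2 * d) :
    ∃ k, l = d + 2 * d * k := by
  have hd0 : 0 < d := hd ▸ Nat.gcd_pos_of_pos_left _ hm
  obtain ⟨r, hr⟩ : d ∣ l := hd ▸ Nat.gcd_dvd_right m l
  have hodd : Odd r := by
    by_contra h
    obtain ⟨k, hk⟩ := Nat.not_odd_iff_even.1 h
    have h1 : 2 * d ∣ d := by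
      nth_rewrite 2 [hd]
      refine Nat.dvd_gcd (hg ▸ Nat.gcd_dvd_left _ _) ⟨k, by rw [hr, hk]; ring⟩
    have := Nat.le_of_dvd hd0 h1
    omega
  obtain ⟨k, hk⟩ := hodd
  exact ⟨k, by rw [hr, hk]; ring⟩

/-- Both `l` and `3l` are odd multiples of `d`, and on the field with `p^(2d)` elements only the
parity of this multiple matters. -/
theorem pow_prime_pow_of_fixed (hm : 0 < m) (hd : d = m.gcd l)
    (hg : m.gcd (2 * l) = 2 * d) {t : F} (ht : t ^ p ^ (2 * d) = t) :
    t ^ p ^ l = t ^ p ^ d ∧ t ^ p ^ (3 * l) = t ^ p ^ d := by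
  obtain ⟨k, hk⟩ := odd_div_of_gcd_eq hm hd hg
  have h1 : ∀ k, t ^ p ^ (d + 2 * d * k) = t ^ p ^ d := by
    intro k
    have h2 := iterate_iterateFrobeniusEquiv (F := F) (p := p) (2 * d) k t
    rw [Function.iterate_fixed (by rwa [iterateFrobeniusEquiv_def])] at h2
    rw [add_comm, pow_add, pow_mul, mul_comm (2 * d) k, ← h2]
  refine ⟨by rw [hk, h1], ?_⟩
  rw [← h1 (3 * k + 1), hk]
  ring_nf

/-- On the field with `p^(2d)` elements both monomials coincide with the norm. A solution of either
side lies in that field: for the right side, apply the `p^d`-th power to `t^(p^d) * t = c`. -/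
theorem doPair_eq_iff_of_even (hF : Fintype.card F = p ^ m) (hm : 0 < m) (hl : 0 < l)
    (hd : d = m.gcd l) (hg : m.gcd (2 * l) = 2 * d) {c : F} (hc0 : c ≠ 0) (hc : c ^ p ^ d = c)
    (t : F) : doPair p l t = (c, c) ↔ t ^ (p ^ d + 1) = c := by
  constructor
  · intro h
    have h1 := pow_two_mul_eq_self_of_doPair hc0 h
    rw [pow_prime_pow_eq_of_fixed hF hl hd hg] at h1
    rw [pow_succ, ← (pow_prime_pow_of_fixed hm hd hg h1).1]
    exact congrArg Prod.snd h
  · intro h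
    have ht : t ≠ 0 := by
      rintro rfl
      rw [zero_pow (Nat.succ_ne_zero _)] at h
      exact hc0 h.symm
    have h1 : t ^ p ^ (2 * d) = t := by
      have h2 : t ^ p ^ d * t = c := by rw [← pow_succ, h]
      have h3 : t ^ p ^ (2 * d) * t ^ p ^ d = c := by
        have h5 := congrArg (· ^ p ^ d) h2
        simp only [mul_pow] at h5
        rwa [← pow_mul, ← pow_add p, ← two_mul, hc] at h5
      have h4 : t ^ p ^ (2 * d) * t ^ p ^ d = t * t ^ p ^ d := by rw [h3, ← h2, mul_comm]
      exact mul_right_cancel₀ (pow_ne_zero _ ht) h4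
    obtain ⟨h5, h6⟩ := pow_prime_pow_of_fixed hm hd hg h1
    rw [doPair, h5, h6, ← pow_succ, h]

theorem card_doPair_eq_of_even (hF : Fintype.card F = p ^ m) (hm : 0 < m) (hl : 0 < l)
    (hd : d = m.gcd l) (hg : m.gcd (2 * l) = 2 * d) {c : F} (hc0 : c ≠ 0) (hc : c ^ p ^ d = c) :
    (univ.filter fun t : F => doPair p l t = (c, c)).card = p ^ d + 1 := by
  simp only [doPair_eq_iff_of_even hF hm hl hd hg hc0 hc]
  exact card_pow_succ_eq hF (hd ▸ Nat.gcd_pos_of_pos_right _ hl) (hg ▸ Nat.gcd_dvd_left _ _) hc0 hc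

/-- With `σ x = x^(p^l)`, the two equations and their `σ`-images give linear relations for `α = σ²x
- x`, `β = σ²y - y` and their images `X = σ α`, `Y = σ β`. The vector `(X, Y)` is orthogonal to `(x,
y)` and to `(α, β)`. If the determinant `α y - β x` is nonzero, then `X = Y = 0`; if it is zero, `σ
x * x + σ y * y = -1` and `α * σ x + β * σ y = 0` give `α = β = 0` directly. -/
theorem fixed_of_doPair_add_doPair {x y : F} (h : doPair p l x + doPair p l y = (-1, -1)) :
    x ^ p ^ (2 * l) = x ∧ y ^ p ^ (2 * l) = y := by
  set σ := iterateFrobeniusEquiv F p l with hσ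
  have h1 : σ x * x + σ y * y = -1 := by
    have : x ^ p ^ l * x + y ^ p ^ l * y = -1 := congrArg Prod.snd h
    simpa only [hσ, iterateFrobeniusEquiv_def] using this
  have hs2 : ∀ z : F, z ^ p ^ (2 * l) = σ (σ z) := by
    intro z
    simp only [hσ, iterateFrobeniusEquiv_def, ← pow_mul, ← pow_add, two_mul]
  have hs3 : ∀ z : F, z ^ p ^ (3 * l) = σ (σ (σ z)) := by
    intro z
    simp only [hσ, iterateFrobeniusEquiv_def, ← pow_mul, ← pow_add]
    ring_nf
  have h3 : σ (σ (σ x)) * x + σ (σ (σ y)) * y = -1 := by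
    have : x ^ p ^ (3 * l) * x + y ^ p ^ (3 * l) * y = -1 := congrArg Prod.fst h
    rwa [hs3, hs3] at this
  have h2 : σ (σ x) * σ x + σ (σ y) * σ y = -1 := by
    have := congrArg σ h1
    simpa only [map_add, map_mul, map_neg, map_one] using this
  have h4 : σ (σ (σ x)) * σ (σ x) + σ (σ (σ y)) * σ (σ y) = -1 := by
    have := congrArg σ h2
    simpa only [map_add, map_mul, map_neg, map_one] using this
  rw [hs2, hs2]
  set X := σ (σ (σ x)) - σ x with hX
  set Y := σ (σ (σ y)) - σ y with hY
  set α := σ (σ x) - x with hα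
  set β := σ (σ y) - y with hβ
  have e1 : X * x + Y * y = 0 := by simp only [hX, hY]; linear_combination h3 - h1
  have e2 : X * α + Y * β = 0 := by
    simp only [hX, hY, hα, hβ]; linear_combination h4 - h2 - h3 + h1
  have e3 : α * σ x + β * σ y = 0 := by simp only [hα, hβ]; linear_combination h2 - h1
  have eX : X * (α * y - β * x) = 0 := by linear_combination y * e2 - β * e1
  have eY : Y * (α * y - β * x) = 0 := by linear_combination α * e1 - x * e2
  suffices hs : α = 0 ∧ β = 0 from ⟨sub_eq_zero.1 hs.1, sub_eq_zero.1 hs.2⟩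
  by_cases hD : α * y - β * x = 0
  · constructor
    · linear_combination α * h1 - x * e3 - σ y * hD
    · linear_combination β * h1 - y * e3 + σ x * hD
  · have hX0 := (mul_eq_zero.1 eX).resolve_right hD
    have hY0 := (mul_eq_zero.1 eY).resolve_right hD
    constructor
    · apply σ.injective; rw [hα, map_sub, map_zero]; exact hX0
    · apply σ.injective; rw [hβ, map_sub, map_zero]; exact hY0

/-- By `fixed_of_doPair_add_doPair` these are the points of the Hermitian equation `N x + N y = -1`
over the field with `y² = p^(2d)` elements. Summing over `u = N x`, the values `u = 0` and `u = -1`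
give `y + 1` solutions each and the other `y - 2` give `(y + 1)²`, in total `y³ - y`. -/
theorem card_doPair_add_doPair_of_even (hF : Fintype.card F = p ^ m) (hm : 0 < m) (hl : 0 < l)
    (hd : d = m.gcd l) (hg : m.gcd (2 * l) = 2 * d) :
    ((univ.filter fun w : F × F => doPair p l w.1 + doPair p l w.2 = (-1, -1)).card : ℤ) =
      (p ^ d : ℤ) ^ 3 - p ^ d := by
  have hp : p.Prime := Fact.out
  have hd0 : 0 < d := hd ▸ Nat.gcd_pos_of_pos_right _ hl
  have h2d : 2 * d ∣ m := hg ▸ Nat.gcd_dvd_left _ _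
  set E := univ.filter fun u : F => u ^ p ^ d = u with hE
  have hEcard : E.card = p ^ d := by
    rw [card_pow_prime_pow_eq_self hp hF hd0, Nat.gcd_eq_right ((Dvd.intro_left 2 rfl).trans h2d)]
  have hneg : ∀ z : F, (-z) ^ p ^ d = -(z ^ p ^ d) := fun z => by
    have := map_neg (iterateFrobenius F p d) z
    simpa only [iterateFrobenius_def] using this
  have hadd : ∀ z w : F, (z + w) ^ p ^ d = z ^ p ^ d + w ^ p ^ d := fun z w =>
    add_pow_char_pow z w p d
  set g : F → ℕ := fun u => (univ.filter fun t : F => t ^ (p ^ d + 1) = u).card with hgdef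
  have hg0 : g 0 = 1 := by
    have : (univ.filter fun t : F => t ^ (p ^ d + 1) = 0) = {0} := by ext; simp
    simp only [hgdef]
    rw [this, Finset.card_singleton]
  have hg1 : ∀ u ∈ E, (g u : ℤ) = (p ^ d + 1) - (if u = 0 then (p ^ d : ℤ) else 0) := by
    intro u hu
    by_cases h0 : u = 0
    · rw [if_pos h0, h0, hg0]; push_cast; ring
    · rw [if_neg h0]
      have := card_pow_succ_eq hF hd0 h2d h0 (mem_filter.1 hu).2
      simp only [hgdef]
      rw [this]; push_cast; ring
  have hiff : ∀ x y : F, doPair p l x + doPair p l y = (-1, -1) ↔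
      x ^ (p ^ d + 1) ∈ E ∧ y ^ (p ^ d + 1) = -1 - x ^ (p ^ d + 1) := by
    have hfix : ∀ x : F, x ^ p ^ (2 * d) = x → doPair p l x = (x ^ (p ^ d + 1), x ^ (p ^ d + 1)) := by
      intro x hx
      obtain ⟨h5, h6⟩ := pow_prime_pow_of_fixed hm hd hg hx
      rw [doPair, h5, h6, ← pow_succ]
    have hback : ∀ x : F, x ^ (p ^ d + 1) ∈ E → x ^ p ^ (2 * d) = x := by
      intro x hx
      by_cases hx0 : x = 0
      · simp [hx0, hp.ne_zero]
      have h1 := (mem_filter.1 hx).2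
      have h3 : x ^ p ^ (2 * d) * x ^ p ^ d = x * x ^ p ^ d := by
        rw [pow_succ x, mul_pow, ← pow_mul, ← pow_add p, ← two_mul] at h1
        rw [h1, mul_comm]
      exact mul_right_cancel₀ (pow_ne_zero _ hx0) h3
    have hin : ∀ x : F, x ^ p ^ (2 * d) = x → x ^ (p ^ d + 1) ∈ E := by
      intro x hx
      simp only [hE, mem_filter, mem_univ, true_and]
      rw [pow_succ x, mul_pow, ← pow_mul, ← pow_add p, ← two_mul, hx, mul_comm]
    intro x y
    constructor
    · intro h
      obtain ⟨hx, hy⟩ := fixed_of_doPair_add_doPair h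
      rw [pow_prime_pow_eq_of_fixed hF hl hd hg] at hx hy
      refine ⟨hin x hx, ?_⟩
      rw [hfix x hx, hfix y hy] at h
      have h1 : x ^ (p ^ d + 1) + y ^ (p ^ d + 1) = -1 := congrArg Prod.fst h
      linear_combination h1
    · rintro ⟨hx, hy⟩
      have hyE : y ^ (p ^ d + 1) ∈ E := by
        have h1 := (mem_filter.1 hx).2
        simp only [hE, mem_filter, mem_univ, true_and, hy]
        rw [sub_eq_add_neg, hadd, hneg, hneg, h1, one_pow]
      rw [hfix x (hback x hx), hfix y (hback y hyE), hy]
      ext <;> simp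
  have hcount : (univ.filter fun w : F × F => doPair p l w.1 + doPair p l w.2 = (-1, -1)).card =
      ∑ u ∈ E, g u * g (-1 - u) := by
    have h1 : (univ.filter fun w : F × F => doPair p l w.1 + doPair p l w.2 = (-1, -1)).card =
        ∑ x : F, (univ.filter fun y : F => doPair p l x + doPair p l y = (-1, -1)).card := by
      simp only [Finset.card_filter]
      rw [Fintype.sum_prod_type]
    have h2 : ∀ x : F, (univ.filter fun y : F => doPair p l x + doPair p l y = (-1, -1)).card =
        if x ^ (p ^ d + 1) ∈ E then g (-1 - x ^ (p ^ d + 1)) else 0 := by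
      intro x
      simp only [hiff]
      split_ifs with hx
      · simp only [hx, true_and, hgdef]
      · simp [hx]
    rw [h1, Finset.sum_congr rfl fun x _ => h2 x, ← Finset.sum_filter,
      ← Finset.sum_fiberwise_of_maps_to (t := E) (g := fun x : F => x ^ (p ^ d + 1))
        (fun x hx => (mem_filter.1 hx).2)]
    refine Finset.sum_congr rfl fun u hu => ?_
    rw [Finset.sum_congr rfl (g := fun _ => g (-1 - u)) (fun x hx => by rw [(mem_filter.1 hx).2]),
      Finset.sum_const, smul_eq_mul]
    congr 1
    simp only [hgdef]
    congr 1
    ext x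
    simp only [mem_filter, mem_univ, true_and]
    exact ⟨fun h => h.2, fun h => ⟨h ▸ hu, h⟩⟩
  have hneg1 : ∀ u ∈ E, -1 - u ∈ E := by
    intro u hu
    have h1 := (mem_filter.1 hu).2
    simp only [hE, mem_filter, mem_univ, true_and]
    rw [sub_eq_add_neg, hadd, hneg, hneg, h1, one_pow]
  have h0E : (0 : F) ∈ E := by simp [hE, hp.ne_zero]
  have h1E : (-1 : F) ∈ E := by simpa using hneg1 0 h0E
  rw [hcount]
  push_cast
  have h5 : ∀ u ∈ E, (g u : ℤ) * g (-1 - u) = (p ^ d + 1) ^ 2 -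
      (if u = 0 then (p ^ d * (p ^ d + 1) : ℤ) else 0) -
      (if u = -1 then (p ^ d * (p ^ d + 1) : ℤ) else 0) := by
    intro u hu
    rw [hg1 u hu, hg1 _ (hneg1 u hu)]
    have h6 : -1 - u = 0 ↔ u = -1 := by
      rw [sub_eq_zero]; exact eq_comm
    simp only [h6]
    by_cases hu0 : u = 0
    · have : ¬ (u = -1) := by rw [hu0]; simp
      rw [if_pos hu0, if_neg this, if_pos hu0, if_neg this]; ring
    · by_cases hu1 : u = -1
      · rw [if_neg hu0, if_pos hu1, if_neg hu0, if_pos hu1]; ring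
      · rw [if_neg hu0, if_neg hu1, if_neg hu0, if_neg hu1]; ring
  rw [Finset.sum_congr rfl h5, Finset.sum_sub_distrib, Finset.sum_sub_distrib, Finset.sum_const,
    Finset.sum_ite_eq', Finset.sum_ite_eq', if_pos h0E, if_pos h1E, hEcard]
  ring

end Counting

/-! ### Power moments of the exponential sums. -/

section Moments

variable {F : Type*} [Field F] [Fintype F] [DecidableEq F] {p m l : ℕ} [Fact p.Prime] [CharP F p]

/-- The `p^l`-power map as an automorphism over a subfield which it fixes. -/
noncomputable def frobAlgEquiv {K : Type*} [Field K] [Algebra K F] (p l : ℕ) [Fact p.Prime]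
    [CharP F p] (h : ∀ c : K, algebraMap K F c ^ p ^ l = algebraMap K F c) : F ≃ₐ[K] F :=
  AlgEquiv.ofRingEquiv (f := iterateFrobeniusEquiv F p l) fun c => by
    rw [iterateFrobeniusEquiv_def]; exact h c

theorem frobAlgEquiv_apply {K : Type*} [Field K] [Algebra K F]
    (h : ∀ c : K, algebraMap K F c ^ p ^ l = algebraMap K F c) (x : F) :
    frobAlgEquiv p l h x = x ^ p ^ l := by
  simp [frobAlgEquiv, iterateFrobenius_def]

variable [Algebra (ZMod p) F]

theorem algebraMap_zmod_pow (l : ℕ) (c : ZMod p) :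
    algebraMap (ZMod p) F c ^ p ^ l = algebraMap (ZMod p) F c := by
  rw [← map_pow, ZMod.pow_card_pow]

/-- The quadratic form `x ↦ Tr(a x^{p^{3l}+1} + b x^{p^l+1})` over `𝔽_p`. -/
noncomputable def doFormZMod (l : ℕ) (a b : F) : QuadraticForm (ZMod p) F :=
  doForm (ZMod p) (frobAlgEquiv p l (algebraMap_zmod_pow l)) a b

theorem doForm_apply_pair {K : Type*} [Field K] [Algebra K F] (σ : F ≃ₐ[K] F)
    (hσ : ∀ x, σ x = x ^ p ^ l) (a b x : F) :
    doForm K σ a b x =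
      Algebra.trace K F (a * (doPair p l x).1 + b * (doPair p l x).2) := by
  rw [doForm_apply, doPair]
  simp only [hσ, ← pow_mul, ← pow_add]
  ring_nf

theorem doFormZMod_apply (a b x : F) : doFormZMod (p := p) l a b x =
    Algebra.trace (ZMod p) F (a * (doPair p l x).1 + b * (doPair p l x).2) :=
  doForm_apply_pair _ (frobAlgEquiv_apply _) a b x

theorem card_ker_doFormZMod (a b : F) :
    Nat.card (LinearMap.ker (doFormZMod (p := p) l a b).polarBilin) =
      (univ.filter fun x => doRadical p l a b x = 0).card :=
  card_ker_doForm _ (frobAlgEquiv_apply _) a b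

/-- Orthogonality of characters on pairs `(a, b)`: by nondegeneracy of the trace form only the
indices with `u i = 0` survive. All moments become numbers of solutions in this way. -/
theorem sum_addChar_trace_pairs {ψ : AddChar (ZMod p) ℂ} (hψ : ψ ≠ 0) {ι : Type*} [Fintype ι]
    (u : ι → F × F) :
    ∑ w : F × F, ∑ i, ψ (Algebra.trace (ZMod p) F (w.1 * (u i).1 + w.2 * (u i).2)) =
      (Fintype.card F : ℂ) ^ 2 * (univ.filter fun i => u i = 0).card := by
  classical
  have hfd : FiniteDimensional (ZMod p) F := Module.Finite.of_finite
  rw [Finset.sum_comm]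
  have h1 : ∀ i, ∑ w : F × F, ψ (Algebra.trace (ZMod p) F (w.1 * (u i).1 + w.2 * (u i).2)) =
      if u i = 0 then (Fintype.card F : ℂ) ^ 2 else 0 := by
    intro i
    let f : F × F →ₗ[ZMod p] ZMod p := (Algebra.trace (ZMod p) F) ∘ₗ
      ((LinearMap.mulRight (ZMod p) (u i).1).coprod (LinearMap.mulRight (ZMod p) (u i).2))
    have hf : ∀ w : F × F, f w =
        Algebra.trace (ZMod p) F (w.1 * (u i).1 + w.2 * (u i).2) := fun w => rfl
    have hf0 : f = 0 ↔ u i = 0 := by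
      constructor
      · intro h
        have hn := (traceForm_nondegenerate (ZMod p) F).1
        have h1 : (u i).1 = 0 := by
          apply hn
          intro y
          have h2 := LinearMap.congr_fun h (y, 0)
          rw [hf] at h2
          rw [Algebra.traceForm_apply, mul_comm]
          simpa using h2
        have h1' : (u i).2 = 0 := by
          apply hn
          intro y
          have h2 := LinearMap.congr_fun h (0, y)
          rw [hf] at h2
          rw [Algebra.traceForm_apply, mul_comm]
          simpa using h2
        exact Prod.ext h1 h1'
      · intro h
        ext y <;> simp [f, h]
    simp only [← hf]
    rw [sum_addChar_dual ψ hψ f]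
    simp only [hf0, Fintype.card_prod]
    push_cast
    rw [sq]
  rw [Finset.sum_congr rfl fun i _ => h1 i, Finset.sum_ite, Finset.sum_const_zero, add_zero,
    Finset.sum_const, nsmul_eq_mul, mul_comm]

variable {ψ : AddChar (ZMod p) ℂ}

theorem sum_quadExpSum (hψ : ψ ≠ 0) :
    ∑ w : F × F, quadExpSum ψ (doFormZMod (p := p) l w.1 w.2) = (Fintype.card F : ℂ) ^ 2 := by
  simp only [quadExpSum, doFormZMod_apply]
  rw [sum_addChar_trace_pairs hψ]
  have : (univ.filter fun x : F => doPair p l x = 0) = {0} := by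
    ext x; simp [doPair_eq_zero]
  rw [this]; simp

theorem sum_quadExpSum_mul_conj (hψ : ψ ≠ 0) (c : F) :
    ∑ w : F × F, quadExpSum ψ (doFormZMod (p := p) l w.1 w.2) *
      conj (quadExpSum ψ (doFormZMod (p := p) l (c * w.1) (c * w.2))) =
    (Fintype.card F : ℂ) ^ 2 *
      (univ.filter fun z : F × F => doPair p l z.1 = (c, c) * doPair p l z.2).card := by
  have h1 : ∀ w : F × F, quadExpSum ψ (doFormZMod (p := p) l w.1 w.2) *
      conj (quadExpSum ψ (doFormZMod (p := p) l (c * w.1) (c * w.2))) =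
      ∑ z : F × F, ψ (Algebra.trace (ZMod p) F (w.1 * (doPair p l z.1 - (c, c) * doPair p l z.2).1 +
        w.2 * (doPair p l z.1 - (c, c) * doPair p l z.2).2)) := by
    intro w
    rw [quadExpSum, quadExpSum, map_sum, Finset.sum_mul_sum, Fintype.sum_prod_type]
    refine Finset.sum_congr rfl fun x _ => Finset.sum_congr rfl fun y _ => ?_
    rw [← AddChar.map_neg_eq_conj, ← AddChar.map_add_eq_mul, doFormZMod_apply, doFormZMod_apply,
      ← map_neg, ← map_add]
    congr 2
    simp only [Prod.fst_sub, Prod.snd_sub, Prod.fst_mul, Prod.snd_mul]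
    ring
  rw [Finset.sum_congr rfl fun w _ => h1 w, sum_addChar_trace_pairs hψ]
  simp only [sub_eq_zero]

theorem sum_quadExpSum_sq (hψ : ψ ≠ 0) :
    ∑ w : F × F, quadExpSum ψ (doFormZMod (p := p) l w.1 w.2) ^ 2 =
    (Fintype.card F : ℂ) ^ 2 *
      (univ.filter fun z : F × F => doPair p l z.1 = (-1, -1) * doPair p l z.2).card := by
  have h1 : ∀ w : F × F, quadExpSum ψ (doFormZMod (p := p) l w.1 w.2) ^ 2 =
      ∑ z : F × F, ψ (Algebra.trace (ZMod p) F (w.1 * (doPair p l z.1 - (-1, -1) * doPair p l z.2).1 +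
        w.2 * (doPair p l z.1 - (-1, -1) * doPair p l z.2).2)) := by
    intro w
    rw [sq, quadExpSum, Finset.sum_mul_sum, Fintype.sum_prod_type]
    refine Finset.sum_congr rfl fun x _ => Finset.sum_congr rfl fun y _ => ?_
    rw [← AddChar.map_add_eq_mul, doFormZMod_apply, doFormZMod_apply, ← map_add]
    congr 2
    simp only [Prod.fst_sub, Prod.snd_sub, Prod.fst_mul, Prod.snd_mul]
    ring
  rw [Finset.sum_congr rfl fun w _ => h1 w, sum_addChar_trace_pairs hψ]
  simp only [sub_eq_zero]

/-- Solutions with third coordinate 0 are those of the quadratic moment; for a nonzero third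
coordinate, dividing by it normalizes the equation to `doPair x + doPair y = (-1, -1)`. -/
theorem card_doPair_sum_three :
    (univ.filter fun z : (F × F) × F =>
      doPair p l z.1.1 + doPair p l z.1.2 + doPair p l z.2 = 0).card =
    (univ.filter fun z : F × F => doPair p l z.1 = (-1, -1) * doPair p l z.2).card +
      (Fintype.card F - 1) *
        (univ.filter fun z : F × F => doPair p l z.1 + doPair p l z.2 = (-1, -1)).card := by
  have h1 : (univ.filter fun z : (F × F) × F =>
      doPair p l z.1.1 + doPair p l z.1.2 + doPair p l z.2 = 0).card =
      ∑ z : F, (univ.filter fun w : F × F =>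
        doPair p l w.1 + doPair p l w.2 + doPair p l z = 0).card := by
    simp only [Finset.card_filter]
    rw [Fintype.sum_prod_type, Finset.sum_comm]
  rw [h1, ← Finset.add_sum_erase _ _ (mem_univ (0 : F))]
  congr 1
  · congr 1
    ext w
    have h2 : ((-1, -1) : F × F) * doPair p l w.2 = - doPair p l w.2 := by
      ext <;> simp
    rw [mem_filter, mem_filter, h2, doPair_eq_zero.2 rfl, add_zero, add_eq_zero_iff_eq_neg]
  · rw [Finset.sum_congr rfl (g := fun _ => (univ.filter fun z : F × F =>
      doPair p l z.1 + doPair p l z.2 = (-1, -1)).card),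
      Finset.sum_const, Finset.card_erase_of_mem (mem_univ _), Finset.card_univ, smul_eq_mul]
    intro z hz
    have hz0 : z ≠ 0 := Finset.ne_of_mem_erase hz
    have key : ∀ x y : F, doPair p l (x * z) + doPair p l (y * z) + doPair p l z = 0 ↔
        doPair p l x + doPair p l y = (-1, -1) := by
      intro x y
      rw [doPair_mul, doPair_mul]
      have h2 : (doPair p l z).1 ≠ 0 := mul_ne_zero (pow_ne_zero _ hz0) hz0
      have h3 : (doPair p l z).2 ≠ 0 := mul_ne_zero (pow_ne_zero _ hz0) hz0
      rw [Prod.ext_iff, Prod.ext_iff]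
      simp only [Prod.fst_add, Prod.snd_add, Prod.fst_mul, Prod.snd_mul, Prod.fst_zero,
        Prod.snd_zero]
      refine and_congr ⟨fun h => ?_, fun h => ?_⟩ ⟨fun h => ?_, fun h => ?_⟩
      · apply mul_right_cancel₀ h2; linear_combination h
      · linear_combination (doPair p l z).1 * h
      · apply mul_right_cancel₀ h3; linear_combination h
      · linear_combination (doPair p l z).2 * h
    refine Finset.card_bij' (fun w _ => (w.1 / z, w.2 / z)) (fun w _ => (w.1 * z, w.2 * z)) ?_ ?_ ?_ ?_
    · intro w hw
      simp only [mem_filter, mem_univ, true_and] at hw ⊢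
      rw [← key, div_mul_cancel₀ _ hz0, div_mul_cancel₀ _ hz0, hw]
    · intro w hw
      simp only [mem_filter, mem_univ, true_and] at hw ⊢
      exact (key _ _).2 hw
    · intro w _; simp [hz0]
    · intro w _; simp [hz0]

theorem sum_quadExpSum_cube (hψ : ψ ≠ 0) :
    ∑ w : F × F, quadExpSum ψ (doFormZMod (p := p) l w.1 w.2) ^ 3 =
    (Fintype.card F : ℂ) ^ 2 * (univ.filter fun z : (F × F) × F =>
      doPair p l z.1.1 + doPair p l z.1.2 + doPair p l z.2 = 0).card := by
  have h1 : ∀ w : F × F, quadExpSum ψ (doFormZMod (p := p) l w.1 w.2) ^ 3 =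
      ∑ z : (F × F) × F, ψ (Algebra.trace (ZMod p) F
        (w.1 * (doPair p l z.1.1 + doPair p l z.1.2 + doPair p l z.2).1 +
        w.2 * (doPair p l z.1.1 + doPair p l z.1.2 + doPair p l z.2).2)) := by
    intro w
    rw [pow_succ, sq, quadExpSum, Finset.sum_mul_sum, Finset.sum_mul, Fintype.sum_prod_type,
      Fintype.sum_prod_type]
    refine Finset.sum_congr rfl fun x _ => ?_
    rw [Finset.sum_mul]
    refine Finset.sum_congr rfl fun y _ => ?_
    rw [Finset.mul_sum]
    refine Finset.sum_congr rfl fun z _ => ?_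
    rw [← AddChar.map_add_eq_mul, ← AddChar.map_add_eq_mul, doFormZMod_apply, doFormZMod_apply,
      doFormZMod_apply, ← map_add, ← map_add]
    congr 2
    simp only [Prod.fst_add, Prod.snd_add]
    ring
  rw [Finset.sum_congr rfl fun w _ => h1 w, sum_addChar_trace_pairs hψ]

/-- There is an element `c` of the fixed field of `x ↦ x^{p^l}`, not a square in this field, such
that multiplying a form of rank `r` over this field by `c` multiplies its exponential sum by
`(-1)^r`. -/
theorem exists_nonsquare_twist (hp : p ≠ 2) (hF : Fintype.card F = p ^ m) (hl : 0 < l)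
    {n : ℕ} (hn : m = m.gcd l * n) (hψ : ψ ≠ 0) :
    ∃ c : F, c ≠ 0 ∧ (∀ t : F, t ^ p ^ l = t → t * t ≠ c) ∧ ∀ (a b : F) (j : ℕ),
      (univ.filter fun x => doRadical p l a b x = 0).card = p ^ (m.gcd l * j) →
      quadExpSum ψ (doFormZMod (p := p) l (c * a) (c * b)) =
        (-1) ^ (n + j) * quadExpSum ψ (doFormZMod (p := p) l a b) := by
  have hp' : p.Prime := Fact.out
  set d := m.gcd l with hd
  have hd0 : 0 < d := Nat.gcd_pos_of_pos_right _ hl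
  let K : IntermediateField (ZMod p) F :=
    ((iterateFrobenius F p l).eqLocusField (RingHom.id F)).toIntermediateField fun c => by
      rw [RingHom.mem_eqLocusField, iterateFrobenius_def]
      exact algebraMap_zmod_pow l c
  have hmem : ∀ x, x ∈ K ↔ x ^ p ^ l = x := fun x => by
    change iterateFrobenius F p l x = x ↔ _
    rw [iterateFrobenius_def]
  let _ : Fintype K := Fintype.ofFinite K
  have hKcard : Fintype.card K = p ^ d := by
    rw [hd, ← card_pow_prime_pow_eq_self hp' hF hl, ← Fintype.card_subtype]
    exact Fintype.card_congr (Equiv.subtypeEquivRight hmem)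
  have hKchar : ringChar K ≠ 2 := by
    have : CharP K p := charP_of_injective_algebraMap (algebraMap K F).injective p |> fun _ =>
      (RingHom.charP_iff (algebraMap K F) (algebraMap K F).injective p).2 inferInstance
    rwa [ringChar.eq K p]
  obtain ⟨c, hc⟩ := FiniteField.exists_nonsquare hKchar
  have hfd : FiniteDimensional (ZMod p) K := Module.Finite.of_finite
  have hfd' : FiniteDimensional K F := Module.Finite.of_finite
  have hfrob : ∀ c : K, algebraMap K F c ^ p ^ l = algebraMap K F c := fun c => (hmem c).1 c.2
  set σ := frobAlgEquiv p l hfrob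
  let ψ' : AddChar K ℂ := ψ.compAddMonoidHom (Algebra.trace (ZMod p) K).toAddMonoidHom
  have hψ' : ψ' ≠ 0 := by
    intro h
    apply hψ
    ext t
    obtain ⟨x, rfl⟩ := Algebra.trace_surjective (ZMod p) K t
    exact DFunLike.congr_fun h x
  -- Transitivity of the trace: the form over the prime field is the trace of a form over the fixed
  -- field `K`, with `ψ'` the lifted character. The nonsquare twist is thus available over `K`,
  -- where the rank is `n - j`.
  have htrans : ∀ a b : F, quadExpSum ψ (doFormZMod (p := p) l a b) =
      quadExpSum ψ' (doForm K σ a b) := by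
    intro a b
    refine Finset.sum_congr rfl fun x _ => ?_
    rw [doFormZMod_apply, doForm_apply_pair σ (frobAlgEquiv_apply _)]
    change _ = ψ (Algebra.trace (ZMod p) K _)
    rw [Algebra.trace_trace]
  have hfin : Module.finrank K F = n := by
    have h1 := Module.card_eq_pow_finrank (K := K) (V := F)
    rw [hF, hKcard, ← pow_mul] at h1
    have h2 := Nat.pow_right_injective hp'.two_le h1
    exact Nat.eq_of_mul_eq_mul_left hd0 (h2.symm.trans hn)
  refine ⟨c, ?_, ?_, ?_⟩
  · intro h
    apply hc
    have : c = 0 := Subtype.ext h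
    rw [this]; exact IsSquare.zero
  · intro t ht h
    exact hc ⟨⟨t, (hmem t).2 ht⟩, Subtype.ext h.symm⟩
  · intro a b j hj
    rw [htrans, htrans, ← hfin, ← quadExpSum_nonsquare_smul hKchar ψ' hψ' hc]
    · congr 1
      ext x
      rw [smul_apply, doForm_apply_pair σ (frobAlgEquiv_apply _),
        doForm_apply_pair σ (frobAlgEquiv_apply _), ← map_smul, Algebra.smul_def]
      have hcF : algebraMap K F c = (c : F) := rfl
      rw [hcF]
      congr 1
      ring_nf
    · rw [card_ker_doForm σ (frobAlgEquiv_apply _), hj, hKcard, pow_mul]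

end Moments

/-! ### Separating the possible values of the excess. -/

section SignCounts

variable {p : ℕ} [Fact p.Prime]

/-- `p - 1` is coprime to `p` and not a unit when `p ≠ 2`. Hence an excess of absolute value `(p -
1) p^R` is never confused with one of absolute value `p^R'`. -/
theorem sub_one_sq_mul_pow_ne (hp : p ≠ 2) (a b : ℕ) :
    ((p : ℤ) - 1) ^ 2 * p ^ a ≠ p ^ b := by
  intro h
  have hp' : p.Prime := Fact.out
  have h2 : 2 < p := lt_of_le_of_ne hp'.two_le (Ne.symm hp)
  have h1 : ((p : ℤ) - 1) ^ 2 ∣ (p : ℤ) ^ b := ⟨_, h.symm⟩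
  have hc : IsCoprime ((p : ℤ) - 1) (p : ℤ) := ⟨-1, 1, by ring⟩
  have h3 : IsUnit (((p : ℤ) - 1) ^ 2) := (hc.pow (m := 2) (n := b)).isUnit_of_dvd' dvd_rfl h1
  rw [isUnit_pow_iff two_ne_zero, Int.isUnit_iff] at h3
  omega

theorem card_quadraticChar_eq (hp : p ≠ 2) {s : ℤ} (hs : s = 1 ∨ s = -1) :
    2 * (univ.filter fun t : ZMod p => quadraticChar (ZMod p) t = s).card = p - 1 := by
  have hchar : ringChar (ZMod p) ≠ 2 := by rwa [ZMod.ringChar_zmod_n]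
  have hsum := quadraticChar_sum_zero (F := ZMod p) hchar
  have h1 : ∀ t : ZMod p, quadraticChar (ZMod p) t =
      (if quadraticChar (ZMod p) t = 1 then 1 else 0) -
      (if quadraticChar (ZMod p) t = -1 then 1 else 0) := by
    intro t
    by_cases ht : t = 0
    · subst ht; simp
    rcases quadraticChar_dichotomy ht with h | h <;> simp [h]
  have h2 : ∀ t : ZMod p, (1 : ℤ) = (if quadraticChar (ZMod p) t = 1 then 1 else 0) +
      (if quadraticChar (ZMod p) t = -1 then 1 else 0) + if t = 0 then 1 else 0 := by
    intro t
    by_cases ht : t = 0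
    · subst ht; simp
    rcases quadraticChar_dichotomy ht with h | h <;> simp [h, ht]
  have h3 : ∑ _t : ZMod p, (1 : ℤ) = p := by simp [ZMod.card]
  rw [Finset.sum_congr rfl fun t _ => h1 t, Finset.sum_sub_distrib, Finset.sum_boole,
    Finset.sum_boole] at hsum
  rw [Finset.sum_congr rfl fun t _ => h2 t, Finset.sum_add_distrib, Finset.sum_add_distrib,
    Finset.sum_boole, Finset.sum_boole, Finset.sum_ite_eq' univ (0 : ZMod p)] at h3
  simp only [mem_univ, if_true] at h3
  have := (Fact.out : p.Prime).one_le
  rcases hs with rfl | rfl <;> omega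

end SignCounts

/-! ### Counting words by excess. -/

section Amplitude

variable {F : Type*} [Field F] [Fintype F] [DecidableEq F] {p m l : ℕ} [Fact p.Prime]
  [Algebra (ZMod p) F] [CharP F p]

/-- The dimension over `𝔽_p` of the radical of `doFormZMod`. -/
noncomputable def radDim (p l : ℕ) [Fact p.Prime] [Algebra (ZMod p) F] [CharP F p] (w : F × F) : ℕ :=
  Module.finrank (ZMod p) (LinearMap.ker (doFormZMod (p := p) l w.1 w.2).polarBilin)

/-- The value of the exponential sum of a form of even rank, and `0` for a form of odd rank. -/
noncomputable def amplitude (p l : ℕ) [Fact p.Prime] [Algebra (ZMod p) F] [CharP F p]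
    (w : F × F) : ℤ :=
  (p * levelCard (doFormZMod (p := p) l w.1 w.2) 0 - Fintype.card F) / (p - 1)

theorem card_ker_eq_pow_radDim (w : F × F) :
    Nat.card (LinearMap.ker (doFormZMod (p := p) l w.1 w.2).polarBilin) = p ^ radDim p l w := by
  have : Fintype (LinearMap.ker (doFormZMod (p := p) l w.1 w.2).polarBilin) := Fintype.ofFinite _
  rw [Nat.card_eq_fintype_card, Module.card_eq_pow_finrank (K := ZMod p), ZMod.card, radDim]

theorem card_doRadical_eq (w : F × F) :
    (univ.filter fun x => doRadical p l w.1 w.2 x = 0).card = p ^ radDim p l w := by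
  rw [← card_ker_eq_pow_radDim, card_ker_doFormZMod]

theorem radDim_le (hF : Fintype.card F = p ^ m) (w : F × F) : radDim p l w ≤ m := by
  have h1 := Finset.card_le_univ (univ.filter fun x => doRadical p l w.1 w.2 x = 0)
  rw [card_doRadical_eq, hF] at h1
  exact (Nat.pow_le_pow_iff_right (Fact.out : p.Prime).one_lt).1 h1

theorem amplitude_of_even (hp : p ≠ 2) (hF : Fintype.card F = p ^ m) {w : F × F}
    (he : Even (m + radDim p l w)) :
    amplitude p l w ^ 2 = (p : ℤ) ^ (m + radDim p l w) ∧
    (∀ t, (p : ℤ) * levelCard (doFormZMod (p := p) l w.1 w.2) t =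
      p ^ m + (if t = 0 then (p - 1 : ℤ) else -1) * amplitude p l w) ∧
    ∀ ψ : AddChar (ZMod p) ℂ, ψ ≠ 0 →
      quadExpSum ψ (doFormZMod (p := p) l w.1 w.2) = amplitude p l w := by
  obtain ⟨A, h1, h2, h3⟩ := exists_levelCard_of_even hp (doFormZMod (p := p) l w.1 w.2) hF
    (card_ker_eq_pow_radDim w) he
  have hA : amplitude p l w = A := by
    have hp1 : (p : ℤ) - 1 ≠ 0 := by
      have := (Fact.out : p.Prime).one_lt
      omega
    rw [amplitude, h2 0, hF, if_pos rfl]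
    push_cast
    rw [add_sub_cancel_left, Int.mul_ediv_cancel_left _ hp1]
  rw [hA]
  exact ⟨h1, h2, h3⟩

theorem amplitude_of_odd (hp : p ≠ 2) (hF : Fintype.card F = p ^ m) {w : F × F}
    (he : Odd (m + radDim p l w)) :
    amplitude p l w = 0 ∧ ∃ B : ℤ, p * B ^ 2 = (p : ℤ) ^ (m + radDim p l w) ∧
    ∀ t, (p : ℤ) * levelCard (doFormZMod (p := p) l w.1 w.2) t =
      p ^ m + p * quadraticChar (ZMod p) t * B := by
  obtain ⟨B, h1, h2⟩ := exists_levelCard_of_odd hp (doFormZMod (p := p) l w.1 w.2) hF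
    (card_ker_eq_pow_radDim w) he
  refine ⟨?_, B, h1, h2⟩
  rw [amplitude, h2 0, hF]
  simp

/-- The function `x ↦ Tr(a x^{p^{3l}+1} + b x^{p^l+1} + c x) + h`. -/
noncomputable def doWord (p l : ℕ) [Fact p.Prime] [Algebra (ZMod p) F] [CharP F p]
    (v : (F × F) × (F × ZMod p)) (x : F) : ZMod p :=
  doFormZMod (p := p) l v.1.1 v.1.2 x + Algebra.trace (ZMod p) F (v.2.1 * x) + v.2.2

/-- The excess of the number of zeros of a word over `q / p`, times `p`. -/
noncomputable def excess (p l : ℕ) [Fact p.Prime] [Algebra (ZMod p) F] [CharP F p]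
    (v : (F × F) × (F × ZMod p)) : ℤ :=
  p * levelCard (doWord p l v) 0 - Fintype.card F

/-- This is `card_words` transported along the identification of `c` with the functional `x ↦ Tr(c
x)` given by the trace form. -/
theorem card_excess_fiber (hp : p ≠ 2) (hF : Fintype.card F = p ^ m) (hm : 0 < m) (w : F × F) (D : ℤ) :
    ((univ.filter fun z : F × ZMod p => excess p l (w, z) = D).card : ℤ) * p ^ radDim p l w =
    p ^ m * (univ.filter fun t => (p : ℤ) * levelCard (doFormZMod (p := p) l w.1 w.2) t - p ^ m = D).card +
      if D = 0 then (p : ℤ) * p ^ m * (p ^ radDim p l w - 1) else 0 := by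
  classical
  have hfd : FiniteDimensional (ZMod p) F := Module.Finite.of_finite
  have : Finite (Module.Dual (ZMod p) F) := Module.finite_of_finite (ZMod p)
  let _ : Fintype (Module.Dual (ZMod p) F) := Fintype.ofFinite _
  have hp0 : (p : ℤ) ≠ 0 := by exact_mod_cast (Fact.out : p.Prime).ne_zero
  have hq : (Fintype.card F : ℤ) = p ^ m := by rw [hF]; push_cast; rfl
  by_cases hN : ∃ N : ℕ, (p : ℤ) * N - p ^ m = D
  · obtain ⟨N, rfl⟩ := hN
    have hiff : ∀ N' : ℕ, (p : ℤ) * N' - p ^ m = p * N - p ^ m ↔ N' = N := by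
      intro N'
      rw [sub_left_inj, mul_right_inj' hp0, Nat.cast_inj]
    have h1 := card_words hp (doFormZMod (p := p) l w.1 w.2) N
    rw [card_ker_eq_pow_radDim] at h1
    have h2 : (univ.filter fun z : F × ZMod p => excess p l (w, z) = p * N - p ^ m).card =
        (univ.filter fun z : Module.Dual (ZMod p) F × ZMod p =>
          levelCard (fun x => doFormZMod (p := p) l w.1 w.2 x + z.1 x + z.2) 0 = N).card := by
      let e := ((Algebra.traceForm (ZMod p) F).toDual (traceForm_nondegenerate _ _)).toEquiv
      refine Finset.card_equiv (e.prodCongr (Equiv.refl _)) ?_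
      intro z
      simp only [mem_filter, mem_univ, true_and, excess, hq, hiff]
      rfl
    have h3 : p * N = Fintype.card F ↔ (p : ℤ) * N - p ^ m = 0 := by
      rw [sub_eq_zero, hF]
      exact_mod_cast Iff.rfl
    simp only [h3] at h1
    simp only [hiff]
    rw [h2]
    have h4 : 1 ≤ p ^ radDim p l w := Nat.one_le_pow _ _ (Fact.out : p.Prime).pos
    have h5 := congrArg (Nat.cast : ℕ → ℤ) h1
    push_cast [Nat.cast_sub h4, hq] at h5
    exact h5
  -- The value 0 is always of the form `p N - p^m`, with `N = p^(m-1)`; so if `D` is not of this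
  -- form then `D ≠ 0` and both sides vanish.
  · push Not at hN
    have hD : D ≠ 0 := by
      intro h
      apply hN (p ^ (m - 1))
      push_cast
      rw [← pow_succ', Nat.sub_add_cancel hm, sub_self, h]
    rw [if_neg hD, Finset.filter_false_of_mem, Finset.filter_false_of_mem]
    · simp
    · intro t _; exact hN _
    · intro z _
      rw [excess, hq]
      exact hN _

theorem card_excess_eq_sum (D : ℤ) :
    (univ.filter fun v : (F × F) × (F × ZMod p) => excess p l v = D).card =
      ∑ w : F × F, (univ.filter fun z : F × ZMod p => excess p l (w, z) = D).card := by
  simp only [Finset.card_filter]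
  rw [Fintype.sum_prod_type]

/-- A nonzero amplitude forces even rank, since it is 0 for odd rank, and its square is `p` to the
power `m` plus the radical dimension. -/
theorem amplitude_eq_iff_of_even (hp : p ≠ 2) (hF : Fintype.card F = p ^ m) {w : F × F} {S : ℤ}
    (hS : S ^ 2 = 1) {R : ℕ} (h : amplitude p l w = S * p ^ R) :
    Even (m + radDim p l w) ∧ m + radDim p l w = 2 * R := by
  have hp' : p.Prime := Fact.out
  have hp0 : (p : ℤ) ≠ 0 := by exact_mod_cast hp'.ne_zero
  have he : Even (m + radDim p l w) := by
    by_contra he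
    rw [(amplitude_of_odd hp hF (Nat.not_even_iff_odd.1 he)).1] at h
    have h1 : S ≠ 0 := by rintro rfl; norm_num at hS
    exact mul_ne_zero h1 (pow_ne_zero R hp0) h.symm
  refine ⟨he, ?_⟩
  have h1 := (amplitude_of_even hp hF he).1
  rw [h, mul_pow, hS, one_mul, ← pow_mul] at h1
  have h2 : p ^ (R * 2) = p ^ (m + radDim p l w) := by exact_mod_cast h1
  rw [← Nat.pow_right_injective hp'.two_le h2, mul_comm]

/-- The number of words with excess `(p-1) S p^R`. -/
theorem card_excess_eq_sub_one_mul (hp : p ≠ 2) (hF : Fintype.card F = p ^ m) (hm : 0 < m) {S : ℤ}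
    (hS : S ^ 2 = 1) (R : ℕ) :
    (univ.filter fun v : (F × F) × (F × ZMod p) => excess p l v = (p - 1) * (S * p ^ R)).card =
      p ^ (2 * m - 2 * R) * (univ.filter fun w : F × F => amplitude p l w = S * p ^ R).card := by
  have hp' : p.Prime := Fact.out
  have hp0 : (p : ℤ) ≠ 0 := by exact_mod_cast hp'.ne_zero
  have hp1 : (p : ℤ) - 1 ≠ 0 := by
    have := hp'.one_lt
    omega
  have hS0 : S ≠ 0 := by rintro rfl; norm_num at hS
  have hD : ((p : ℤ) - 1) * (S * p ^ R) ≠ 0 := mul_ne_zero hp1 (mul_ne_zero hS0 (pow_ne_zero _ hp0))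
  have hDsq : (((p : ℤ) - 1) * (S * p ^ R)) ^ 2 = (p - 1) ^ 2 * p ^ (R * 2) := by
    rw [mul_pow, mul_pow, hS, one_mul, pow_mul]
  rw [card_excess_eq_sum, Finset.card_filter, Finset.mul_sum]
  refine Finset.sum_congr rfl fun w _ => ?_
  have h1 := card_excess_fiber (l := l) hp hF hm w ((p - 1) * (S * p ^ R))
  rw [if_neg hD, add_zero] at h1
  have hk := radDim_le (l := l) hF w
  have hpk : (p : ℤ) ^ radDim p l w ≠ 0 := pow_ne_zero _ hp0
  -- The excess `(p - 1) S p^R` comes only from the level `t = 0` of a form of even rank: all other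
  -- levels, and all levels of forms of odd rank, give 0 or plus or minus a power whose square is a
  -- power of `p`.
  have hlev : (univ.filter fun t => (p : ℤ) * levelCard (doFormZMod (p := p) l w.1 w.2) t - p ^ m =
      (p - 1) * (S * p ^ R)) = if amplitude p l w = S * p ^ R then {0} else ∅ := by
    ext t
    simp only [mem_filter, mem_univ, true_and]
    rcases Nat.even_or_odd (m + radDim p l w) with he | he
    · obtain ⟨hA, hZ, -⟩ := amplitude_of_even hp hF he
      rw [hZ t, add_sub_cancel_left]
      by_cases ht : t = 0
      · rw [if_pos ht, mul_right_inj' hp1]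
        split_ifs with h <;> simp [h, ht]
      · rw [if_neg ht]
        have h2 : ¬ (-1 * amplitude p l w = (p - 1) * (S * p ^ R)) := by
          intro h
          have h3 := congrArg (· ^ 2) h
          simp only [hDsq] at h3
          rw [mul_pow, hA] at h3
          exact sub_one_sq_mul_pow_ne hp (R * 2) (m + radDim p l w) (by rw [← h3]; ring)
        simp only [h2, false_iff]
        split_ifs <;> simp [ht]
    · obtain ⟨hA, B, hB, hZ⟩ := amplitude_of_odd hp hF he
      rw [hZ t, add_sub_cancel_left, hA, if_neg (mul_ne_zero hS0 (pow_ne_zero _ hp0)).symm]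
      simp only [notMem_empty, iff_false]
      intro h
      by_cases ht : t = 0
      · subst ht
        apply hD; rw [← h]; simp
      · have h3 := congrArg (· ^ 2) h
        simp only [hDsq] at h3
        rw [mul_pow, mul_pow, quadraticChar_sq_one ht, mul_one] at h3
        refine sub_one_sq_mul_pow_ne hp (R * 2) (m + radDim p l w + 1) ?_
        rw [← h3, pow_succ (p : ℤ) (m + radDim p l w), ← hB]; ring
  rw [hlev] at h1
  split_ifs at h1 ⊢ with h
  · obtain ⟨-, h2⟩ := amplitude_eq_iff_of_even hp hF hS h
    rw [mul_one]
    have h3 : (p : ℤ) ^ m = p ^ (2 * m - 2 * R) * p ^ radDim p l w := by rw [← pow_add]; congr 1; omega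
    rw [Finset.card_singleton, Nat.cast_one, mul_one] at h1
    rw [h3] at h1
    exact_mod_cast mul_right_cancel₀ hpk h1
  · rw [Finset.card_empty, Nat.cast_zero, mul_zero] at h1
    have := (mul_eq_zero.1 h1).resolve_right hpk
    rw [mul_zero]
    exact_mod_cast this

/-- Twice the number of words with excess `-S p^R`. -/
theorem two_mul_card_excess_eq_neg (hp : p ≠ 2) (hF : Fintype.card F = p ^ m) (hm : 0 < m) {S : ℤ}
    (hS : S = 1 ∨ S = -1) (R : ℕ) :
    2 * (univ.filter fun v : (F × F) × (F × ZMod p) => excess p l v = - (S * p ^ R)).card =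
      2 * (p - 1) * p ^ (2 * m - 2 * R) *
        (univ.filter fun w : F × F => amplitude p l w = S * p ^ R).card +
      (p - 1) * p ^ (2 * m + 1 - 2 * R) *
        (univ.filter fun w : F × F => m + radDim p l w + 1 = 2 * R).card := by
  have hp' : p.Prime := Fact.out
  have hp0 : (p : ℤ) ≠ 0 := by exact_mod_cast hp'.ne_zero
  have hp1 : (p : ℤ) - 1 ≠ 0 := by
    have := hp'.one_lt
    omega
  have hS2 : S ^ 2 = 1 := by rcases hS with rfl | rfl <;> norm_num
  have hS0 : S ≠ 0 := by rintro rfl; norm_num at hS2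
  have hSR : S * (p : ℤ) ^ R ≠ 0 := mul_ne_zero hS0 (pow_ne_zero _ hp0)
  have hD : -(S * (p : ℤ) ^ R) ≠ 0 := neg_ne_zero.2 hSR
  have hDsq : (-(S * (p : ℤ) ^ R)) ^ 2 = p ^ (R * 2) := by
    rw [neg_sq, mul_pow, hS2, one_mul, pow_mul]
  rw [card_excess_eq_sum, Finset.card_filter, Finset.card_filter, Finset.mul_sum, Finset.mul_sum,
    Finset.mul_sum, ← Finset.sum_add_distrib]
  refine Finset.sum_congr rfl fun w _ => ?_
  have h1 := card_excess_fiber (l := l) hp hF hm w (-(S * p ^ R))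
  rw [if_neg hD, add_zero] at h1
  have hk := radDim_le (l := l) hF w
  have hpk : (p : ℤ) ^ radDim p l w ≠ 0 := pow_ne_zero _ hp0
  rcases Nat.even_or_odd (m + radDim p l w) with he | he
  · obtain ⟨hA, hZ, -⟩ := amplitude_of_even hp hF he
    have hno : ¬ (m + radDim p l w + 1 = 2 * R) := by
      rintro h
      obtain ⟨k, hk⟩ := he
      omega
    rw [if_neg hno, mul_zero, add_zero]
    -- For even rank, all `p - 1` nonzero levels share the value `-amplitude`.
    have hlev : (univ.filter fun t => (p : ℤ) * levelCard (doFormZMod (p := p) l w.1 w.2) t - p ^ m =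
        -(S * p ^ R)) = if amplitude p l w = S * p ^ R then univ.erase 0 else ∅ := by
      ext t
      simp only [mem_filter, mem_univ, true_and]
      rw [hZ t, add_sub_cancel_left]
      by_cases ht : t = 0
      · rw [if_pos ht]
        have h2 : ¬ ((p - 1) * amplitude p l w = -(S * p ^ R)) := by
          intro h
          have h3 := congrArg (· ^ 2) h
          simp only [hDsq] at h3
          rw [mul_pow, hA] at h3
          exact sub_one_sq_mul_pow_ne hp _ _ h3
        simp only [h2, false_iff]
        split_ifs <;> simp [ht]
      · rw [if_neg ht, neg_mul, one_mul, neg_inj]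
        split_ifs with h <;> simp [h, ht]
    rw [hlev] at h1
    split_ifs at h1 ⊢ with h
    · obtain ⟨-, h2⟩ := amplitude_eq_iff_of_even hp hF hS2 h
      have h3 : (p : ℤ) ^ m = p ^ (2 * m - 2 * R) * p ^ radDim p l w := by rw [← pow_add]; congr 1; omega
      rw [Finset.card_erase_of_mem (mem_univ _), Finset.card_univ, ZMod.card] at h1
      rw [h3, mul_right_comm] at h1
      have h4 := mul_right_cancel₀ hpk h1
      have h5 : (univ.filter fun z : F × ZMod p => excess p l (w, z) = -(S * p ^ R)).card =
        p ^ (2 * m - 2 * R) * (p - 1) := by exact_mod_cast h4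
      rw [h5]; ring
    · rw [Finset.card_empty, Nat.cast_zero, mul_zero] at h1
      have := (mul_eq_zero.1 h1).resolve_right hpk
      rw [mul_zero]
      simpa using this
  · obtain ⟨hA, B, hB, hZ⟩ := amplitude_of_odd hp hF he
    rw [hA, if_neg hSR.symm, mul_zero, zero_add]
    have hpB : ((p : ℤ) * B) ^ 2 = p ^ (m + radDim p l w + 1) := by
      rw [pow_succ (p : ℤ), ← hB]; ring
    by_cases hR : m + radDim p l w + 1 = 2 * R
    · rw [if_pos hR, mul_one]
      have hB' : ∃ s : ℤ, (s = 1 ∨ s = -1) ∧ (p : ℤ) * B = -(s * (S * p ^ R)) := by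
        have h2 : ((p : ℤ) * B) ^ 2 = (S * p ^ R) ^ 2 := by
          rw [hpB, hR, mul_pow, hS2, one_mul, mul_comm, pow_mul]
        rcases sq_eq_sq_iff_eq_or_eq_neg.1 h2 with h | h
        · exact ⟨-1, Or.inr rfl, by rw [h]; ring⟩
        · exact ⟨1, Or.inl rfl, by rw [h]; ring⟩
      obtain ⟨s, hs, hsB⟩ := hB'
      have hss : s * s = 1 := by rcases hs with rfl | rfl <;> norm_num
      -- For odd rank, the value is attained on one quadratic character class, which has `(p - 1) /
      -- 2` elements whichever sign occurs. The sign of `B` is therefore irrelevant, and the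
      -- statement is doubled to avoid the division.
      have hlev : (univ.filter fun t => (p : ℤ) * levelCard (doFormZMod (p := p) l w.1 w.2) t - p ^ m =
          -(S * p ^ R)) = univ.filter fun t => quadraticChar (ZMod p) t = s := by
        ext t
        simp only [mem_filter, mem_univ, true_and]
        rw [hZ t, add_sub_cancel_left, mul_assoc, mul_left_comm, hsB]
        constructor
        · intro h
          have h2 : (quadraticChar (ZMod p) t * s) * (S * p ^ R) = 1 * (S * p ^ R) := by
            linear_combination -h
          have h3 := mul_right_cancel₀ hSR h2
          calc quadraticChar (ZMod p) t = quadraticChar (ZMod p) t * (s * s) := by rw [hss, mul_one]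
            _ = s := by rw [← mul_assoc, h3, one_mul]
        · intro h
          rw [h]
          linear_combination -(S * (p : ℤ) ^ R) * hss
      rw [hlev] at h1
      have h3 : (p : ℤ) ^ m = p ^ (2 * m + 1 - 2 * R) * p ^ radDim p l w := by rw [← pow_add]; congr 1; omega
      rw [h3, mul_right_comm] at h1
      have h4 := mul_right_cancel₀ hpk h1
      have h5 : (univ.filter fun z : F × ZMod p => excess p l (w, z) = -(S * p ^ R)).card =
        p ^ (2 * m + 1 - 2 * R) * (univ.filter fun t => quadraticChar (ZMod p) t = s).card := by
        exact_mod_cast h4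
      rw [h5, ← card_quadraticChar_eq hp hs]; ring
    · rw [if_neg hR, mul_zero]
      have hlev : (univ.filter fun t => (p : ℤ) * levelCard (doFormZMod (p := p) l w.1 w.2) t - p ^ m =
          -(S * p ^ R)) = ∅ := by
        rw [Finset.filter_eq_empty_iff]
        intro t _ h
        rw [hZ t, add_sub_cancel_left] at h
        by_cases ht : t = 0
        · subst ht
          apply hD; rw [← h]; simp
        · have h3 := congrArg (· ^ 2) h
          simp only [hDsq] at h3
          rw [mul_right_comm, mul_pow, quadraticChar_sq_one ht, mul_one, hpB] at h3
          have h4 : p ^ (m + radDim p l w + 1) = p ^ (R * 2) := by exact_mod_cast h3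
          have h5 := Nat.pow_right_injective hp'.two_le h4
          omega
      rw [hlev, Finset.card_empty, Nat.cast_zero, mul_zero] at h1
      have := (mul_eq_zero.1 h1).resolve_right hpk
      simpa using this

/-- The number of words with excess `0`. -/
theorem card_excess_eq_zero (hp : p ≠ 2) (hF : Fintype.card F = p ^ m) (hm : 0 < m) :
    ((univ.filter fun v : (F × F) × (F × ZMod p) => excess p l v = 0).card : ℚ) =
      ∑ w : F × F, ((p : ℚ) ^ (m + 1) - p ^ (m + 1) / p ^ radDim p l w +
        if Odd (m + radDim p l w) then (p : ℚ) ^ m / p ^ radDim p l w else 0) := by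
  have hp' : p.Prime := Fact.out
  have hp0 : (p : ℤ) ≠ 0 := by exact_mod_cast hp'.ne_zero
  have hp0' : (p : ℚ) ≠ 0 := by exact_mod_cast hp'.ne_zero
  have hp1 : (p : ℤ) - 1 ≠ 0 := by
    have := hp'.one_lt
    omega
  rw [card_excess_eq_sum]
  push_cast
  refine Finset.sum_congr rfl fun w _ => ?_
  have h1 := card_excess_fiber (l := l) hp hF hm w 0
  rw [if_pos rfl] at h1
  have hpk : (p : ℚ) ^ radDim p l w ≠ 0 := pow_ne_zero _ hp0'
  -- Among the levels of a single form, the excess 0 never occurs for even rank and occurs only at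
  -- `t = 0` for odd rank; the other words of excess 0 have a linear part that is nonzero on the
  -- radical.
  have hlev : (univ.filter fun t => (p : ℤ) * levelCard (doFormZMod (p := p) l w.1 w.2) t - p ^ m =
      0).card = if Odd (m + radDim p l w) then 1 else 0 := by
    rcases Nat.even_or_odd (m + radDim p l w) with he | he
    · obtain ⟨hA, hZ, -⟩ := amplitude_of_even hp hF he
      rw [if_neg (Nat.not_odd_iff_even.2 he), Finset.card_eq_zero, Finset.filter_eq_empty_iff]
      intro t _ h
      rw [hZ t, add_sub_cancel_left] at h
      have h2 : amplitude p l w ≠ 0 := by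
        intro h0
        rw [h0] at hA
        exact pow_ne_zero _ hp0 (by rw [← hA]; norm_num)
      split_ifs at h
      · exact mul_ne_zero hp1 h2 h
      · exact mul_ne_zero (by norm_num) h2 h
    · obtain ⟨hA, B, hB, hZ⟩ := amplitude_of_odd hp hF he
      have hB0 : B ≠ 0 := by
        intro h0
        rw [h0] at hB
        exact pow_ne_zero (m + radDim p l w) hp0 (by rw [← hB]; ring)
      have : (univ.filter fun t => (p : ℤ) * levelCard (doFormZMod (p := p) l w.1 w.2) t - p ^ m =
          0) = {0} := by
        ext t
        simp only [mem_filter, mem_univ, true_and, mem_singleton]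
        rw [hZ t, add_sub_cancel_left]
        rw [mul_eq_zero, mul_eq_zero, quadraticChar_eq_zero_iff]
        simp [hB0, hp'.ne_zero]
      rw [if_pos he, this, Finset.card_singleton]
  rw [hlev] at h1
  have h2 := congrArg (Int.cast : ℤ → ℚ) h1
  push_cast at h2
  rw [← mul_left_inj' hpk, h2]
  split_ifs <;> field_simp <;> ring

end Amplitude

/-! ### Block systems with a group transitive on pairs. -/

section Designs

theorem choose_two_mul_two (n : ℕ) : n.choose 2 * 2 = n * (n - 1) := by
  rw [Nat.choose_two_right, Nat.div_mul_cancel (Nat.even_mul_pred_self n).two_dvd]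

/-- The blocks of a `2`-homogeneous block system form a `2`-design. -/
theorem exists_balanced_of_transitive {P : Type*} [Fintype P] [DecidableEq P]
    (𝓑 : Finset (Finset P)) (i : ℕ) (hcard : ∀ B ∈ 𝓑, B.card = i) (hP : 2 ≤ Fintype.card P)
    (htrans : ∀ T T' : Finset P, T.card = 2 → T'.card = 2 →
      ∃ g : Equiv.Perm P, T.map g.toEmbedding = T' ∧ ∀ B ∈ 𝓑, B.map g.toEmbedding ∈ 𝓑) :
    ∃ L, (∀ T : Finset P, T.card = 2 → (𝓑.filter fun B => T ⊆ B).card = L) ∧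
      L * (Fintype.card P * (Fintype.card P - 1)) = 𝓑.card * (i * (i - 1)) := by
  have hle : ∀ T T' : Finset P, T.card = 2 → T'.card = 2 →
      (𝓑.filter fun B => T ⊆ B).card ≤ (𝓑.filter fun B => T' ⊆ B).card := by
    intro T T' hT hT'
    obtain ⟨g, rfl, hg⟩ := htrans T T' hT hT'
    refine Finset.card_le_card_of_injOn (fun B => B.map g.toEmbedding) ?_ ?_
    · intro B hB
      rw [Finset.mem_coe, mem_filter] at hB ⊢
      exact ⟨hg B hB.1, Finset.map_subset_map.2 hB.2⟩
    · intro B _ B' _ h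
      exact Finset.map_injective _ h
  obtain ⟨T₀, -, hT₀⟩ := Finset.exists_subset_card_eq (s := (univ : Finset P)) (n := 2)
    (by rwa [Finset.card_univ])
  have hL : ∀ T : Finset P, T.card = 2 →
      (𝓑.filter fun B => T ⊆ B).card = (𝓑.filter fun B => T₀ ⊆ B).card :=
    fun T hT => le_antisymm (hle T T₀ hT hT₀) (hle T₀ T hT₀ hT)
  refine ⟨_, hL, ?_⟩
  -- Double counting of the incidences between two-element sets and the blocks containing them.
  have hdc := Finset.sum_card_bipartiteAbove_eq_sum_card_bipartiteBelow
    (s := powersetCard 2 (univ : Finset P)) (t := 𝓑) (fun T B => T ⊆ B)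
  have h1 : ∑ T ∈ powersetCard 2 (univ : Finset P),
      (bipartiteAbove (fun T B : Finset P => T ⊆ B) 𝓑 T).card =
      (Fintype.card P).choose 2 * (𝓑.filter fun B => T₀ ⊆ B).card := by
    rw [Finset.sum_congr rfl (g := fun _ => (𝓑.filter fun B => T₀ ⊆ B).card), Finset.sum_const,
      Finset.card_powersetCard, Finset.card_univ, smul_eq_mul]
    exact fun T hT => hL T (mem_powersetCard.1 hT).2
  have h2 : ∑ B ∈ 𝓑, (bipartiteBelow (fun T B : Finset P => T ⊆ B)
      (powersetCard 2 (univ : Finset P)) B).card = 𝓑.card * i.choose 2 := by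
    rw [Finset.sum_congr rfl (g := fun _ => i.choose 2), Finset.sum_const, smul_eq_mul]
    intro B hB
    rw [← hcard B hB, ← Finset.card_powersetCard]
    congr 1
    ext T
    simp only [bipartiteBelow, mem_filter, mem_powersetCard, subset_univ, true_and]
    exact and_comm
  rw [h1, h2] at hdc
  rw [← choose_two_mul_two, ← choose_two_mul_two, ← mul_assoc, ← mul_assoc, mul_comm _ (Nat.choose _ 2),
    hdc]

end Designs

/-! ### Words of small weight and their supports. -/

section Code

variable {p : ℕ} [Fact p.Prime] {ι V : Type*} [Fintype ι] [AddCommGroup V] [Module (ZMod p) V]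

/-- A codeword of small weight, compared with the minimum distance, is determined by its support
up to a scalar. -/
theorem exists_smul_eq_of_wordSupport_eq (Φ : V →ₗ[ZMod p] (ι → ZMod p)) {i dm : ℕ}
    (hmin : ∀ v, v ≠ 0 → dm ≤ hammingNorm (Φ v)) (hi : (p - 2) * i < (p - 1) * dm)
    {v v' : V} (hv : hammingNorm (Φ v) = i) (h : wordSupport (Φ v) = wordSupport (Φ v')) :
    ∃ c : ZMod p, v = c • v' := by
  classical
  have hp : p.Prime := Fact.out
  set S := wordSupport (Φ v) with hS
  have hSi : S.card = i := by rw [← hv]; rfl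
  have hmem : ∀ x, x ∈ S ↔ Φ v x ≠ 0 := by simp [hS, wordSupport]
  have hmem' : ∀ x, x ∈ S ↔ Φ v' x ≠ 0 := by rw [h]; simp [wordSupport]
  have hfib := Finset.card_eq_sum_card_fiberwise (s := S) (t := (univ : Finset (ZMod p)).erase 0)
    (f := fun x => Φ v x / Φ v' x) (fun x hx => by
      rw [Finset.mem_coe] at hx
      rw [Finset.mem_coe, Finset.mem_erase]
      exact ⟨div_ne_zero ((hmem x).1 hx) ((hmem' x).1 hx), mem_univ _⟩)
  have hcard : ((univ : Finset (ZMod p)).erase 0).card = p - 1 := by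
    rw [Finset.card_erase_of_mem (mem_univ _), Finset.card_univ, ZMod.card]
  -- Pigeonhole: the ratio of the two words takes at most `p - 1` values on the common support, so
  -- some ratio `c` occurs on at least `i / (p - 1)` of its points. Then `v - c • v'` has weight at
  -- most `i (p - 2) / (p - 1)`, below the minimum weight.
  obtain ⟨c, hc, hci⟩ : ∃ c ∈ (univ : Finset (ZMod p)).erase 0,
      i ≤ (p - 1) * (S.filter fun x => Φ v x / Φ v' x = c).card := by
    by_contra! hlt
    have hne : ((univ : Finset (ZMod p)).erase 0).Nonempty :=
      Finset.card_pos.1 (by rw [hcard]; have := hp.one_lt; omega)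
    have h1 := Finset.sum_lt_sum_of_nonempty hne hlt
    rw [← Finset.mul_sum, ← hfib, hSi, Finset.sum_const, hcard, smul_eq_mul] at h1
    exact lt_irrefl _ h1
  refine ⟨c, ?_⟩
  by_contra hne
  have h2 := hmin (v - c • v') (sub_ne_zero.2 hne)
  have h3 : hammingNorm (Φ (v - c • v')) ≤
      (S.filter fun x => ¬ (Φ v x / Φ v' x = c)).card := by
    refine Finset.card_le_card fun x hx => ?_
    rw [mem_filter] at hx ⊢
    have hx2 := hx.2
    simp only [map_sub, map_smul, Pi.sub_apply, Pi.smul_apply, smul_eq_mul] at hx2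
    have hxS : x ∈ S := by
      by_contra hxS
      have h4 : Φ v x = 0 := by
        by_contra h; exact hxS ((hmem x).2 h)
      have h5 : Φ v' x = 0 := by
        by_contra h; exact hxS ((hmem' x).2 h)
      rw [h4, h5] at hx2
      simp at hx2
    refine ⟨hxS, fun h6 => hx2 ?_⟩
    rw [← h6, div_mul_cancel₀ _ ((hmem' x).1 hxS), sub_self]
  have h4 := Finset.card_filter_add_card_filter_not (s := S) (fun x => Φ v x / Φ v' x = c)
  rw [hSi] at h4
  set α := (S.filter fun x => Φ v x / Φ v' x = c).card
  set β := (S.filter fun x => ¬ (Φ v x / Φ v' x = c)).card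
  obtain ⟨r, rfl⟩ : ∃ r, p = r + 2 := ⟨p - 2, by have := hp.two_le; omega⟩
  simp only [Nat.add_sub_cancel, show r + 2 - 1 = r + 1 by omega] at hi hci
  have h5 : (r + 1) * dm ≤ (r + 1) * β := Nat.mul_le_mul_left _ (h2.trans h3)
  nlinarith

theorem wordSupport_smul (f : ι → ZMod p) {c : ZMod p} (hc : c ≠ 0) :
    wordSupport (c • f) = wordSupport f := by
  ext x
  simp [wordSupport, hc]

theorem hammingNorm_smul' (f : ι → ZMod p) {c : ZMod p} (hc : c ≠ 0) :
    hammingNorm (c • f) = hammingNorm f := congrArg Finset.card (wordSupport_smul f hc)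

/-- The number of supports of codewords of weight `i`. -/
theorem card_blocks [Fintype V] [DecidableEq ι] (Φ : V →ₗ[ZMod p] (ι → ZMod p)) {i dm : ℕ}
    (hmin : ∀ v, v ≠ 0 → dm ≤ hammingNorm (Φ v)) (hi : (p - 2) * i < (p - 1) * dm) (hi0 : 0 < i) :
    (univ.filter fun v => hammingNorm (Φ v) = i).card = (p - 1) *
      ((univ.filter fun v => hammingNorm (Φ v) = i).image fun v => wordSupport (Φ v)).card := by
  classical
  set A := univ.filter fun v => hammingNorm (Φ v) = i
  have h1 := Finset.card_eq_sum_card_fiberwise (s := A)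
    (t := A.image fun v => wordSupport (Φ v)) (f := fun v => wordSupport (Φ v))
    (fun v hv => Finset.mem_coe.2 (Finset.mem_image_of_mem _ hv))
  rw [h1, Finset.sum_congr rfl (g := fun _ => p - 1), Finset.sum_const, smul_eq_mul, mul_comm]
  intro B hB
  obtain ⟨v₀, hv₀, rfl⟩ := Finset.mem_image.1 hB
  have hw₀ : hammingNorm (Φ v₀) = i := (mem_filter.1 hv₀).2
  have hv0 : v₀ ≠ 0 := by
    rintro rfl
    rw [map_zero, hammingNorm_zero] at hw₀
    omega
  have hcard : ((univ : Finset (ZMod p)).erase 0).card = p - 1 := by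
    rw [Finset.card_erase_of_mem (mem_univ _), Finset.card_univ, ZMod.card]
  rw [← hcard]
  symm
  refine Finset.card_bij (fun c _ => c • v₀) ?_ ?_ ?_
  · intro c hc
    have hc0 := Finset.ne_of_mem_erase hc
    simp only [A, mem_filter, mem_univ, true_and, map_smul]
    exact ⟨by rw [hammingNorm_smul' _ hc0, hw₀], wordSupport_smul _ hc0⟩
  · intro c _ c' _ h
    exact smul_left_injective _ hv0 h
  · intro v hv
    rw [mem_filter] at hv
    have hwv : hammingNorm (Φ v) = i := (mem_filter.1 hv.1).2
    obtain ⟨c, rfl⟩ := exists_smul_eq_of_wordSupport_eq Φ hmin hi hwv hv.2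
    refine ⟨c, Finset.mem_erase.2 ⟨?_, mem_univ _⟩, rfl⟩
    rintro rfl
    rw [zero_smul, map_zero, hammingNorm_zero] at hwv
    omega

end Code

/-! ### Affine invariance and the criterion for a design. -/

section DoCode

variable {F : Type*} [Field F] [Fintype F] [DecidableEq F] {p m l : ℕ} [Fact p.Prime]
  [Algebra (ZMod p) F] [CharP F p]

theorem doWord_eq (v : (F × F) × (F × ZMod p)) (x : F) :
    doWord p l v x = Algebra.trace (ZMod p) F
      (v.1.1 * x ^ (p ^ (3 * l) + 1) + v.1.2 * x ^ (p ^ l + 1) + v.2.1 * x) + v.2.2 := by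
  rw [doWord, doFormZMod_apply, ← map_add, doPair]
  simp only [pow_succ]

/-- The parametrization of the code as a linear map. -/
noncomputable def doWordLin (p l : ℕ) [Fact p.Prime] (F : Type*) [Field F] [Fintype F] [DecidableEq F]
    [Algebra (ZMod p) F] [CharP F p] : ((F × F) × (F × ZMod p)) →ₗ[ZMod p] (F → ZMod p) where
  toFun := doWord p l
  map_add' v v' := by
    ext x
    rw [Pi.add_apply, doWord_eq, doWord_eq, doWord_eq, add_add_add_comm, ← map_add]
    congr 2
    simp only [Prod.fst_add, Prod.snd_add]
    ring
  map_smul' c v := by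
    ext x
    rw [Pi.smul_apply, doWord_eq, doWord_eq, smul_add, ← map_smul]
    congr 2
    simp only [Prod.smul_fst, Prod.smul_snd, RingHom.id_apply, Algebra.smul_def (A := F)]
    ring

theorem mem_doCode_iff (f : F → ZMod p) : f ∈ doCode p l F ↔ ∃ v, doWord p l v = f := by
  constructor
  · rintro ⟨a, b, c, h, hf⟩
    exact ⟨((a, b), (c, h)), funext fun x => by rw [doWord_eq, hf]⟩
  · rintro ⟨v, rfl⟩
    exact ⟨v.1.1, v.1.2, v.2.1, v.2.2, fun x => doWord_eq v x⟩

/-- The code is invariant under affine substitutions. -/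
theorem exists_doWord_comp_affine (v : (F × F) × (F × ZMod p)) (u t : F) :
    ∃ v', ∀ x, doWord p l v' x = doWord p l v (u * x + t) := by
  obtain ⟨⟨a, b⟩, c, h⟩ := v
  -- Expanding at `u x + t` produces cross terms `z * x^(p^k)` under the trace. Applying the inverse
  -- of Frobenius inside the trace makes them linear in `x`, so the substituted function is again a
  -- word.
  have hinv : ∀ (k : ℕ) (z : F), ∃ y, ∀ x, Algebra.trace (ZMod p) F (z * x ^ p ^ k) =
      Algebra.trace (ZMod p) F (y * x) := by
    intro k z
    set σ := frobAlgEquiv (F := F) (K := ZMod p) p k (algebraMap_zmod_pow k)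
    refine ⟨σ.symm z, fun x => ?_⟩
    rw [← Algebra.trace_eq_of_algEquiv σ (σ.symm z * x), map_mul σ, AlgEquiv.apply_symm_apply,
      frobAlgEquiv_apply]
  obtain ⟨y₁, hy₁⟩ := hinv (3 * l) (a * u ^ p ^ (3 * l) * t)
  obtain ⟨y₂, hy₂⟩ := hinv l (b * u ^ p ^ l * t)
  refine ⟨((a * u ^ (p ^ (3 * l) + 1), b * u ^ (p ^ l + 1)),
    (y₁ + y₂ + a * u * t ^ p ^ (3 * l) + b * u * t ^ p ^ l + c * u,
    Algebra.trace (ZMod p) F (a * t ^ (p ^ (3 * l) + 1) + b * t ^ (p ^ l + 1) + c * t) + h)),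
    fun x => ?_⟩
  have hadd : ∀ (k : ℕ) (x y : F), (x + y) ^ p ^ k = x ^ p ^ k + y ^ p ^ k :=
    fun k x y => add_pow_char_pow x y p k
  have e : ∀ z : F, Algebra.trace (ZMod p) F ((y₁ + y₂ + z) * x) =
      Algebra.trace (ZMod p) F (a * u ^ p ^ (3 * l) * t * x ^ p ^ (3 * l) +
        b * u ^ p ^ l * t * x ^ p ^ l + z * x) := by
    intro z
    rw [add_mul, add_mul, map_add, map_add, map_add, map_add, hy₁, hy₂]
  rw [doWord_eq, doWord_eq]
  simp only
  have e' := e (a * u * t ^ p ^ (3 * l) + b * u * t ^ p ^ l + c * u)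
  rw [show y₁ + y₂ + a * u * t ^ p ^ (3 * l) + b * u * t ^ p ^ l + c * u =
      y₁ + y₂ + (a * u * t ^ p ^ (3 * l) + b * u * t ^ p ^ l + c * u) by ring,
    map_add (Algebra.trace (ZMod p) F), e', ← map_add (Algebra.trace (ZMod p) F), ← add_assoc,
    ← map_add (Algebra.trace (ZMod p) F)]
  congr 2
  simp only [pow_succ, hadd, mul_pow]
  ring

theorem mul_hammingNorm_doWord (v : (F × F) × (F × ZMod p)) :
    (p : ℤ) * hammingNorm (doWord p l v) = (p - 1) * Fintype.card F - excess p l v := by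
  have h1 : levelCard (doWord p l v) 0 + hammingNorm (doWord p l v) = Fintype.card F := by
    rw [levelCard, hammingNorm, Finset.card_filter_add_card_filter_not, Finset.card_univ]
  rw [excess, ← h1]
  push_cast
  ring

/-- The affine map with slope `(x' - y') / (x - y)` carries one ordered pair of distinct points to
the other; the word `v'` is `v` composed with its inverse. -/
theorem exists_perm_doWord (T T' : Finset F) (hT : T.card = 2) (hT' : T'.card = 2) :
    ∃ g : Equiv.Perm F, T.map g.toEmbedding = T' ∧
      ∀ v : (F × F) × (F × ZMod p), ∃ v', ∀ x, doWord p l v' (g x) = doWord p l v x := by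
  obtain ⟨x, y, hxy, rfl⟩ := Finset.card_eq_two.1 hT
  obtain ⟨x', y', hxy', rfl⟩ := Finset.card_eq_two.1 hT'
  have h1 : x - y ≠ 0 := sub_ne_zero.2 hxy
  have h2 : x' - y' ≠ 0 := sub_ne_zero.2 hxy'
  set u := (x' - y') / (x - y) with hu
  have hu0 : u ≠ 0 := div_ne_zero h2 h1
  have hux : u * (x - y) = x' - y' := div_mul_cancel₀ _ h1
  let g : Equiv.Perm F := (Equiv.mulLeft₀ u hu0).trans (Equiv.addRight (x' - u * x))
  have hg : ∀ z, g z = u * z + (x' - u * x) := fun z => rfl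
  refine ⟨g, ?_, fun v => ?_⟩
  · rw [Finset.map_insert, Finset.map_singleton]
    have e1 : g x = x' := by rw [hg]; ring
    have e2 : g y = y' := by rw [hg]; linear_combination -hux
    simp only [Equiv.coe_toEmbedding, e1, e2]
  · obtain ⟨v', hv'⟩ := exists_doWord_comp_affine v u⁻¹ (-(u⁻¹ * (x' - u * x)))
    refine ⟨v', fun z => ?_⟩
    rw [hv', hg]
    congr 1
    field_simp
    ring

/-- A criterion for the words of a given weight to hold a `2`-design, in terms of the excess. -/
theorem holdsDesign_of_excess (hF : Fintype.card F = p ^ m) (hm : 0 < m) {D Δ : ℤ} {P : ℕ}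
    (hΔ : ∀ v : (F × F) × (F × ZMod p), v ≠ 0 → excess p l v ≤ Δ)
    (hD : (p - 1) * Δ - (p - 2) * D < (p - 1) * (p : ℤ) ^ m)
    (hD1 : -(p : ℤ) ^ m < D) (hD2 : 2 * (p : ℤ) < (p - 1) * p ^ m - D)
    (hP : (univ.filter fun v : (F × F) × (F × ZMod p) => excess p l v = D).card = P) (hP0 : 0 < P)
    {i lam : ℚ} (hi : p * i = (p - 1) * p ^ m - D)
    (hlam : lam * ((p - 1) * p ^ m * (p ^ m - 1)) = P * (i * (i - 1))) :
    HoldsDesign (doCode p l F : Set (F → ZMod p)) 2 (p ^ m) i lam := by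
  have hp' : p.Prime := Fact.out
  have hp0 : (p : ℤ) ≠ 0 := by exact_mod_cast hp'.ne_zero
  have hpQ : (p : ℚ) ≠ 0 := by exact_mod_cast hp'.ne_zero
  have hpos : (0 : ℤ) < p := by exact_mod_cast hp'.pos
  have hp2 : (2 : ℤ) ≤ p := by exact_mod_cast hp'.two_le
  have hq : (Fintype.card F : ℤ) = p ^ m := by rw [hF]; push_cast; rfl
  have hwt : ∀ v, (p : ℤ) * hammingNorm (doWordLin p l F v) = (p - 1) * p ^ m - excess p l v :=
    fun v => by rw [← hq]; exact mul_hammingNorm_doWord v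
  obtain ⟨v₀, hv₀⟩ : ∃ v₀ : (F × F) × (F × ZMod p), excess p l v₀ = D := by
    obtain ⟨v, hv⟩ := Finset.card_pos.1 (hP ▸ hP0)
    exact ⟨v, (mem_filter.1 hv).2⟩
  set k := hammingNorm (doWordLin p l F v₀) with hk
  have hkD : (p : ℤ) * k = (p - 1) * p ^ m - D := by rw [hwt, hv₀]
  have hki : (k : ℚ) = i := by
    have := congrArg (Int.cast : ℤ → ℚ) hkD
    push_cast at this
    exact mul_left_cancel₀ hpQ (this.trans hi.symm)
  have hiff : ∀ v, hammingNorm (doWordLin p l F v) = k ↔ excess p l v = D := by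
    intro v
    have h1 := hwt v
    rw [← Nat.cast_inj (R := ℤ), ← mul_right_inj' hp0, h1, hkD]
    constructor <;> intro h <;> linarith
  have h2k : 2 < k := by
    have : (p : ℤ) * 2 < p * k := by rw [hkD]; linarith
    exact_mod_cast lt_of_mul_lt_mul_left this hpos.le
  have hkq : k < p ^ m := by
    have : (p : ℤ) * k < p * (p ^ m : ℕ) := by rw [hkD]; push_cast; linarith
    exact_mod_cast lt_of_mul_lt_mul_left this hpos.le
  obtain ⟨v₁, hv₁, hmin⟩ := Finset.exists_min_image
    ((univ : Finset ((F × F) × (F × ZMod p))).erase 0) (fun v => hammingNorm (doWordLin p l F v))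
    ⟨v₀, Finset.mem_erase.2 ⟨by
      rintro rfl
      rw [map_zero, hammingNorm_zero] at hk
      omega, mem_univ _⟩⟩
  have hv₁0 : v₁ ≠ 0 := Finset.ne_of_mem_erase hv₁
  -- After multiplication by `p` and substitution of weights by excesses, `(p - 2) k < (p - 1)
  -- d_min` follows from `hD`, with `Δ` bounding the excess of a word of minimum weight.
  have hbound : (p - 2) * k < (p - 1) * hammingNorm (doWordLin p l F v₁) := by
    have h1 := hwt v₁
    have h2 := hΔ v₁ hv₁0
    zify [hp'.two_le, hp'.one_le]
    refine lt_of_mul_lt_mul_left (a := (p : ℤ)) ?_ hpos.le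
    have e1 : (p : ℤ) * ((p - 2) * k) = (p - 2) * ((p - 1) * p ^ m - D) := by rw [← hkD]; ring
    have e2 : (p : ℤ) * ((p - 1) * hammingNorm (doWordLin p l F v₁)) =
      (p - 1) * ((p - 1) * p ^ m - excess p l v₁) := by rw [← h1]; ring
    rw [e1, e2]
    have h3 : ((p : ℤ) - 1) * excess p l v₁ ≤ (p - 1) * Δ :=
      mul_le_mul_of_nonneg_left h2 (by linarith)
    linarith
  have hcb := card_blocks (doWordLin p l F)
    (fun v hv => hmin v (Finset.mem_erase.2 ⟨hv, mem_univ _⟩)) hbound (by omega)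
  set 𝓑 := (univ.filter fun v => hammingNorm (doWordLin p l F v) = k).image
    fun v => wordSupport (doWordLin p l F v) with h𝓑
  simp only [hiff] at hcb
  rw [hP] at hcb
  have hset : supportBlocks (doCode p l F : Set (F → ZMod p)) k = 𝓑 := by
    ext B
    simp only [supportBlocks, Set.mem_ofPred_eq, h𝓑, Finset.coe_image, Set.mem_image,
      mem_filter, mem_univ, true_and, SetLike.mem_coe, mem_doCode_iff]
    constructor
    · rintro ⟨f, ⟨v, rfl⟩, h1, h2⟩
      exact ⟨v, h1, h2⟩
    · rintro ⟨v, h1, h2⟩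
      exact ⟨_, ⟨v, rfl⟩, h1, h2⟩
  have hcard : ∀ B ∈ 𝓑, B.card = k := by
    intro B hB
    obtain ⟨v, hv, rfl⟩ := Finset.mem_image.1 hB
    exact (mem_filter.1 hv).2
  have hq2 : 2 ≤ Fintype.card F := by
    rw [hF]
    exact hp'.two_le.trans (Nat.le_self_pow hm.ne' p)
  obtain ⟨L, hL, hLc⟩ := exists_balanced_of_transitive 𝓑 k hcard hq2 (by
    intro T T' hT hT'
    obtain ⟨g, hg, hv⟩ := exists_perm_doWord (p := p) (l := l) T T' hT hT'
    refine ⟨g, hg, fun B hB => ?_⟩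
    obtain ⟨v, hvk, rfl⟩ := Finset.mem_image.1 hB
    obtain ⟨v', hv'⟩ := hv v
    have hs : wordSupport (doWordLin p l F v') =
        (wordSupport (doWordLin p l F v)).map g.toEmbedding := by
      ext x
      simp only [wordSupport, mem_filter, mem_univ, true_and, Finset.mem_map_equiv]
      have := hv' (g.symm x)
      rw [Equiv.apply_symm_apply] at this
      change doWord p l v' x ≠ 0 ↔ doWord p l v (g.symm x) ≠ 0
      rw [this]
    refine Finset.mem_image.2 ⟨v', mem_filter.2 ⟨mem_univ _, ?_⟩, hs⟩
    rw [← (mem_filter.1 hvk).2]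
    change (wordSupport (doWordLin p l F v')).card = (wordSupport (doWordLin p l F v)).card
    rw [hs, Finset.card_map])
  have hB0 : 0 < 𝓑.card := Nat.pos_of_mul_pos_left (hcb ▸ hP0)
  have hL0 : 0 < L := by
    refine Nat.pos_of_ne_zero fun h => ?_
    rw [h, zero_mul] at hLc
    have : 0 < 𝓑.card * (k * (k - 1)) := by
      have : 0 < k - 1 := by omega
      positivity
    omega
  refine ⟨k, L, hki, ?_, ?_⟩
  · have hc1 : (1 : ℚ) < p := by exact_mod_cast hp'.one_lt
    have hc2 : (1 : ℚ) < (p : ℚ) ^ m := one_lt_pow₀ hc1 hm.ne'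
    have hne : ((p : ℚ) - 1) * p ^ m * (p ^ m - 1) ≠ 0 := by
      have := sub_pos.2 hc1
      have := sub_pos.2 hc2
      positivity
    rw [← mul_left_inj' hne, hlam, ← hki, hcb]
    have h1 := congrArg (Nat.cast : ℕ → ℚ) hLc
    rw [hF] at h1
    push_cast [Nat.cast_sub (Nat.one_le_pow m p hp'.pos), Nat.cast_sub (show 1 ≤ k by omega),
      Nat.cast_sub hp'.one_le] at h1 ⊢
    linear_combination ((p : ℚ) - 1) * h1
  · refine ⟨hF, by norm_num, h2k, hkq, hL0, ?_, ?_⟩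
    · rw [hset]; exact hcard
    · intro T hT
      rw [hset, ← hL T hT, ← Set.ncard_coe_finset]
      congr 1
      ext B
      simp

/-- The alternative is whether the linear part is represented by the polar form; if so, the square
can be completed. -/
theorem excess_eq_zero_or (hp : p ≠ 2) (v : (F × F) × (F × ZMod p)) :
    excess p l v = 0 ∨ ∃ t, excess p l v =
      p * levelCard (doFormZMod (p := p) l v.1.1 v.1.2) t - Fintype.card F := by
  have hfd : FiniteDimensional (ZMod p) F := Module.Finite.of_finite
  obtain ⟨w, c, h⟩ := v
  set f : Module.Dual (ZMod p) F := Algebra.traceForm (ZMod p) F c with hf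
  have hw : doWord p l (w, c, h) = fun x => doFormZMod (p := p) l w.1 w.2 x + f x + h := rfl
  rw [excess, hw]
  by_cases hr : f ∈ LinearMap.range (doFormZMod (p := p) l w.1 w.2).polarBilin
  · obtain ⟨u, hu⟩ := hr
    right
    refine ⟨doFormZMod (p := p) l w.1 w.2 u - h, ?_⟩
    rw [← hu, levelCard_polarBilin_add]
  · left
    have := levelCard_of_notMem_range hp _ hr h
    rw [← this]
    push_cast
    ring

/-- The excess of a word with nonzero form is 0 or that of a level set of the form. When the form is
zero but the word is not, the remaining function is either balanced or a nonzero constant, and the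
excess is not positive. -/
theorem excess_le (hp : p ≠ 2) (hF : Fintype.card F = p ^ m) {Δ : ℤ} (hΔ : 0 ≤ Δ)
    (he : ∀ w : F × F, w ≠ 0 → Even (m + radDim p l w) →
      (p - 1) * amplitude p l w ≤ Δ ∧ - amplitude p l w ≤ Δ)
    (ho : ∀ w : F × F, w ≠ 0 → Odd (m + radDim p l w) → (p : ℤ) ^ (m + radDim p l w + 1) ≤ Δ ^ 2)
    (v : (F × F) × (F × ZMod p)) (hv : v ≠ 0) : excess p l v ≤ Δ := by
  have hp' : p.Prime := Fact.out
  have hq : (Fintype.card F : ℤ) = p ^ m := by rw [hF]; push_cast; rfl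
  by_cases hw : v.1 = 0
  · have h0 : doWord p l v = fun x => Algebra.trace (ZMod p) F (v.2.1 * x) + v.2.2 := by
      ext x
      rw [doWord_eq, hw]
      simp
    refine le_trans ?_ hΔ
    rw [excess, h0]
    by_cases hc : v.2.1 = 0
    · have hh : v.2.2 ≠ 0 := fun hh => hv (Prod.ext hw (Prod.ext hc hh))
      have : levelCard (fun x => Algebra.trace (ZMod p) F (v.2.1 * x) + v.2.2) 0 = 0 := by
        rw [levelCard, Finset.card_eq_zero, Finset.filter_eq_empty_iff]
        intro x _
        simpa [hc] using hh
      rw [this]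
      simp
    · have hf : Algebra.traceForm (ZMod p) F v.2.1 ≠ 0 := by
        intro hf
        have hfd : FiniteDimensional (ZMod p) F := Module.Finite.of_finite
        exact hc (((Algebra.traceForm (ZMod p) F).toDual
          (traceForm_nondegenerate _ _)).map_eq_zero_iff.1 hf)
      have := levelCard_of_notMem_range hp (0 : QuadraticForm (ZMod p) F)
        (f := Algebra.traceForm (ZMod p) F v.2.1) (by
          rintro ⟨u, hu⟩
          apply hf
          rw [← hu]
          ext x
          simp [QuadraticMap.polar]) v.2.2
      simp only [zero_apply, zero_add, Algebra.traceForm_apply] at this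
      rw [← this]
      push_cast
      rw [sub_self]
  · rcases excess_eq_zero_or hp v with h | ⟨t, h⟩
    · rw [h]; exact hΔ
    rw [h, hq]
    rcases Nat.even_or_odd (m + radDim p l v.1) with h1 | h1
    · obtain ⟨-, h2, -⟩ := amplitude_of_even hp hF h1
      rw [h2 t, add_sub_cancel_left]
      split_ifs
      · exact (he _ hw h1).1
      · rw [neg_mul, one_mul]; exact (he _ hw h1).2
    · obtain ⟨-, B, hB, h2⟩ := amplitude_of_odd hp hF h1
      rw [h2 t, add_sub_cancel_left]
      refine (abs_le_of_sq_le_sq' ?_ hΔ).2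
      refine le_trans ?_ (ho _ hw h1)
      rw [pow_succ (p : ℤ), ← hB]
      have hq1 : (quadraticChar (ZMod p) t) ^ 2 ≤ 1 := by
        by_cases ht : t = 0
        · subst ht; simp
        · rw [quadraticChar_sq_one ht]
      calc ((p : ℤ) * quadraticChar (ZMod p) t * B) ^ 2 =
          (p * B) ^ 2 * (quadraticChar (ZMod p) t) ^ 2 := by ring
        _ ≤ (p * B) ^ 2 * 1 := mul_le_mul_of_nonneg_left hq1 (sq_nonneg _)
        _ = p * B ^ 2 * p := by ring

end DoCode

/-! ### Radical dimensions and signs when `m / d` is odd. -/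

section Distribution

variable {F : Type*} [Field F] [Fintype F] [DecidableEq F] {p m l : ℕ} [Fact p.Prime]
  [Algebra (ZMod p) F] [CharP F p]

theorem exists_addChar_zmod_ne_zero (p : ℕ) [Fact p.Prime] : ∃ ψ : AddChar (ZMod p) ℂ, ψ ≠ 0 := by
  refine ⟨ZMod.stdAddChar, fun h => ?_⟩
  have h1 := ZMod.isPrimitive_stdAddChar p (one_ne_zero (α := ZMod p))
  rw [AddChar.mulShift_one, h] at h1
  exact h1 rfl

theorem radDim_zero (hF : Fintype.card F = p ^ m) : radDim p l (0 : F × F) = m := by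
  have h1 := card_doRadical_eq (p := p) (l := l) (0 : F × F)
  have h2 : (univ.filter fun x : F => doRadical p l (0 : F × F).1 (0 : F × F).2 x = 0) = univ := by
    ext x
    simp [doRadical, (Fact.out : p.Prime).ne_zero]
  rw [h2, Finset.card_univ, hF] at h1
  exact (Nat.pow_right_injective (Fact.out : p.Prime).two_le h1).symm

theorem exists_radDim_eq (hp : p ≠ 2) (hF : Fintype.card F = p ^ m) (hl : 0 < l) {w : F × F}
    (hw : w ≠ 0) : ∃ j, j ≤ 3 ∧ radDim p l w = m.gcd (2 * l) * j ∧
      (m.gcd (2 * l) = m.gcd l → j ≤ 2) := by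
  have hp' : p.Prime := Fact.out
  obtain ⟨j, h1, h2, h3⟩ := exists_card_doRadical (a := w.1) (b := w.2) (hp'.odd_of_ne_two hp) hF hl
    (fun h => hw (Prod.ext h.1 h.2))
  rw [card_doRadical_eq] at h2
  exact ⟨j, h1, Nat.pow_right_injective hp'.two_le h2, h3⟩

/-- The zero pair has radical dimension `m`; the condition `e * k < m` keeps it out of every fibre
in the sum. -/
theorem sum_eq_of_radDim (hF : Fintype.card F = p ^ m) {M : Type*} [AddCommMonoid M] {e k : ℕ}
    (he : 0 < e) (hek : e * k < m)
    (hr : ∀ w : F × F, w ≠ 0 → ∃ j, j ≤ k ∧ radDim p l w = e * j) (f : F × F → M) (g : ℕ → M)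
    (hfg : ∀ w : F × F, w ≠ 0 → f w = g (radDim p l w)) :
    ∑ w, f w = f 0 + ∑ j ∈ range (k + 1),
      (univ.filter fun w : F × F => radDim p l w = e * j).card • g (e * j) := by
  classical
  rw [← Finset.add_sum_erase univ f (mem_univ 0)]
  congr 1
  rw [← Finset.sum_fiberwise_of_maps_to (t := range (k + 1)) (g := fun w => radDim p l w / e)]
  · refine Finset.sum_congr rfl fun j hj => ?_
    have hjk : j ≤ k := Nat.lt_succ_iff.1 (mem_range.1 hj)
    have hset : ((univ.erase (0 : F × F)).filter fun w => radDim p l w / e = j) =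
        univ.filter fun w : F × F => radDim p l w = e * j := by
      ext w
      simp only [mem_filter, mem_erase, mem_univ, true_and, and_true]
      constructor
      · rintro ⟨hw, h⟩
        obtain ⟨j', -, h'⟩ := hr w hw
        rw [h', Nat.mul_div_cancel_left _ he] at h
        rw [h', h]
      · intro h
        refine ⟨?_, by rw [h, Nat.mul_div_cancel_left _ he]⟩
        rintro rfl
        rw [radDim_zero hF] at h
        have := Nat.mul_le_mul_left e hjk
        omega
    rw [hset, ← Finset.sum_const]
    refine Finset.sum_congr rfl fun w hw => ?_
    have hw' : w ≠ 0 := by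
      rw [← hset] at hw
      exact Finset.ne_of_mem_erase (mem_filter.1 hw).1
    rw [hfg w hw', (mem_filter.1 hw).2]
  · intro w hw
    obtain ⟨j, hj, h⟩ := hr w (Finset.ne_of_mem_erase hw)
    rw [h, Nat.mul_div_cancel_left _ he]
    exact mem_range.2 (Nat.lt_succ_of_le hj)

theorem quadExpSum_mul_conj_doFormZMod (hp : p ≠ 2) (hF : Fintype.card F = p ^ m)
    {ψ : AddChar (ZMod p) ℂ} (hψ : ψ ≠ 0) (w : F × F) :
    quadExpSum ψ (doFormZMod (p := p) l w.1 w.2) *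
      conj (quadExpSum ψ (doFormZMod (p := p) l w.1 w.2)) = (p : ℂ) ^ m * p ^ radDim p l w := by
  have h2 : (2 : ZMod p) ≠ 0 := Ring.two_ne_zero (by rwa [ZMod.ringChar_zmod_n])
  rw [quadExpSum_mul_conj h2 ψ hψ, card_ker_eq_pow_radDim, hF]
  push_cast
  rfl

/-- The modulus of the exponential sum determines the size of the radical. -/
theorem radDim_mul_eq (hp : p ≠ 2) (hF : Fintype.card F = p ^ m) {ψ : AddChar (ZMod p) ℂ}
    (hψ : ψ ≠ 0) {w w' : F × F} {z : ℂ} (hz : z * conj z = 1)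
    (h : quadExpSum ψ (doFormZMod (p := p) l w'.1 w'.2) =
      z * quadExpSum ψ (doFormZMod (p := p) l w.1 w.2)) : radDim p l w' = radDim p l w := by
  have h1 := quadExpSum_mul_conj_doFormZMod (l := l) hp hF hψ w'
  rw [h, map_mul, mul_mul_mul_comm, hz, one_mul, quadExpSum_mul_conj_doFormZMod hp hF hψ,
    ← pow_add, ← pow_add] at h1
  have h2 : p ^ (m + radDim p l w) = p ^ (m + radDim p l w') := by exact_mod_cast h1
  have := Nat.pow_right_injective (Fact.out : p.Prime).two_le h2
  omega

theorem card_amplitude_add_card_amplitude (hp : p ≠ 2) (hF : Fintype.card F = p ^ m) (R : ℕ) :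
    (univ.filter fun w : F × F => amplitude p l w = p ^ R).card +
      (univ.filter fun w : F × F => amplitude p l w = - p ^ R).card =
      (univ.filter fun w : F × F => m + radDim p l w = 2 * R).card := by
  have hp' : p.Prime := Fact.out
  have hpR : (p : ℤ) ^ R ≠ 0 := pow_ne_zero _ (by exact_mod_cast hp'.ne_zero)
  rw [← Finset.card_union_of_disjoint]
  · congr 1
    ext w
    simp only [mem_union, mem_filter, mem_univ, true_and]
    constructor
    · rintro (h | h)
      · exact (amplitude_eq_iff_of_even hp hF (S := 1) (by norm_num) (by rw [h, one_mul])).2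
      · exact (amplitude_eq_iff_of_even hp hF (S := -1) (by norm_num) (by rw [h, neg_mul, one_mul])).2
    · intro h
      have h1 := (amplitude_of_even hp hF (w := w) (l := l) ⟨R, by omega⟩).1
      rw [h, mul_comm, pow_mul] at h1
      exact sq_eq_sq_iff_eq_or_eq_neg.1 h1
  · rw [Finset.disjoint_filter]
    intro w _ h h'
    rw [h] at h'
    exact hpR (by linarith)

theorem doFormZMod_zero_eq_zero : doFormZMod (p := p) l (0 : F) 0 = 0 := by
  ext x
  rw [doFormZMod_apply]
  simp

theorem quadExpSum_doFormZMod_zero (hF : Fintype.card F = p ^ m) (ψ : AddChar (ZMod p) ℂ) :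
    quadExpSum ψ (doFormZMod (p := p) l (0 : F) 0) = (p : ℂ) ^ m := by
  rw [doFormZMod_zero_eq_zero, quadExpSum]
  simp [hF]

theorem exists_radDim_eq_of_odd (hp : p ≠ 2) (hF : Fintype.card F = p ^ m) (hl : 0 < l)
    (hg : m.gcd (2 * l) = m.gcd l) {d : ℕ} (hd : d = m.gcd l) {w : F × F} (hw : w ≠ 0) :
    ∃ j, j ≤ 2 ∧ radDim p l w = d * j := by
  obtain ⟨j, -, h, h2⟩ := exists_radDim_eq hp hF hl hw
  exact ⟨j, h2 hg, by rw [h, hg, hd]⟩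

/-- The distribution of the dimension of the radical, for `m / d` odd. -/
theorem card_radDim_of_odd (hp : p ≠ 2) (hF : Fintype.card F = p ^ m) (hl : 0 < l)
    (hg : m.gcd (2 * l) = m.gcd l) {d n : ℕ} (hd : d = m.gcd l) (hmn : m = d * n) (hn : Odd n)
    (hn3 : 3 ≤ n) {N : ℕ → ℚ}
    (hN : ∀ j, N j = (univ.filter fun w : F × F => radDim p l w = d * j).card) :
    N 0 + N 1 + N 2 = (p ^ m : ℚ) ^ 2 - 1 ∧ N 1 * p ^ d = p ^ m * (p ^ m - 1) ∧
      N 2 * ((p ^ d) ^ 2 - 1) = N 1 - (p ^ m - 1) := by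
  have hp' : p.Prime := Fact.out
  have hpC : (p : ℂ) ≠ 0 := by exact_mod_cast hp'.ne_zero
  have hd0 : 0 < d := hd ▸ Nat.gcd_pos_of_pos_right _ hl
  have h2d : d * 2 < m := by rw [hmn]; exact Nat.mul_lt_mul_of_pos_left (by omega) hd0
  have hr := fun (w : F × F) (hw : w ≠ 0) => exists_radDim_eq_of_odd hp hF hl hg hd hw
  obtain ⟨ψ, hψ⟩ := exists_addChar_zmod_ne_zero p
  have h2 : (2 : F) ≠ 0 := Ring.two_ne_zero (by rwa [ringChar.eq F p])
  have hcF : (Fintype.card F : ℂ) = p ^ m := by rw [hF]; push_cast; rfl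
  have hq1 : ((p ^ m - 1 : ℕ) : ℂ) = p ^ m - 1 := by
    rw [Nat.cast_sub (Nat.one_le_pow _ _ hp'.pos)]
    push_cast
    rfl
  have hNC : ∀ j, ((N j : ℚ) : ℂ) = (univ.filter fun w : F × F => radDim p l w = d * j).card := by
    intro j
    rw [hN]
    push_cast
    rfl
  have e0 := sum_eq_of_radDim hF hd0 h2d hr (fun _ => (1 : ℂ)) (fun _ => 1) (fun _ _ => rfl)
  simp only [Finset.sum_range_succ, Finset.sum_range_zero, nsmul_eq_mul, ← hNC, Finset.sum_const,
    Finset.card_univ, Fintype.card_prod, mul_one, zero_add, Nat.cast_mul, hcF] at e0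
  -- The second moment counts `N 0 + N 1 y + N 2 y²` with `y = p^d`. The moment twisted by a
  -- nonsquare gives the same sum with the signs `-1, +1, -1`, since `n` is odd. With the total
  -- count, these are three equations for three unknowns.
  have e1 := sum_quadExpSum_mul_conj (l := l) (F := F) hψ 1
  simp only [one_mul] at e1
  rw [card_doPair_eq_mul, card_doPair_eq_one_of_odd h2 hF hl hg, hF,
    sum_eq_of_radDim hF hd0 h2d hr _ (fun r => (p : ℂ) ^ m * p ^ r)
      (fun w _ => quadExpSum_mul_conj_doFormZMod hp hF hψ w),
    quadExpSum_mul_conj_doFormZMod hp hF hψ, radDim_zero hF] at e1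
  simp only [Finset.sum_range_succ, Finset.sum_range_zero, nsmul_eq_mul, ← hNC, zero_add,
    Nat.cast_add, Nat.cast_mul, hq1, Nat.cast_pow, pow_zero, mul_one, pow_mul,
    Nat.cast_one, Nat.cast_ofNat, pow_one] at e1
  obtain ⟨c, -, hc, htw⟩ := exists_nonsquare_twist hp hF hl (hd ▸ hmn) hψ
  have e2 := sum_quadExpSum_mul_conj (l := l) (F := F) hψ c
  have htw' : ∀ w : F × F, w ≠ 0 → quadExpSum ψ (doFormZMod (p := p) l w.1 w.2) *
      conj (quadExpSum ψ (doFormZMod (p := p) l (c * w.1) (c * w.2))) =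
      (-1) ^ (n + radDim p l w / d) * ((p : ℂ) ^ m * p ^ radDim p l w) := by
    intro w hw
    obtain ⟨j, -, hj⟩ := hr w hw
    rw [htw w.1 w.2 j (by rw [card_doRadical_eq w, hj, hd]), map_mul, mul_left_comm,
      quadExpSum_mul_conj_doFormZMod hp hF hψ, hj, Nat.mul_div_cancel_left _ hd0, map_pow, map_neg,
      map_one]
  rw [card_doPair_eq_mul, card_doPair_eq_nonsquare_of_odd hF hl hg hc, hF,
    sum_eq_of_radDim hF hd0 h2d hr _ (fun r => (-1) ^ (n + r / d) * ((p : ℂ) ^ m * p ^ r)) htw'] at e2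
  simp only [Prod.fst_zero, Prod.snd_zero, mul_zero, quadExpSum_doFormZMod_zero hF, map_pow,
    Complex.conj_natCast, Finset.sum_range_succ, Finset.sum_range_zero, nsmul_eq_mul, ← hNC, zero_add,
    Nat.mul_div_cancel_left _ hd0, pow_add (-1 : ℂ), hn.neg_one_pow, pow_zero, pow_one, add_zero,
    mul_one, Nat.cast_one, pow_mul, Nat.cast_pow] at e2
  norm_num at e2
  have hm0 : (p : ℂ) ^ m ≠ 0 := pow_ne_zero _ hpC
  have f0 : (N 0 : ℂ) + N 1 + N 2 = (p ^ m) ^ 2 - 1 := by linear_combination -e0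
  have f1 : (N 0 : ℂ) + N 1 * p ^ d + N 2 * (p ^ d) ^ 2 = 2 * p ^ m * (p ^ m - 1) := by
    refine mul_left_cancel₀ hm0 ?_
    linear_combination e1
  have f2 : -(N 0 : ℂ) + N 1 * p ^ d - N 2 * (p ^ d) ^ 2 = 0 := by
    refine mul_left_cancel₀ hm0 ?_
    linear_combination e2
  have g0 : N 0 + N 1 + N 2 = (p ^ m : ℚ) ^ 2 - 1 := by exact_mod_cast f0
  have g1 : N 0 + N 1 * p ^ d + N 2 * (p ^ d) ^ 2 = 2 * p ^ m * ((p : ℚ) ^ m - 1) := by exact_mod_cast f1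
  have g2 : -N 0 + N 1 * p ^ d - N 2 * ((p : ℚ) ^ d) ^ 2 = 0 := by exact_mod_cast f2
  refine ⟨g0, ?_, ?_⟩ <;> linarith

/-- Multiplication by a suitable scalar changes the sign of the exponential sums of the forms
of odd rank over the fixed field. -/
theorem exists_flip (hp : p ≠ 2) (hF : Fintype.card F = p ^ m) (hl : 0 < l)
    {d n : ℕ} (hd : d = m.gcd l) (hmn : m = d * n) (hn : Odd n)
    {ψ : AddChar (ZMod p) ℂ} (hψ : ψ ≠ 0) :
    ∃ e : Equiv.Perm (F × F), ∀ (w : F × F) (j : ℕ), radDim p l w = d * (2 * j) →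
      radDim p l (e w) = d * (2 * j) ∧
      quadExpSum ψ (doFormZMod (p := p) l (e w).1 (e w).2) =
        - quadExpSum ψ (doFormZMod (p := p) l w.1 w.2) := by
  obtain ⟨c, hc0, hc, htw⟩ := exists_nonsquare_twist hp hF hl (hd ▸ hmn) hψ
  refine ⟨(Equiv.mulLeft₀ c hc0).prodCongr (Equiv.mulLeft₀ c hc0), fun w j hj => ?_⟩
  have h1 : quadExpSum ψ (doFormZMod (p := p) l (c * w.1) (c * w.2)) =
      (-1) * quadExpSum ψ (doFormZMod (p := p) l w.1 w.2) := by
    -- The rank over the fixed field is `n - 2j`, which is odd, so the twist contributes the sign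
    -- `-1`.
    rw [htw w.1 w.2 (2 * j) (by rw [card_doRadical_eq w, hj, hd]),
      (hn.add_even (even_two_mul j)).neg_one_pow]
  refine ⟨?_, by rw [← neg_one_mul]; exact h1⟩
  rw [← hj]
  exact radDim_mul_eq hp hF hψ (z := -1) (by simp) h1

/-- For `m / d` odd, the signs are balanced for the forms of odd rank over the fixed field. -/
theorem card_amplitude_eq_card_amplitude_neg (hp : p ≠ 2) (hF : Fintype.card F = p ^ m) (hl : 0 < l)
    {d n : ℕ} (hd : d = m.gcd l) (hmn : m = d * n) (hn : Odd n) {R j : ℕ}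
    (hR : m + d * (2 * j) = 2 * R) :
    (univ.filter fun w : F × F => amplitude p l w = p ^ R).card =
      (univ.filter fun w : F × F => amplitude p l w = - p ^ R).card := by
  obtain ⟨ψ, hψ⟩ := exists_addChar_zmod_ne_zero p
  obtain ⟨e, he⟩ := exists_flip hp hF hl hd hmn hn hψ
  have key : ∀ (w : F × F) (S : ℤ), S ^ 2 = 1 → amplitude p l w = S * p ^ R →
      amplitude p l (e w) = - S * p ^ R := by
    intro w S hS h
    obtain ⟨h1, h2⟩ := amplitude_eq_iff_of_even hp hF hS h
    obtain ⟨h3, h4⟩ := he w j (by omega)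
    obtain ⟨-, -, h5⟩ := amplitude_of_even hp hF h1
    obtain ⟨-, -, h6⟩ := amplitude_of_even (l := l) hp hF (w := e w) (by rw [h3, hR]; exact even_two_mul R)
    rw [h5 ψ hψ, h6 ψ hψ] at h4
    have h7 : amplitude p l (e w) = - amplitude p l w := by exact_mod_cast h4
    rw [h7, h, neg_mul]
  refine le_antisymm ?_ ?_
  · refine Finset.card_le_card_of_injOn e ?_ e.injective.injOn
    intro w hw
    simp only [coe_filter, mem_univ, true_and, Set.mem_ofPred_eq] at hw ⊢
    rw [key w 1 (by norm_num) (by rw [hw, one_mul]), neg_mul, one_mul]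
  · refine Finset.card_le_card_of_injOn e ?_ e.injective.injOn
    intro w hw
    simp only [coe_filter, mem_univ, true_and, Set.mem_ofPred_eq] at hw ⊢
    rw [key w (-1) (by norm_num) (by rw [hw, neg_mul, one_mul]), neg_neg, one_mul]

/-- For `m / d` odd, the difference of the numbers of forms of even rank over the fixed field with
positive and with negative exponential sum. -/
theorem card_amplitude_sub_card_amplitude (hp : p ≠ 2) (hF : Fintype.card F = p ^ m) (hl : 0 < l)
    (hg : m.gcd (2 * l) = m.gcd l) {d n : ℕ} (hd : d = m.gcd l) (hmn : m = d * n) (hn : Odd n)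
    (hn3 : 3 ≤ n) {R : ℕ} (hR : m + d = 2 * R) :
    ((univ.filter fun w : F × F => amplitude p l w = p ^ R).card -
      (univ.filter fun w : F × F => amplitude p l w = - p ^ R).card : ℚ) * p ^ R =
      p ^ m * (p ^ m - 1) := by
  classical
  have hp' : p.Prime := Fact.out
  have hd0 : 0 < d := hd ▸ Nat.gcd_pos_of_pos_right _ hl
  have h2d : d * 2 < m := by rw [hmn]; exact Nat.mul_lt_mul_of_pos_left (by omega) hd0
  obtain ⟨ψ, hψ⟩ := exists_addChar_zmod_ne_zero p
  obtain ⟨e, he⟩ := exists_flip hp hF hl hd hmn hn hψ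
  set T : F × F → ℂ := fun w => quadExpSum ψ (doFormZMod (p := p) l w.1 w.2) with hT
  have hpR : (p : ℤ) ^ R ≠ 0 := pow_ne_zero _ (by exact_mod_cast hp'.ne_zero)
  -- The twist permutes the forms with this radical dimension and negates their sums, so together
  -- they contribute nothing to the first moment. Only the zero form and the forms with radical
  -- dimension `d` remain.
  have h0 : ∀ j, ∑ w, (if radDim p l w = d * (2 * j) then T w else 0) = 0 := by
    intro j
    set S := univ.filter fun w : F × F => radDim p l w = d * (2 * j) with hS
    have hmap : S.map e.toEmbedding = S := by
      refine Finset.eq_of_subset_of_card_le (fun w hw => ?_) (Finset.card_map _).ge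
      obtain ⟨w', hw', rfl⟩ := Finset.mem_map.1 hw
      exact mem_filter.2 ⟨mem_univ _, (he w' j (mem_filter.1 hw').2).1⟩
    have h1 : ∑ w ∈ S, T w = - ∑ w ∈ S, T w := by
      rw [← Finset.sum_neg_distrib]
      conv_lhs => rw [← hmap, Finset.sum_map]
      exact Finset.sum_congr rfl fun w hw => (he w j (mem_filter.1 hw).2).2
    rw [← Finset.sum_filter]
    exact self_eq_neg.1 h1
  have h1 : ∀ w, T w = (if w = 0 then (p : ℂ) ^ m else 0) +
      (if radDim p l w = d * (2 * 0) then T w else 0) +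
      (if radDim p l w = d * (2 * 1) then T w else 0) +
      (((if amplitude p l w = p ^ R then 1 else 0) - if amplitude p l w = - p ^ R then 1 else 0) * p ^ R) := by
    intro w
    have hamp : ∀ S : ℤ, S ^ 2 = 1 → radDim p l w ≠ d → amplitude p l w ≠ S * p ^ R := by
      intro S hS h h'
      have := (amplitude_eq_iff_of_even hp hF hS h').2
      omega
    have hamp1 : radDim p l w ≠ d → amplitude p l w ≠ p ^ R := fun h => by
      rw [← one_mul ((p : ℤ) ^ R)]; exact hamp 1 (by norm_num) h
    have hamp2 : radDim p l w ≠ d → amplitude p l w ≠ - p ^ R := fun h => by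
      rw [← neg_one_mul ((p : ℤ) ^ R)]; exact hamp (-1) (by norm_num) h
    by_cases hw : w = 0
    · have hr : radDim p l w = m := by rw [hw, radDim_zero hF]
      rw [if_pos hw, if_neg (by omega), if_neg (by omega), if_neg (hamp1 (by omega)),
        if_neg (hamp2 (by omega)), hw]
      simp only [hT, Prod.fst_zero, Prod.snd_zero, quadExpSum_doFormZMod_zero hF]
      ring
    rw [if_neg hw]
    obtain ⟨j, hj, hr⟩ := exists_radDim_eq_of_odd hp hF hl hg hd hw
    rcases (show j = 0 ∨ j = 1 ∨ j = 2 by omega) with rfl | rfl | rfl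
    · rw [if_pos (by omega), if_neg (by omega), if_neg (hamp1 (by omega)), if_neg (hamp2 (by omega))]
      ring
    · rw [if_neg (by omega), if_neg (by omega)]
      obtain ⟨h3, -, h4⟩ := amplitude_of_even (l := l) hp hF (w := w) ⟨R, by omega⟩
      rw [show m + radDim p l w = R * 2 by omega, pow_mul] at h3
      have hne : ¬ ((p : ℤ) ^ R = - p ^ R) := fun h => hpR (by linarith)
      have hne' : ¬ (-(p : ℤ) ^ R = p ^ R) := fun h => hpR (by linarith)
      simp only [hT, h4 ψ hψ]
      rcases sq_eq_sq_iff_eq_or_eq_neg.1 h3 with h | h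
      · rw [h, if_pos rfl, if_neg hne]; push_cast; ring
      · rw [h, if_pos rfl, if_neg hne']; push_cast; ring
    · rw [if_neg (by omega), if_pos (by omega), if_neg (hamp1 (by omega)), if_neg (hamp2 (by omega))]
      ring
  have h2 := sum_quadExpSum (l := l) (F := F) hψ
  change ∑ w, T w = _ at h2
  rw [Finset.sum_congr rfl fun w _ => h1 w, Finset.sum_add_distrib, Finset.sum_add_distrib,
    Finset.sum_add_distrib, h0, h0, ← Finset.sum_mul, Finset.sum_sub_distrib, Finset.sum_boole,
    Finset.sum_boole, Finset.sum_ite_eq' univ (0 : F × F), if_pos (mem_univ _), hF] at h2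
  have h3 : ((univ.filter fun w : F × F => amplitude p l w = p ^ R).card -
      (univ.filter fun w : F × F => amplitude p l w = - p ^ R).card : ℂ) * p ^ R =
      p ^ m * (p ^ m - 1) := by
    push_cast at h2
    linear_combination h2
  exact_mod_cast h3

end Distribution

/-! ### Radical dimensions and signs when `m / d` is even. -/

section EvenDistribution

variable {F : Type*} [Field F] [Fintype F] [DecidableEq F] {p m l : ℕ} [Fact p.Prime]
  [Algebra (ZMod p) F] [CharP F p]

/-- The level sets of a function of `x^N` off the origin are unions of cosets of the `N`-th roots
of unity. -/
theorem card_nthRoots_dvd_levelCard {K : Type*} [DecidableEq K] (f : F → K) (t : K) (N : ℕ)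
    (h0 : f 0 ≠ t) (hf : ∀ x u : F, u ^ N = 1 → f (x * u) = f x) :
    (univ.filter fun u : F => u ^ N = 1).card ∣ levelCard f t := by
  rw [levelCard, Finset.card_eq_sum_card_image (fun x => x ^ N) (univ.filter fun x => f x = t)]
  apply Finset.dvd_sum
  intro c hc
  obtain ⟨x₀, hx₀, rfl⟩ := Finset.mem_image.1 hc
  have hfx : f x₀ = t := (mem_filter.1 hx₀).2
  have hx0 : x₀ ≠ 0 := by
    rintro rfl
    exact h0 hfx
  refine dvd_of_eq (Finset.card_bij (fun u _ => x₀ * u) ?_ ?_ ?_)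
  · intro u hu
    have hu' := (mem_filter.1 hu).2
    simp only [mem_filter, mem_univ, true_and]
    exact ⟨by rw [hf _ _ hu', hfx], by rw [mul_pow, hu', mul_one]⟩
  · intro u _ v _ h
    exact mul_left_cancel₀ hx0 h
  · intro x hx
    have hx' : x ^ N = x₀ ^ N := (mem_filter.1 hx).2
    refine ⟨x₀⁻¹ * x, mem_filter.2 ⟨mem_univ _, ?_⟩, mul_inv_cancel_left₀ hx0 x⟩
    rw [mul_pow, hx', inv_pow, inv_mul_cancel₀ (pow_ne_zero _ hx0)]

theorem doPair_mul_of_pow_eq_one {d k : ℕ} (hk : l = d + 2 * d * k) (x : F) {u : F}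
    (hu : u ^ (p ^ d + 1) = 1) : doPair p l (x * u) = doPair p l x := by
  have h1 : ∀ j, u ^ (p ^ (d * (2 * j + 1)) + 1) = 1 := by
    intro j
    have h2 : p ^ d + 1 ∣ p ^ (d * (2 * j + 1)) + 1 := by
      have := (odd_two_mul_add_one j).nat_add_dvd_pow_add_pow (p ^ d) 1
      rwa [one_pow, ← pow_mul] at this
    obtain ⟨r, hr⟩ := h2
    rw [hr, pow_mul, hu, one_pow]
  have h2 : doPair p l u = 1 := by
    rw [doPair, ← pow_succ, ← pow_succ]
    have e1 : 3 * l = d * (2 * (3 * k + 1) + 1) := by rw [hk]; ring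
    have e2 : l = d * (2 * k + 1) := by rw [hk]; ring
    rw [e1, h1, e2, h1]
    rfl
  rw [doPair_mul, h2, mul_one]

theorem exists_radDim_eq_of_even (hp : p ≠ 2) (hF : Fintype.card F = p ^ m) (hl : 0 < l) {d : ℕ}
    (hg : m.gcd (2 * l) = 2 * d) {w : F × F} (hw : w ≠ 0) :
    ∃ j, j ≤ 3 ∧ radDim p l w = 2 * d * j := by
  obtain ⟨j, h1, h, -⟩ := exists_radDim_eq hp hF hl hw
  exact ⟨j, h1, by rw [h, hg]⟩

/-- For `m / d` even, the exponential sum is determined by the dimension of the radical. -/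
theorem amplitude_eq_of_even (hp : p ≠ 2) (hF : Fintype.card F = p ^ m) (hm : 0 < m) (hl : 0 < l)
    {d n j : ℕ} (hd : d = m.gcd l) (hg : m.gcd (2 * l) = 2 * d) (hmn : m = 2 * (d * n))
    {w : F × F} (hw : radDim p l w = 2 * d * j) :
    amplitude p l w = (-1) ^ n * (-1) ^ j * p ^ (d * n + d * j) := by
  have hp' : p.Prime := Fact.out
  have hd0 : 0 < d := hd ▸ Nat.gcd_pos_of_pos_right _ hl
  have he : m + radDim p l w = (d * n + d * j) * 2 := by rw [hw, hmn]; ring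
  obtain ⟨hA, hZ, -⟩ := amplitude_of_even (l := l) hp hF (w := w) ⟨d * n + d * j, by rw [he]; ring⟩
  rw [he, pow_mul] at hA
  obtain ⟨k, hk⟩ := odd_div_of_gcd_eq hm hd hg
  have h2dm : 2 * d ∣ m := hg ▸ Nat.gcd_dvd_left _ _
  -- Both monomials are invariant under multiplication by `(p^d + 1)`-th roots of unity, since `l`
  -- and `3l` are odd multiples of `d`. So `y + 1` divides the size of the level 1, and the
  -- amplitude is congruent to `p^m`, hence to 1, modulo `y + 1`.
  have hdvd := card_nthRoots_dvd_levelCard (doFormZMod (p := p) l w.1 w.2) 1 (p ^ d + 1)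
    (by rw [doFormZMod_apply]; simp [doPair, hp'.ne_zero])
    (fun x u hu => by rw [doFormZMod_apply, doFormZMod_apply, doPair_mul_of_pow_eq_one hk x hu])
  rw [card_pow_succ_eq hF hd0 h2dm one_ne_zero (one_pow _)] at hdvd
  have hdvd' : ((p : ℤ) ^ d + 1) ∣ levelCard (doFormZMod (p := p) l w.1 w.2) 1 := by
    exact_mod_cast Int.natCast_dvd_natCast.2 hdvd
  set y : ℤ := (p : ℤ) ^ d with hy
  have hym : y ≡ -1 [ZMOD (y + 1)] := (Int.modEq_iff_dvd.2 ⟨-1, by ring⟩)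
  have h1 := hZ 1
  rw [if_neg one_ne_zero, neg_mul, one_mul] at h1
  have h2 : amplitude p l w ≡ 1 [ZMOD (y + 1)] := by
    have e1 : (p : ℤ) ^ m ≡ 1 [ZMOD (y + 1)] := by
      have : (p : ℤ) ^ m = y ^ (2 * n) := by rw [hy, ← pow_mul, hmn]; ring_nf
      rw [this]
      have h3 := hym.pow (2 * n)
      rwa [(even_two_mul n).neg_one_pow] at h3
    have e2 : amplitude p l w ≡ p ^ m [ZMOD (y + 1)] := by
      rw [Int.modEq_iff_dvd]
      have : (p : ℤ) ^ m - amplitude p l w = p * levelCard (doFormZMod (p := p) l w.1 w.2) 1 := by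
        rw [h1]; ring
      rw [this]
      exact hdvd'.mul_left _
    exact e2.trans e1
  have h3 : (p : ℤ) ^ (d * n + d * j) ≡ (-1) ^ n * (-1) ^ j [ZMOD (y + 1)] := by
    rw [← pow_add, ← mul_add, pow_mul]
    exact hym.pow _
  have h4 : ((-1) ^ n * (-1) ^ j : ℤ) * ((-1) ^ n * (-1) ^ j) = 1 := by
    rw [← pow_add, ← mul_pow]; norm_num
  have h5 : (-1) ^ n * (-1) ^ j * (p : ℤ) ^ (d * n + d * j) ≡ 1 [ZMOD (y + 1)] := by
    have := h3.mul_left ((-1) ^ n * (-1) ^ j)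
    rwa [h4] at this
  have hA' : amplitude p l w ^ 2 = ((-1) ^ n * (-1) ^ j * (p : ℤ) ^ (d * n + d * j)) ^ 2 := by
    rw [hA, mul_pow _ ((p : ℤ) ^ _), sq ((-1) ^ n * (-1) ^ j), h4, one_mul]
  rcases sq_eq_sq_iff_eq_or_eq_neg.1 hA' with h | h
  · exact h
  -- The wrong sign would give `1 ≡ -1` modulo `y + 1`, although `y + 1 ≥ 4`.
  · exfalso
    rw [h] at h2
    have h6 := h2.symm.trans h5.neg
    rw [Int.modEq_iff_dvd] at h6
    have h7 := Int.le_of_dvd (by norm_num) (show y + 1 ∣ 2 by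
      have := h6.neg_right; norm_num at this; exact this)
    have h8 : (p : ℤ) ≤ y := by
      rw [hy]; exact_mod_cast Nat.le_self_pow hd0.ne' p
    have h9 : (3 : ℤ) ≤ p := by
      have := hp'.two_le
      omega
    linarith

/-- The power moments of the distribution of the dimension of the radical, for `m / d` even. -/
theorem card_radDim_of_even (hp : p ≠ 2) (hF : Fintype.card F = p ^ m) (hl : 0 < l)
    {d n : ℕ} (hd : d = m.gcd l) (hg : m.gcd (2 * l) = 2 * d) (hmn : m = 2 * (d * n)) (hn : 4 ≤ n)
    {N : ℕ → ℚ} (hN : ∀ j, N j = (univ.filter fun w : F × F => radDim p l w = 2 * d * j).card)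
    {M y : ℚ} (hM : M = (-1) ^ n * p ^ (d * n)) (hy : y = p ^ d) :
    N 0 + N 1 + N 2 + N 3 = M ^ 4 - 1 ∧
    N 0 - y * N 1 + y ^ 2 * N 2 - y ^ 3 * N 3 = M ^ 3 - M ∧
    N 0 + y ^ 2 * N 1 + y ^ 4 * N 2 + y ^ 6 * N 3 = M ^ 2 * (M ^ 2 - 1) * (y + 1) ∧
    N 0 - y ^ 3 * N 1 + y ^ 6 * N 2 - y ^ 9 * N 3 = M * (M ^ 2 - 1) * y ^ 3 := by
  have hp' : p.Prime := Fact.out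
  have hpQ : (p : ℚ) ≠ 0 := by exact_mod_cast hp'.ne_zero
  have hd0 : 0 < d := hd ▸ Nat.gcd_pos_of_pos_right _ hl
  have h6d : 2 * d * 3 < m := by
    have := Nat.mul_le_mul_left d hn
    omega
  have hm : 0 < m := by omega
  have hr := fun (w : F × F) (hw : w ≠ 0) => exists_radDim_eq_of_even hp hF hl hg hw
  obtain ⟨ψ, hψ⟩ := exists_addChar_zmod_ne_zero p
  have hM0 : M ≠ 0 := by
    rw [hM]; exact mul_ne_zero (pow_ne_zero _ (by norm_num)) (pow_ne_zero _ hpQ)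
  have hM2 : M ^ 2 = p ^ m := by
    rw [hM, mul_pow, ← pow_mul, ← pow_mul, mul_comm n, (even_two_mul n).neg_one_pow, one_mul, hmn,
      mul_comm 2]
  have hcF : (Fintype.card F : ℂ) = ((M ^ 2 : ℚ) : ℂ) := by rw [hF, hM2]; push_cast; rfl
  have hq1 : ((Fintype.card F - 1 : ℕ) : ℂ) = ((M ^ 2 - 1 : ℚ) : ℂ) := by
    rw [hM2, hF, Nat.cast_sub (Nat.one_le_pow _ _ hp'.pos)]
    push_cast
    rfl
  have hNC : ∀ j, (((univ.filter fun w : F × F => radDim p l w = 2 * d * j).card : ℕ) : ℂ) =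
      ((N j : ℚ) : ℂ) := by
    intro j
    rw [hN]
    push_cast
    rfl
  have hyC : (p : ℂ) ^ d = ((y : ℚ) : ℂ) := by rw [hy]; push_cast; rfl
  -- With the sign known, every sum is `M (-y)^j`, so the moments of order 0 to 3 become power sums
  -- in the nodes `(-y)^j`. The zero pair contributes the powers of `M²`, which are separated off
  -- before dividing by a power of `M`.
  have hT : ∀ w : F × F, w ≠ 0 → quadExpSum ψ (doFormZMod (p := p) l w.1 w.2) =
      ((M * (-y) ^ (radDim p l w / (2 * d)) : ℚ) : ℂ) := by
    intro w hw
    obtain ⟨j, -, hj⟩ := hr w hw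
    obtain ⟨-, -, h⟩ := amplitude_of_even (l := l) hp hF (w := w) ⟨d * n + d * j, by rw [hj, hmn]; ring⟩
    rw [h ψ hψ, amplitude_eq_of_even hp hF hm hl hd hg hmn hj, hj,
      Nat.mul_div_cancel_left _ (by omega), hM, hy, neg_pow ((p : ℚ) ^ d) j, ← pow_mul]
    push_cast
    ring
  have hT0 : quadExpSum ψ (doFormZMod (p := p) l (0 : F × F).1 (0 : F × F).2) =
      ((M ^ 2 : ℚ) : ℂ) := by
    rw [Prod.fst_zero, Prod.snd_zero, quadExpSum_doFormZMod_zero hF, hM2]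
    push_cast
    rfl
  have hneg : (univ.filter fun t : F => doPair p l t = (-1, -1)).card = p ^ d + 1 :=
    card_doPair_eq_of_even hF hm hl hd hg (neg_ne_zero.2 one_ne_zero)
      (((hp'.odd_of_ne_two hp).pow).neg_one_pow)
  have hthree : (((univ.filter fun w : F × F => doPair p l w.1 + doPair p l w.2 = (-1, -1)).card : ℕ) : ℂ) =
      ((y ^ 3 - y : ℚ) : ℂ) := by
    have := congrArg (Int.cast : ℤ → ℂ) (card_doPair_add_doPair_of_even (F := F) hF hm hl hd hg)
    push_cast at this ⊢
    rw [← hyC, ← this]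
  have key := fun k : ℕ => sum_eq_of_radDim (p := p) (l := l) hF (show 0 < 2 * d by omega) h6d hr
    (fun w => quadExpSum ψ (doFormZMod (p := p) l w.1 w.2) ^ k)
    (fun r => ((M * (-y) ^ (r / (2 * d)) : ℚ) : ℂ) ^ k) (fun w hw => by rw [hT w hw])
  simp only [hT0, Finset.sum_range_succ, Finset.sum_range_zero, nsmul_eq_mul, hNC, zero_add,
    Nat.mul_div_cancel_left _ (show 0 < 2 * d by omega)] at key
  have e0 := key 0
  have e1 := key 1
  have e2 := key 2
  have e3 := key 3
  simp only [pow_one] at e1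
  simp only [pow_zero, Finset.sum_const, Finset.card_univ, Fintype.card_prod, nsmul_eq_mul,
    Nat.cast_mul, hcF] at e0
  rw [sum_quadExpSum hψ, hcF] at e1
  rw [sum_quadExpSum_sq hψ, card_doPair_eq_mul, hneg] at e2
  rw [sum_quadExpSum_cube hψ, card_doPair_sum_three, card_doPair_eq_mul, hneg] at e3
  simp only [Nat.cast_add, Nat.cast_mul, Nat.cast_one, hq1, hthree, hcF, Nat.cast_pow, hyC] at e2 e3
  have f0 : M ^ 2 * M ^ 2 * 1 = 1 + (N 0 * 1 + N 1 * 1 + N 2 * 1 + N 3 * 1) := by exact_mod_cast e0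
  have f1 : (M ^ 2) ^ 2 = M ^ 2 + (N 0 * (M * (-y) ^ 0) + N 1 * (M * -y) +
      N 2 * (M * (-y) ^ 2) + N 3 * (M * (-y) ^ 3)) := by exact_mod_cast e1
  have f2 : (M ^ 2) ^ 2 * (1 + (M ^ 2 - 1) * (y + 1)) = (M ^ 2) ^ 2 + (N 0 * (M * (-y) ^ 0) ^ 2 +
      N 1 * (M * (-y) ^ 1) ^ 2 + N 2 * (M * (-y) ^ 2) ^ 2 + N 3 * (M * (-y) ^ 3) ^ 2) := by
    exact_mod_cast e2
  have f3 : (M ^ 2) ^ 2 * (1 + (M ^ 2 - 1) * (y + 1) + (M ^ 2 - 1) * (y ^ 3 - y)) =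
      (M ^ 2) ^ 3 + (N 0 * (M * (-y) ^ 0) ^ 3 +
      N 1 * (M * (-y) ^ 1) ^ 3 + N 2 * (M * (-y) ^ 2) ^ 3 + N 3 * (M * (-y) ^ 3) ^ 3) := by
    exact_mod_cast e3
  refine ⟨by linear_combination -f0, mul_left_cancel₀ hM0 (by linear_combination -f1),
    mul_left_cancel₀ (pow_ne_zero 2 hM0) (by linear_combination -f2),
    mul_left_cancel₀ (pow_ne_zero 3 hM0) (by linear_combination -f3)⟩

end EvenDistribution

/-! ### Designs for each type of weight, given the counts of forms. -/

section WeightFamilies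

variable {F : Type*} [Field F] [Fintype F] [DecidableEq F] {p m l : ℕ} [Fact p.Prime]
  [Algebra (ZMod p) F] [CharP F p]

theorem three_le_of_ne_two (hp : p ≠ 2) : (3 : ℤ) ≤ p := by
  have := (Fact.out : p.Prime).two_le
  omega

theorem abs_mul_pow_le (hp : p ≠ 2) {S : ℤ} (hS : S = 1 ∨ S = -1) {R : ℕ} (hR : R + 1 ≤ m) :
    p * |S * (p : ℤ) ^ R| ≤ p ^ m := by
  have h3 := three_le_of_ne_two hp
  have h1 : |S * (p : ℤ) ^ R| = p ^ R := by
    rw [abs_mul, abs_of_nonneg (show (0 : ℤ) ≤ p ^ R by positivity)]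
    rcases hS with rfl | rfl <;> simp
  rw [h1, ← pow_succ' (p : ℤ)]
  exact pow_le_pow_right₀ (by linarith) hR

theorem nine_mul_le_pow (hp : p ≠ 2) (hm : 3 ≤ m) : 9 * (p : ℤ) ≤ p ^ m := by
  have h3 := three_le_of_ne_two hp
  have h1 : (p : ℤ) ^ 3 ≤ p ^ m := pow_le_pow_right₀ (by linarith) hm
  nlinarith [mul_le_mul h3 h3 (by norm_num) (by linarith)]

/-- The designs of the weights `(p-1)(p^{m-1} - S p^{R-1})`. -/
theorem holdsDesign_sub_one_mul (hp : p ≠ 2) (hF : Fintype.card F = p ^ m) (hm : 3 ≤ m) {Δ : ℤ}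
    (hΔ : ∀ v : (F × F) × (F × ZMod p), v ≠ 0 → excess p l v ≤ Δ)
    {S : ℤ} (hS : S = 1 ∨ S = -1) {R r : ℕ} (hr : 2 * R + r = 2 * m) (hr0 : 2 ≤ r)
    (hmin : (p - 1) * Δ - (p - 2) * ((p - 1) * (S * p ^ R)) < (p - 1) * (p : ℤ) ^ m)
    {A : ℚ} (hA : (univ.filter fun w : F × F => amplitude p l w = S * p ^ R).card = A) (hA0 : 0 < A)
    {i lam : ℚ} (hi : p * i = (p - 1) * (p ^ m - S * p ^ R))
    (hlam : lam * ((p - 1) * (p ^ m * (p ^ m - 1))) = p ^ r * A * (i * (i - 1))) :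
    HoldsDesign (doCode p l F : Set (F → ZMod p)) 2 (p ^ m) i lam := by
  have hp' : p.Prime := Fact.out
  have h3 := three_le_of_ne_two hp
  have hS2 : S ^ 2 = 1 := by rcases hS with rfl | rfl <;> norm_num
  have hcard := card_excess_eq_sub_one_mul (l := l) (F := F) hp hF (by omega) hS2 R
  rw [show 2 * m - 2 * R = r by omega] at hcard
  have habs := abs_mul_pow_le (m := m) (R := R) hp hS (by omega)
  have hle := le_abs_self (S * (p : ℤ) ^ R)
  have hle' := neg_abs_le (S * (p : ℤ) ^ R)
  have h9 := nine_mul_le_pow hp hm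
  have hA' : 0 < (univ.filter fun w : F × F => amplitude p l w = S * p ^ R).card := by
    rw [← hA] at hA0
    exact_mod_cast hA0
  refine holdsDesign_of_excess hF (by omega) hΔ hmin ?_ ?_ hcard
    (Nat.mul_pos (pow_pos hp'.pos _) hA') (by rw [hi]; push_cast; ring) ?_
  · have h0 : 0 < |S * (p : ℤ) ^ R| := by
      refine abs_pos.2 (mul_ne_zero (by rintro rfl; norm_num at hS2) (pow_ne_zero _ ?_))
      linarith
    linarith [mul_nonneg (show (0 : ℤ) ≤ p - 1 by linarith) (show (0 : ℤ) ≤ S * p ^ R + |S * p ^ R| by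
      linarith)]
  · nlinarith
  · push_cast
    rw [hA, ← hlam]
    ring

/-- The designs of the weights `(p-1) p^{m-1} + S p^{R-1}`. -/
theorem holdsDesign_add (hp : p ≠ 2) (hF : Fintype.card F = p ^ m) (hm : 3 ≤ m) {Δ : ℤ}
    (hΔ : ∀ v : (F × F) × (F × ZMod p), v ≠ 0 → excess p l v ≤ Δ)
    {S : ℤ} (hS : S = 1 ∨ S = -1) {R r : ℕ} (hr : 2 * R + r = 2 * m) (hr0 : 2 ≤ r)
    (hmin : (p - 1) * Δ + (p - 2) * (S * p ^ R) < (p - 1) * (p : ℤ) ^ m)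
    {A B : ℚ} (hA : (univ.filter fun w : F × F => amplitude p l w = S * p ^ R).card = A)
    (hB : (univ.filter fun w : F × F => m + radDim p l w + 1 = 2 * R).card = B)
    (hAB : 0 < A + p * B / 2)
    {i lam : ℚ} (hi : p * i = (p - 1) * p ^ m + S * p ^ R)
    (hlam : lam * (p ^ m * (p ^ m - 1)) = p ^ r * (A + p * B / 2) * (i * (i - 1))) :
    HoldsDesign (doCode p l F : Set (F → ZMod p)) 2 (p ^ m) i lam := by
  have hp' : p.Prime := Fact.out
  have h3 := three_le_of_ne_two hp
  have hcard := two_mul_card_excess_eq_neg (l := l) (F := F) hp hF (by omega) hS R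
  rw [show 2 * m - 2 * R = r by omega, show 2 * m + 1 - 2 * R = r + 1 by omega] at hcard
  have habs := abs_mul_pow_le (m := m) (R := R) hp hS (by omega)
  have hle := le_abs_self (S * (p : ℤ) ^ R)
  have hle' := neg_abs_le (S * (p : ℤ) ^ R)
  have h9 := nine_mul_le_pow hp hm
  have hpos : (0 : ℚ) < p := by exact_mod_cast hp'.pos
  have hpos1 : (0 : ℚ) < p - 1 := by
    have : (1 : ℚ) < p := by exact_mod_cast hp'.one_lt
    linarith
  have hcard' := congrArg (Nat.cast : ℕ → ℚ) hcard
  push_cast [Nat.cast_sub hp'.one_le] at hcard'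
  rw [hA, hB] at hcard'
  set P := (univ.filter fun v : (F × F) × (F × ZMod p) => excess p l v = -(S * p ^ R)).card with hP
  -- Forms of even rank contribute `A`. A form of odd rank contributes through half of the nonzero
  -- levels, but its radical is smaller by a factor `p`, which accounts for the term `p * B / 2`.
  have hP' : (P : ℚ) = (p - 1) * p ^ r * (A + p * B / 2) := by linear_combination hcard' / 2
  have hP0 : 0 < P := by
    have : (0 : ℚ) < P := by rw [hP']; positivity
    exact_mod_cast this
  refine holdsDesign_of_excess hF (by omega) hΔ (by linarith) ?_ ?_ hP.symm hP0
    (by rw [hi]; push_cast; ring) ?_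
  · nlinarith
  · nlinarith
  · rw [hP']
    linear_combination ((p : ℚ) - 1) * hlam

/-- The design of the weight `(p-1) p^{m-1}`. -/
theorem holdsDesign_mul_sub_one (hp : p ≠ 2) (hF : Fintype.card F = p ^ m) (hm : 3 ≤ m) {Δ : ℤ}
    (hΔ : ∀ v : (F × F) × (F × ZMod p), v ≠ 0 → excess p l v ≤ Δ) (hmin : Δ < (p : ℤ) ^ m)
    {Z : ℚ} (hZ : ∑ w : F × F, ((p : ℚ) ^ (m + 1) - p ^ (m + 1) / p ^ radDim p l w +
        if Odd (m + radDim p l w) then (p : ℚ) ^ m / p ^ radDim p l w else 0) = Z)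
    {i lam : ℚ} (hi : p * i = (p - 1) * p ^ m)
    (hlam : lam * (p * (p ^ m - 1)) = Z * (i - 1)) :
    HoldsDesign (doCode p l F : Set (F → ZMod p)) 2 (p ^ m) i lam := by
  have hp' : p.Prime := Fact.out
  have h3 := three_le_of_ne_two hp
  have h9 := nine_mul_le_pow hp hm
  have hpQ : (p : ℚ) ≠ 0 := by exact_mod_cast hp'.ne_zero
  have hp1 : (1 : ℚ) < p := by exact_mod_cast hp'.one_lt
  have hterm : ∀ r : ℕ, (p : ℚ) ^ (m + 1) / p ^ r ≤ p ^ (m + 1) := fun r =>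
    div_le_self (by positivity) (one_le_pow₀ hp1.le)
  have hZ0 : 0 < Z := by
    rw [← hZ]
    refine Finset.sum_pos' (fun w _ => add_nonneg (sub_nonneg.2 (hterm _)) ?_) ⟨0, mem_univ _, ?_⟩
    · split_ifs <;> positivity
    · rw [radDim_zero hF]
      refine add_pos_of_pos_of_nonneg (sub_pos.2 ?_) ?_
      · exact div_lt_self (by positivity) (one_lt_pow₀ hp1 (by omega))
      · split_ifs <;> positivity
  rw [← card_excess_eq_zero hp hF (by omega)] at hZ
  refine holdsDesign_of_excess (D := 0) hF (by omega) hΔ ?_ ?_ ?_ rfl ?_ (by rw [hi]; push_cast; ring) ?_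
  · rw [mul_zero, sub_zero]
    exact mul_lt_mul_of_pos_left hmin (by linarith)
  · linarith
  · nlinarith
  · rw [← hZ] at hZ0
    exact_mod_cast hZ0
  · rw [hZ]
    refine mul_left_cancel₀ hpQ ?_
    linear_combination ((p : ℚ) - 1) * p ^ m * hlam - Z * (i - 1) * hi

/-- Dividing by `X`, the left side is at most `(p - 1)² + (p - 2) = p (p - 1) - 1`. This is the
minimum distance condition for the bound `Δ = (p - 1) X` on the excess. -/
theorem excess_min_of_neg_le (hp : p ≠ 2) {X D q : ℤ} (hX : 0 < X) (hXq : p * X ≤ q)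
    (hD : -X ≤ D) : ((p : ℤ) - 1) * ((p - 1) * X) - (p - 2) * D < (p - 1) * q := by
  have h3 := three_le_of_ne_two hp
  nlinarith [mul_le_mul_of_nonneg_left hD (show (0 : ℤ) ≤ p - 2 by linarith),
    mul_le_mul_of_nonneg_left hXq (show (0 : ℤ) ≤ p - 1 by linarith)]

end WeightFamilies

/-! ### Explicit counts for `m / d` odd. -/

section OddQuotientCounts

variable {F : Type*} [Field F] [Fintype F] [DecidableEq F] {p m l : ℕ} [Fact p.Prime]
  [Algebra (ZMod p) F] [CharP F p]

theorem three_le_pow_of_ne_two (hp : p ≠ 2) {d : ℕ} (hd : 0 < d) : (3 : ℚ) ≤ (p : ℚ) ^ d := by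
  have h3 : (3 : ℚ) ≤ p := by exact_mod_cast three_le_of_ne_two hp
  exact h3.trans (le_self_pow₀ (by linarith) hd.ne')

/-- The distribution of the dimension of the radical, for `m / d` odd. -/
theorem card_radDim_of_odd_eq (hp : p ≠ 2) (hF : Fintype.card F = p ^ m) (hl : 0 < l)
    (hg : m.gcd (2 * l) = m.gcd l) {d n : ℕ} (hd : d = m.gcd l) (hmn : m = d * n) (hn : Odd n)
    (hn3 : 3 ≤ n) {y q : ℚ} (hy : y = p ^ d) (hq : q = p ^ m) {N : ℕ → ℚ}
    (hN : ∀ j, N j = (univ.filter fun w : F × F => radDim p l w = d * j).card) :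
    (N 0 = (q - 1) * y ^ 2 * (q - q / y - q / y ^ 2 + 1) / (y ^ 2 - 1) ∧ 0 < N 0) ∧
    (N 1 = (q - 1) * (q / y) ∧ 0 < N 1) ∧
    (N 2 = (q - 1) * (q / y - 1) / (y ^ 2 - 1) ∧ 0 < N 2) := by
  have hp' : p.Prime := Fact.out
  have hd0 : 0 < d := hd ▸ Nat.gcd_pos_of_pos_right _ hl
  obtain ⟨h0, h1, h2⟩ := card_radDim_of_odd hp hF hl hg hd hmn hn hn3 hN
  rw [← hq] at h0 h1 h2
  rw [← hy] at h1 h2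
  have hy3 : 3 ≤ y := hy ▸ three_le_pow_of_ne_two hp hd0
  have hqy : y ^ 2 < q := by
    rw [hq, hy, ← pow_mul, hmn]
    refine pow_lt_pow_right₀ (by exact_mod_cast hp'.one_lt) ?_
    exact Nat.mul_lt_mul_of_pos_left (by omega) hd0
  have hy0 : y ≠ 0 := by positivity
  have hy1 : 0 < y ^ 2 - 1 := by nlinarith
  have hq1 : 0 < q - 1 := by nlinarith
  have hqy' : y < q / y := by rw [lt_div_iff₀ (by linarith)]; linarith
  have hqyy : q / y ^ 2 = q / y / y := by field_simp
  have e1 : N 1 = (q - 1) * (q / y) := by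
    rw [← mul_left_inj' hy0, h1, mul_assoc, div_mul_cancel₀ _ hy0, mul_comm]
  have e2 : N 2 = (q - 1) * (q / y - 1) / (y ^ 2 - 1) := by
    rw [eq_div_iff hy1.ne', h2, e1]
    ring
  have e0 : N 0 = (q - 1) * y ^ 2 * (q - q / y - q / y ^ 2 + 1) / (y ^ 2 - 1) := by
    have : N 0 = q ^ 2 - 1 - N 1 - N 2 := by linarith
    rw [this, e1, e2]
    field_simp
    ring
  refine ⟨⟨e0, ?_⟩, ⟨e1, ?_⟩, ⟨e2, ?_⟩⟩
  · rw [e0]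
    have : 0 < q - q / y - q / y ^ 2 + 1 := by
      have h3 : q = q / y * y := (div_mul_cancel₀ _ hy0).symm
      have h4 : q / y = q / y ^ 2 * y := by rw [hqyy, div_mul_cancel₀ _ hy0]
      have h5 : 0 < q / y ^ 2 := div_pos (by linarith) (by positivity)
      nlinarith
    positivity
  · rw [e1]
    have : 0 < q / y := by linarith
    positivity
  · rw [e2]
    have : 0 < q / y - 1 := by linarith
    positivity

/-- For `m / d` odd, the distribution of the exponential sums of forms of even rank over the fixed
field. -/
theorem card_amplitude_of_add_eq (hp : p ≠ 2) (hF : Fintype.card F = p ^ m) (hl : 0 < l)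
    (hg : m.gcd (2 * l) = m.gcd l) {d n : ℕ} (hd : d = m.gcd l) (hmn : m = d * n) (hn : Odd n)
    (hn3 : 3 ≤ n) {R : ℕ} (hR : m + d = 2 * R) {S : ℤ} (hS : S = 1 ∨ S = -1) :
    ((univ.filter fun w : F × F => amplitude p l w = S * p ^ R).card : ℚ) =
      p ^ m * (p ^ m - 1) / 2 * (1 / p ^ d + S / p ^ R) := by
  have hpQ : (p : ℚ) ≠ 0 := by exact_mod_cast (Fact.out : p.Prime).ne_zero
  have h1 := (card_radDim_of_odd (N := fun j => ((univ.filter fun w : F × F => radDim p l w = d * j).card : ℚ))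
    hp hF hl hg hd hmn hn hn3 fun _ => rfl).2.1
  have h2 := congrArg (Nat.cast : ℕ → ℚ) (card_amplitude_add_card_amplitude (l := l) (F := F) hp hF R)
  have h3 := card_amplitude_sub_card_amplitude hp hF hl hg hd hmn hn hn3 hR
  have h4 : ∀ w : F × F, m + radDim p l w = 2 * R ↔ radDim p l w = d * 1 := fun w => by omega
  simp only [h4] at h2
  push_cast at h2
  rw [← h2] at h1
  have hd1 : (p : ℚ) ^ d ≠ 0 := pow_ne_zero _ hpQ
  have hR1 : (p : ℚ) ^ R ≠ 0 := pow_ne_zero _ hpQ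
  rcases hS with rfl | rfl
  -- The sum of the two sign counts is the number of forms with radical dimension `d`, and their
  -- difference comes from the first moment.
  · simp only [one_mul, Int.cast_one]
    field_simp
    linear_combination p ^ R * h1 + p ^ d * h3
  · simp only [neg_mul, one_mul, Int.cast_neg, Int.cast_one]
    field_simp
    linear_combination p ^ R * h1 - p ^ d * h3

theorem card_amplitude_pos_of_add_eq {d R : ℕ} (hm : 0 < m) (hR : d < R)
    {S : ℤ} (hS : S = 1 ∨ S = -1) :
    0 < (p : ℚ) ^ m * (p ^ m - 1) / 2 * (1 / p ^ d + S / p ^ R) := by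
  have hp1 : (1 : ℚ) < p := by exact_mod_cast (Fact.out : p.Prime).one_lt
  have h1 : (1 : ℚ) < p ^ m := one_lt_pow₀ hp1 hm.ne'
  have h2 : (1 : ℚ) / p ^ R < 1 / p ^ d :=
    one_div_lt_one_div_of_lt (by positivity) (pow_lt_pow_right₀ hp1 hR)
  have h3 : 0 < (1 : ℚ) / p ^ R := by positivity
  have h4 : 0 < 1 / (p : ℚ) ^ d + S / p ^ R := by
    rcases hS with rfl | rfl
    · push_cast; linarith
    · push_cast; rw [neg_div]; linarith
  have : 0 < (p : ℚ) ^ m - 1 := by linarith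
  positivity

/-- For `m / d` odd, the distribution of the exponential sums of forms of odd rank over the fixed
field and of even rank over the prime field. -/
theorem card_amplitude_eq_half (hp : p ≠ 2) (hF : Fintype.card F = p ^ m) (hl : 0 < l)
    {d n : ℕ} (hd : d = m.gcd l) (hmn : m = d * n) (hn : Odd n) {R j : ℕ}
    (hR : m + d * (2 * j) = 2 * R) {S : ℤ} (hS : S = 1 ∨ S = -1) :
    ((univ.filter fun w : F × F => amplitude p l w = S * p ^ R).card : ℚ) =
      (univ.filter fun w : F × F => radDim p l w = d * (2 * j)).card / 2 := by
  have h1 := card_amplitude_eq_card_amplitude_neg (F := F) hp hF hl hd hmn hn hR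
  have h2 := congrArg (Nat.cast : ℕ → ℚ) (card_amplitude_add_card_amplitude (l := l) (F := F) hp hF R)
  have h4 : ∀ w : F × F, m + radDim p l w = 2 * R ↔ radDim p l w = d * (2 * j) := fun w => by omega
  simp only [h4] at h2
  push_cast at h2
  rcases hS with rfl | rfl
  · simp only [one_mul]
    rw [← h1] at h2
    linarith
  · simp only [neg_mul, one_mul]
    rw [h1] at h2
    linarith

end OddQuotientCounts

/-! ### Individual designs for `m / d` odd and `d` odd. -/

section OddQuotientOddDegree

variable {F : Type*} [Field F] [Fintype F] [DecidableEq F] {p m l : ℕ} [Fact p.Prime]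
  [Algebra (ZMod p) F] [CharP F p]

theorem pow_sub_one_pos_of_prime {p : ℕ} [Fact p.Prime] {k : ℕ} (hk : k ≠ 0) : 0 < (p : ℚ) ^ k - 1 :=
  sub_pos.2 (one_lt_pow₀ (by exact_mod_cast (Fact.out : p.Prime).one_lt) hk)

theorem two_mul_pow_le_pow (p : ℕ) [Fact p.Prime] {a b : ℕ} (h : a + 1 ≤ b) :
    2 * (p : ℤ) ^ a ≤ p ^ b := by
  have h2 : (2 : ℤ) ≤ p := by exact_mod_cast (Fact.out : p.Prime).two_le
  calc 2 * (p : ℤ) ^ a ≤ p * p ^ a := mul_le_mul_of_nonneg_right h2 (by positivity)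
    _ = p ^ (a + 1) := (pow_succ' _ _).symm
    _ ≤ p ^ b := pow_le_pow_right₀ (by linarith) h

theorem abs_sign_mul_pow {S : ℤ} (hS : S = 1 ∨ S = -1) (R : ℕ) : |S * (p : ℤ) ^ R| = p ^ R := by
  rw [abs_mul, abs_of_nonneg (show (0 : ℤ) ≤ p ^ R by positivity)]
  rcases hS with rfl | rfl <;> simp

/-- Here the excess is bounded by `Δ = p^R` and `2 p^R ≤ p^m`, so the condition reduces to `2 p - 3
< 2 (p - 1)`. -/
theorem excess_min_of_abs_le (hp : p ≠ 2) {R : ℕ} (hR : R + 1 ≤ m) {D : ℤ} (hD : |D| ≤ p ^ R) :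
    ((p : ℤ) - 1) * p ^ R - (p - 2) * D < (p - 1) * p ^ m := by
  have h3 := three_le_of_ne_two hp
  have h1 := two_mul_pow_le_pow p hR
  have h2 := (abs_le.1 hD).1
  have h4 : (0 : ℤ) < p ^ R := by positivity
  nlinarith [mul_le_mul_of_nonneg_left h2 (show (0 : ℤ) ≤ p - 2 by linarith),
    mul_le_mul_of_nonneg_left h1 (show (0 : ℤ) ≤ p - 1 by linarith)]

theorem excess_min_of_le (hp : p ≠ 2) {S : ℤ} (hS : S = 1 ∨ S = -1) {R R' : ℕ} (hR : R + 1 ≤ m)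
    (hR' : R' ≤ R) : ((p : ℤ) - 1) * p ^ R + (p - 2) * (S * p ^ R') < (p - 1) * p ^ m := by
  have h3 := three_le_of_ne_two hp
  have := excess_min_of_abs_le (D := -(S * p ^ R')) hp hR (by
    rw [abs_neg, abs_sign_mul_pow hS]
    exact pow_le_pow_right₀ (by linarith) hR')
  linarith

/-- In this part `d = 2e + 1` and `m = 3d + 2f`, which makes all halved exponents linear in `e` and
`f`. The three values `3e + f + 2`, `4e + f + 2`, `5e + f + 3` of `R` belong to radical dimensions
`0`, `d`, `2d`, called bottom, middle and top; the rank is even only in the middle. -/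
theorem holdsDesign_odd_middle_sub_one_mul (hp : p ≠ 2) (hF : Fintype.card F = p ^ m) {d e f : ℕ}
    (hef : 1 ≤ e + f) (hde : d = 2 * e + 1) (hmf : m = 6 * e + 2 * f + 3)
    (hΔ : ∀ v : (F × F) × (F × ZMod p), v ≠ 0 → excess p l v ≤ p ^ (5 * e + f + 3))
    (hA : ∀ S : ℤ, S = 1 ∨ S = -1 → ((univ.filter fun w : F × F =>
      amplitude p l w = S * p ^ (4 * e + f + 2)).card : ℚ) =
      p ^ m * (p ^ m - 1) / 2 * (1 / p ^ d + S / p ^ (4 * e + f + 2)))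
    {S : ℤ} (hS : S = 1 ∨ S = -1) {Q : ℚ} (hQ : Q = p) :
    HoldsDesign (doCode p l F : Set (F → ZMod p)) 2 (p ^ m)
        (Q^(4*e+f+1) * (Q - 1) * (Q^(2*e+f+1) + S))
        (1 / 2 * Q^(4*e+2*f+1) * (Q^(4*e+f+1) * (Q - 1) * (Q^(2*e+f+1) + S) - 1)
          * (Q^(4*e+2*f+2) - 1)) := by
  have h3 := three_le_of_ne_two hp
  -- A positive amplitude lowers the weight, so the sign in the weight is opposite to that of the
  -- amplitude.
  have hS' : -S = 1 ∨ -S = -1 := by omega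
  subst hQ
  have hpos : (0 : ℚ) < p := by exact_mod_cast (Fact.out : p.Prime).pos
  refine holdsDesign_sub_one_mul hp hF (by omega) hΔ hS' (R := 4 * e + f + 2)
    (r := 4 * e + 2 * f + 2) (by omega) (by omega) (excess_min_of_abs_le hp (by omega) ?_) (hA _ hS')
    (card_amplitude_pos_of_add_eq (by omega) (by omega) hS') ?_ ?_
  · rw [abs_mul, abs_sign_mul_pow hS', abs_of_nonneg (by linarith)]
    have h1 : (p : ℤ) ^ (4 * e + f + 2) * p ≤ p ^ (5 * e + f + 3) := by
      rw [← pow_succ]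
      exact pow_le_pow_right₀ (by linarith) (by omega)
    have h2 : (0 : ℤ) ≤ p ^ (4 * e + f + 2) := by positivity
    linarith
  · rw [hmf]; push_cast; ring
  · have ha : 0 < (p : ℚ) ^ e := by positivity
    have hb : 0 < (p : ℚ) ^ f := by positivity
    simp only [hmf, hde, pow_add, pow_mul', pow_one]
    -- Once every power is a monomial in `p`, `p^e` and `p^f`, the claim is an identity of rational
    -- functions in three independent variables.
    generalize (p : ℚ) ^ e = a at *
    generalize (p : ℚ) ^ f = b at *
    generalize (p : ℚ) = Q at *
    rcases hS with rfl | rfl <;> push_cast <;> field_simp <;> ring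

/-- The forms concerned have odd rank, so only `B` contributes. The exponent `2R = m + 2d + 1` is
also the one that bounds every excess. -/
theorem holdsDesign_odd_top_add (hp : p ≠ 2) (hF : Fintype.card F = p ^ m) {d e f : ℕ}
    (hef : 1 ≤ e + f) (hde : d = 2 * e + 1) (hmf : m = 6 * e + 2 * f + 3)
    (hΔ : ∀ v : (F × F) × (F × ZMod p), v ≠ 0 → excess p l v ≤ p ^ (5 * e + f + 3))
    {S : ℤ} (hS : S = 1 ∨ S = -1)
    (hA : ((univ.filter fun w : F × F => amplitude p l w = S * p ^ (5 * e + f + 3)).card : ℚ) = 0)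
    (hB : ((univ.filter fun w : F × F => m + radDim p l w + 1 = 2 * (5 * e + f + 3)).card : ℚ) =
      (p ^ m - 1) * (p ^ m / p ^ d - 1) / ((p ^ d) ^ 2 - 1))
    (hB0 : 0 < ((univ.filter fun w : F × F => m + radDim p l w + 1 = 2 * (5 * e + f + 3)).card : ℚ))
    {Q : ℚ} (hQ : Q = p) :
    HoldsDesign (doCode p l F : Set (F → ZMod p)) 2 (p ^ m)
        (Q^(5*e+f+2) * (Q^(e+f+1) - Q^(e+f) + S))
        (1 / 2 * Q^(e+f) * (Q^(e+f+1) - Q^(e+f) + S)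
          * (Q^(5*e+f+2) * (Q^(e+f+1) - Q^(e+f) + S) - 1)
          * (Q^(4*e+2*f+2) - 1) / (Q^(4*e+2) - 1)) := by
  subst hQ
  have hpos : (0 : ℚ) < p := by exact_mod_cast (Fact.out : p.Prime).pos
  refine holdsDesign_add hp hF (by omega) hΔ hS (R := 5 * e + f + 3) (r := 2 * e + 2 * f)
    (by omega) (by omega) (excess_min_of_le hp hS (by omega) le_rfl) hA hB
    (by rw [← hB, zero_add]; positivity) ?_ ?_
  · rw [hmf]; ring
  · have ha : 0 < (p : ℚ) ^ e := by positivity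
    have hb : 0 < (p : ℚ) ^ f := by positivity
    have hden := (pow_sub_one_pos_of_prime (p := p) (k := 4 * e + 2) (by omega)).ne'
    simp only [hmf, hde, pow_add, pow_mul', pow_one, mul_add] at hden ⊢
    generalize (p : ℚ) ^ e = a at *
    generalize (p : ℚ) ^ f = b at *
    generalize (p : ℚ) = Q at *
    rcases hS with rfl | rfl <;> push_cast <;> field_simp <;> ring

theorem holdsDesign_odd_bottom_add (hp : p ≠ 2) (hF : Fintype.card F = p ^ m) {d e f : ℕ}
    (hef : 1 ≤ e + f) (hde : d = 2 * e + 1) (hmf : m = 6 * e + 2 * f + 3)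
    (hΔ : ∀ v : (F × F) × (F × ZMod p), v ≠ 0 → excess p l v ≤ p ^ (5 * e + f + 3))
    {S : ℤ} (hS : S = 1 ∨ S = -1)
    (hA : ((univ.filter fun w : F × F => amplitude p l w = S * p ^ (3 * e + f + 2)).card : ℚ) = 0)
    (hB : ((univ.filter fun w : F × F => m + radDim p l w + 1 = 2 * (3 * e + f + 2)).card : ℚ) =
      (p ^ m - 1) * (p ^ d) ^ 2 * (p ^ m - p ^ m / p ^ d - p ^ m / (p ^ d) ^ 2 + 1) /
        ((p ^ d) ^ 2 - 1))
    (hB0 : 0 < ((univ.filter fun w : F × F => m + radDim p l w + 1 = 2 * (3 * e + f + 2)).card : ℚ))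
    {Q : ℚ} (hQ : Q = p) :
    HoldsDesign (doCode p l F : Set (F → ZMod p)) 2 (p ^ m)
        (Q^(3*e+f+1) * (Q^(3*e+f+2) - Q^(3*e+f+1) + S))
        (Q^(7*e+f+3) * (Q^(3*e+f+2) - Q^(3*e+f+1) + S)
          * (Q^(3*e+f+1) * (Q^(3*e+f+2) - Q^(3*e+f+1) + S) - 1)
          * (Q^(6*e+2*f+3) - Q^(4*e+2*f+2) - Q^(2*e+2*f+1) + 1) / (2 * (Q^(4*e+2) - 1))) := by
  subst hQ
  have hpos : (0 : ℚ) < p := by exact_mod_cast (Fact.out : p.Prime).pos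
  refine holdsDesign_add hp hF (by omega) hΔ hS (R := 3 * e + f + 2) (r := 6 * e + 2 * f + 2)
    (by omega) (by omega) (excess_min_of_le hp hS (by omega) (by omega)) hA hB
    (by rw [← hB, zero_add]; positivity) ?_ ?_
  · rw [hmf]; ring
  · have ha : 0 < (p : ℚ) ^ e := by positivity
    have hb : 0 < (p : ℚ) ^ f := by positivity
    have hden := (pow_sub_one_pos_of_prime (p := p) (k := 4 * e + 2) (by omega)).ne'
    simp only [hmf, hde, pow_add, pow_mul', pow_one, mul_add, mul_one] at hden ⊢
    generalize (p : ℚ) ^ e = a at *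
    generalize (p : ℚ) ^ f = b at *
    generalize (p : ℚ) = Q at *
    rcases hS with rfl | rfl <;> push_cast <;> field_simp <;> ring

theorem holdsDesign_odd_middle_add (hp : p ≠ 2) (hF : Fintype.card F = p ^ m) {d e f : ℕ}
    (hef : 1 ≤ e + f) (hde : d = 2 * e + 1) (hmf : m = 6 * e + 2 * f + 3)
    (hΔ : ∀ v : (F × F) × (F × ZMod p), v ≠ 0 → excess p l v ≤ p ^ (5 * e + f + 3))
    {S : ℤ} (hS : S = 1 ∨ S = -1)
    (hA : ((univ.filter fun w : F × F => amplitude p l w = S * p ^ (4 * e + f + 2)).card : ℚ) =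
      p ^ m * (p ^ m - 1) / 2 * (1 / p ^ d + S / p ^ (4 * e + f + 2)))
    (hB : ((univ.filter fun w : F × F => m + radDim p l w + 1 = 2 * (4 * e + f + 2)).card : ℚ) = 0)
    {Q : ℚ} (hQ : Q = p) :
    HoldsDesign (doCode p l F : Set (F → ZMod p)) 2 (p ^ m)
        (Q^(4*e+f+1) * (Q^(2*e+f+2) - Q^(2*e+f+1) + S))
        (1 / 2 * Q^(4*e+2*f+1) * (Q^(2*e+f+2) - Q^(2*e+f+1) + S)
          * (Q^(4*e+f+1) * (Q^(2*e+f+2) - Q^(2*e+f+1) + S) - 1) * (Q^(2*e+f+1) + S)) := by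
  subst hQ
  have hpos : (0 : ℚ) < p := by exact_mod_cast (Fact.out : p.Prime).pos
  have hAp := card_amplitude_pos_of_add_eq (p := p) (m := m) (d := d) (R := 4 * e + f + 2)
    (by omega) (by omega) hS
  refine holdsDesign_add hp hF (by omega) hΔ hS (R := 4 * e + f + 2) (r := 4 * e + 2 * f + 2)
    (by omega) (by omega) (excess_min_of_le hp hS (by omega) (by omega)) hA hB
    (by rw [mul_zero, zero_div, add_zero]; exact hAp) ?_ ?_
  · rw [hmf]; ring
  · have ha : 0 < (p : ℚ) ^ e := by positivity
    have hb : 0 < (p : ℚ) ^ f := by positivity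
    simp only [hmf, hde, pow_add, pow_mul', pow_one]
    generalize (p : ℚ) ^ e = a at *
    generalize (p : ℚ) ^ f = b at *
    generalize (p : ℚ) = Q at *
    rcases hS with rfl | rfl <;> push_cast <;> field_simp <;> ring

/-- For `d = 1` the exponents `(m + 1) / 2` and `(m + d) / 2` coincide, so forms with zero radical
and forms with radical dimension 1 produce the same weight. The two contributions to `λ` add up. -/
theorem holdsDesign_odd_bottom_add_of_one (hp : p ≠ 2) (hF : Fintype.card F = p ^ m) {f : ℕ}
    (hf : 1 ≤ f) (hmf : m = 2 * f + 3)
    (hΔ : ∀ v : (F × F) × (F × ZMod p), v ≠ 0 → excess p l v ≤ p ^ (f + 3))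
    {S : ℤ} (hS : S = 1 ∨ S = -1)
    (hA : ((univ.filter fun w : F × F => amplitude p l w = S * p ^ (f + 2)).card : ℚ) =
      p ^ m * (p ^ m - 1) / 2 * (1 / p + S / p ^ (f + 2)))
    (hB : ((univ.filter fun w : F × F => m + radDim p l w + 1 = 2 * (f + 2)).card : ℚ) =
      (p ^ m - 1) * p ^ 2 * (p ^ m - p ^ m / p - p ^ m / p ^ 2 + 1) / (p ^ 2 - 1))
    (hB0 : 0 < ((univ.filter fun w : F × F => m + radDim p l w + 1 = 2 * (f + 2)).card : ℚ))
    {Q : ℚ} (hQ : Q = p) :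
    HoldsDesign (doCode p l F : Set (F → ZMod p)) 2 (p ^ m)
        (Q^(f+1) * (Q^(f+2) - Q^(f+1) + S))
        (Q^(f+3) * (Q^(f+2) - Q^(f+1) + S) * (Q^(f+1) * (Q^(f+2) - Q^(f+1) + S) - 1)
          * (Q^(2*f+3) - Q^(2*f+2) - Q^(2*f+1) + 1) / (2 * (Q^2 - 1))
        + 1 / 2 * Q^(2*f+1) * (Q^(f+2) - Q^(f+1) + S)
          * (Q^(f+1) * (Q^(f+2) - Q^(f+1) + S) - 1) * (Q^(f+1) + S)) := by
  subst hQ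
  have hpos : (0 : ℚ) < p := by exact_mod_cast (Fact.out : p.Prime).pos
  have hAp := card_amplitude_pos_of_add_eq (p := p) (m := m) (d := 1) (R := f + 2)
    (by omega) (by omega) hS
  rw [pow_one] at hAp
  refine holdsDesign_add hp hF (by omega) hΔ hS (R := f + 2) (r := 2 * f + 2)
    (by omega) (by omega) (excess_min_of_le hp hS (by omega) (by omega)) hA hB
    (add_pos hAp (by rw [← hB]; positivity)) ?_ ?_
  · rw [hmf]; ring
  · have hb : 0 < (p : ℚ) ^ f := by positivity
    have hden := (pow_sub_one_pos_of_prime (p := p) (k := 2) (by omega)).ne'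
    simp only [hmf, pow_add, pow_mul', pow_one, mul_add, mul_one] at hden ⊢
    generalize (p : ℚ) ^ f = b at *
    generalize (p : ℚ) = Q at *
    rcases hS with rfl | rfl <;> push_cast <;> field_simp <;> ring

theorem sum_zero_excess_of_odd (hp : p ≠ 2) (hF : Fintype.card F = p ^ m) (hl : 0 < l)
    (hg : m.gcd (2 * l) = m.gcd l) {d n : ℕ} (hd : d = m.gcd l) (hmn : m = d * n)
    (hn3 : 3 ≤ n) {N : ℕ → ℚ}
    (hN : ∀ j, N j = (univ.filter fun w : F × F => radDim p l w = d * j).card) :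
    ∑ w : F × F, ((p : ℚ) ^ (m + 1) - p ^ (m + 1) / p ^ radDim p l w +
        if Odd (m + radDim p l w) then (p : ℚ) ^ m / p ^ radDim p l w else 0) =
      p * (p ^ m - 1) + (N 0 * (if Odd m then (p : ℚ) ^ m else 0) +
        N 1 * (p ^ (m + 1) - p ^ (m + 1) / p ^ d +
          if Odd (m + d) then (p : ℚ) ^ m / p ^ d else 0) +
        N 2 * (p ^ (m + 1) - p ^ (m + 1) / (p ^ d) ^ 2 +
          if Odd (m + d * 2) then (p : ℚ) ^ m / (p ^ d) ^ 2 else 0)) := by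
  have hpQ : (p : ℚ) ≠ 0 := by exact_mod_cast (Fact.out : p.Prime).ne_zero
  have hd0 : 0 < d := hd ▸ Nat.gcd_pos_of_pos_right _ hl
  have h2d : d * 2 < m := by rw [hmn]; exact Nat.mul_lt_mul_of_pos_left (by omega) hd0
  rw [sum_eq_of_radDim hF hd0 h2d (fun w hw => exists_radDim_eq_of_odd hp hF hl hg hd hw) _
    (fun r => (p : ℚ) ^ (m + 1) - p ^ (m + 1) / p ^ r +
        if Odd (m + r) then (p : ℚ) ^ m / p ^ r else 0) (fun _ _ => rfl), radDim_zero hF,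
    if_neg (Nat.not_odd_iff_even.2 ⟨m, rfl⟩)]
  simp only [Finset.sum_range_succ, Finset.sum_range_zero, nsmul_eq_mul, ← hN, mul_zero, mul_one,
    add_zero, pow_zero, div_one, sub_self, zero_add, ← pow_mul]
  congr 1
  rw [pow_succ (p : ℚ) m]
  field_simp

theorem holdsDesign_odd_mul_sub_one (hp : p ≠ 2) (hF : Fintype.card F = p ^ m) (hl : 0 < l)
    (hg : m.gcd (2 * l) = m.gcd l) {d n e f : ℕ} (hd : d = m.gcd l) (hmn : m = d * n) (hn3 : 3 ≤ n)
    (hef : 1 ≤ e + f) (hde : d = 2 * e + 1) (hmf : m = 6 * e + 2 * f + 3)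
    (hΔ : ∀ v : (F × F) × (F × ZMod p), v ≠ 0 → excess p l v ≤ p ^ (5 * e + f + 3))
    {N : ℕ → ℚ} (hN : ∀ j, N j = (univ.filter fun w : F × F => radDim p l w = d * j).card)
    (hN0 : N 0 = (p ^ m - 1) * (p ^ d) ^ 2 * (p ^ m - p ^ m / p ^ d - p ^ m / (p ^ d) ^ 2 + 1) /
      ((p ^ d) ^ 2 - 1))
    (hN1 : N 1 = (p ^ m - 1) * (p ^ m / p ^ d))
    (hN2 : N 2 = (p ^ m - 1) * (p ^ m / p ^ d - 1) / ((p ^ d) ^ 2 - 1)) {Q : ℚ} (hQ : Q = p) :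
    HoldsDesign (doCode p l F : Set (F → ZMod p)) 2 (p ^ m)
        (Q^(6*e+2*f+2) * (Q - 1))
        ((Q^(6*e+2*f+3) - Q^(6*e+2*f+2) - 1) * (Q^(16*e+4*f+7) + Q^(14*e+4*f+7) - Q^(14*e+4*f+6)
          - Q^(12*e+4*f+6) - Q^(12*e+4*f+5) + Q^(8*e+4*f+4) - Q^(6*e+4*f+3) + Q^(6*e+4*f+2)
          + Q^(10*e+2*f+4) - Q^(6*e+2*f+3) + Q^(2*e+2*f+1) - Q^(2*e+2*f) + Q^(4*e+2) - 1)
          / (Q^(4*e+2) - 1)) := by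
  subst hQ
  have hpos : (0 : ℚ) < p := by exact_mod_cast (Fact.out : p.Prime).pos
  refine holdsDesign_mul_sub_one hp hF (by omega) hΔ
    (pow_lt_pow_right₀ (by linarith [three_le_of_ne_two hp]) (by omega))
    (sum_zero_excess_of_odd hp hF hl hg hd hmn hn3 hN) ?_ ?_
  · rw [hmf]; ring
  · rw [hN0, hN1, hN2, if_pos ⟨3 * e + f + 1, by omega⟩,
      if_neg (Nat.not_odd_iff_even.2 ⟨4 * e + f + 2, by omega⟩), if_pos ⟨5 * e + f + 2, by omega⟩]
    have ha : 0 < (p : ℚ) ^ e := by positivity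
    have hb : 0 < (p : ℚ) ^ f := by positivity
    have hden := (pow_sub_one_pos_of_prime (p := p) (k := 4 * e + 2) (by omega)).ne'
    simp only [hmf, hde, pow_add, pow_mul', pow_one, mul_add] at hden ⊢
    generalize (p : ℚ) ^ e = a at *
    generalize (p : ℚ) ^ f = b at *
    generalize (p : ℚ) = Q at *
    field_simp
    ring

end OddQuotientOddDegree

/-! ### The bounds and the complete list for `m / d` odd and `d` odd. -/

section OddQuotientOddDegreeFamily

variable {F : Type*} [Field F] [Fintype F] [DecidableEq F] {p m l : ℕ} [Fact p.Prime]
  [Algebra (ZMod p) F] [CharP F p]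

/-- For `m / d` odd, the exponential sums of nonzero forms of even rank take the values `± p^R` for
`R` between `m / 2` and `(m + 2 d) / 2` only. -/
theorem card_amplitude_eq_zero (hp : p ≠ 2) (hF : Fintype.card F = p ^ m) (hl : 0 < l)
    (hg : m.gcd (2 * l) = m.gcd l) {d : ℕ} (hd : d = m.gcd l) {S : ℤ} (hS : S = 1 ∨ S = -1) {R : ℕ}
    (hRm : R ≠ m) (hR : ∀ j, j ≤ 2 → m + d * j ≠ 2 * R) :
    ((univ.filter fun w : F × F => amplitude p l w = S * p ^ R).card : ℚ) = 0 := by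
  rw [Nat.cast_eq_zero, Finset.card_eq_zero, Finset.filter_eq_empty_iff]
  intro w _ h
  have h1 := (amplitude_eq_iff_of_even hp hF (by rcases hS with rfl | rfl <;> norm_num) h).2
  by_cases hw : w = 0
  · rw [hw, radDim_zero hF] at h1
    omega
  obtain ⟨j, hj, hr⟩ := exists_radDim_eq_of_odd hp hF hl hg hd hw
  exact hR j hj (by rw [← hr, h1])

theorem card_radDim_eq_zero (hp : p ≠ 2) (hF : Fintype.card F = p ^ m) (hl : 0 < l)
    (hg : m.gcd (2 * l) = m.gcd l) {d : ℕ} (hd : d = m.gcd l) {R : ℕ}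
    (hR : ∀ j, j ≤ 2 → m + d * j + 1 ≠ 2 * R) :
    ((univ.filter fun w : F × F => m + radDim p l w + 1 = 2 * R).card : ℚ) = 0 := by
  rw [Nat.cast_eq_zero, Finset.card_eq_zero, Finset.filter_eq_empty_iff]
  intro w _ h
  by_cases hw : w = 0
  · rw [hw, radDim_zero hF] at h
    omega
  obtain ⟨j, hj, hr⟩ := exists_radDim_eq_of_odd hp hF hl hg hd hw
  exact hR j hj (by rw [← hr, h])

theorem amplitude_bounds (hp : p ≠ 2) (hF : Fintype.card F = p ^ m) {w : F × F} {R : ℕ}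
    (h : m + radDim p l w = 2 * R) :
    (p - 1) * amplitude p l w ≤ (p - 1) * p ^ R ∧ - amplitude p l w ≤ p ^ R := by
  obtain ⟨h1, -, -⟩ := amplitude_of_even (l := l) hp hF (w := w) (by rw [h]; exact even_two_mul R)
  rw [h, mul_comm, pow_mul] at h1
  have h2 := abs_le_of_sq_le_sq' h1.le (by positivity)
  have h3 := three_le_of_ne_two hp
  exact ⟨mul_le_mul_of_nonneg_left h2.2 (by linarith), by linarith [h2.1]⟩

theorem sub_one_mul_pow_lt (p : ℕ) [Fact p.Prime] {a b : ℕ} (h : a + 1 ≤ b) :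
    ((p : ℤ) - 1) * p ^ a < p ^ b := by
  have h2 : (2 : ℤ) ≤ p := by exact_mod_cast (Fact.out : p.Prime).two_le
  have h4 : (p : ℤ) * p ^ a ≤ p ^ b := by
    rw [← pow_succ']
    exact pow_le_pow_right₀ (by linarith) h
  have h5 : (0 : ℤ) < p ^ a := by positivity
  linarith

theorem excess_le_of_odd (hp : p ≠ 2) (hF : Fintype.card F = p ^ m) (hl : 0 < l)
    (hg : m.gcd (2 * l) = m.gcd l) {d e f : ℕ} (hd : d = m.gcd l)
    (hde : d = 2 * e + 1) (hmf : m = 6 * e + 2 * f + 3)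
    (v : (F × F) × (F × ZMod p)) (hv : v ≠ 0) : excess p l v ≤ p ^ (5 * e + f + 3) := by
  have h3 := three_le_of_ne_two hp
  refine excess_le hp hF (by positivity) (fun w hw he => ?_) (fun w hw ho => ?_) v hv
  · obtain ⟨j, hj, hr⟩ := exists_radDim_eq_of_odd hp hF hl hg hd hw
    obtain ⟨k, hk⟩ := he
    obtain ⟨h1, h2⟩ := amplitude_bounds (l := l) (w := w) (R := k) hp hF (by omega)
    have hk' : k + 1 ≤ 5 * e + f + 3 := by interval_cases j <;> omega
    exact ⟨h1.trans (sub_one_mul_pow_lt p hk').le,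
      h2.trans (pow_le_pow_right₀ (by linarith) (by omega))⟩
  · obtain ⟨j, hj, hr⟩ := exists_radDim_eq_of_odd hp hF hl hg hd hw
    rw [← pow_mul]
    refine pow_le_pow_right₀ (by linarith) ?_
    interval_cases j <;> omega

theorem exists_int_sign {ε : ℚ} (hε : ε = 1 ∨ ε = -1) : ∃ S : ℤ, (S = 1 ∨ S = -1) ∧ ε = S := by
  rcases hε with rfl | rfl
  · exact ⟨1, by simp, by simp⟩
  · exact ⟨-1, by simp, by simp⟩

theorem exists_int_sign_mul {S : ℤ} (hS : S = 1 ∨ S = -1) (k : ℕ) :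
    ∃ S' : ℤ, (S' = 1 ∨ S' = -1) ∧ (S : ℚ) * (-1) ^ k = S' := by
  refine ⟨S * (-1) ^ k, ?_, by push_cast; rfl⟩
  rcases hS with rfl | rfl <;> rcases neg_one_pow_eq_or ℤ k with h | h <;> rw [h] <;> norm_num

/-- The designs for `m / d` odd and `d` odd. -/
theorem holdsDesign_of_odd_of_odd (hp : p ≠ 2) (hF : Fintype.card F = p ^ m) (hl : 0 < l)
    (hg : m.gcd (2 * l) = m.gcd l) {d n e f : ℕ} (hd : d = m.gcd l) (hmn : m = d * n) (hn : Odd n)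
    (hn3 : 3 ≤ n) (hef : 1 ≤ e + f) (hde : d = 2 * e + 1) (hmf : m = 6 * e + 2 * f + 3)
    {Q : ℚ} (hQ : Q = p) {ε : ℚ} (hε : ε = 1 ∨ ε = -1) :
      HoldsDesign (doCode p l F : Set (F → ZMod p)) 2 (p ^ m)
        (Q^(m-1) * (Q - 1))
        ((Q^m - Q^(m-1) - 1) * (Q^(2*m+2*d-1) + Q^(2*m+d) - Q^(2*m+d-1)
          - Q^(2*m) - Q^(2*m-1) + Q^(2*m-2*d) - Q^(2*m-3*d) + Q^(2*m-3*d-1)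
          + Q^(m+2*d-1) - Q^m + Q^(m-2*d) - Q^(m-2*d-1) + Q^(2*d) - 1)
          / (Q^(2*d) - 1)) ∧
      HoldsDesign (doCode p l F : Set (F → ZMod p)) 2 (p ^ m)
        (Q^((m+d-2)/2) * (Q - 1) * (Q^((m-d)/2) + ε))
        (1 / 2 * Q^(m-d-1) * (Q^((m+d-2)/2) * (Q - 1) * (Q^((m-d)/2) + ε) - 1)
          * (Q^(m-d) - 1)) ∧
      HoldsDesign (doCode p l F : Set (F → ZMod p)) 2 (p ^ m)
        (Q^((m+2*d-1)/2) * (Q^((m-2*d+1)/2) - Q^((m-2*d-1)/2) + ε * (-1)^((p-1)/2)))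
        (1 / 2 * Q^((m-2*d-1)/2) * (Q^((m-2*d+1)/2) - Q^((m-2*d-1)/2) + ε * (-1)^((p-1)/2))
          * (Q^((m+2*d-1)/2) * (Q^((m-2*d+1)/2) - Q^((m-2*d-1)/2) + ε * (-1)^((p-1)/2)) - 1)
          * (Q^(m-d) - 1) / (Q^(2*d) - 1)) ∧
      (d ≠ 1 →
      HoldsDesign (doCode p l F : Set (F → ZMod p)) 2 (p ^ m)
        (Q^((m-1)/2) * (Q^((m+1)/2) - Q^((m-1)/2) + ε * (-1)^((p-1)/2)))
        (Q^((m+4*d-1)/2) * (Q^((m+1)/2) - Q^((m-1)/2) + ε * (-1)^((p-1)/2))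
          * (Q^((m-1)/2) * (Q^((m+1)/2) - Q^((m-1)/2) + ε * (-1)^((p-1)/2)) - 1)
          * (Q^m - Q^(m-d) - Q^(m-2*d) + 1) / (2 * (Q^(2*d) - 1))) ∧
      HoldsDesign (doCode p l F : Set (F → ZMod p)) 2 (p ^ m)
        (Q^((m+d-2)/2) * (Q^((m-d+2)/2) - Q^((m-d)/2) + ε))
        (1 / 2 * Q^(m-d-1) * (Q^((m-d+2)/2) - Q^((m-d)/2) + ε)
          * (Q^((m+d-2)/2) * (Q^((m-d+2)/2) - Q^((m-d)/2) + ε) - 1) * (Q^((m-d)/2) + ε))) ∧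
      (d = 1 →
      HoldsDesign (doCode p l F : Set (F → ZMod p)) 2 (p ^ m)
        (Q^((m-1)/2) * (Q^((m+1)/2) - Q^((m-1)/2) + ε))
        (Q^((m+3)/2) * (Q^((m+1)/2) - Q^((m-1)/2) + ε)
          * (Q^((m-1)/2) * (Q^((m+1)/2) - Q^((m-1)/2) + ε) - 1)
          * (Q^m - Q^(m-1) - Q^(m-2) + 1) / (2 * (Q^2 - 1))
        + 1 / 2 * Q^(m-2) * (Q^((m+1)/2) - Q^((m-1)/2) + ε)
          * (Q^((m-1)/2) * (Q^((m+1)/2) - Q^((m-1)/2) + ε) - 1) * (Q^((m-1)/2) + ε))) := by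
  have hp' : p.Prime := Fact.out
  have h3 := three_le_of_ne_two hp
  obtain ⟨⟨hN0, hN0p⟩, ⟨hN1, -⟩, ⟨hN2, hN2p⟩⟩ := card_radDim_of_odd_eq
    (N := fun j => ((univ.filter fun w : F × F => radDim p l w = d * j).card : ℚ))
    hp hF hl hg hd hmn hn hn3 rfl rfl fun _ => rfl
  have hA : ∀ S : ℤ, S = 1 ∨ S = -1 → ((univ.filter fun w : F × F =>
      amplitude p l w = S * p ^ (4 * e + f + 2)).card : ℚ) =
      p ^ m * (p ^ m - 1) / 2 * (1 / p ^ d + S / p ^ (4 * e + f + 2)) := fun S hS =>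
    card_amplitude_of_add_eq hp hF hl hg hd hmn hn hn3 (by omega) hS
  have hB : ∀ (j R : ℕ), m + d * j + 1 = 2 * R →
      ((univ.filter fun w : F × F => m + radDim p l w + 1 = 2 * R).card : ℚ) =
      (univ.filter fun w : F × F => radDim p l w = d * j).card := by
    intro j R hR
    congr 2
    ext w
    simp only [mem_filter, mem_univ, true_and]
    omega
  have hΔ := excess_le_of_odd (F := F) hp hF hl hg hd hde hmf
  obtain ⟨S, hS, rfl⟩ := exists_int_sign hε
  -- The factor `(-1)^((p-1)/2)` merely permutes the two signs, both of which occur.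
  obtain ⟨S', hS', hSS'⟩ := exists_int_sign_mul hS ((p - 1) / 2)
  have hzero : ∀ (S : ℤ) (R : ℕ), S = 1 ∨ S = -1 → R = 5 * e + f + 3 ∨ R = 3 * e + f + 2 →
      R ≠ 4 * e + f + 2 →
      ((univ.filter fun w : F × F => amplitude p l w = S * p ^ R).card : ℚ) = 0 :=
    fun S R hS hR hR' => card_amplitude_eq_zero hp hF hl hg hd hS (by omega)
      (fun j hj => by interval_cases j <;> omega)
  rw [hSS']
  have x1 : (m+d-2)/2 = 4*e+f+1 := by omega
  have x2 : (m-d)/2 = 2*e+f+1 := by omega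
  have x3 : m-d-1 = 4*e+2*f+1 := by omega
  have x4 : m-d = 4*e+2*f+2 := by omega
  have x8 : (m-1)/2 = 3*e+f+1 := by omega
  have x9 : (m+1)/2 = 3*e+f+2 := by omega
  have x13 : 2*d = 4*e+2 := by omega
  refine ⟨?_, ?_, ?_, fun hd1 => ⟨?_, ?_⟩, fun hd1 => ?_⟩
  -- The arrows make `simp` rewrite a whole exponent before its subterms, so that `2 * m + 2 * d -
  -- 1` is replaced before `2 * m` or `2 * d` can be.
  · simp only [
      ↓show m - 1 = 6 * e + 2 * f + 2 by omega,
      ↓show 2 * m + 2 * d - 1 = 16 * e + 4 * f + 7 by omega,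
      ↓show 2 * m + d - 1 = 14 * e + 4 * f + 6 by omega,
      ↓show 2 * m + d = 14 * e + 4 * f + 7 by omega,
      ↓show 2 * m - 1 = 12 * e + 4 * f + 5 by omega,
      ↓show 2 * m - 2 * d = 8 * e + 4 * f + 4 by omega,
      ↓show 2 * m - 3 * d - 1 = 6 * e + 4 * f + 2 by omega,
      ↓show 2 * m - 3 * d = 6 * e + 4 * f + 3 by omega,
      ↓show 2 * m = 12 * e + 4 * f + 6 by omega,
      ↓show m + 2 * d - 1 = 10 * e + 2 * f + 4 by omega,
      ↓show m - 2 * d - 1 = 2 * e + 2 * f by omega,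
      ↓show m - 2 * d = 2 * e + 2 * f + 1 by omega, ↓x13]
    have h := holdsDesign_odd_mul_sub_one hp hF hl hg hd hmn hn3 hef hde hmf hΔ (fun _ => rfl)
      hN0 hN1 hN2 hQ
    rw [← hmf] at h
    exact h
  · simp only [↓x1, ↓x2, ↓x3, ↓x4]
    exact holdsDesign_odd_middle_sub_one_mul hp hF hef hde hmf hΔ hA hS hQ
  · simp only [↓show (m+2*d-1)/2 = 5*e+f+2 by omega, ↓show (m-2*d+1)/2 = e+f+1 by omega,
      ↓show (m-2*d-1)/2 = e+f by omega, ↓x4, ↓x13]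
    have hB2 := hB 2 (5 * e + f + 3) (by omega)
    exact holdsDesign_odd_top_add hp hF hef hde hmf hΔ hS'
      (hzero S' _ hS' (Or.inl rfl) (by omega)) (hB2.trans hN2) (hN2p.trans_eq hB2.symm) hQ
  · simp only [↓x8, ↓x9, ↓show (m+4*d-1)/2 = 7*e+f+3 by omega, ↓x4,
      ↓show m - 2 * d = 2 * e + 2 * f + 1 by omega, ↓x13]
    have hB2 := hB 0 (3 * e + f + 2) (by omega)
    have h := holdsDesign_odd_bottom_add hp hF hef hde hmf hΔ hS'
      (hzero S' _ hS' (Or.inr rfl) (by omega)) (hB2.trans hN0) (hN0p.trans_eq hB2.symm) hQ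
    rw [← hmf] at h
    exact h
  · simp only [↓x1, ↓x2, ↓x3, ↓show (m-d+2)/2 = 2*e+f+2 by omega]
    exact holdsDesign_odd_middle_add hp hF hef hde hmf hΔ hS (hA S hS)
      (card_radDim_eq_zero hp hF hl hg hd fun j hj => by interval_cases j <;> omega) hQ
  -- Since `e = 0`, the bottom and middle values of `R` are both `f + 2`.
  · have he : e = 0 := by omega
    subst he
    subst hd1
    simp only [mul_zero, zero_add, pow_one] at hmf hef hA hΔ hN0
    simp only [↓show (m-1)/2 = f+1 by omega, ↓show (m+1)/2 = f+2 by omega,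
      ↓show (m+3)/2 = f+3 by omega, ↓show m-1 = 2*f+2 by omega, ↓show m-2 = 2*f+1 by omega]
    have hB2 := hB 0 (f + 2) (by omega)
    have h := holdsDesign_odd_bottom_add_of_one hp hF hef hmf hΔ hS (hA S hS) (hB2.trans hN0)
      (hN0p.trans_eq hB2.symm) hQ
    rw [← hmf] at h
    exact h

end OddQuotientOddDegreeFamily

/-! ### Designs for `m / d` odd and `d` even. -/

section OddQuotientEvenDegree

variable {F : Type*} [Field F] [Fintype F] [DecidableEq F] {p m l : ℕ} [Fact p.Prime]
  [Algebra (ZMod p) F] [CharP F p]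

/-- With `Δ = (p - 1) p^R`, the dangerous case is a weight whose excess is `-(p - 1) p^R'`. It is
harmless if `R'` is strictly below `R`; if `R' = R`, a gap of two between `R` and `m` is needed. -/
theorem excess_min_sub_one_mul (hp : p ≠ 2) {S : ℤ} (hS : S = 1 ∨ S = -1) {R R' : ℕ}
    (hR : R + 1 ≤ m) (hR' : R' + 1 ≤ R ∨ R' ≤ R ∧ S = 1 ∨ R' = R ∧ R + 2 ≤ m) :
    ((p : ℤ) - 1) * ((p - 1) * p ^ R) - (p - 2) * ((p - 1) * (S * p ^ R')) < (p - 1) * p ^ m := by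
  have h3 := three_le_of_ne_two hp
  have hpR : (p : ℤ) * p ^ R ≤ p ^ m := by
    rw [← pow_succ']
    exact pow_le_pow_right₀ (by linarith) hR
  have h0 : (0 : ℤ) < p ^ R := by positivity
  have h0' : (0 : ℤ) < p ^ R' := by positivity
  rcases hR' with h | ⟨-, rfl⟩ | ⟨rfl, h⟩
  · refine excess_min_of_neg_le hp h0 hpR ?_
    have h1 := (sub_one_mul_pow_lt p h).le
    rcases hS with rfl | rfl
    · have : (0 : ℤ) ≤ (p - 1) * p ^ R' := mul_nonneg (by linarith) h0'.le
      linarith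
    · linarith
  · refine excess_min_of_neg_le hp h0 hpR ?_
    have : (0 : ℤ) ≤ (p - 1) * p ^ R' := mul_nonneg (by linarith) h0'.le
    linarith
  · have h1 := two_mul_pow_le_pow p (show R' + 1 + 1 ≤ m by omega)
    rw [pow_succ] at h1
    have h2 : ((p : ℤ) - 1) * (2 * (p ^ R' * p)) ≤ (p - 1) * p ^ m :=
      mul_le_mul_of_nonneg_left h1 (by linarith)
    have h4 : (0 : ℤ) < (p - 1) * p ^ R' := mul_pos (by linarith) h0'
    rcases hS with rfl | rfl <;> nlinarith

theorem excess_min_add (hp : p ≠ 2) {S : ℤ} (hS : S = 1 ∨ S = -1) {R R' : ℕ} (hR : R + 1 ≤ m)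
    (hR' : R' ≤ R) :
    ((p : ℤ) - 1) * ((p - 1) * p ^ R) + (p - 2) * (S * p ^ R') < (p - 1) * p ^ m := by
  have h3 := three_le_of_ne_two hp
  have hpR : (p : ℤ) * p ^ R ≤ p ^ m := by
    rw [← pow_succ']
    exact pow_le_pow_right₀ (by linarith) hR
  have h := excess_min_of_neg_le (D := -(S * p ^ R')) hp (show (0 : ℤ) < p ^ R by positivity) hpR (by
    have h1 := le_abs_self (S * (p : ℤ) ^ R')
    rw [abs_sign_mul_pow hS] at h1
    have h2 : (p : ℤ) ^ R' ≤ p ^ R := pow_le_pow_right₀ (by linarith) hR'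
    linarith)
  linarith

theorem holdsDesign_even_bottom_sub_one_mul (hp : p ≠ 2) (hF : Fintype.card F = p ^ m) {d e f : ℕ}
    (hde : d = 2 * e + 2) (hmf : m = 6 * e + 2 * f + 6)
    (hΔ : ∀ v : (F × F) × (F × ZMod p), v ≠ 0 → excess p l v ≤ (p - 1) * p ^ (5 * e + f + 5))
    {S : ℤ} (hS : S = 1 ∨ S = -1)
    (hA : ((univ.filter fun w : F × F => amplitude p l w = (-S : ℤ) * p ^ (3 * e + f + 3)).card : ℚ) =
      (p ^ m - 1) * (p ^ d) ^ 2 * (p ^ m - p ^ m / p ^ d - p ^ m / (p ^ d) ^ 2 + 1) /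
        ((p ^ d) ^ 2 - 1) / 2)
    (hA0 : 0 < ((univ.filter fun w : F × F => amplitude p l w = (-S : ℤ) * p ^ (3 * e + f + 3)).card : ℚ))
    {Q : ℚ} (hQ : Q = p) :
      HoldsDesign (doCode p l F : Set (F → ZMod p)) 2 (p ^ m)
        (Q^(3*e+f+2) * (Q - 1) * (Q^(3*e+f+3) + S))
        (Q^(7*e+f+6) * (Q^(3*e+f+3) + S) * (Q^(3*e+f+2) * (Q - 1) * (Q^(3*e+f+3) + S) - 1)
          * (Q^(6*e+2*f+6) - Q^(4*e+2*f+4) - Q^(2*e+2*f+2) + 1) / (2 * (Q^(4*e+4) - 1))) := by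
  subst hQ
  have hpos : (0 : ℚ) < p := by exact_mod_cast (Fact.out : p.Prime).pos
  have hS' : -S = 1 ∨ -S = -1 := by omega
  refine holdsDesign_sub_one_mul hp hF (by omega) hΔ hS' (R := 3 * e + f + 3) (r := 6 * e + 2 * f + 6)
    (by omega) (by omega) (excess_min_sub_one_mul hp hS' (by omega) (Or.inl (by omega))) hA (hA ▸ hA0) ?_ ?_
  · rw [hmf]; push_cast; ring
  · have ha : 0 < (p : ℚ) ^ e := by positivity
    have hb : 0 < (p : ℚ) ^ f := by positivity
    have hden := (pow_sub_one_pos_of_prime (p := p) (k := 4 * e + 4) (by omega)).ne'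
    simp only [hmf, hde, pow_add, pow_mul', mul_add] at hden ⊢
    generalize (p : ℚ) ^ e = a at *
    generalize (p : ℚ) ^ f = b at *
    generalize (p : ℚ) = Q at *
    rcases hS with rfl | rfl <;> push_cast <;> field_simp

theorem holdsDesign_even_bottom_add (hp : p ≠ 2) (hF : Fintype.card F = p ^ m) {d e f : ℕ}
    (hde : d = 2 * e + 2) (hmf : m = 6 * e + 2 * f + 6)
    (hΔ : ∀ v : (F × F) × (F × ZMod p), v ≠ 0 → excess p l v ≤ (p - 1) * p ^ (5 * e + f + 5))
    {S : ℤ} (hS : S = 1 ∨ S = -1)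
    (hA : ((univ.filter fun w : F × F => amplitude p l w = S * p ^ (3 * e + f + 3)).card : ℚ) =
      (p ^ m - 1) * (p ^ d) ^ 2 * (p ^ m - p ^ m / p ^ d - p ^ m / (p ^ d) ^ 2 + 1) /
        ((p ^ d) ^ 2 - 1) / 2)
    (hA0 : 0 < ((univ.filter fun w : F × F => amplitude p l w = S * p ^ (3 * e + f + 3)).card : ℚ))
    (hB : ((univ.filter fun w : F × F => m + radDim p l w + 1 = 2 * (3 * e + f + 3)).card : ℚ) = 0)
    {Q : ℚ} (hQ : Q = p) :
      HoldsDesign (doCode p l F : Set (F → ZMod p)) 2 (p ^ m)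
        (Q^(3*e+f+2) * (Q^(3*e+f+4) - Q^(3*e+f+3) + S))
        (1 / 2 * Q^(7*e+f+6) * (Q^(3*e+f+4) - Q^(3*e+f+3) + S)
          * (Q^(3*e+f+2) * (Q^(3*e+f+4) - Q^(3*e+f+3) + S) - 1)
          * (Q^(6*e+2*f+6) - Q^(4*e+2*f+4) - Q^(2*e+2*f+2) + 1) / (Q^(4*e+4) - 1)) := by
  subst hQ
  have hpos : (0 : ℚ) < p := by exact_mod_cast (Fact.out : p.Prime).pos
  refine holdsDesign_add hp hF (by omega) hΔ hS (R := 3 * e + f + 3) (r := 6 * e + 2 * f + 6)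
    (by omega) (by omega) (excess_min_add hp hS (by omega) (by omega)) hA hB
    (by rw [← hA, mul_zero, zero_div, add_zero]; exact hA0) ?_ ?_
  · rw [hmf]; ring
  · have ha : 0 < (p : ℚ) ^ e := by positivity
    have hb : 0 < (p : ℚ) ^ f := by positivity
    have hden := (pow_sub_one_pos_of_prime (p := p) (k := 4 * e + 4) (by omega)).ne'
    simp only [hmf, hde, pow_add, pow_mul', mul_add] at hden ⊢
    generalize (p : ℚ) ^ e = a at *
    generalize (p : ℚ) ^ f = b at *
    generalize (p : ℚ) = Q at *
    rcases hS with rfl | rfl <;> field_simp <;> ring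

theorem holdsDesign_even_middle_sub_one_mul (hp : p ≠ 2) (hF : Fintype.card F = p ^ m) {d e f : ℕ}
    (hde : d = 2 * e + 2) (hmf : m = 6 * e + 2 * f + 6)
    (hΔ : ∀ v : (F × F) × (F × ZMod p), v ≠ 0 → excess p l v ≤ (p - 1) * p ^ (5 * e + f + 5))
    {S : ℤ} (hS : S = 1 ∨ S = -1)
    (hA : ((univ.filter fun w : F × F => amplitude p l w = (-S : ℤ) * p ^ (4 * e + f + 4)).card : ℚ) =
      p ^ m * (p ^ m - 1) / 2 * (1 / p ^ d + (-S : ℤ) / p ^ (4 * e + f + 4)))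
    {Q : ℚ} (hQ : Q = p) :
      HoldsDesign (doCode p l F : Set (F → ZMod p)) 2 (p ^ m)
        (Q^(4*e+f+3) * (Q - 1) * (Q^(2*e+f+2) + S))
        (1 / 2 * Q^(4*e+2*f+3) * (Q^(4*e+2*f+4) - 1)
          * (Q^(4*e+f+3) * (Q - 1) * (Q^(2*e+f+2) + S) - 1)) := by
  subst hQ
  have hpos : (0 : ℚ) < p := by exact_mod_cast (Fact.out : p.Prime).pos
  have hS' : -S = 1 ∨ -S = -1 := by omega
  have hA0 := card_amplitude_pos_of_add_eq (p := p) (m := m) (d := d) (R := 4 * e + f + 4)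
    (by omega) (by omega) hS'
  rw [← hA] at hA0
  refine holdsDesign_sub_one_mul hp hF (by omega) hΔ hS' (R := 4 * e + f + 4) (r := 4 * e + 2 * f + 4)
    (by omega) (by omega) (excess_min_sub_one_mul hp hS' (by omega) (Or.inl (by omega))) hA (hA ▸ hA0) ?_ ?_
  · rw [hmf]; push_cast; ring
  · have ha : 0 < (p : ℚ) ^ e := by positivity
    have hb : 0 < (p : ℚ) ^ f := by positivity
    have hden := (pow_sub_one_pos_of_prime (p := p) (k := 4 * e + 4) (by omega)).ne'
    simp only [hmf, hde, pow_add, pow_mul', mul_add] at hden ⊢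
    generalize (p : ℚ) ^ e = a at *
    generalize (p : ℚ) ^ f = b at *
    generalize (p : ℚ) = Q at *
    rcases hS with rfl | rfl <;> push_cast <;> field_simp <;> ring

theorem holdsDesign_even_middle_add (hp : p ≠ 2) (hF : Fintype.card F = p ^ m) {d e f : ℕ}
    (hde : d = 2 * e + 2) (hmf : m = 6 * e + 2 * f + 6)
    (hΔ : ∀ v : (F × F) × (F × ZMod p), v ≠ 0 → excess p l v ≤ (p - 1) * p ^ (5 * e + f + 5))
    {S : ℤ} (hS : S = 1 ∨ S = -1)
    (hA : ((univ.filter fun w : F × F => amplitude p l w = S * p ^ (4 * e + f + 4)).card : ℚ) =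
      p ^ m * (p ^ m - 1) / 2 * (1 / p ^ d + S / p ^ (4 * e + f + 4)))
    (hB : ((univ.filter fun w : F × F => m + radDim p l w + 1 = 2 * (4 * e + f + 4)).card : ℚ) = 0)
    {Q : ℚ} (hQ : Q = p) :
      HoldsDesign (doCode p l F : Set (F → ZMod p)) 2 (p ^ m)
        (Q^(4*e+f+3) * (Q^(2*e+f+3) - Q^(2*e+f+2) + S))
        (1 / 2 * Q^(4*e+2*f+3) * (Q^(2*e+f+3) - Q^(2*e+f+2) + S)
          * (Q^(4*e+f+3) * (Q^(2*e+f+3) - Q^(2*e+f+2) + S) - 1) * (Q^(2*e+f+2) + S)) := by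
  subst hQ
  have hpos : (0 : ℚ) < p := by exact_mod_cast (Fact.out : p.Prime).pos
  have hA0 := card_amplitude_pos_of_add_eq (p := p) (m := m) (d := d) (R := 4 * e + f + 4)
    (by omega) (by omega) hS
  rw [← hA] at hA0
  refine holdsDesign_add hp hF (by omega) hΔ hS (R := 4 * e + f + 4) (r := 4 * e + 2 * f + 4)
    (by omega) (by omega) (excess_min_add hp hS (by omega) (by omega)) hA hB
    (by rw [← hA, mul_zero, zero_div, add_zero]; exact hA0) ?_ ?_
  · rw [hmf]; ring
  · have ha : 0 < (p : ℚ) ^ e := by positivity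
    have hb : 0 < (p : ℚ) ^ f := by positivity
    have hden := (pow_sub_one_pos_of_prime (p := p) (k := 4 * e + 4) (by omega)).ne'
    simp only [hmf, hde, pow_add, pow_mul', mul_add] at hden ⊢
    generalize (p : ℚ) ^ e = a at *
    generalize (p : ℚ) ^ f = b at *
    generalize (p : ℚ) = Q at *
    rcases hS with rfl | rfl <;> field_simp <;> ring

/-- Radical dimension `2d`, so the excess attains the extreme value `(p - 1) p^R` in absolute value.
For `m = 6` one has `R = m - 1` and the minimum distance argument covers only the smaller of the two
weights, that of positive amplitude; `hSm` expresses this. -/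
theorem holdsDesign_even_top_sub_one_mul (hp : p ≠ 2) (hF : Fintype.card F = p ^ m) {d e f : ℕ}
    (hde : d = 2 * e + 2) (hmf : m = 6 * e + 2 * f + 6)
    (hΔ : ∀ v : (F × F) × (F × ZMod p), v ≠ 0 → excess p l v ≤ (p - 1) * p ^ (5 * e + f + 5))
    {S : ℤ} (hS : S = 1 ∨ S = -1)
    (hSm : S = -1 ∨ 8 ≤ m)
    (hA : ((univ.filter fun w : F × F => amplitude p l w = (-S : ℤ) * p ^ (5 * e + f + 5)).card : ℚ) =
      (p ^ m - 1) * (p ^ m / p ^ d - 1) / ((p ^ d) ^ 2 - 1) / 2)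
    (hA0 : 0 < ((univ.filter fun w : F × F => amplitude p l w = (-S : ℤ) * p ^ (5 * e + f + 5)).card : ℚ))
    {Q : ℚ} (hQ : Q = p) :
      HoldsDesign (doCode p l F : Set (F → ZMod p)) 2 (p ^ m)
        (Q^(5*e+f+4) * (Q - 1) * (Q^(e+f+1) + S))
        (1 / 2 * Q^(e+f) * (Q^(e+f+1) + S)
          * (Q^(5*e+f+4) * (Q - 1) * (Q^(e+f+1) + S) - 1)
          * (Q^(4*e+2*f+4) - 1) / (Q^(4*e+4) - 1)) := by
  subst hQ
  have hpos : (0 : ℚ) < p := by exact_mod_cast (Fact.out : p.Prime).pos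
  have hS' : -S = 1 ∨ -S = -1 := by omega
  refine holdsDesign_sub_one_mul hp hF (by omega) hΔ hS' (R := 5 * e + f + 5) (r := 2 * e + 2 * f + 2)
    (by omega) (by omega) (excess_min_sub_one_mul hp hS' (by omega) (by omega)) hA (hA ▸ hA0) ?_ ?_
  · rw [hmf]; push_cast; ring
  · have ha : 0 < (p : ℚ) ^ e := by positivity
    have hb : 0 < (p : ℚ) ^ f := by positivity
    have hden := (pow_sub_one_pos_of_prime (p := p) (k := 4 * e + 4) (by omega)).ne'
    simp only [hmf, hde, pow_add, pow_mul', pow_one, mul_add] at hden ⊢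
    generalize (p : ℚ) ^ e = a at *
    generalize (p : ℚ) ^ f = b at *
    generalize (p : ℚ) = Q at *
    rcases hS with rfl | rfl <;> push_cast <;> field_simp

theorem holdsDesign_even_top_add (hp : p ≠ 2) (hF : Fintype.card F = p ^ m) {d e f : ℕ}
    (hde : d = 2 * e + 2) (hmf : m = 6 * e + 2 * f + 6)
    (hΔ : ∀ v : (F × F) × (F × ZMod p), v ≠ 0 → excess p l v ≤ (p - 1) * p ^ (5 * e + f + 5))
    {S : ℤ} (hS : S = 1 ∨ S = -1)
    (hA : ((univ.filter fun w : F × F => amplitude p l w = S * p ^ (5 * e + f + 5)).card : ℚ) =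
      (p ^ m - 1) * (p ^ m / p ^ d - 1) / ((p ^ d) ^ 2 - 1) / 2)
    (hA0 : 0 < ((univ.filter fun w : F × F => amplitude p l w = S * p ^ (5 * e + f + 5)).card : ℚ))
    (hB : ((univ.filter fun w : F × F => m + radDim p l w + 1 = 2 * (5 * e + f + 5)).card : ℚ) = 0)
    {Q : ℚ} (hQ : Q = p) :
      HoldsDesign (doCode p l F : Set (F → ZMod p)) 2 (p ^ m)
        (Q^(5*e+f+4) * (Q^(e+f+2) - Q^(e+f+1) + S))
        (1 / 2 * Q^(e+f) * (Q^(e+f+2) - Q^(e+f+1) + S)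
          * (Q^(5*e+f+4) * (Q^(e+f+2) - Q^(e+f+1) + S) - 1)
          * (Q^(4*e+2*f+4) - 1) / (Q^(4*e+4) - 1)) := by
  subst hQ
  have hpos : (0 : ℚ) < p := by exact_mod_cast (Fact.out : p.Prime).pos
  refine holdsDesign_add hp hF (by omega) hΔ hS (R := 5 * e + f + 5) (r := 2 * e + 2 * f + 2)
    (by omega) (by omega) (excess_min_add hp hS (by omega) (by omega)) hA hB
    (by rw [← hA, mul_zero, zero_div, add_zero]; exact hA0) ?_ ?_
  · rw [hmf]; ring
  · have ha : 0 < (p : ℚ) ^ e := by positivity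
    have hb : 0 < (p : ℚ) ^ f := by positivity
    have hden := (pow_sub_one_pos_of_prime (p := p) (k := 4 * e + 4) (by omega)).ne'
    simp only [hmf, hde, pow_add, pow_mul', pow_one, mul_add] at hden ⊢
    generalize (p : ℚ) ^ e = a at *
    generalize (p : ℚ) ^ f = b at *
    generalize (p : ℚ) = Q at *
    rcases hS with rfl | rfl <;> field_simp <;> ring

theorem holdsDesign_even_mul_sub_one (hp : p ≠ 2) (hF : Fintype.card F = p ^ m) (hl : 0 < l)
    (hg : m.gcd (2 * l) = m.gcd l) {d n e f : ℕ} (hd : d = m.gcd l) (hmn : m = d * n) (hn3 : 3 ≤ n)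
    (hde : d = 2 * e + 2) (hmf : m = 6 * e + 2 * f + 6)
    (hΔ : ∀ v : (F × F) × (F × ZMod p), v ≠ 0 → excess p l v ≤ (p - 1) * p ^ (5 * e + f + 5))
    {N : ℕ → ℚ} (hN : ∀ j, N j = (univ.filter fun w : F × F => radDim p l w = d * j).card)
    (hN1 : N 1 = (p ^ m - 1) * (p ^ m / p ^ d))
    (hN2 : N 2 = (p ^ m - 1) * (p ^ m / p ^ d - 1) / ((p ^ d) ^ 2 - 1)) {Q : ℚ} (hQ : Q = p) :
      HoldsDesign (doCode p l F : Set (F → ZMod p)) 2 (p ^ m)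
        (Q^(6*e+2*f+5) * (Q - 1))
        ((Q^(6*e+2*f+6) - Q^(6*e+2*f+5) - 1)
          * (Q^(10*e+4*f+10) - Q^(8*e+4*f+8) + Q^(6*e+4*f+6) - Q^(2*e+2*f+2) + 1)) := by
  subst hQ
  have hpos : (0 : ℚ) < p := by exact_mod_cast (Fact.out : p.Prime).pos
  refine holdsDesign_mul_sub_one hp hF (by omega) hΔ
    (sub_one_mul_pow_lt p (by omega))
    (sum_zero_excess_of_odd hp hF hl hg hd hmn hn3 hN) ?_ ?_
  · rw [hmf]; ring
  · rw [hN1, hN2, if_neg (Nat.not_odd_iff_even.2 ⟨3 * e + f + 3, by omega⟩),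
      if_neg (Nat.not_odd_iff_even.2 ⟨4 * e + f + 4, by omega⟩),
      if_neg (Nat.not_odd_iff_even.2 ⟨5 * e + f + 5, by omega⟩)]
    have ha : 0 < (p : ℚ) ^ e := by positivity
    have hb : 0 < (p : ℚ) ^ f := by positivity
    have hden := (pow_sub_one_pos_of_prime (p := p) (k := 4 * e + 4) (by omega)).ne'
    simp only [hmf, hde, pow_add, pow_mul', pow_one, mul_add] at hden ⊢
    generalize (p : ℚ) ^ e = a at *
    generalize (p : ℚ) ^ f = b at *
    generalize (p : ℚ) = Q at *
    field_simp
    ring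

/-- Now `m` and `d` are even, hence so are all ranks, and the bound is the level-0 excess of a form
with radical dimension `2d` and positive sum. -/
theorem excess_le_of_odd_of_even (hp : p ≠ 2) (hF : Fintype.card F = p ^ m) (hl : 0 < l)
    (hg : m.gcd (2 * l) = m.gcd l) {d e f : ℕ} (hd : d = m.gcd l)
    (hde : d = 2 * e + 2) (hmf : m = 6 * e + 2 * f + 6)
    (v : (F × F) × (F × ZMod p)) (hv : v ≠ 0) : excess p l v ≤ (p - 1) * p ^ (5 * e + f + 5) := by
  have h3 := three_le_of_ne_two hp
  have hX : (0 : ℤ) < p ^ (5 * e + f + 5) := by positivity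
  refine excess_le hp hF (mul_nonneg (by linarith) hX.le) (fun w hw he => ?_)
    (fun w hw ho => ?_) v hv
  · obtain ⟨j, hj, hr⟩ := exists_radDim_eq_of_odd hp hF hl hg hd hw
    obtain ⟨k, hk⟩ := he
    obtain ⟨h1, h2⟩ := amplitude_bounds (l := l) (w := w) (R := k) hp hF (by omega)
    have hk' : k ≤ 5 * e + f + 5 := by interval_cases j <;> omega
    have h4 : (p : ℤ) ^ k ≤ p ^ (5 * e + f + 5) := pow_le_pow_right₀ (by linarith) hk'
    exact ⟨h1.trans (mul_le_mul_of_nonneg_left h4 (by linarith)), by nlinarith⟩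
  · obtain ⟨j, hj, hr⟩ := exists_radDim_eq_of_odd hp hF hl hg hd hw
    obtain ⟨k, hk⟩ := ho
    interval_cases j <;> omega

/-- The designs for `m / d` odd and `d` even. -/
theorem holdsDesign_of_odd_of_even (hp : p ≠ 2) (hF : Fintype.card F = p ^ m) (hl : 0 < l)
    (hg : m.gcd (2 * l) = m.gcd l) {d n e f s : ℕ} (hd : d = m.gcd l) (hmn : m = d * n)
    (hn : Odd n) (hn3 : 3 ≤ n) (hde : d = 2 * e + 2) (hmf : m = 6 * e + 2 * f + 6)
    (hs : s = 3 * e + f + 3) {Q : ℚ} (hQ : Q = p) {ε : ℚ} (hε : ε = 1 ∨ ε = -1) :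
      HoldsDesign (doCode p l F : Set (F → ZMod p)) 2 (p ^ m)
        (Q^(s-1) * (Q - 1) * (Q^s + ε))
        (Q^(s+2*d-1) * (Q^s + ε) * (Q^(s-1) * (Q - 1) * (Q^s + ε) - 1)
          * (Q^m - Q^(m-d) - Q^(m-2*d) + 1) / (2 * (Q^(2*d) - 1))) ∧
      HoldsDesign (doCode p l F : Set (F → ZMod p)) 2 (p ^ m)
        (Q^(s-1) * (Q^(s+1) - Q^s + ε))
        (1 / 2 * Q^(s+2*d-1) * (Q^(s+1) - Q^s + ε)
          * (Q^(s-1) * (Q^(s+1) - Q^s + ε) - 1)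
          * (Q^m - Q^(m-d) - Q^(m-2*d) + 1) / (Q^(2*d) - 1)) ∧
      HoldsDesign (doCode p l F : Set (F → ZMod p)) 2 (p ^ m)
        (Q^((m+d-2)/2) * (Q - 1) * (Q^((m-d)/2) + ε))
        (1 / 2 * Q^(m-d-1) * (Q^(m-d) - 1)
          * (Q^((m+d-2)/2) * (Q - 1) * (Q^((m-d)/2) + ε) - 1)) ∧
      HoldsDesign (doCode p l F : Set (F → ZMod p)) 2 (p ^ m)
        (Q^((m+d-2)/2) * (Q^((m-d+2)/2) - Q^((m-d)/2) + ε))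
        (1 / 2 * Q^(m-d-1) * (Q^((m-d+2)/2) - Q^((m-d)/2) + ε)
          * (Q^((m+d-2)/2) * (Q^((m-d+2)/2) - Q^((m-d)/2) + ε) - 1) * (Q^((m-d)/2) + ε)) ∧
      (ε = -1 ∨ 8 ≤ m →
      HoldsDesign (doCode p l F : Set (F → ZMod p)) 2 (p ^ m)
        (Q^((m+2*d-2)/2) * (Q - 1) * (Q^((m-2*d)/2) + ε))
        (1 / 2 * Q^(s-d-1) * (Q^((m-2*d)/2) + ε)
          * (Q^((m+2*d-2)/2) * (Q - 1) * (Q^((m-2*d)/2) + ε) - 1)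
          * (Q^(m-d) - 1) / (Q^(2*d) - 1))) ∧
      HoldsDesign (doCode p l F : Set (F → ZMod p)) 2 (p ^ m)
        (Q^((m+2*d-2)/2) * (Q^((m-2*d+2)/2) - Q^((m-2*d)/2) + ε))
        (1 / 2 * Q^(s-d-1) * (Q^((m-2*d+2)/2) - Q^((m-2*d)/2) + ε)
          * (Q^((m+2*d-2)/2) * (Q^((m-2*d+2)/2) - Q^((m-2*d)/2) + ε) - 1)
          * (Q^(m-d) - 1) / (Q^(2*d) - 1)) ∧
      HoldsDesign (doCode p l F : Set (F → ZMod p)) 2 (p ^ m)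
        (Q^(m-1) * (Q - 1))
        ((Q^m - Q^(m-1) - 1)
          * (Q^(2*m-d) - Q^(2*m-2*d) + Q^(2*m-3*d) - Q^(m-2*d) + 1)) := by
  obtain ⟨⟨hN0, hN0p⟩, ⟨hN1, -⟩, ⟨hN2, hN2p⟩⟩ := card_radDim_of_odd_eq
    (N := fun j => ((univ.filter fun w : F × F => radDim p l w = d * j).card : ℚ))
    hp hF hl hg hd hmn hn hn3 rfl rfl fun _ => rfl
  -- The signs are biased only at radical dimension `d`; at `0` and `2d` each sign takes exactly
  -- half of the forms.
  have hA : ∀ S : ℤ, S = 1 ∨ S = -1 → ((univ.filter fun w : F × F =>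
      amplitude p l w = S * p ^ (4 * e + f + 4)).card : ℚ) =
      p ^ m * (p ^ m - 1) / 2 * (1 / p ^ d + S / p ^ (4 * e + f + 4)) := fun S hS =>
    card_amplitude_of_add_eq hp hF hl hg hd hmn hn hn3 (by omega) hS
  have hA0 : ∀ S : ℤ, S = 1 ∨ S = -1 → ((univ.filter fun w : F × F =>
      amplitude p l w = S * p ^ (3 * e + f + 3)).card : ℚ) =
      (univ.filter fun w : F × F => radDim p l w = d * 0).card / 2 := fun S hS =>
    card_amplitude_eq_half (j := 0) hp hF hl hd hmn hn (by omega) hS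
  have hA2 : ∀ S : ℤ, S = 1 ∨ S = -1 → ((univ.filter fun w : F × F =>
      amplitude p l w = S * p ^ (5 * e + f + 5)).card : ℚ) =
      (univ.filter fun w : F × F => radDim p l w = d * 2).card / 2 := fun S hS =>
    card_amplitude_eq_half (j := 1) hp hF hl hd hmn hn (by omega) hS
  have hA0p : ∀ S : ℤ, S = 1 ∨ S = -1 → 0 < ((univ.filter fun w : F × F =>
      amplitude p l w = S * p ^ (3 * e + f + 3)).card : ℚ) := fun S hS =>
    (half_pos hN0p).trans_eq (hA0 S hS).symm
  have hA2p : ∀ S : ℤ, S = 1 ∨ S = -1 → 0 < ((univ.filter fun w : F × F =>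
      amplitude p l w = S * p ^ (5 * e + f + 5)).card : ℚ) := fun S hS =>
    (half_pos hN2p).trans_eq (hA2 S hS).symm
  rw [hN0] at hA0
  rw [hN2] at hA2
  have hB : ∀ R : ℕ, ((univ.filter fun w : F × F => m + radDim p l w + 1 = 2 * R).card : ℚ) = 0 :=
    fun R => card_radDim_eq_zero hp hF hl hg hd fun j hj => by interval_cases j <;> omega
  have hΔ := excess_le_of_odd_of_even (F := F) hp hF hl hg hd hde hmf
  obtain ⟨S, hS, rfl⟩ := exists_int_sign hε
  have hS' : -S = 1 ∨ -S = -1 := by omega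
  have x1 : (m+d-2)/2 = 4*e+f+3 := by omega
  have x2 : (m-d)/2 = 2*e+f+2 := by omega
  have x3 : m-d-1 = 4*e+2*f+3 := by omega
  have x4 : m-d = 4*e+2*f+4 := by omega
  have x5 : m-2*d = 2*e+2*f+2 := by omega
  have x6 : 2*d = 4*e+4 := by omega
  have x7 : s-1 = 3*e+f+2 := by omega
  have x8 : s+2*d-1 = 7*e+f+6 := by omega
  have x9 : (m+2*d-2)/2 = 5*e+f+4 := by omega
  have x10 : (m-2*d)/2 = e+f+1 := by omega
  have x11 : s-d-1 = e+f := by omega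
  refine ⟨?_, ?_, ?_, ?_, fun h8 => ?_, ?_, ?_⟩
  · simp only [↓x7, ↓x8, ↓x4, ↓x5, ↓x6, ↓hs]
    have h := holdsDesign_even_bottom_sub_one_mul hp hF hde hmf hΔ hS (hA0 _ hS') (hA0p _ hS') hQ
    rw [← hmf] at h
    exact h
  · simp only [↓x7, ↓x8, ↓x4, ↓x5, ↓x6, ↓show s+1 = 3*e+f+4 by omega, ↓hs]
    have h := holdsDesign_even_bottom_add hp hF hde hmf hΔ hS (hA0 _ hS) (hA0p _ hS) (hB _) hQ
    rw [← hmf] at h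
    exact h
  · simp only [↓x1, ↓x2, ↓x3, ↓x4]
    exact holdsDesign_even_middle_sub_one_mul hp hF hde hmf hΔ hS (hA _ hS') hQ
  · simp only [↓x1, ↓x2, ↓x3, ↓show (m-d+2)/2 = 2*e+f+3 by omega]
    exact holdsDesign_even_middle_add hp hF hde hmf hΔ hS (hA _ hS) (hB _) hQ
  · simp only [↓x9, ↓x10, ↓x11, ↓x4, ↓x6]
    exact holdsDesign_even_top_sub_one_mul hp hF hde hmf hΔ hS
      (h8.imp_left fun h => by exact_mod_cast h) (hA2 _ hS') (hA2p _ hS') hQ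
  · simp only [↓x9, ↓show (m-2*d+2)/2 = e+f+2 by omega, ↓x10, ↓x11, ↓x4, ↓x6]
    exact holdsDesign_even_top_add hp hF hde hmf hΔ hS (hA2 _ hS) (hA2p _ hS) (hB _) hQ
  · simp only [↓show m-1 = 6*e+2*f+5 by omega, ↓show 2*m-d = 10*e+4*f+10 by omega,
      ↓show 2*m-2*d = 8*e+4*f+8 by omega, ↓show 2*m-3*d = 6*e+4*f+6 by omega, ↓x5]
    have h := holdsDesign_even_mul_sub_one hp hF hl hg hd hmn hn3 hde hmf hΔ (fun _ => rfl)
      hN1 hN2 hQ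
    rw [← hmf] at h
    exact h

end OddQuotientEvenDegree

/-! ### Explicit counts for `m / d` even. -/

section EvenQuotientCounts

variable {F : Type*} [Field F] [Fintype F] [DecidableEq F] {p m l : ℕ} [Fact p.Prime]
  [Algebra (ZMod p) F] [CharP F p]

/-- The solution of the system of moment equations. -/
theorem eq_of_moments {N : ℕ → ℚ} {M y : ℚ} (hy : 3 ≤ y)
    (h0 : N 0 + N 1 + N 2 + N 3 = M ^ 4 - 1)
    (h1 : N 0 - y * N 1 + y ^ 2 * N 2 - y ^ 3 * N 3 = M ^ 3 - M)
    (h2 : N 0 + y ^ 2 * N 1 + y ^ 4 * N 2 + y ^ 6 * N 3 = M ^ 2 * (M ^ 2 - 1) * (y + 1))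
    (h3 : N 0 - y ^ 3 * N 1 + y ^ 6 * N 2 - y ^ 9 * N 3 = M * (M ^ 2 - 1) * y ^ 3) :
    N 0 = (M ^ 2 - 1) * (M ^ 2 * (y ^ 6 - y ^ 4 - y) + M * (y ^ 5 - y ^ 4) + y ^ 6) /
      ((y + 1) * (y ^ 2 - 1) * (y ^ 3 + 1)) ∧
    N 1 = (M ^ 2 - 1) * (M ^ 2 * (y ^ 3 + y ^ 2 - 1 - 1 / y - 1 / y ^ 2) + M * (1 - y ^ 3) + y ^ 3) /
      ((y + 1) ^ 2 * (y ^ 2 - 1)) ∧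
    N 2 = (M ^ 2 - 1) * ((M / y + 1) * (M * (y + 1 - 1 / y ^ 2) - y)) /
      ((y + 1) ^ 2 * (y ^ 2 - 1)) ∧
    N 3 = (M ^ 2 - 1) * ((M / y ^ 2 - 1) * (M / y + 1)) / ((y + 1) * (y ^ 2 - 1) * (y ^ 3 + 1)) := by
  have hy0 : y ≠ 0 := by positivity
  have hy1 : y ^ 2 - 1 ≠ 0 := by nlinarith
  have hy2 : y + 1 ≠ 0 := by positivity
  have hy3 : y ^ 3 + 1 ≠ 0 := by positivity
  refine ⟨?_, ?_, ?_, ?_⟩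
  · rw [eq_div_iff (by positivity)]
    -- In each of the four cases the multipliers are, up to sign, the coefficients of the cubic
    -- vanishing at the other three of the nodes `1, -y, y², -y³`.
    linear_combination -h3 + (-y + y ^ 2 - y ^ 3) * h2 - (-y ^ 3 + y ^ 4 - y ^ 5) * h1 + y ^ 6 * h0
  · rw [eq_div_iff (by positivity)]
    field_simp
    linear_combination h3 - (1 + y ^ 2 - y ^ 3) * h2 + (y ^ 2 - y ^ 3 - y ^ 5) * h1 + y ^ 5 * h0
  · rw [eq_div_iff (by positivity)]
    field_simp
    linear_combination h3 - (1 - y - y ^ 3) * h2 + (-y - y ^ 3 + y ^ 4) * h1 - y ^ 4 * h0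
  · rw [eq_div_iff (by positivity)]
    field_simp
    linear_combination -h3 + (1 - y + y ^ 2) * h2 - (-y + y ^ 2 - y ^ 3) * h1 - y ^ 3 * h0

/-- Here `W = p^s` with `s ≥ 4d`. In the first two counts the term in `M²` dominates the one in `M`;
in the last two, the factors containing `M` have the same sign because `W` exceeds the relevant
powers of `y`. -/
theorem pos_of_moments {M y W : ℚ} (hy : 3 ≤ y) (hW : y ^ 4 ≤ W) (hM : M = W ∨ M = -W) :
    0 < (M ^ 2 - 1) * (M ^ 2 * (y ^ 6 - y ^ 4 - y) + M * (y ^ 5 - y ^ 4) + y ^ 6) /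
      ((y + 1) * (y ^ 2 - 1) * (y ^ 3 + 1)) ∧
    0 < (M ^ 2 - 1) * (M ^ 2 * (y ^ 3 + y ^ 2 - 1 - 1 / y - 1 / y ^ 2) + M * (1 - y ^ 3) + y ^ 3) /
      ((y + 1) ^ 2 * (y ^ 2 - 1)) ∧
    0 < (M ^ 2 - 1) * ((M / y + 1) * (M * (y + 1 - 1 / y ^ 2) - y)) /
      ((y + 1) ^ 2 * (y ^ 2 - 1)) ∧
    0 < (M ^ 2 - 1) * ((M / y ^ 2 - 1) * (M / y + 1)) / ((y + 1) * (y ^ 2 - 1) * (y ^ 3 + 1)) := by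
  have hy0 : 0 < y := by linarith
  have e2 : 9 ≤ y ^ 2 := by nlinarith
  have e21 : 3 * y ≤ y ^ 2 := by nlinarith
  have e3 : 3 * y ^ 2 ≤ y ^ 3 := by nlinarith
  have e4 : 3 * y ^ 3 ≤ y ^ 4 := by nlinarith [pow_pos hy0 3]
  have e5 : 3 * y ^ 4 ≤ y ^ 5 := by nlinarith [pow_pos hy0 4]
  have e6 : 3 * y ^ 5 ≤ y ^ 6 := by nlinarith [pow_pos hy0 5]
  have hW1 : 1 ≤ W := by nlinarith
  have hMW : M ^ 2 = W ^ 2 := by rcases hM with rfl | rfl <;> ring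
  have hMle : -W ≤ M := by rcases hM with rfl | rfl <;> linarith
  have hMle' : M ≤ W := by rcases hM with rfl | rfl <;> linarith
  have hWW : W ≤ W ^ 2 := by nlinarith
  have hM1 : 0 < M ^ 2 - 1 := by rw [hMW]; nlinarith
  have hy1 : 0 < y ^ 2 - 1 := by linarith
  have i1 : 1 / y ≤ 1 := by rw [div_le_one hy0]; linarith
  have i2 : 1 / y ^ 2 ≤ 1 := by rw [div_le_one (by positivity)]; linarith
  have hA : 0 < (M / y + 1) * (M * (y + 1 - 1 / y ^ 2) - y) := by
    have h1 : y < W / y := by rw [lt_div_iff₀ hy0]; nlinarith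
    have h2 : y < W * (y + 1 - 1 / y ^ 2) := by nlinarith
    rcases hM with rfl | rfl
    · exact mul_pos (by linarith) (by linarith)
    · exact mul_pos_of_neg_of_neg (by rw [neg_div]; linarith) (by linarith)
  have hB : 0 < (M / y ^ 2 - 1) * (M / y + 1) := by
    have h1 : 1 < W / y := by rw [lt_div_iff₀ hy0]; nlinarith
    have h2 : 1 < W / y ^ 2 := by rw [lt_div_iff₀ (by positivity)]; nlinarith
    rcases hM with rfl | rfl
    · exact mul_pos (by linarith) (by linarith)
    · exact mul_pos_of_neg_of_neg (by rw [neg_div]; linarith) (by rw [neg_div]; linarith)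
  have hC : 0 < M ^ 2 * (y ^ 6 - y ^ 4 - y) + M * (y ^ 5 - y ^ 4) + y ^ 6 := by
    rw [hMW]
    have h1 : y ^ 5 - y ^ 4 ≤ y ^ 6 - y ^ 4 - y := by linarith
    have h2 : 0 ≤ y ^ 5 - y ^ 4 := by linarith [pow_pos hy0 4]
    have h3 : W * (y ^ 5 - y ^ 4) ≤ W ^ 2 * (y ^ 6 - y ^ 4 - y) := by
      refine mul_le_mul hWW h1 h2 (by positivity)
    have h4 : -W * (y ^ 5 - y ^ 4) ≤ M * (y ^ 5 - y ^ 4) := mul_le_mul_of_nonneg_right hMle h2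
    linarith [pow_pos hy0 6]
  have hD : 0 < M ^ 2 * (y ^ 3 + y ^ 2 - 1 - 1 / y - 1 / y ^ 2) + M * (1 - y ^ 3) + y ^ 3 := by
    rw [hMW]
    have h1 : y ^ 3 - 1 ≤ y ^ 3 + y ^ 2 - 1 - 1 / y - 1 / y ^ 2 := by linarith
    have h2 : 0 ≤ y ^ 3 - 1 := by linarith
    have h3 : W * (y ^ 3 - 1) ≤ W ^ 2 * (y ^ 3 + y ^ 2 - 1 - 1 / y - 1 / y ^ 2) := by
      refine mul_le_mul hWW h1 h2 (by positivity)
    have h4 : M * (y ^ 3 - 1) ≤ W * (y ^ 3 - 1) := mul_le_mul_of_nonneg_right hMle' h2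
    linarith [pow_pos hy0 3]
  exact ⟨by positivity, by positivity, by positivity, by positivity⟩

/-- Since `j` determines the sign, only one sign occurs for each radical dimension, and its count is
that of the dimension itself. -/
theorem card_amplitude_eq_of_even (hp : p ≠ 2) (hF : Fintype.card F = p ^ m) (hm : 0 < m) (hl : 0 < l)
    {d n j : ℕ} (hd : d = m.gcd l) (hg : m.gcd (2 * l) = 2 * d) (hmn : m = 2 * (d * n)) {S : ℤ}
    (hS : S = (-1) ^ n * (-1) ^ j) {R : ℕ} (hR : R = d * n + d * j) :
    (univ.filter fun w : F × F => amplitude p l w = S * p ^ R).card =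
      (univ.filter fun w : F × F => radDim p l w = 2 * d * j).card := by
  congr 1
  ext w
  simp only [mem_filter, mem_univ, true_and]
  subst hS hR
  refine ⟨fun h => ?_, fun h => amplitude_eq_of_even hp hF hm hl hd hg hmn h⟩
  have h1 := (amplitude_eq_iff_of_even hp hF (by rw [← pow_add, ← pow_mul, mul_comm,
    (even_two_mul _).neg_one_pow]) h).2
  have h2 : 2 * (d * n + d * j) = m + 2 * d * j := by rw [hmn]; ring
  omega

theorem card_radDim_add_one_eq_zero (hp : p ≠ 2) (hF : Fintype.card F = p ^ m) (hl : 0 < l)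
    {d n : ℕ} (hg : m.gcd (2 * l) = 2 * d) (hmn : m = 2 * (d * n)) (R : ℕ) :
    ((univ.filter fun w : F × F => m + radDim p l w + 1 = 2 * R).card : ℚ) = 0 := by
  rw [Nat.cast_eq_zero, Finset.card_eq_zero, Finset.filter_eq_empty_iff]
  intro w _ h
  by_cases hw : w = 0
  · rw [hw, radDim_zero hF] at h
    omega
  obtain ⟨j, -, hr⟩ := exists_radDim_eq_of_even hp hF hl hg hw
  rw [hr, hmn, mul_assoc] at h
  omega

theorem sum_zero_excess_of_even (hp : p ≠ 2) (hF : Fintype.card F = p ^ m) (hl : 0 < l)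
    {d n : ℕ} (hg : m.gcd (2 * l) = 2 * d) (hmn : m = 2 * (d * n)) (hd0 : 0 < d) (hn : 4 ≤ n)
    {N : ℕ → ℚ} (hN : ∀ j, N j = (univ.filter fun w : F × F => radDim p l w = 2 * d * j).card) :
    ∑ w : F × F, ((p : ℚ) ^ (m + 1) - p ^ (m + 1) / p ^ radDim p l w +
        if Odd (m + radDim p l w) then (p : ℚ) ^ m / p ^ radDim p l w else 0) =
      p * (p ^ m - 1) + (N 1 * (p ^ (m + 1) - p ^ (m + 1) / (p ^ d) ^ 2) +
        N 2 * (p ^ (m + 1) - p ^ (m + 1) / (p ^ d) ^ 4) +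
        N 3 * (p ^ (m + 1) - p ^ (m + 1) / (p ^ d) ^ 6)) := by
  have hpQ : (p : ℚ) ≠ 0 := by exact_mod_cast (Fact.out : p.Prime).ne_zero
  have h6d : 2 * d * 3 < m := by
    have := Nat.mul_le_mul_left d hn
    omega
  have hodd : ∀ j, ¬ Odd (m + 2 * d * j) := fun j => by
    rw [Nat.not_odd_iff_even, hmn, mul_assoc, ← mul_add]
    exact even_two_mul _
  rw [sum_eq_of_radDim hF (show 0 < 2 * d by omega) h6d
    (fun w hw => exists_radDim_eq_of_even hp hF hl hg hw) _
    (fun r => (p : ℚ) ^ (m + 1) - p ^ (m + 1) / p ^ r +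
        if Odd (m + r) then (p : ℚ) ^ m / p ^ r else 0) (fun _ _ => rfl), radDim_zero hF,
    if_neg (Nat.not_odd_iff_even.2 ⟨m, rfl⟩)]
  simp only [Finset.sum_range_succ, Finset.sum_range_zero, nsmul_eq_mul, ← hN, if_neg (hodd _)]
  rw [pow_succ (p : ℚ) m, show 2 * d * 0 = 0 by ring, show 2 * d * 1 = d * 2 by ring,
    show 2 * d * 2 = d * 4 by ring, show 2 * d * 3 = d * 6 by ring]
  simp only [pow_mul]
  field_simp
  ring

end EvenQuotientCounts

/-! ### Individual designs for `m / d` even. -/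

section EvenQuotient

variable {F : Type*} [Field F] [Fintype F] [DecidableEq F] {p m l : ℕ} [Fact p.Prime]
  [Algebra (ZMod p) F] [CharP F p]

/-- Here `d = e + 1` and `s = 4d + f`. The names zeroth to third refer to `j`, with radical
dimension `2dj` and amplitude `S (-1)^j p^(s + dj)`, where `S` is the sign `μ`. -/
theorem holdsDesign_even_quotient_zeroth_sub_one_mul (hp : p ≠ 2) (hF : Fintype.card F = p ^ m) {d e f s : ℕ}
    (hde : d = e + 1) (hmf : m = 8 * e + 2 * f + 8) (hs : s = 4 * e + f + 4) {Δ : ℤ}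
    (hΔ : ∀ v : (F × F) × (F × ZMod p), v ≠ 0 → excess p l v ≤ Δ) {S : ℤ} (hS : S = 1 ∨ S = -1)
    (hA : ((univ.filter fun w : F × F => amplitude p l w = S * p ^ (4 * e + f + 4)).card : ℚ) =
      ((S * p ^ s : ℚ) ^ 2 - 1) * ((S * p ^ s : ℚ) ^ 2 * ((p ^ d : ℚ) ^ 6 - (p ^ d : ℚ) ^ 4 - (p ^ d : ℚ)) + (S * p ^ s : ℚ) * ((p ^ d : ℚ) ^ 5 - (p ^ d : ℚ) ^ 4) +
        (p ^ d : ℚ) ^ 6) / (((p ^ d : ℚ) + 1) * ((p ^ d : ℚ) ^ 2 - 1) * ((p ^ d : ℚ) ^ 3 + 1)))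
    (hA0 : 0 < ((univ.filter fun w : F × F => amplitude p l w = S * p ^ (4 * e + f + 4)).card : ℚ))
    (hmin : (p - 1) * Δ - (p - 2) * ((p - 1) * (S * p ^ (4 * e + f + 4))) < (p - 1) * (p : ℤ) ^ m)
    {Q : ℚ} (hQ : Q = p) :
      HoldsDesign (doCode p l F : Set (F → ZMod p)) 2 (p ^ m)
        (Q^(4*e+f+3) * (Q - 1) * (Q^(4*e+f+4) - S))
        (Q^(4*e+f+3) * (Q^(4*e+f+4) - S) * (Q^(4*e+f+3) * (Q - 1) * (Q^(4*e+f+4) - S) - 1)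
          * (Q^(14*e+2*f+14) - Q^(12*e+2*f+12) - Q^(9*e+2*f+9) + S * Q^(9*e+f+9)
            - S * Q^(8*e+f+8) + Q^(6*e+6))
          / ((Q^(e+1) + 1) * (Q^(2*e+2) - 1) * (Q^(3*e+3) + 1))) := by
  subst hQ
  have hpos : (0 : ℚ) < p := by exact_mod_cast (Fact.out : p.Prime).pos
  refine holdsDesign_sub_one_mul hp hF (by omega) hΔ hS (R := 4 * e + f + 4)
    (r := 8 * e + 2 * f + 8) (by omega) (by omega) hmin hA (hA ▸ hA0) ?_ ?_
  · rw [hmf]; ring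
  · have ha : 0 < (p : ℚ) ^ e := by positivity
    have hb : 0 < (p : ℚ) ^ f := by positivity
    have hden := (pow_sub_one_pos_of_prime (p := p) (k := 2 * e + 2) (by omega)).ne'
    simp only [hmf, hde, hs, pow_add, pow_mul', pow_one, mul_add] at hden ⊢
    generalize (p : ℚ) ^ e = a at *
    generalize (p : ℚ) ^ f = b at *
    generalize (p : ℚ) = Q at *
    rcases hS with rfl | rfl <;> push_cast <;> field_simp <;> ring

theorem holdsDesign_even_quotient_zeroth_add (hp : p ≠ 2) (hF : Fintype.card F = p ^ m) {d e f s : ℕ}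
    (hde : d = e + 1) (hmf : m = 8 * e + 2 * f + 8) (hs : s = 4 * e + f + 4) {Δ : ℤ}
    (hΔ : ∀ v : (F × F) × (F × ZMod p), v ≠ 0 → excess p l v ≤ Δ) {S : ℤ} (hS : S = 1 ∨ S = -1)
    (hA : ((univ.filter fun w : F × F => amplitude p l w = S * p ^ (4 * e + f + 4)).card : ℚ) =
      ((S * p ^ s : ℚ) ^ 2 - 1) * ((S * p ^ s : ℚ) ^ 2 * ((p ^ d : ℚ) ^ 6 - (p ^ d : ℚ) ^ 4 - (p ^ d : ℚ)) + (S * p ^ s : ℚ) * ((p ^ d : ℚ) ^ 5 - (p ^ d : ℚ) ^ 4) +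
        (p ^ d : ℚ) ^ 6) / (((p ^ d : ℚ) + 1) * ((p ^ d : ℚ) ^ 2 - 1) * ((p ^ d : ℚ) ^ 3 + 1)))
    (hA0 : 0 < ((univ.filter fun w : F × F => amplitude p l w = S * p ^ (4 * e + f + 4)).card : ℚ))
    (hB : ((univ.filter fun w : F × F => m + radDim p l w + 1 = 2 * (4 * e + f + 4)).card : ℚ) = 0)
    (hmin : (p - 1) * Δ + (p - 2) * (S * p ^ (4 * e + f + 4)) < (p - 1) * (p : ℤ) ^ m)
    {Q : ℚ} (hQ : Q = p) :
      HoldsDesign (doCode p l F : Set (F → ZMod p)) 2 (p ^ m)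
        (Q^(4*e+f+3) * (Q^(4*e+f+5) - Q^(4*e+f+4) + S))
        (Q^(4*e+f+3) * (Q^(4*e+f+5) - Q^(4*e+f+4) + S) * (Q^(4*e+f+3) * (Q^(4*e+f+5) - Q^(4*e+f+4) + S) - 1)
          * (Q^(14*e+2*f+14) - Q^(12*e+2*f+12) - Q^(9*e+2*f+9) + S * Q^(9*e+f+9)
            - S * Q^(8*e+f+8) + Q^(6*e+6))
          / ((Q^(e+1) + 1) * (Q^(2*e+2) - 1) * (Q^(3*e+3) + 1))) := by
  subst hQ
  have hpos : (0 : ℚ) < p := by exact_mod_cast (Fact.out : p.Prime).pos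
  refine holdsDesign_add hp hF (by omega) hΔ hS (R := 4 * e + f + 4)
    (r := 8 * e + 2 * f + 8) (by omega) (by omega) hmin hA hB
    (by rw [← hA, mul_zero, zero_div, add_zero]; exact hA0) ?_ ?_
  · rw [hmf]; ring
  · have ha : 0 < (p : ℚ) ^ e := by positivity
    have hb : 0 < (p : ℚ) ^ f := by positivity
    have hden := (pow_sub_one_pos_of_prime (p := p) (k := 2 * e + 2) (by omega)).ne'
    simp only [hmf, hde, hs, pow_add, pow_mul', pow_one, mul_add] at hden ⊢
    generalize (p : ℚ) ^ e = a at *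
    generalize (p : ℚ) ^ f = b at *
    generalize (p : ℚ) = Q at *
    rcases hS with rfl | rfl <;> push_cast <;> field_simp <;> ring

theorem holdsDesign_even_quotient_first_sub_one_mul (hp : p ≠ 2) (hF : Fintype.card F = p ^ m) {d e f s : ℕ}
    (hde : d = e + 1) (hmf : m = 8 * e + 2 * f + 8) (hs : s = 4 * e + f + 4) {Δ : ℤ}
    (hΔ : ∀ v : (F × F) × (F × ZMod p), v ≠ 0 → excess p l v ≤ Δ) {S : ℤ} (hS : S = 1 ∨ S = -1)
    (hA : ((univ.filter fun w : F × F => amplitude p l w = (-S : ℤ) * p ^ (5 * e + f + 5)).card : ℚ) =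
      ((S * p ^ s : ℚ) ^ 2 - 1) * ((S * p ^ s : ℚ) ^ 2 * ((p ^ d : ℚ) ^ 3 + (p ^ d : ℚ) ^ 2 - 1 - 1 / (p ^ d : ℚ) - 1 / (p ^ d : ℚ) ^ 2) +
        (S * p ^ s : ℚ) * (1 - (p ^ d : ℚ) ^ 3) + (p ^ d : ℚ) ^ 3) / (((p ^ d : ℚ) + 1) ^ 2 * ((p ^ d : ℚ) ^ 2 - 1)))
    (hA0 : 0 < ((univ.filter fun w : F × F => amplitude p l w = (-S : ℤ) * p ^ (5 * e + f + 5)).card : ℚ))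
    (hmin : (p - 1) * Δ - (p - 2) * ((p - 1) * ((-S : ℤ) * p ^ (5 * e + f + 5))) < (p - 1) * (p : ℤ) ^ m)
    {Q : ℚ} (hQ : Q = p) :
      HoldsDesign (doCode p l F : Set (F → ZMod p)) 2 (p ^ m)
        (Q^(5*e+f+4) * (Q - 1) * (Q^(3*e+f+3) + S))
        (Q^(3*e+f+2) * (Q^(3*e+f+3) + S) * (Q^(5*e+f+4) * (Q - 1) * (Q^(3*e+f+3) + S) - 1)
          * (Q^(11*e+2*f+11) + Q^(10*e+2*f+10) - Q^(8*e+2*f+8) - Q^(7*e+2*f+7) - Q^(6*e+2*f+6)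
            - S * Q^(7*e+f+7) + S * Q^(4*e+f+4) + Q^(3*e+3))
          / ((Q^(e+1) + 1)^2 * (Q^(2*e+2) - 1))) := by
  subst hQ
  have hpos : (0 : ℚ) < p := by exact_mod_cast (Fact.out : p.Prime).pos
  refine holdsDesign_sub_one_mul hp hF (by omega) hΔ (show -S = 1 ∨ -S = -1 by omega) (R := 5 * e + f + 5)
    (r := 6 * e + 2 * f + 6) (by omega) (by omega) hmin hA (hA ▸ hA0) ?_ ?_
  · rw [hmf]; push_cast; ring
  · have ha : 0 < (p : ℚ) ^ e := by positivity
    have hb : 0 < (p : ℚ) ^ f := by positivity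
    have hden := (pow_sub_one_pos_of_prime (p := p) (k := 2 * e + 2) (by omega)).ne'
    simp only [hmf, hde, hs, pow_add, pow_mul', pow_one, mul_add] at hden ⊢
    generalize (p : ℚ) ^ e = a at *
    generalize (p : ℚ) ^ f = b at *
    generalize (p : ℚ) = Q at *
    rcases hS with rfl | rfl <;> push_cast <;> field_simp <;> ring

theorem holdsDesign_even_quotient_first_add (hp : p ≠ 2) (hF : Fintype.card F = p ^ m) {d e f s : ℕ}
    (hde : d = e + 1) (hmf : m = 8 * e + 2 * f + 8) (hs : s = 4 * e + f + 4) {Δ : ℤ}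
    (hΔ : ∀ v : (F × F) × (F × ZMod p), v ≠ 0 → excess p l v ≤ Δ) {S : ℤ} (hS : S = 1 ∨ S = -1)
    (hA : ((univ.filter fun w : F × F => amplitude p l w = (-S : ℤ) * p ^ (5 * e + f + 5)).card : ℚ) =
      ((S * p ^ s : ℚ) ^ 2 - 1) * ((S * p ^ s : ℚ) ^ 2 * ((p ^ d : ℚ) ^ 3 + (p ^ d : ℚ) ^ 2 - 1 - 1 / (p ^ d : ℚ) - 1 / (p ^ d : ℚ) ^ 2) +
        (S * p ^ s : ℚ) * (1 - (p ^ d : ℚ) ^ 3) + (p ^ d : ℚ) ^ 3) / (((p ^ d : ℚ) + 1) ^ 2 * ((p ^ d : ℚ) ^ 2 - 1)))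
    (hA0 : 0 < ((univ.filter fun w : F × F => amplitude p l w = (-S : ℤ) * p ^ (5 * e + f + 5)).card : ℚ))
    (hB : ((univ.filter fun w : F × F => m + radDim p l w + 1 = 2 * (5 * e + f + 5)).card : ℚ) = 0)
    (hmin : (p - 1) * Δ + (p - 2) * ((-S : ℤ) * p ^ (5 * e + f + 5)) < (p - 1) * (p : ℤ) ^ m)
    {Q : ℚ} (hQ : Q = p) :
      HoldsDesign (doCode p l F : Set (F → ZMod p)) 2 (p ^ m)
        (Q^(5*e+f+4) * (Q^(3*e+f+4) - Q^(3*e+f+3) - S))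
        (Q^(3*e+f+2) * (Q^(3*e+f+4) - Q^(3*e+f+3) - S) * (Q^(5*e+f+4) * (Q^(3*e+f+4) - Q^(3*e+f+3) - S) - 1)
          * (Q^(11*e+2*f+11) + Q^(10*e+2*f+10) - Q^(8*e+2*f+8) - Q^(7*e+2*f+7) - Q^(6*e+2*f+6)
            - S * Q^(7*e+f+7) + S * Q^(4*e+f+4) + Q^(3*e+3))
          / ((Q^(e+1) + 1)^2 * (Q^(2*e+2) - 1))) := by
  subst hQ
  have hpos : (0 : ℚ) < p := by exact_mod_cast (Fact.out : p.Prime).pos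
  refine holdsDesign_add hp hF (by omega) hΔ (show -S = 1 ∨ -S = -1 by omega) (R := 5 * e + f + 5)
    (r := 6 * e + 2 * f + 6) (by omega) (by omega) hmin hA hB
    (by rw [← hA, mul_zero, zero_div, add_zero]; exact hA0) ?_ ?_
  · rw [hmf]; push_cast; ring
  · have ha : 0 < (p : ℚ) ^ e := by positivity
    have hb : 0 < (p : ℚ) ^ f := by positivity
    have hden := (pow_sub_one_pos_of_prime (p := p) (k := 2 * e + 2) (by omega)).ne'
    simp only [hmf, hde, hs, pow_add, pow_mul', pow_one, mul_add] at hden ⊢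
    generalize (p : ℚ) ^ e = a at *
    generalize (p : ℚ) ^ f = b at *
    generalize (p : ℚ) = Q at *
    rcases hS with rfl | rfl <;> push_cast <;> field_simp <;> ring

theorem holdsDesign_even_quotient_second_sub_one_mul (hp : p ≠ 2) (hF : Fintype.card F = p ^ m) {d e f s : ℕ}
    (hde : d = e + 1) (hmf : m = 8 * e + 2 * f + 8) (hs : s = 4 * e + f + 4) {Δ : ℤ}
    (hΔ : ∀ v : (F × F) × (F × ZMod p), v ≠ 0 → excess p l v ≤ Δ) {S : ℤ} (hS : S = 1 ∨ S = -1)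
    (hA : ((univ.filter fun w : F × F => amplitude p l w = S * p ^ (6 * e + f + 6)).card : ℚ) =
      ((S * p ^ s : ℚ) ^ 2 - 1) * (((S * p ^ s : ℚ) / (p ^ d : ℚ) + 1) * ((S * p ^ s : ℚ) * ((p ^ d : ℚ) + 1 - 1 / (p ^ d : ℚ) ^ 2) - (p ^ d : ℚ))) / (((p ^ d : ℚ) + 1) ^ 2 * ((p ^ d : ℚ) ^ 2 - 1)))
    (hA0 : 0 < ((univ.filter fun w : F × F => amplitude p l w = S * p ^ (6 * e + f + 6)).card : ℚ))
    (hmin : (p - 1) * Δ - (p - 2) * ((p - 1) * (S * p ^ (6 * e + f + 6))) < (p - 1) * (p : ℤ) ^ m)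
    {Q : ℚ} (hQ : Q = p) :
      HoldsDesign (doCode p l F : Set (F → ZMod p)) 2 (p ^ m)
        (Q^(6*e+f+5) * (Q - 1) * (Q^(2*e+f+2) - S))
        (Q^(2*e+f+1) * (Q^(2*e+f+2) - S) * (Q^(6*e+f+5) * (Q - 1) * (Q^(2*e+f+2) - S) - 1)
          * (Q^(3*e+f+3) + S) * (Q^(5*e+f+5) + Q^(4*e+f+4) - Q^(2*e+f+2) - S * Q^(e+1))
          / ((Q^(e+1) + 1)^2 * (Q^(2*e+2) - 1))) := by
  subst hQ
  have hpos : (0 : ℚ) < p := by exact_mod_cast (Fact.out : p.Prime).pos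
  refine holdsDesign_sub_one_mul hp hF (by omega) hΔ hS (R := 6 * e + f + 6)
    (r := 4 * e + 2 * f + 4) (by omega) (by omega) hmin hA (hA ▸ hA0) ?_ ?_
  · rw [hmf]; ring
  · have ha : 0 < (p : ℚ) ^ e := by positivity
    have hb : 0 < (p : ℚ) ^ f := by positivity
    have hden := (pow_sub_one_pos_of_prime (p := p) (k := 2 * e + 2) (by omega)).ne'
    simp only [hmf, hde, hs, pow_add, pow_mul', pow_one, mul_add] at hden ⊢
    generalize (p : ℚ) ^ e = a at *
    generalize (p : ℚ) ^ f = b at *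
    generalize (p : ℚ) = Q at *
    rcases hS with rfl | rfl <;> push_cast <;> field_simp <;> ring

theorem holdsDesign_even_quotient_second_add (hp : p ≠ 2) (hF : Fintype.card F = p ^ m) {d e f s : ℕ}
    (hde : d = e + 1) (hmf : m = 8 * e + 2 * f + 8) (hs : s = 4 * e + f + 4) {Δ : ℤ}
    (hΔ : ∀ v : (F × F) × (F × ZMod p), v ≠ 0 → excess p l v ≤ Δ) {S : ℤ} (hS : S = 1 ∨ S = -1)
    (hA : ((univ.filter fun w : F × F => amplitude p l w = S * p ^ (6 * e + f + 6)).card : ℚ) =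
      ((S * p ^ s : ℚ) ^ 2 - 1) * (((S * p ^ s : ℚ) / (p ^ d : ℚ) + 1) * ((S * p ^ s : ℚ) * ((p ^ d : ℚ) + 1 - 1 / (p ^ d : ℚ) ^ 2) - (p ^ d : ℚ))) / (((p ^ d : ℚ) + 1) ^ 2 * ((p ^ d : ℚ) ^ 2 - 1)))
    (hA0 : 0 < ((univ.filter fun w : F × F => amplitude p l w = S * p ^ (6 * e + f + 6)).card : ℚ))
    (hB : ((univ.filter fun w : F × F => m + radDim p l w + 1 = 2 * (6 * e + f + 6)).card : ℚ) = 0)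
    (hmin : (p - 1) * Δ + (p - 2) * (S * p ^ (6 * e + f + 6)) < (p - 1) * (p : ℤ) ^ m)
    {Q : ℚ} (hQ : Q = p) :
      HoldsDesign (doCode p l F : Set (F → ZMod p)) 2 (p ^ m)
        (Q^(6*e+f+5) * (Q^(2*e+f+3) - Q^(2*e+f+2) + S))
        (Q^(2*e+f+1) * (Q^(2*e+f+3) - Q^(2*e+f+2) + S) * (Q^(6*e+f+5) * (Q^(2*e+f+3) - Q^(2*e+f+2) + S) - 1)
          * (Q^(3*e+f+3) + S) * (Q^(5*e+f+5) + Q^(4*e+f+4) - Q^(2*e+f+2) - S * Q^(e+1))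
          / ((Q^(e+1) + 1)^2 * (Q^(2*e+2) - 1))) := by
  subst hQ
  have hpos : (0 : ℚ) < p := by exact_mod_cast (Fact.out : p.Prime).pos
  refine holdsDesign_add hp hF (by omega) hΔ hS (R := 6 * e + f + 6)
    (r := 4 * e + 2 * f + 4) (by omega) (by omega) hmin hA hB
    (by rw [← hA, mul_zero, zero_div, add_zero]; exact hA0) ?_ ?_
  · rw [hmf]; ring
  · have ha : 0 < (p : ℚ) ^ e := by positivity
    have hb : 0 < (p : ℚ) ^ f := by positivity
    have hden := (pow_sub_one_pos_of_prime (p := p) (k := 2 * e + 2) (by omega)).ne'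
    simp only [hmf, hde, hs, pow_add, pow_mul', pow_one, mul_add] at hden ⊢
    generalize (p : ℚ) ^ e = a at *
    generalize (p : ℚ) ^ f = b at *
    generalize (p : ℚ) = Q at *
    rcases hS with rfl | rfl <;> push_cast <;> field_simp <;> ring

theorem holdsDesign_even_quotient_third_sub_one_mul (hp : p ≠ 2) (hF : Fintype.card F = p ^ m) {d e f s : ℕ}
    (hde : d = e + 1) (hmf : m = 8 * e + 2 * f + 8) (hs : s = 4 * e + f + 4) {Δ : ℤ}
    (hΔ : ∀ v : (F × F) × (F × ZMod p), v ≠ 0 → excess p l v ≤ Δ) {S : ℤ} (hS : S = 1 ∨ S = -1)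
    (hA : ((univ.filter fun w : F × F => amplitude p l w = (-S : ℤ) * p ^ (7 * e + f + 7)).card : ℚ) =
      ((S * p ^ s : ℚ) ^ 2 - 1) * (((S * p ^ s : ℚ) / (p ^ d : ℚ) ^ 2 - 1) * ((S * p ^ s : ℚ) / (p ^ d : ℚ) + 1)) / (((p ^ d : ℚ) + 1) * ((p ^ d : ℚ) ^ 2 - 1) * ((p ^ d : ℚ) ^ 3 + 1)))
    (hA0 : 0 < ((univ.filter fun w : F × F => amplitude p l w = (-S : ℤ) * p ^ (7 * e + f + 7)).card : ℚ))
    (hmin : (p - 1) * Δ - (p - 2) * ((p - 1) * ((-S : ℤ) * p ^ (7 * e + f + 7))) < (p - 1) * (p : ℤ) ^ m)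
    {Q : ℚ} (hQ : Q = p) :
      HoldsDesign (doCode p l F : Set (F → ZMod p)) 2 (p ^ m)
        (Q^(7*e+f+6) * (Q - 1) * (Q^(e+f+1) + S))
        (Q^(e+f) * (Q^(e+f+1) + S) * (Q^(7*e+f+6) * (Q - 1) * (Q^(e+f+1) + S) - 1)
          * (Q^(2*e+f+2) - S) * (Q^(3*e+f+3) + S)
          / ((Q^(e+1) + 1) * (Q^(2*e+2) - 1) * (Q^(3*e+3) + 1))) := by
  subst hQ
  have hpos : (0 : ℚ) < p := by exact_mod_cast (Fact.out : p.Prime).pos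
  refine holdsDesign_sub_one_mul hp hF (by omega) hΔ (show -S = 1 ∨ -S = -1 by omega) (R := 7 * e + f + 7)
    (r := 2 * e + 2 * f + 2) (by omega) (by omega) hmin hA (hA ▸ hA0) ?_ ?_
  · rw [hmf]; push_cast; ring
  · have ha : 0 < (p : ℚ) ^ e := by positivity
    have hb : 0 < (p : ℚ) ^ f := by positivity
    have hden := (pow_sub_one_pos_of_prime (p := p) (k := 2 * e + 2) (by omega)).ne'
    simp only [hmf, hde, hs, pow_add, pow_mul', pow_one, mul_add] at hden ⊢
    generalize (p : ℚ) ^ e = a at *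
    generalize (p : ℚ) ^ f = b at *
    generalize (p : ℚ) = Q at *
    rcases hS with rfl | rfl <;> push_cast <;> field_simp <;> ring

theorem holdsDesign_even_quotient_third_add (hp : p ≠ 2) (hF : Fintype.card F = p ^ m) {d e f s : ℕ}
    (hde : d = e + 1) (hmf : m = 8 * e + 2 * f + 8) (hs : s = 4 * e + f + 4) {Δ : ℤ}
    (hΔ : ∀ v : (F × F) × (F × ZMod p), v ≠ 0 → excess p l v ≤ Δ) {S : ℤ} (hS : S = 1 ∨ S = -1)
    (hA : ((univ.filter fun w : F × F => amplitude p l w = (-S : ℤ) * p ^ (7 * e + f + 7)).card : ℚ) =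
      ((S * p ^ s : ℚ) ^ 2 - 1) * (((S * p ^ s : ℚ) / (p ^ d : ℚ) ^ 2 - 1) * ((S * p ^ s : ℚ) / (p ^ d : ℚ) + 1)) / (((p ^ d : ℚ) + 1) * ((p ^ d : ℚ) ^ 2 - 1) * ((p ^ d : ℚ) ^ 3 + 1)))
    (hA0 : 0 < ((univ.filter fun w : F × F => amplitude p l w = (-S : ℤ) * p ^ (7 * e + f + 7)).card : ℚ))
    (hB : ((univ.filter fun w : F × F => m + radDim p l w + 1 = 2 * (7 * e + f + 7)).card : ℚ) = 0)
    (hmin : (p - 1) * Δ + (p - 2) * ((-S : ℤ) * p ^ (7 * e + f + 7)) < (p - 1) * (p : ℤ) ^ m)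
    {Q : ℚ} (hQ : Q = p) :
      HoldsDesign (doCode p l F : Set (F → ZMod p)) 2 (p ^ m)
        (Q^(7*e+f+6) * (Q^(e+f+2) - Q^(e+f+1) - S))
        (Q^(e+f) * (Q^(e+f+2) - Q^(e+f+1) - S) * (Q^(7*e+f+6) * (Q^(e+f+2) - Q^(e+f+1) - S) - 1)
          * (Q^(2*e+f+2) - S) * (Q^(3*e+f+3) + S)
          / ((Q^(e+1) + 1) * (Q^(2*e+2) - 1) * (Q^(3*e+3) + 1))) := by
  subst hQ
  have hpos : (0 : ℚ) < p := by exact_mod_cast (Fact.out : p.Prime).pos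
  refine holdsDesign_add hp hF (by omega) hΔ (show -S = 1 ∨ -S = -1 by omega) (R := 7 * e + f + 7)
    (r := 2 * e + 2 * f + 2) (by omega) (by omega) hmin hA hB
    (by rw [← hA, mul_zero, zero_div, add_zero]; exact hA0) ?_ ?_
  · rw [hmf]; push_cast; ring
  · have ha : 0 < (p : ℚ) ^ e := by positivity
    have hb : 0 < (p : ℚ) ^ f := by positivity
    have hden := (pow_sub_one_pos_of_prime (p := p) (k := 2 * e + 2) (by omega)).ne'
    simp only [hmf, hde, hs, pow_add, pow_mul', pow_one, mul_add] at hden ⊢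
    generalize (p : ℚ) ^ e = a at *
    generalize (p : ℚ) ^ f = b at *
    generalize (p : ℚ) = Q at *
    rcases hS with rfl | rfl <;> push_cast <;> field_simp <;> ring

theorem holdsDesign_even_quotient_mul_sub_one (hp : p ≠ 2) (hF : Fintype.card F = p ^ m)
    (hl : 0 < l) {d n e f s : ℕ} (hg : m.gcd (2 * l) = 2 * d) (hmn : m = 2 * (d * n)) (hn : 4 ≤ n)
    (hde : d = e + 1) (hmf : m = 8 * e + 2 * f + 8) (hs : s = 4 * e + f + 4) {Δ : ℤ}
    (hΔ : ∀ v : (F × F) × (F × ZMod p), v ≠ 0 → excess p l v ≤ Δ) (hmin : Δ < (p : ℤ) ^ m)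
    {S : ℤ} (hS : S = 1 ∨ S = -1)
    {N : ℕ → ℚ} (hN : ∀ j, N j = (univ.filter fun w : F × F => radDim p l w = 2 * d * j).card)
    (hN1 : N 1 = ((S * p ^ s : ℚ) ^ 2 - 1) * ((S * p ^ s : ℚ) ^ 2 * ((p ^ d : ℚ) ^ 3 + (p ^ d : ℚ) ^ 2 - 1 - 1 / (p ^ d : ℚ) - 1 / (p ^ d : ℚ) ^ 2) +
        (S * p ^ s : ℚ) * (1 - (p ^ d : ℚ) ^ 3) + (p ^ d : ℚ) ^ 3) / (((p ^ d : ℚ) + 1) ^ 2 * ((p ^ d : ℚ) ^ 2 - 1)))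
    (hN2 : N 2 = ((S * p ^ s : ℚ) ^ 2 - 1) * (((S * p ^ s : ℚ) / (p ^ d : ℚ) + 1) * ((S * p ^ s : ℚ) * ((p ^ d : ℚ) + 1 - 1 / (p ^ d : ℚ) ^ 2) - (p ^ d : ℚ))) / (((p ^ d : ℚ) + 1) ^ 2 * ((p ^ d : ℚ) ^ 2 - 1)))
    (hN3 : N 3 = ((S * p ^ s : ℚ) ^ 2 - 1) * (((S * p ^ s : ℚ) / (p ^ d : ℚ) ^ 2 - 1) * ((S * p ^ s : ℚ) / (p ^ d : ℚ) + 1)) / (((p ^ d : ℚ) + 1) * ((p ^ d : ℚ) ^ 2 - 1) * ((p ^ d : ℚ) ^ 3 + 1)))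
    {Q : ℚ} (hQ : Q = p) :
      HoldsDesign (doCode p l F : Set (F → ZMod p)) 2 (p ^ m)
        (Q^(8*e+2*f+7) * (Q - 1))
        ((Q^(8*e+2*f+8) - Q^(8*e+2*f+7) - 1) * (1 + (Q^(16*e+4*f+16) + Q^(7*e+4*f+7)
            - S * (Q^(e+1) - 1) * (Q^(11*e+3*f+11) + Q^(4*e+3*f+4))
            + S * Q^(9*e+3*f+9) - S * Q^(7*e+3*f+7)
            + (Q^(e+1) - 1) * Q^(7*e+2*f+7) - Q^(4*e+2*f+4) - Q^(2*e+2*f+2)) / (Q^(e+1) + 1))) := by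
  subst hQ
  have hpos : (0 : ℚ) < p := by exact_mod_cast (Fact.out : p.Prime).pos
  refine holdsDesign_mul_sub_one hp hF (by omega) hΔ hmin
    (sum_zero_excess_of_even hp hF hl hg hmn (by omega) hn hN) ?_ ?_
  · rw [hmf]; ring
  · rw [hN1, hN2, hN3]
    have ha : 0 < (p : ℚ) ^ e := by positivity
    have hb : 0 < (p : ℚ) ^ f := by positivity
    have hden := (pow_sub_one_pos_of_prime (p := p) (k := 2 * e + 2) (by omega)).ne'
    simp only [hmf, hde, hs, pow_add, pow_mul', pow_one, mul_add] at hden ⊢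
    generalize (p : ℚ) ^ e = a at *
    generalize (p : ℚ) ^ f = b at *
    generalize (p : ℚ) = Q at *
    rcases hS with rfl | rfl <;> push_cast <;> field_simp <;> ring

end EvenQuotient

/-! ### The bounds and the complete list for `m / d` even. -/

section EvenQuotientFamily

variable {F : Type*} [Field F] [Fintype F] [DecidableEq F] {p m l : ℕ} [Fact p.Prime]
  [Algebra (ZMod p) F] [CharP F p]

/-- The forms with the largest radical, `j = 3`, have the sign `-(-1)^n`. For `n` even this is
negative and their largest excess is only `p^R₃`, which also bounds `(p - 1) p^R` for the smaller
radicals. For `n` odd it is positive and the bound is `(p - 1) p^R₃`, but then the critical excess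
`-(p - 1) p^R₃` does not occur. In both cases all weights satisfy the minimum distance condition. -/
theorem exists_excess_bound_of_even (hp : p ≠ 2) (hF : Fintype.card F = p ^ m) (hl : 0 < l)
    {d n : ℕ} (hd : d = m.gcd l) (hg : m.gcd (2 * l) = 2 * d) (hmn : m = 2 * (d * n)) (hn : 4 ≤ n) :
    ∃ Δ : ℤ, (∀ v : (F × F) × (F × ZMod p), v ≠ 0 → excess p l v ≤ Δ) ∧ Δ < (p : ℤ) ^ m ∧
      ∀ j ≤ 3, ∀ (S : ℤ) (R : ℕ), S = (-1) ^ n * (-1) ^ j → R = d * n + d * j →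
        (p - 1) * Δ - (p - 2) * ((p - 1) * (S * p ^ R)) < (p - 1) * (p : ℤ) ^ m ∧
        (p - 1) * Δ + (p - 2) * (S * p ^ R) < (p - 1) * (p : ℤ) ^ m := by
  have h3 := three_le_of_ne_two hp
  have hd0 : 0 < d := hd ▸ Nat.gcd_pos_of_pos_right _ hl
  have hdn := Nat.mul_le_mul_left d hn
  have hm : 0 < m := by omega
  set R₃ := d * n + d * 3 with hR₃
  have hX : (0 : ℤ) < p ^ R₃ := by positivity
  have hpX : (p : ℤ) * p ^ R₃ ≤ p ^ m := by
    rw [← pow_succ']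
    exact pow_le_pow_right₀ (by linarith) (by omega)
  have hle : ∀ j ≤ 3, d * n + d * j ≤ R₃ := fun j hj => by
    have := Nat.mul_le_mul_left d hj
    omega
  have hlt : ∀ j ≤ 2, d * n + d * j + 1 ≤ R₃ := fun j hj => by
    have := Nat.mul_le_mul_left d hj
    omega
  have heven : ∀ j, m + 2 * d * j = 2 * (d * n + d * j) := fun j => by rw [hmn]; ring
  have hno : ∀ w : F × F, w ≠ 0 → ¬ Odd (m + radDim p l w) := fun w hw => by
    obtain ⟨j, -, hr⟩ := exists_radDim_eq_of_even hp hF hl hg hw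
    rw [Nat.not_odd_iff_even, hr, heven]
    exact even_two_mul _
  rcases Nat.even_or_odd n with hne | hno'
  · refine ⟨p ^ R₃, excess_le hp hF hX.le (fun w hw he => ?_) (fun w hw ho => absurd ho (hno w hw)),
      pow_lt_pow_right₀ (by linarith) (by omega), fun j hj S R hS hR => ?_⟩
    · obtain ⟨j, hj, hr⟩ := exists_radDim_eq_of_even hp hF hl hg hw
      have hA := amplitude_eq_of_even hp hF hm hl hd hg hmn hr
      rw [hne.neg_one_pow, one_mul] at hA
      have h1 : (p : ℤ) ^ (d * n + d * j) ≤ p ^ R₃ := pow_le_pow_right₀ (by linarith) (hle j hj)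
      have h2 : (0 : ℤ) < p ^ (d * n + d * j) := by positivity
      rcases Nat.even_or_odd j with hj' | hj'
      · have hj2 : j ≤ 2 := by
          obtain ⟨k, hk⟩ := hj'
          omega
        rw [hA, hj'.neg_one_pow, one_mul]
        exact ⟨(sub_one_mul_pow_lt p (hlt j hj2)).le, by linarith⟩
      · rw [hA, hj'.neg_one_pow, neg_one_mul, neg_neg]
        exact ⟨by nlinarith, h1⟩
    · have hS' : S = 1 ∨ S = -1 := by
        rw [hS, ← pow_add]
        exact neg_one_pow_eq_or ℤ _
      have h1 : |S * (p : ℤ) ^ R| ≤ p ^ R₃ := by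
        rw [abs_sign_mul_pow hS', hR]
        exact pow_le_pow_right₀ (by linarith) (hle j hj)
      obtain ⟨h2, h4⟩ := abs_le.1 h1
      set Y := S * (p : ℤ) ^ R
      have h5 : ((p : ℤ) - 1) * (p * p ^ R₃) ≤ (p - 1) * p ^ m :=
        mul_le_mul_of_nonneg_left hpX (by linarith)
      have h6 : 0 < ((p : ℤ) - 1) * p ^ R₃ := mul_pos (by linarith) hX
      constructor
      · have h7 : 0 ≤ ((p : ℤ) - 2) * (p - 1) * (Y + p ^ R₃) :=
          mul_nonneg (mul_nonneg (by linarith) (by linarith)) (by linarith)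
        nlinarith
      · have h7 : 0 ≤ ((p : ℤ) - 2) * (p ^ R₃ - Y) := mul_nonneg (by linarith) (by linarith)
        nlinarith
  · refine ⟨(p - 1) * p ^ R₃, excess_le hp hF (mul_nonneg (by linarith) hX.le) (fun w hw he => ?_)
      (fun w hw ho => absurd ho (hno w hw)), sub_one_mul_pow_lt p (by omega),
      fun j hj S R hS hR => ?_⟩
    · obtain ⟨j, hj, hr⟩ := exists_radDim_eq_of_even hp hF hl hg hw
      obtain ⟨h1, h2⟩ := amplitude_bounds (l := l) (w := w) hp hF (by rw [hr, heven])
      have h4 : (p : ℤ) ^ (d * n + d * j) ≤ p ^ R₃ := pow_le_pow_right₀ (by linarith) (hle j hj)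
      exact ⟨h1.trans (mul_le_mul_of_nonneg_left h4 (by linarith)), by nlinarith⟩
    · have hS' : S = 1 ∨ S = -1 := by
        rw [hS, ← pow_add]
        exact neg_one_pow_eq_or ℤ _
      subst hR
      refine ⟨excess_min_sub_one_mul hp hS' (by omega) ?_, excess_min_add hp hS' (by omega) (hle j hj)⟩
      rcases (show j ≤ 2 ∨ j = 3 by omega) with h | rfl
      · exact Or.inl (hlt j h)
      · refine Or.inr (Or.inl ⟨le_rfl, ?_⟩)
        rw [hS, hno'.neg_one_pow]
        norm_num

set_option maxHeartbeats 800000 in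
/-- The designs for `m / d` even. -/
theorem holdsDesign_of_even (hp : p ≠ 2) (hF : Fintype.card F = p ^ m) (hl : 0 < l)
    {d n e f s : ℕ} (hd : d = m.gcd l) (hg : m.gcd (2 * l) = 2 * d) (hmn : m = 2 * (d * n))
    (hn : 4 ≤ n) (hde : d = e + 1) (hmf : m = 8 * e + 2 * f + 8) (hs : s = 4 * e + f + 4)
    {μ : ℚ} (hμ : μ = (-1) ^ n) {Q : ℚ} (hQ : Q = p) :
      HoldsDesign (doCode p l F : Set (F → ZMod p)) 2 (p ^ m)
        (Q^(s-1) * (Q - 1) * (Q^s - μ))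
        (Q^(s-1) * (Q^s - μ) * (Q^(s-1) * (Q - 1) * (Q^s - μ) - 1)
          * (Q^(m+6*d) - Q^(m+4*d) - Q^(m+d) + μ * Q^(s+5*d)
            - μ * Q^(s+4*d) + Q^(6*d))
          / ((Q^d + 1) * (Q^(2*d) - 1) * (Q^(3*d) + 1))) ∧
      HoldsDesign (doCode p l F : Set (F → ZMod p)) 2 (p ^ m)
        (Q^(s-1) * (Q^(s+1) - Q^s + μ))
        (Q^(s-1) * (Q^(s+1) - Q^s + μ) * (Q^(s-1) * (Q^(s+1) - Q^s + μ) - 1)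
          * (Q^(m+6*d) - Q^(m+4*d) - Q^(m+d) + μ * Q^(s+5*d)
            - μ * Q^(s+4*d) + Q^(6*d))
          / ((Q^d + 1) * (Q^(2*d) - 1) * (Q^(3*d) + 1))) ∧
      HoldsDesign (doCode p l F : Set (F → ZMod p)) 2 (p ^ m)
        (Q^(s+d-1) * (Q - 1) * (Q^(s-d) + μ))
        (Q^(s-d-1) * (Q^(s-d) + μ) * (Q^(s+d-1) * (Q - 1) * (Q^(s-d) + μ) - 1)
          * (Q^(m+3*d) + Q^(m+2*d) - Q^m - Q^(m-d) - Q^(m-2*d)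
            - μ * Q^(s+3*d) + μ * Q^s + Q^(3*d))
          / ((Q^d + 1)^2 * (Q^(2*d) - 1))) ∧
      HoldsDesign (doCode p l F : Set (F → ZMod p)) 2 (p ^ m)
        (Q^(s+d-1) * (Q^(s-d+1) - Q^(s-d) - μ))
        (Q^(s-d-1) * (Q^(s-d+1) - Q^(s-d) - μ) * (Q^(s+d-1) * (Q^(s-d+1) - Q^(s-d) - μ) - 1)
          * (Q^(m+3*d) + Q^(m+2*d) - Q^m - Q^(m-d) - Q^(m-2*d)
            - μ * Q^(s+3*d) + μ * Q^s + Q^(3*d))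
          / ((Q^d + 1)^2 * (Q^(2*d) - 1))) ∧
      HoldsDesign (doCode p l F : Set (F → ZMod p)) 2 (p ^ m)
        (Q^(s+2*d-1) * (Q - 1) * (Q^(s-2*d) - μ))
        (Q^(s-2*d-1) * (Q^(s-2*d) - μ) * (Q^(s+2*d-1) * (Q - 1) * (Q^(s-2*d) - μ) - 1)
          * (Q^(s-d) + μ) * (Q^(s+d) + Q^s - Q^(s-2*d) - μ * Q^d)
          / ((Q^d + 1)^2 * (Q^(2*d) - 1))) ∧
      HoldsDesign (doCode p l F : Set (F → ZMod p)) 2 (p ^ m)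
        (Q^(s+2*d-1) * (Q^(s-2*d+1) - Q^(s-2*d) + μ))
        (Q^(s-2*d-1) * (Q^(s-2*d+1) - Q^(s-2*d) + μ) * (Q^(s+2*d-1) * (Q^(s-2*d+1) - Q^(s-2*d) + μ) - 1)
          * (Q^(s-d) + μ) * (Q^(s+d) + Q^s - Q^(s-2*d) - μ * Q^d)
          / ((Q^d + 1)^2 * (Q^(2*d) - 1))) ∧
      HoldsDesign (doCode p l F : Set (F → ZMod p)) 2 (p ^ m)
        (Q^(s+3*d-1) * (Q - 1) * (Q^(s-3*d) + μ))
        (Q^(s-3*d-1) * (Q^(s-3*d) + μ) * (Q^(s+3*d-1) * (Q - 1) * (Q^(s-3*d) + μ) - 1)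
          * (Q^(s-2*d) - μ) * (Q^(s-d) + μ)
          / ((Q^d + 1) * (Q^(2*d) - 1) * (Q^(3*d) + 1))) ∧
      HoldsDesign (doCode p l F : Set (F → ZMod p)) 2 (p ^ m)
        (Q^(s+3*d-1) * (Q^(s-3*d+1) - Q^(s-3*d) - μ))
        (Q^(s-3*d-1) * (Q^(s-3*d+1) - Q^(s-3*d) - μ) * (Q^(s+3*d-1) * (Q^(s-3*d+1) - Q^(s-3*d) - μ) - 1)
          * (Q^(s-2*d) - μ) * (Q^(s-d) + μ)
          / ((Q^d + 1) * (Q^(2*d) - 1) * (Q^(3*d) + 1))) ∧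
      HoldsDesign (doCode p l F : Set (F → ZMod p)) 2 (p ^ m)
        (Q^(m-1) * (Q - 1))
        ((Q^m - Q^(m-1) - 1) * (1 + (Q^(2*m) + Q^(2*m-9*d)
            - μ * (Q^d - 1) * (Q^(3*s-d) + Q^(3*s-8*d))
            + μ * Q^(3*s-3*d) - μ * Q^(3*s-5*d)
            + (Q^d - 1) * Q^(m-d) - Q^(m-4*d) - Q^(m-6*d)) / (Q^d + 1))) := by
  have hp' : p.Prime := Fact.out
  have hsn : s = d * n := by omega
  have hdn := Nat.mul_le_mul_left d hn
  obtain ⟨S, hσ⟩ : ∃ S : ℤ, S = (-1) ^ n := ⟨_, rfl⟩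
  have hS : S = 1 ∨ S = -1 := hσ ▸ neg_one_pow_eq_or ℤ n
  obtain rfl : μ = S := by rw [hμ, hσ]; push_cast; rfl
  have hM : (S * p ^ s : ℚ) = (-1) ^ n * p ^ (d * n) := by rw [hσ, hsn]; push_cast; rfl
  obtain ⟨m0, m1, m2, m3⟩ := card_radDim_of_even
    (N := fun j => ((univ.filter fun w : F × F => radDim p l w = 2 * d * j).card : ℚ))
    hp hF hl hd hg hmn hn (fun _ => rfl) hM rfl
  have hy : (3 : ℚ) ≤ p ^ d := three_le_pow_of_ne_two hp (by omega)
  obtain ⟨hN0, hN1, hN2, hN3⟩ := eq_of_moments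
    (N := fun j => ((univ.filter fun w : F × F => radDim p l w = 2 * d * j).card : ℚ)) hy m0 m1 m2 m3
  obtain ⟨hN0p, hN1p, hN2p, hN3p⟩ := pos_of_moments (M := S * p ^ s) (W := (p : ℚ) ^ s) hy
    -- `W = p^s` satisfies `y^4 ≤ W` because `s = d n` with `n ≥ 4`.
    (by
      rw [← pow_mul]
      exact pow_le_pow_right₀ (by exact_mod_cast hp'.one_le) (by omega))
    (by rcases hS with h | h <;> rw [h] <;> simp)
  rw [← hN0] at hN0p
  rw [← hN1] at hN1p
  rw [← hN2] at hN2p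
  rw [← hN3] at hN3p
  have hA := fun (j : ℕ) (S' : ℤ) (hS' : S' = (-1) ^ n * (-1) ^ j) (R : ℕ) (hR : R = d * n + d * j) =>
    congrArg (Nat.cast : ℕ → ℚ)
      (card_amplitude_eq_of_even (F := F) hp hF (by omega) hl hd hg hmn hS' hR)
  have hA0 := hA 0 S (by rw [hσ]; ring) (4 * e + f + 4) (by omega)
  have hA1 := hA 1 (-S) (by rw [hσ]; ring) (5 * e + f + 5) (by omega)
  have hA2 := hA 2 S (by rw [hσ]; ring) (6 * e + f + 6) (by omega)
  have hA3 := hA 3 (-S) (by rw [hσ]; ring) (7 * e + f + 7) (by omega)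
  have hB := fun R => card_radDim_add_one_eq_zero (F := F) hp hF hl hg hmn R
  obtain ⟨Δ, hΔ, hΔm, hmin⟩ := exists_excess_bound_of_even (F := F) hp hF hl hd hg hmn hn
  refine ⟨?_, ?_, ?_, ?_, ?_, ?_, ?_, ?_, ?_⟩
  · simp only [↓show m+6*d = 14*e+2*f+14 by omega,
      ↓show m+4*d = 12*e+2*f+12 by omega,
      ↓show s+5*d = 9*e+f+9 by omega,
      ↓show s+4*d = 8*e+f+8 by omega,
      ↓show s-1 = 4*e+f+3 by omega,
      ↓show m+d = 9*e+2*f+9 by omega,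
      ↓show 6*d = 6*e+6 by omega,
      ↓show 2*d = 2*e+2 by omega,
      ↓show 3*d = 3*e+3 by omega]
    have h := holdsDesign_even_quotient_zeroth_sub_one_mul hp hF hde hmf hs hΔ hS
      (hA0.trans hN0) (hN0p.trans_eq hA0.symm)
      (hmin 0 (by omega) S _ (by rw [hσ]; ring) (by omega)).1 hQ
    rw [← hs, ← hde] at h
    exact h
  · simp only [↓show m+6*d = 14*e+2*f+14 by omega,
      ↓show m+4*d = 12*e+2*f+12 by omega,
      ↓show s+5*d = 9*e+f+9 by omega,
      ↓show s+4*d = 8*e+f+8 by omega,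
      ↓show s-1 = 4*e+f+3 by omega,
      ↓show s+1 = 4*e+f+5 by omega,
      ↓show m+d = 9*e+2*f+9 by omega,
      ↓show 6*d = 6*e+6 by omega,
      ↓show 2*d = 2*e+2 by omega,
      ↓show 3*d = 3*e+3 by omega]
    have h := holdsDesign_even_quotient_zeroth_add hp hF hde hmf hs hΔ hS
      (hA0.trans hN0) (hN0p.trans_eq hA0.symm) (hB _)
      (hmin 0 (by omega) S _ (by rw [hσ]; ring) (by omega)).2 hQ
    rw [← hs, ← hde] at h
    exact h
  · simp only [↓show s+d-1 = 5*e+f+4 by omega,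
      ↓show s-d-1 = 3*e+f+2 by omega,
      ↓show m+3*d = 11*e+2*f+11 by omega,
      ↓show m+2*d = 10*e+2*f+10 by omega,
      ↓show m-2*d = 6*e+2*f+6 by omega,
      ↓show s+3*d = 7*e+f+7 by omega,
      ↓show s-d = 3*e+f+3 by omega,
      ↓show m-d = 7*e+2*f+7 by omega,
      ↓show 3*d = 3*e+3 by omega,
      ↓show 2*d = 2*e+2 by omega]
    have h := holdsDesign_even_quotient_first_sub_one_mul hp hF hde hmf hs hΔ hS
      (hA1.trans hN1) (hN1p.trans_eq hA1.symm)
      (hmin 1 (by omega) (-S) _ (by rw [hσ]; ring) (by omega)).1 hQ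
    rw [← hs, ← hde, ← hmf] at h
    exact h
  · simp only [↓show s+d-1 = 5*e+f+4 by omega,
      ↓show s-d+1 = 3*e+f+4 by omega,
      ↓show s-d-1 = 3*e+f+2 by omega,
      ↓show m+3*d = 11*e+2*f+11 by omega,
      ↓show m+2*d = 10*e+2*f+10 by omega,
      ↓show m-2*d = 6*e+2*f+6 by omega,
      ↓show s+3*d = 7*e+f+7 by omega,
      ↓show s-d = 3*e+f+3 by omega,
      ↓show m-d = 7*e+2*f+7 by omega,
      ↓show 3*d = 3*e+3 by omega,
      ↓show 2*d = 2*e+2 by omega]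
    have h := holdsDesign_even_quotient_first_add hp hF hde hmf hs hΔ hS
      (hA1.trans hN1) (hN1p.trans_eq hA1.symm) (hB _)
      (hmin 1 (by omega) (-S) _ (by rw [hσ]; ring) (by omega)).2 hQ
    rw [← hs, ← hde, ← hmf] at h
    exact h
  · simp only [↓show s+2*d-1 = 6*e+f+5 by omega,
      ↓show s-2*d-1 = 2*e+f+1 by omega,
      ↓show s-2*d = 2*e+f+2 by omega,
      ↓show s-d = 3*e+f+3 by omega,
      ↓show s+d = 5*e+f+5 by omega,
      ↓show 2*d = 2*e+2 by omega]
    have h := holdsDesign_even_quotient_second_sub_one_mul hp hF hde hmf hs hΔ hS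
      (hA2.trans hN2) (hN2p.trans_eq hA2.symm)
      (hmin 2 (by omega) S _ (by rw [hσ]; ring) (by omega)).1 hQ
    rw [← hs, ← hde] at h
    exact h
  · simp only [↓show s+2*d-1 = 6*e+f+5 by omega,
      ↓show s-2*d+1 = 2*e+f+3 by omega,
      ↓show s-2*d-1 = 2*e+f+1 by omega,
      ↓show s-2*d = 2*e+f+2 by omega,
      ↓show s-d = 3*e+f+3 by omega,
      ↓show s+d = 5*e+f+5 by omega,
      ↓show 2*d = 2*e+2 by omega]
    have h := holdsDesign_even_quotient_second_add hp hF hde hmf hs hΔ hS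
      (hA2.trans hN2) (hN2p.trans_eq hA2.symm) (hB _)
      (hmin 2 (by omega) S _ (by rw [hσ]; ring) (by omega)).2 hQ
    rw [← hs, ← hde] at h
    exact h
  · simp only [↓show s+3*d-1 = 7*e+f+6 by omega,
      ↓show s-3*d-1 = e+f by omega,
      ↓show s-3*d = e+f+1 by omega,
      ↓show s-2*d = 2*e+f+2 by omega,
      ↓show s-d = 3*e+f+3 by omega,
      ↓show 2*d = 2*e+2 by omega,
      ↓show 3*d = 3*e+3 by omega]
    have h := holdsDesign_even_quotient_third_sub_one_mul hp hF hde hmf hs hΔ hS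
      (hA3.trans hN3) (hN3p.trans_eq hA3.symm)
      (hmin 3 (by omega) (-S) _ (by rw [hσ]; ring) (by omega)).1 hQ
    rw [← hde] at h
    exact h
  · simp only [↓show s+3*d-1 = 7*e+f+6 by omega,
      ↓show s-3*d+1 = e+f+2 by omega,
      ↓show s-3*d-1 = e+f by omega,
      ↓show s-3*d = e+f+1 by omega,
      ↓show s-2*d = 2*e+f+2 by omega,
      ↓show s-d = 3*e+f+3 by omega,
      ↓show 2*d = 2*e+2 by omega,
      ↓show 3*d = 3*e+3 by omega]
    have h := holdsDesign_even_quotient_third_add hp hF hde hmf hs hΔ hS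
      (hA3.trans hN3) (hN3p.trans_eq hA3.symm) (hB _)
      (hmin 3 (by omega) (-S) _ (by rw [hσ]; ring) (by omega)).2 hQ
    rw [← hde] at h
    exact h
  · simp only [↓show 2*m-9*d = 7*e+4*f+7 by omega,
      ↓show 3*s-8*d = 4*e+3*f+4 by omega,
      ↓show 3*s-3*d = 9*e+3*f+9 by omega,
      ↓show 3*s-5*d = 7*e+3*f+7 by omega,
      ↓show 3*s-d = 11*e+3*f+11 by omega,
      ↓show m-4*d = 4*e+2*f+4 by omega,
      ↓show m-6*d = 2*e+2*f+2 by omega,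
      ↓show m-1 = 8*e+2*f+7 by omega,
      ↓show 2*m = 16*e+4*f+16 by omega,
      ↓show m-d = 7*e+2*f+7 by omega]
    have h := holdsDesign_even_quotient_mul_sub_one hp hF hl hg hmn hn hde hmf hs hΔ hΔm hS
      (fun _ => rfl) hN1 hN2 hN3 hQ
    rw [← hde, ← hmf] at h
    exact h

end EvenQuotientFamily

/-! ### The shape of `m / d`, and the excluded values of `l`. -/

section Parameters

/-- If `m / d` were even, `2d` would divide both `m` and `2l`, hence their gcd `d`. -/
theorem odd_of_gcd_two_mul_eq {m l d n : ℕ} (hd0 : 0 < d) (hd : d = m.gcd l)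
    (hg : m.gcd (2 * l) = m.gcd l) (hmn : m = d * n) : Odd n := by
  by_contra h
  obtain ⟨k, rfl⟩ := (Nat.not_odd_iff_even.1 h).two_dvd
  have h1 : 2 * d ∣ m.gcd (2 * l) :=
    Nat.dvd_gcd ⟨k, by rw [hmn]; ring⟩ (Nat.mul_dvd_mul_left 2 (hd ▸ Nat.gcd_dvd_right m l))
  rw [hg, ← hd] at h1
  have := Nat.le_of_dvd hd0 h1
  omega

/-- Put `l = d r`, so that `r < 2n` is coprime to `2n`. For `n ≤ 3` the fractions `r / (2n)` are
`1/2`, `1/4`, `3/4`, `1/6`, `5/6`, exactly the excluded ones. -/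
theorem four_le_of_gcd_two_mul_eq {m l d n : ℕ} (hm : 0 < m) (hl1 : 1 ≤ l) (hl2 : l ≤ m - 1)
    (hl3 : 6 * l ≠ m ∧ 4 * l ≠ m ∧ 2 * l ≠ m ∧ 4 * l ≠ 3 * m ∧ 6 * l ≠ 5 * m)
    (hd0 : 0 < d) (hd : d = m.gcd l) (hmn : m = 2 * (d * n)) : 4 ≤ n := by
  obtain ⟨r, hr⟩ : d ∣ l := hd ▸ Nat.gcd_dvd_right m l
  have hk : ∀ k, 2 ≤ k → k ∣ 2 * n → k ∣ r → False := by
    intro k hk h1 h2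
    have h3 : d * k ∣ m.gcd l := by
      refine Nat.dvd_gcd ?_ ?_
      · rw [hmn, show 2 * (d * n) = d * (2 * n) by ring]
        exact Nat.mul_dvd_mul_left d h1
      · rw [hr]
        exact Nat.mul_dvd_mul_left d h2
    rw [← hd] at h3
    have h4 := Nat.le_of_dvd hd0 h3
    have h5 := Nat.mul_le_mul_left d hk
    omega
  by_contra! hn
  have hrn : r < 2 * n := by
    have : d * r < d * (2 * n) := by
      rw [← hr, show d * (2 * n) = m by rw [hmn]; ring]
      omega
    exact lt_of_mul_lt_mul_left this hd0.le
  have h2 := hk 2 le_rfl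
  -- The remaining pairs have `r` even, against coprimality, or fall under an excluded ratio, except
  -- `n = r = 3`, where the excluded ratio is again `1/2`.
  interval_cases n <;> interval_cases r <;> first | omega | exact h2 (by norm_num) (by norm_num)

end Parameters

/-! ### The cases according to `d'`, the parity of `d`, and `m`. -/

theorem mainTheorem3 (p m l : ℕ) [Fact p.Prime] (hp : p ≠ 2) (hm : 6 ≤ m)
    (hl1 : 1 ≤ l) (hl2 : l ≤ m - 1)
    (hl3 : 6 * l ≠ m ∧ 4 * l ≠ m ∧ 2 * l ≠ m ∧ 4 * l ≠ 3 * m ∧ 6 * l ≠ 5 * m)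
    (F : Type*) [Field F] [Fintype F] [Algebra (ZMod p) F] (hF : Fintype.card F = p ^ m)
    (d d' s : ℕ) (hd : d = Nat.gcd m l) (hd' : d' = Nat.gcd m (2 * l)) (hs : s = m / 2)
    (μ : ℚ) (hμ : μ = (-1) ^ (s / d)) (Q : ℚ) (hQ : Q = p)
    (C : Set (F → ZMod p)) (hC : C = doCode p l F)
    (ε : ℚ) (hε : ε = 1 ∨ ε = -1) :
    (d' = d → Odd d →
      HoldsDesign C 2 (p ^ m)
        (Q^(m-1) * (Q - 1))
        ((Q^m - Q^(m-1) - 1) * (Q^(2*m+2*d-1) + Q^(2*m+d) - Q^(2*m+d-1)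
          - Q^(2*m) - Q^(2*m-1) + Q^(2*m-2*d) - Q^(2*m-3*d) + Q^(2*m-3*d-1)
          + Q^(m+2*d-1) - Q^m + Q^(m-2*d) - Q^(m-2*d-1) + Q^(2*d) - 1)
          / (Q^(2*d) - 1)) ∧
      HoldsDesign C 2 (p ^ m)
        (Q^((m+d-2)/2) * (Q - 1) * (Q^((m-d)/2) + ε))
        (1 / 2 * Q^(m-d-1) * (Q^((m+d-2)/2) * (Q - 1) * (Q^((m-d)/2) + ε) - 1)
          * (Q^(m-d) - 1)) ∧
      HoldsDesign C 2 (p ^ m)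
        (Q^((m+2*d-1)/2) * (Q^((m-2*d+1)/2) - Q^((m-2*d-1)/2) + ε * (-1)^((p-1)/2)))
        (1 / 2 * Q^((m-2*d-1)/2) * (Q^((m-2*d+1)/2) - Q^((m-2*d-1)/2) + ε * (-1)^((p-1)/2))
          * (Q^((m+2*d-1)/2) * (Q^((m-2*d+1)/2) - Q^((m-2*d-1)/2) + ε * (-1)^((p-1)/2)) - 1)
          * (Q^(m-d) - 1) / (Q^(2*d) - 1)) ∧
      (d ≠ 1 →
      HoldsDesign C 2 (p ^ m)
        (Q^((m-1)/2) * (Q^((m+1)/2) - Q^((m-1)/2) + ε * (-1)^((p-1)/2)))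
        (Q^((m+4*d-1)/2) * (Q^((m+1)/2) - Q^((m-1)/2) + ε * (-1)^((p-1)/2))
          * (Q^((m-1)/2) * (Q^((m+1)/2) - Q^((m-1)/2) + ε * (-1)^((p-1)/2)) - 1)
          * (Q^m - Q^(m-d) - Q^(m-2*d) + 1) / (2 * (Q^(2*d) - 1))) ∧
      HoldsDesign C 2 (p ^ m)
        (Q^((m+d-2)/2) * (Q^((m-d+2)/2) - Q^((m-d)/2) + ε))
        (1 / 2 * Q^(m-d-1) * (Q^((m-d+2)/2) - Q^((m-d)/2) + ε)
          * (Q^((m+d-2)/2) * (Q^((m-d+2)/2) - Q^((m-d)/2) + ε) - 1) * (Q^((m-d)/2) + ε))) ∧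
      (d = 1 →
      HoldsDesign C 2 (p ^ m)
        (Q^((m-1)/2) * (Q^((m+1)/2) - Q^((m-1)/2) + ε))
        (Q^((m+3)/2) * (Q^((m+1)/2) - Q^((m-1)/2) + ε)
          * (Q^((m-1)/2) * (Q^((m+1)/2) - Q^((m-1)/2) + ε) - 1)
          * (Q^m - Q^(m-1) - Q^(m-2) + 1) / (2 * (Q^2 - 1))
        + 1 / 2 * Q^(m-2) * (Q^((m+1)/2) - Q^((m-1)/2) + ε)
          * (Q^((m-1)/2) * (Q^((m+1)/2) - Q^((m-1)/2) + ε) - 1) * (Q^((m-1)/2) + ε)))) ∧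
    (d' = d → Even d → 8 ≤ m →
      HoldsDesign C 2 (p ^ m)
        (Q^(s-1) * (Q - 1) * (Q^s + ε))
        (Q^(s+2*d-1) * (Q^s + ε) * (Q^(s-1) * (Q - 1) * (Q^s + ε) - 1)
          * (Q^m - Q^(m-d) - Q^(m-2*d) + 1) / (2 * (Q^(2*d) - 1))) ∧
      HoldsDesign C 2 (p ^ m)
        (Q^(s-1) * (Q^(s+1) - Q^s + ε))
        (1 / 2 * Q^(s+2*d-1) * (Q^(s+1) - Q^s + ε)
          * (Q^(s-1) * (Q^(s+1) - Q^s + ε) - 1)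
          * (Q^m - Q^(m-d) - Q^(m-2*d) + 1) / (Q^(2*d) - 1)) ∧
      HoldsDesign C 2 (p ^ m)
        (Q^((m+d-2)/2) * (Q - 1) * (Q^((m-d)/2) + ε))
        (1 / 2 * Q^(m-d-1) * (Q^(m-d) - 1)
          * (Q^((m+d-2)/2) * (Q - 1) * (Q^((m-d)/2) + ε) - 1)) ∧
      HoldsDesign C 2 (p ^ m)
        (Q^((m+d-2)/2) * (Q^((m-d+2)/2) - Q^((m-d)/2) + ε))
        (1 / 2 * Q^(m-d-1) * (Q^((m-d+2)/2) - Q^((m-d)/2) + ε)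
          * (Q^((m+d-2)/2) * (Q^((m-d+2)/2) - Q^((m-d)/2) + ε) - 1) * (Q^((m-d)/2) + ε)) ∧
      HoldsDesign C 2 (p ^ m)
        (Q^((m+2*d-2)/2) * (Q - 1) * (Q^((m-2*d)/2) + ε))
        (1 / 2 * Q^(s-d-1) * (Q^((m-2*d)/2) + ε)
          * (Q^((m+2*d-2)/2) * (Q - 1) * (Q^((m-2*d)/2) + ε) - 1)
          * (Q^(m-d) - 1) / (Q^(2*d) - 1)) ∧
      HoldsDesign C 2 (p ^ m)
        (Q^((m+2*d-2)/2) * (Q^((m-2*d+2)/2) - Q^((m-2*d)/2) + ε))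
        (1 / 2 * Q^(s-d-1) * (Q^((m-2*d+2)/2) - Q^((m-2*d)/2) + ε)
          * (Q^((m+2*d-2)/2) * (Q^((m-2*d+2)/2) - Q^((m-2*d)/2) + ε) - 1)
          * (Q^(m-d) - 1) / (Q^(2*d) - 1)) ∧
      HoldsDesign C 2 (p ^ m)
        (Q^(m-1) * (Q - 1))
        ((Q^m - Q^(m-1) - 1)
          * (Q^(2*m-d) - Q^(2*m-2*d) + Q^(2*m-3*d) - Q^(m-2*d) + 1))) ∧
    (d' = d → Even d → m = 6 →
      HoldsDesign C 2 (p ^ m)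
        (Q^2 * (Q - 1) * (Q^3 + ε))
        (Q^6 * (Q^3 + ε) * (Q^2 * (Q - 1) * (Q^3 + ε) - 1)
          * (Q^6 - Q^4 - Q^2 + 1) / (2 * (Q^4 - 1))) ∧
      HoldsDesign C 2 (p ^ m)
        (Q^2 * (Q^4 - Q^3 + ε))
        (1 / 2 * Q^6 * (Q^4 - Q^3 + ε) * (Q^2 * (Q^4 - Q^3 + ε) - 1)
          * (Q^6 - Q^4 - Q^2 + 1) / (Q^4 - 1)) ∧
      HoldsDesign C 2 (p ^ m)
        (Q^3 * (Q - 1) * (Q^2 + ε))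
        (1 / 2 * Q^3 * (Q^4 - 1) * (Q^3 * (Q - 1) * (Q^2 + ε) - 1)) ∧
      HoldsDesign C 2 (p ^ m)
        (Q^3 * (Q^3 - Q^2 + ε))
        (1 / 2 * Q^3 * (Q^3 - Q^2 + ε) * (Q^3 * (Q^3 - Q^2 + ε) - 1)
          * (Q^2 + ε)) ∧
      HoldsDesign C 2 (p ^ m)
        (Q^4 * (Q - 1)^2)
        (1 / 2 * (Q - 1) * (Q^4 * (Q - 1)^2 - 1)) ∧
      HoldsDesign C 2 (p ^ m)
        (Q^4 * (Q^2 - Q + ε))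
        (1 / 2 * (Q^2 - Q + ε) * (Q^4 * (Q^2 - Q + ε) - 1)) ∧
      HoldsDesign C 2 (p ^ m)
        (Q^5 * (Q - 1))
        ((Q^6 - Q^5 - 1) * (Q^10 - Q^8 + Q^6 - Q^2 + 1))) ∧
    (d' = 2 * d →
      HoldsDesign C 2 (p ^ m)
        (Q^(s-1) * (Q - 1) * (Q^s - μ))
        (Q^(s-1) * (Q^s - μ) * (Q^(s-1) * (Q - 1) * (Q^s - μ) - 1)
          * (Q^(m+6*d) - Q^(m+4*d) - Q^(m+d) + μ * Q^(s+5*d)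
            - μ * Q^(s+4*d) + Q^(6*d))
          / ((Q^d + 1) * (Q^(2*d) - 1) * (Q^(3*d) + 1))) ∧
      HoldsDesign C 2 (p ^ m)
        (Q^(s-1) * (Q^(s+1) - Q^s + μ))
        (Q^(s-1) * (Q^(s+1) - Q^s + μ) * (Q^(s-1) * (Q^(s+1) - Q^s + μ) - 1)
          * (Q^(m+6*d) - Q^(m+4*d) - Q^(m+d) + μ * Q^(s+5*d)
            - μ * Q^(s+4*d) + Q^(6*d))
          / ((Q^d + 1) * (Q^(2*d) - 1) * (Q^(3*d) + 1))) ∧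
      HoldsDesign C 2 (p ^ m)
        (Q^(s+d-1) * (Q - 1) * (Q^(s-d) + μ))
        (Q^(s-d-1) * (Q^(s-d) + μ) * (Q^(s+d-1) * (Q - 1) * (Q^(s-d) + μ) - 1)
          * (Q^(m+3*d) + Q^(m+2*d) - Q^m - Q^(m-d) - Q^(m-2*d)
            - μ * Q^(s+3*d) + μ * Q^s + Q^(3*d))
          / ((Q^d + 1)^2 * (Q^(2*d) - 1))) ∧
      HoldsDesign C 2 (p ^ m)
        (Q^(s+d-1) * (Q^(s-d+1) - Q^(s-d) - μ))
        (Q^(s-d-1) * (Q^(s-d+1) - Q^(s-d) - μ) * (Q^(s+d-1) * (Q^(s-d+1) - Q^(s-d) - μ) - 1)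
          * (Q^(m+3*d) + Q^(m+2*d) - Q^m - Q^(m-d) - Q^(m-2*d)
            - μ * Q^(s+3*d) + μ * Q^s + Q^(3*d))
          / ((Q^d + 1)^2 * (Q^(2*d) - 1))) ∧
      HoldsDesign C 2 (p ^ m)
        (Q^(s+2*d-1) * (Q - 1) * (Q^(s-2*d) - μ))
        (Q^(s-2*d-1) * (Q^(s-2*d) - μ) * (Q^(s+2*d-1) * (Q - 1) * (Q^(s-2*d) - μ) - 1)
          * (Q^(s-d) + μ) * (Q^(s+d) + Q^s - Q^(s-2*d) - μ * Q^d)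
          / ((Q^d + 1)^2 * (Q^(2*d) - 1))) ∧
      HoldsDesign C 2 (p ^ m)
        (Q^(s+2*d-1) * (Q^(s-2*d+1) - Q^(s-2*d) + μ))
        (Q^(s-2*d-1) * (Q^(s-2*d+1) - Q^(s-2*d) + μ) * (Q^(s+2*d-1) * (Q^(s-2*d+1) - Q^(s-2*d) + μ) - 1)
          * (Q^(s-d) + μ) * (Q^(s+d) + Q^s - Q^(s-2*d) - μ * Q^d)
          / ((Q^d + 1)^2 * (Q^(2*d) - 1))) ∧
      HoldsDesign C 2 (p ^ m)
        (Q^(s+3*d-1) * (Q - 1) * (Q^(s-3*d) + μ))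
        (Q^(s-3*d-1) * (Q^(s-3*d) + μ) * (Q^(s+3*d-1) * (Q - 1) * (Q^(s-3*d) + μ) - 1)
          * (Q^(s-2*d) - μ) * (Q^(s-d) + μ)
          / ((Q^d + 1) * (Q^(2*d) - 1) * (Q^(3*d) + 1))) ∧
      HoldsDesign C 2 (p ^ m)
        (Q^(s+3*d-1) * (Q^(s-3*d+1) - Q^(s-3*d) - μ))
        (Q^(s-3*d-1) * (Q^(s-3*d+1) - Q^(s-3*d) - μ) * (Q^(s+3*d-1) * (Q^(s-3*d+1) - Q^(s-3*d) - μ) - 1)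
          * (Q^(s-2*d) - μ) * (Q^(s-d) + μ)
          / ((Q^d + 1) * (Q^(2*d) - 1) * (Q^(3*d) + 1))) ∧
      HoldsDesign C 2 (p ^ m)
        (Q^(m-1) * (Q - 1))
        ((Q^m - Q^(m-1) - 1) * (1 + (Q^(2*m) + Q^(2*m-9*d)
            - μ * (Q^d - 1) * (Q^(3*s-d) + Q^(3*s-8*d))
            + μ * Q^(3*s-3*d) - μ * Q^(3*s-5*d)
            + (Q^d - 1) * Q^(m-d) - Q^(m-4*d) - Q^(m-6*d)) / (Q^d + 1)))) := by
  classical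
  have hp' : p.Prime := Fact.out
  have hchar : CharP F p := charP_of_injective_algebraMap (algebraMap (ZMod p) F).injective p
  have hd0 : 0 < d := hd ▸ Nat.gcd_pos_of_pos_right _ hl1
  obtain ⟨n, hmn⟩ : d ∣ m := hd ▸ Nat.gcd_dvd_left m l
  have hdl : d ≤ l := Nat.le_of_dvd hl1 (hd ▸ Nat.gcd_dvd_right m l)
  subst hC
  have hodd : d' = d → Odd n ∧ ∃ t, n = 2 * t + 3 := by
    intro hdd
    have hn := odd_of_gcd_two_mul_eq hd0 hd (by rw [← hd', ← hd, hdd]) hmn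
    refine ⟨hn, ?_⟩
    obtain ⟨t, rfl⟩ := hn
    -- `n = 1` would mean `d = m`, impossible since `d ≤ l < m`; so `n` is odd and at least 3.
    rcases Nat.eq_zero_or_pos t with rfl | ht
    · omega
    · exact ⟨t - 1, by omega⟩
  have heven : d' = d → Even d → ∃ e f : ℕ, Odd n ∧ 3 ≤ n ∧ d = 2 * e + 2 ∧ m = 6 * e + 2 * f + 6 := by
    intro hdd hde
    obtain ⟨hn, t, ht⟩ := hodd hdd
    obtain ⟨k, hk⟩ := hde
    refine ⟨k - 1, t * d, hn, by omega, by omega, ?_⟩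
    have : m = 3 * d + 2 * (t * d) := by rw [hmn, ht]; ring
    omega
  refine ⟨fun hdd hdo => ?_, fun hdd hde h8 => ?_, fun hdd hde h6 => ?_, fun hdd => ?_⟩
  · obtain ⟨hn, t, ht⟩ := hodd hdd
    obtain ⟨e, he⟩ := hdo
    have hmt : m = 3 * d + 2 * (t * d) := by rw [hmn, ht]; ring
    -- With `n = 2t + 3` one has `m = 3d + 2td`, whence `f = t * d`; `e = f = 0` would mean `m = 3`.
    exact holdsDesign_of_odd_of_odd hp hF hl1 (by rw [← hd', ← hd, hdd]) hd hmn hn (by omega)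
      (e := e) (f := t * d) (by omega) he (by omega) hQ hε
  · obtain ⟨e, f, hn, hn3, he, hf⟩ := heven hdd hde
    obtain ⟨a1, a2, a3, a4, a5, a6, a7⟩ := holdsDesign_of_odd_of_even hp hF hl1
      (by rw [← hd', ← hd, hdd]) hd hmn hn hn3 he hf (s := s) (by omega) hQ hε
    exact ⟨a1, a2, a3, a4, a5 (Or.inr h8), a6, a7⟩
  · obtain ⟨e, f, hn, hn3, he, hf⟩ := heven hdd hde
    have key := fun (ε : ℚ) (hε : ε = 1 ∨ ε = -1) => holdsDesign_of_odd_of_even (s := s) hp hF hl1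
      (by rw [← hd', ← hd, hdd]) hd hmn hn hn3 he hf (by omega) hQ hε
    obtain rfl : d = 2 := by omega
    obtain rfl : s = 3 := by omega
    subst h6
    have hQ1 : 1 < Q := by rw [hQ]; exact_mod_cast hp'.one_lt
    have hden : Q ^ 4 - 1 ≠ 0 := (sub_pos.2 (one_lt_pow₀ hQ1 (by norm_num))).ne'
    simp only [Nat.reduceMul, Nat.reduceAdd, Nat.reduceSub, Nat.reduceDiv, pow_one, pow_zero] at key
    obtain ⟨a1, a2, a3, a4, -, a6, a7⟩ := key ε hε
    -- For `m = 6` only the sign `-1` is available at the largest radical, independently of `ε`; the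
    -- factor `Q^1 - 1` explains the weight `Q^4 * (Q - 1)^2`.
    have a5 := (key (-1) (Or.inr rfl)).2.2.2.2.1 (Or.inl rfl)
    refine ⟨a1, a2, ?_, a4, ?_, ?_, a7⟩
    · convert a3 using 1
    · convert a5 using 1
      · ring
      · field_simp
        ring
    · convert a6 using 1
      field_simp
  · have hg : m.gcd (2 * l) = 2 * d := by rw [← hd', hdd]
    obtain ⟨n', hmn'⟩ : 2 * d ∣ m := hg ▸ Nat.gcd_dvd_left _ _
    rw [mul_assoc] at hmn'
    have hn := four_le_of_gcd_two_mul_eq (by omega) hl1 hl2 hl3 hd0 hd hmn'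
    have hsd : s = d * n' := by omega
    obtain ⟨t, rfl⟩ := Nat.exists_eq_add_of_le hn
    have h4 : d * (4 + t) = 4 * d + d * t := by ring
    -- With `n' = 4 + t` one has `s = 4d + d t`, so `e = d - 1` and `f = d * t`.
    exact holdsDesign_of_even hp hF hl1 hd hg hmn' hn (e := d - 1) (f := d * t) (by omega) (by omega)
      (by omega) (by rw [hμ, hsd, Nat.mul_div_cancel_left _ hd0]) hQ
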